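/- A graph below may be finite or infinite, may have multiple edges, and may contain any mixture of undirected and directed edges, but has no loops. Paths need not be self-avoiding, and they follow directed edges in their direction only; the length $|\gamma|$ of a path is its number of edges counted with multiplicity. For a graph $G$ of bounded degree (a uniform bound on the number of edges, undirected, outgoing and incoming, at a vertex), vertices $v,w$ and $t\ge 0$, let $$m_G(v,w,t)=\sum_{\gamma}\frac{t^{|\gamma|}}{|\gamma|!},$$ where the sum is over all paths $\gamma$ from $v$ to $w$ in $G$ and $0^0=1$. The critical time $t^*_G(v,w)\in[0,\infty]$ is the solution $t\ge 0$ of $m_G(v,w,t)=1$, where $t^*_G(v,v)=0$, and $t^*_G(v,w)=\infty$ if there is no path from $v$ to $w$. Let $G^n$ be the $n$-th Cartesian power of $G$: its vertices are the $n$-tuples of vertices of $G$, and its edges consist of a coordinate $i$, an edge $e$ of $G$ and a choice of the other $n-1$ coordinates, such an edge having the type and direction of $e$ and moving only coordinate $i$, along $e$. Write $\bar v=(v,\dots,v)$. For a probability distribution $F$ on $[0,\infty)$, give the edges of $G^n$ independent passage times with distribution $F$, and let $T^F_{G^n}(x,y)\in[0,\infty]$ be the infimum, over all paths from $x$ to $y$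 in $G^n$, of the sum of the passage times along the path ($\infty$ if there is no path). For $\rho\in(0,\infty)$ let $\mathcal C(\rho)$ be the set of probability distributions $F$ on $[0,\infty)$ with $\lim_{x\downarrow 0}F([0,x])/x=\rho$, and let $\mathcal C_{L^1}(\rho)$ be the set of those $F\in\mathcal C(\rho)$ with $\int_0^\infty x\,dF(x)<\infty$. **Corollary 1.6.** Let $\rho\in(0,\infty)$ and $F\in\mathcal C(\rho)$. Let $G$ be a graph of bounded degree which is connected (when directions of edges are ignored), and suppose that at least one of the following holds: (i) $G$ is a Cayley graph of a group $\mathcal G$ with respect to a finite generating set $S$ that is normal, that is $gSg^{-1}=S$ for all $g\in\mathcal G$; in particular, this is the case if $G$ is a Cayley graph of an abelian group with respect to a finite generating set. Here the Cayley graph is either the directed one, with one edge from $g$ to $gs$ for each $g\in\mathcal G$ and $s\in S\setminus\{1\}$, or the undirected one, with one edge between $g$ and $h\neq g$ whenever $h=gs$ or $g=hs$ for some $s\in S$. (ii) For every pair of vertices $x,y$ of $G$ there is an automorphism of $G$ that maps $x$ to $y$ and $y$ to $x$. Then for all vertices $v,w$ of $G$ $$T^F_{G^n}(\bar v,\bar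 w)\to\frac{t^*_G(v,w)}{\rho}\quad\text{in probability as } n\to\infty,$$ and if $F\in\mathcal C_{L^1}(\rho)$, then the convergence holds also in $L^1$. (If there is no path from $v$ to $w$, then both sides are $\infty$ and $|\infty-\infty|$ is read as $0$.) -/

import Mathlib

open MeasureTheory ProbabilityTheory Filter Topology
open scoped ENNReal NNReal Nat

universe u v u' v'

/-- A graph with vertex set `V` and edge set `E`, possibly infinite, with any mixture of undirected
and directed edges and with multiple edges allowed: each edge has either an unordered pair of
end-points (undirected edge) or an ordered pair, source first (directed edge). -/
structure MixedGraph (V : Type u) (E : Type v) where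
  /-- the end-points of an edge -/
  ends : E → Sym2 V ⊕ V × V

namespace MixedGraph

variable {V : Type u} {E : Type v} {V' : Type u'} {E' : Type v'}

/-- The image of the end-points of an edge under a map of the vertices; undirected edges stay
undirected and directed edges keep their direction. -/
def mapEnds (f : V → V') : Sym2 V ⊕ V × V → Sym2 V' ⊕ V' × V' :=
  Sum.map (Sym2.map f) (Prod.map f f)

/-- The edge `e` can be traversed from `x` to `y`. -/
def Joins (G : MixedGraph V E) (e : E) (x y : V) : Prop :=
  G.ends e = Sum.inl s(x, y) ∨ G.ends e = Sum.inr (x, y)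

/-- No edge is a loop. -/
def Loopless (G : MixedGraph V E) : Prop := ∀ e x, ¬ G.Joins e x x

/-- Some uniform bound holds for the number of edges (undirected, outgoing and incoming, counted
with multiplicity) at a vertex. -/
def BoundedDegree (G : MixedGraph V E) : Prop :=
  ∃ D : ℕ, ∀ x, {e : E | ∃ y, G.Joins e x y ∨ G.Joins e y x}.encard ≤ D

/-- The graph is connected when the directions of its edges are ignored. -/
def Connected (G : MixedGraph V E) : Prop :=
  ∀ x y, Relation.ReflTransGen (fun a b => ∃ e, G.Joins e a b ∨ G.Joins e b a) x y

/-- Paths from one vertex to another, not necessarily self-avoiding, following the directions of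
the directed edges. -/
inductive Path (G : MixedGraph V E) : V → V → Type (max u v)
  | nil (x : V) : Path G x x
  | cons {x y z : V} (e : E) (h : G.Joins e x y) (γ : Path G y z) : Path G x z

/-- The number of edges of a path, counted with multiplicity. -/
def Path.length {G : MixedGraph V E} : {x y : V} → G.Path x y → ℕ
  | _, _, .nil _ => 0
  | _, _, .cons _ _ γ => γ.length + 1

/-- The passage time of a path: the sum of the passage times `τ e` of its edges `e`. -/
noncomputable def Path.time {G : MixedGraph V E} (τ : E → ℝ≥0) :
    {x y : V} → G.Path x y → ℝ≥0∞
  | _, _, .nil _ => 0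
  | _, _, .cons e _ γ => (τ e : ℝ≥0∞) + γ.time τ

/-- The first-passage time from `x` to `y` for the edge passage times `τ`; it is `∞` if there is no
path from `x` to `y`. -/
noncomputable def passageTime (G : MixedGraph V E) (τ : E → ℝ≥0) (x y : V) : ℝ≥0∞ :=
  ⨅ γ : G.Path x y, γ.time τ

/-- The generating function `m_G(x, y, t) = ∑ t ^ |γ| / |γ|!`, summed over all paths from
`x` to `y`. -/
noncomputable def genFun (G : MixedGraph V E) (x y : V) (t : ℝ≥0) : ℝ≥0∞ :=
  ∑' γ : G.Path x y, (t : ℝ≥0∞) ^ γ.length / (γ.length ! : ℝ≥0∞)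

/-- The critical time `t*_G(x, y)`: the solution `t ≥ 0` of `m_G(x, y, t) = 1`, and `∞` if there is
none. The infimum only matters for `x = y`, where `t = 0` is always a solution but need not be the
only one; for `x ≠ y` and bounded degree there is at most one solution. -/
noncomputable def criticalTime (G : MixedGraph V E) (x y : V) : ℝ≥0∞ :=
  ⨅ (t : ℝ≥0) (_ : G.genFun x y t = 1), (t : ℝ≥0∞)

/-- The vertex of the `n`-th power with `i`-th coordinate `a` and other coordinates `r`. -/
def insertCoord {n : ℕ} (i : Fin n) (r : {j : Fin n // j ≠ i} → V) (a : V) : Fin n → V :=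
  fun j => if h : j = i then a else r ⟨j, h⟩

/-- The edges of the `n`-th Cartesian power: a coordinate `i`, an edge of the graph, used in
direction `i`, and the remaining `n - 1` coordinates. -/
abbrev PowEdge (V : Type u) (E : Type v) (n : ℕ) : Type (max u v) :=
  Σ i : Fin n, E × ({j : Fin n // j ≠ i} → V)

/-- The `n`-th Cartesian power of a graph. -/
def pow (G : MixedGraph V E) (n : ℕ) : MixedGraph (Fin n → V) (PowEdge V E n) where
  ends e := mapEnds (insertCoord e.1 e.2.2) (G.ends e.2.1)

/-- Isomorphisms of graphs: bijections of the vertices and of the edges, compatible with the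
end-points and with the kinds and directions of the edges. -/
structure Iso (G : MixedGraph V E) (H : MixedGraph V' E') where
  /-- the bijection of the vertices -/
  vert : V ≃ V'
  /-- the bijection of the edges -/
  edge : E ≃ E'
  ends_edge : ∀ e, H.ends (edge e) = mapEnds vert (G.ends e)

/-- `(x₁, x₂) ≅ (y₁, y₂)`: some automorphism of `G` maps `x₁` to `y₁` and `x₂` to `y₂`. -/
def PairIso (G : MixedGraph V E) (x₁ x₂ y₁ y₂ : V) : Prop :=
  ∃ σ : Iso G G, σ.vert x₁ = y₁ ∧ σ.vert x₂ = y₂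

/-- The directed Cayley graph: one directed edge from `g` to `g * s` for each `g` and each `s ∈ S`
(loops, which would come from `s = 1`, are left out). -/
def cayleyDirected {Γ : Type u} [Group Γ] (S : Set Γ) :
    MixedGraph Γ (Γ × {s : Γ // s ∈ S ∧ s ≠ 1}) where
  ends e := Sum.inr (e.1, e.1 * e.2.1)

/-- The undirected Cayley graph: one undirected edge between `g` and `h` whenever `h = g * s` for
some `s ∈ S` (loops, which would come from `s = 1`, are left out). -/
def cayleyUndirected {Γ : Type u} [Group Γ] (S : Set Γ) :
    MixedGraph Γ {p : Sym2 Γ // ∃ g s : Γ, s ∈ S ∧ s ≠ 1 ∧ p = s(g, g * s)} where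
  ends p := Sum.inl p.1

/-- `G` is, up to isomorphism, a directed or undirected Cayley graph of `Γ` with respect to `S`. -/
def IsCayleyGraph (G : MixedGraph V E) (Γ : Type u) [Group Γ] (S : Set Γ) : Prop :=
  Nonempty (Iso G (cayleyDirected S)) ∨ Nonempty (Iso G (cayleyUndirected S))

/-- `G` is a Cayley graph of a group with respect to a finite normal generating set. -/
def IsNormalCayley (G : MixedGraph V E) : Prop :=
  ∃ (Γ : Type u) (_ : Group Γ) (S : Set Γ), S.Finite ∧ Subgroup.closure S = ⊤ ∧
    (∀ g : Γ, (fun s => g * s * g⁻¹) '' S = S) ∧ G.IsCayleyGraph Γ S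

/-- `G` is a Cayley graph of an abelian group with respect to a finite generating set. -/
def IsAbelianCayley (G : MixedGraph V E) : Prop :=
  ∃ (Γ : Type u) (_ : CommGroup Γ) (S : Set Γ), S.Finite ∧ Subgroup.closure S = ⊤ ∧
    G.IsCayleyGraph Γ S

end MixedGraph

/-- The class `C(ρ)` of probability distributions on `[0, ∞)` whose distribution function
`F(x) = F([0, x])` satisfies `F(x) / x → ρ` as `x ↓ 0`. -/
structure ClassC (ρ : ℝ≥0) (F : Measure ℝ≥0) : Prop where
  isProbabilityMeasure : IsProbabilityMeasure F
  tendsto : Tendsto (fun x : ℝ≥0 => F (Set.Iic x) / (x : ℝ≥0∞)) (𝓝[>] 0) (𝓝 (ρ : ℝ≥0∞))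

/-- The class of the distributions in `C(ρ)` with finite mean. -/
structure ClassCL1 (ρ : ℝ≥0) (F : Measure ℝ≥0) : Prop extends ClassC ρ F where
  mean_lt_top : ∫⁻ x, (x : ℝ≥0∞) ∂F < ∞

/-- Convergence in `L¹` of a sequence `X 1, X 2, …` of `[0, ∞]`-valued random variables to a
constant `c`: all `|X n - c|` are integrable and `E |X n - c| → 0` (with `|∞ - ∞| = 0`). -/
def TendstoInL1 {Ω : Type*} [MeasurableSpace Ω] (μ : Measure Ω) (X : ℕ → Ω → ℝ≥0∞) (c : ℝ≥0∞) :
    Prop :=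
  (∀ n, 1 ≤ n → AEMeasurable (X n) μ ∧ ∫⁻ ω, edist (X n ω) c ∂μ < ∞) ∧
    Tendsto (fun n => ∫⁻ ω, edist (X n ω) c ∂μ) atTop (𝓝 0)

/-! Write `A` for the adjacency kernel of `G`, `m(t)` for `genFun` between `v` and `w`, and `t*` for
the critical time. By `genFun_eq_tsum`, `m(t)` is an entry of `exp (t A)`.

Lower bound, by a first moment. A path can be shortened until no edge occurs twice, and `k` distinct
edges have total passage time at most `s` with probability about `(ρ s)^k / k!`. The expected number
of fast paths in `G^n` is thus about the generating function of `G^n` at `ρ s`. This is at most `m(ρ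
s)^n` (`genFun_pow_le`), which tends to zero when `ρ s < t*` (`measure_passageTime_lt_le`).

Upper bound, by a second moment. Take `t` slightly above `t*`, so that `m(t) > 1`, and cut the time
into `2h` slices. With `θ = t / 2h` and `W = 1 + θ A`, the entry `Z = W^(2h)(v, w)` is close to
`m(t)`. In one slice a configuration goes from `x` to `y`, each changed coordinate crossing one
edge. That some order of the crossings takes time at most `δ` has probability about `∏ W(x i, y i)`
(`tens_le_measure_cubeEvent_mul`), so chains of `2h` such steps on `N` coordinates have total weight
`Z^N`. If a second chain leaves a given chain and meets it again, the sum over its excursion is a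
power `W^k` between points of the given chain. So the second moment is under control
(`chain_measure_ge`) if, for the bridge from `v` to `w` with step weights `W`, the mean of `log W^k`
over a window of `k` steps is at most `(k / 2h) log Z`, and at most `0` for `k ≤ h`.

These bounds are where the symmetry of `G` is used. `Reversible` allows any window to be shifted to
the beginning of the bridge (`psi_shift`). Submodularity of entropy then makes the mean of `-log
W^k` concave in `k` (`psi_concave`), and it remains to see that the midpoint of the bridge has
entropy at least `log Z` (`psi_half`). This holds because `log Z` is tiny for `t` close to `t*`,
whereas the midpoint is `v` or `w` with probabilities bounded below. A law of large numbers over the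
coordinates then provides typical chains (`exists_typical`).

The outcome, `exists_chain`, is that a chain succeeds with probability at least `exp (-err N)` for
any `err > 0`, even if an event of a certain exponentially small probability is required halfway.
This allowance is spent on moving two blocks, a small fraction of the coordinates, halfway. Within a
short time exponentially many subsets of one block are switched on from the start, and likewise
backwards from the end (`measure_growSets_card_le`). Such a pair of subsets defines a try, and tries
for pairs without common members use disjoint edges, hence are independent. So some try succeeds
except with exponentially small probability (`exists_bad_of_lt`).

For convergence in `L¹`, the path that moves the coordinates one after the other avoids all edges on
which the exceptional event depends. Its mean passage time is linear in `n`, so on the exceptional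
event it contributes a vanishing amount. -/

/-- Kernels on `V` with values in `[0, ∞]`, with the composition of kernels as multiplication. -/
def Kern (V : Type u) : Type u := V → V → ℝ≥0∞

/-! ### The semiring of kernels, lazy kernels and reversibility. -/

namespace Kern

variable {V : Type u}

noncomputable instance : AddCommMonoid (Kern V) := inferInstanceAs (AddCommMonoid (V → V → ℝ≥0∞))

open Classical in
noncomputable instance : One (Kern V) := ⟨fun x y => if x = y then 1 else 0⟩

noncomputable instance : Mul (Kern V) := ⟨fun K L x z => ∑' y, K x y * L y z⟩

open Classical in
theorem one_apply (x y : V) : (1 : Kern V) x y = if x = y then 1 else 0 := rfl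

theorem mul_apply (K L : Kern V) (x z : V) : (K * L) x z = ∑' y, K x y * L y z := rfl

theorem add_apply (K L : Kern V) (x z : V) : (K + L) x z = K x z + L x z := rfl

theorem zero_apply (x z : V) : (0 : Kern V) x z = 0 := rfl

@[simp] theorem one_self (x : V) : (1 : Kern V) x x = 1 := by simp [one_apply]

theorem one_of_ne {x y : V} (h : x ≠ y) : (1 : Kern V) x y = 0 := by simp [one_apply, h]

theorem tsum_one_mul (x : V) (f : V → ℝ≥0∞) : ∑' y, (1 : Kern V) x y * f y = f x := by
  rw [tsum_eq_single x]
  · simp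
  · intro y hy; simp [one_of_ne hy.symm]

theorem tsum_mul_one (z : V) (f : V → ℝ≥0∞) : ∑' y, f y * (1 : Kern V) y z = f z := by
  rw [tsum_eq_single z]
  · simp
  · intro y hy; simp [one_of_ne hy]

noncomputable instance : Semiring (Kern V) where
  __ := (inferInstance : AddCommMonoid (Kern V))
  mul_assoc K L N := by
    funext x z
    simp only [mul_apply]
    simp_rw [← ENNReal.tsum_mul_right, ← ENNReal.tsum_mul_left]
    rw [ENNReal.tsum_comm]
    simp_rw [mul_assoc]
  one_mul K := by funext x z; simp only [mul_apply]; exact tsum_one_mul x fun y => K y z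
  mul_one K := by funext x z; simp only [mul_apply]; exact tsum_mul_one z fun y => K x y
  zero_mul K := by funext x z; simp [mul_apply, zero_apply]
  mul_zero K := by funext x z; simp [mul_apply, zero_apply]
  left_distrib K L N := by
    funext x z; simp only [mul_apply, add_apply, mul_add]; exact ENNReal.tsum_add
  right_distrib K L N := by
    funext x z; simp only [mul_apply, add_apply, add_mul]; exact ENNReal.tsum_add

/-- Scaling of a kernel. -/
noncomputable def scale (c : ℝ≥0∞) (K : Kern V) : Kern V := fun x y => c * K x y

theorem scale_apply (c : ℝ≥0∞) (K : Kern V) (x y : V) : scale c K x y = c * K x y := rfl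

theorem scale_pow (c : ℝ≥0∞) (K : Kern V) (n : ℕ) : scale c K ^ n = scale (c ^ n) (K ^ n) := by
  induction n with
  | zero => funext x y; simp [scale_apply]
  | succ n ih =>
    funext x y
    rw [pow_succ, ih, mul_apply, scale_apply, pow_succ K, mul_apply, ← ENNReal.tsum_mul_left]
    refine tsum_congr fun z => ?_
    rw [scale_apply, scale_apply, pow_succ]; ring

theorem nsmul_apply (n : ℕ) (K : Kern V) (x y : V) : (n • K) x y = n * K x y := by
  induction n with
  | zero => simp [zero_apply]
  | succ n ih => rw [succ_nsmul, add_apply, ih]; push_cast; ring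

theorem finset_sum_apply {ι : Type*} (s : Finset ι) (f : ι → Kern V) (x y : V) :
    (∑ i ∈ s, f i) x y = ∑ i ∈ s, f i x y := by
  classical
  induction s using Finset.induction_on with
  | empty => simp [zero_apply]
  | insert a s ha ih => rw [Finset.sum_insert ha, Finset.sum_insert ha, add_apply, ih]

/-- The lazy kernel `1 + c A`. -/
noncomputable def lazy (c : ℝ≥0∞) (A : Kern V) : Kern V := 1 + scale c A

theorem lazy_apply (c : ℝ≥0∞) (A : Kern V) (x y : V) :
    lazy c A x y = (1 : Kern V) x y + c * A x y := rfl

theorem lazy_pow_apply (c : ℝ≥0∞) (A : Kern V) (n : ℕ) (x y : V) :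
    (lazy c A ^ n) x y = ∑ j ∈ Finset.range (n + 1), (n.choose j : ℝ≥0∞) * (c ^ j * (A ^ j) x y) := by
  rw [lazy, add_comm, (Commute.one_right (scale c A)).add_pow, finset_sum_apply]
  refine Finset.sum_congr rfl fun j _ => ?_
  rw [one_pow, mul_one, ← nsmul_eq_mul', nsmul_apply, scale_pow, scale_apply]

theorem lazy_pow_mono_left (c : ℝ≥0∞) (A : Kern V) (n : ℕ) (x y : V) :
    (lazy c A ^ n) x y ≤ (lazy c A ^ (n + 1)) x y := by
  rw [pow_succ, lazy, mul_add, mul_one, add_apply]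
  exact le_self_add

/-- For all `x`, `z` some bijection of the vertices reverses the pairs of powers of `A` between `x`
and `z`. -/
def Reversible (A : Kern V) : Prop :=
  ∀ x z, ∃ β : V ≃ V, ∀ y (k : ℕ), (A ^ k) x y = (A ^ k) (β y) z ∧ (A ^ k) y z = (A ^ k) x (β y)

theorem pow_equiv {A : Kern V} (σ : V ≃ V) (h : ∀ x y, A (σ x) (σ y) = A x y) (k : ℕ) (x y : V) :
    (A ^ k) (σ x) (σ y) = (A ^ k) x y := by
  induction k generalizing x y with
  | zero =>
    rw [pow_zero]
    by_cases hxy : x = y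
    · rw [hxy, one_self, one_self]
    · rw [one_of_ne hxy, one_of_ne fun h' => hxy (σ.injective h')]
  | succ k ih =>
    rw [pow_succ, mul_apply, mul_apply, ← Equiv.tsum_eq σ]
    exact tsum_congr fun z => by rw [ih, h]

theorem Reversible.lazy_pow {A : Kern V} (h : A.Reversible) (c : ℝ≥0∞) (x z : V) :
    ∃ β : V ≃ V, ∀ y (k : ℕ), (lazy c A ^ k) x y = (lazy c A ^ k) (β y) z ∧
      (lazy c A ^ k) y z = (lazy c A ^ k) x (β y) := by
  obtain ⟨β, hβ⟩ := h x z
  refine ⟨β, fun y k => ?_⟩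
  simp only [lazy_pow_apply]
  exact ⟨Finset.sum_congr rfl fun j _ => by rw [(hβ y j).1],
    Finset.sum_congr rfl fun j _ => by rw [(hβ y j).2]⟩

/-- Functions of powers of a reversible lazy kernel commute with its powers. -/
theorem Reversible.commute {A : Kern V} (h : A.Reversible) (c : ℝ≥0∞) (g : ℝ≥0∞ → ℝ≥0∞) (k a : ℕ)
    (x z : V) : ∑' y, g ((lazy c A ^ k) x y) * (lazy c A ^ a) y z =
      ∑' y, (lazy c A ^ a) x y * g ((lazy c A ^ k) y z) := by
  obtain ⟨β, hβ⟩ := h.lazy_pow c x z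
  -- Replacing `y` by `β y` turns the intermediate point after `a` steps into one after `k` steps.
  rw [← Equiv.tsum_eq β (fun y => (lazy c A ^ a) x y * _)]
  refine tsum_congr fun y => ?_
  rw [(hβ y k).1, (hβ y a).2, mul_comm]

end Kern

/-! ### Adjacency kernels and the counting of paths. -/

namespace MixedGraph

variable {V : Type u} {E : Type v} {V' : Type u'} {E' : Type v'}

theorem Joins.right_unique {G : MixedGraph V E} {e : E} {x y z : V} (h₁ : G.Joins e x y)
    (h₂ : G.Joins e x z) : y = z := by
  rcases h₁ with h₁ | h₁ <;> rcases h₂ with h₂ | h₂ <;> rw [h₁] at h₂ <;> simp at h₂ <;> grind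

theorem Joins.eq_or_eq {G : MixedGraph V E} {e : E} {x y z w : V} (h₁ : G.Joins e x y)
    (h₂ : G.Joins e z w) : (z = x ∧ w = y) ∨ (z = y ∧ w = x) := by
  rcases h₁ with h₁ | h₁ <;> rcases h₂ with h₂ | h₂ <;> rw [h₁] at h₂ <;> simp at h₂
  · rcases h₂ with ⟨rfl, rfl⟩ | ⟨rfl, rfl⟩ <;> simp
  · obtain ⟨rfl, rfl⟩ := h₂; simp

theorem Loopless.ne {G : MixedGraph V E} (h : G.Loopless) {e : E} {x y : V} (hj : G.Joins e x y) :
    x ≠ y := fun hxy => h e x (hxy ▸ hj)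

/-- The number of edges that can be traversed from `x` to `y`. -/
noncomputable def mult (G : MixedGraph V E) (x y : V) : ℕ := Nat.card {e // G.Joins e x y}

/-- The adjacency kernel, with multiplicities. -/
noncomputable def adj (G : MixedGraph V E) : Kern V := fun x y => (ENat.card {e // G.Joins e x y} : ℝ≥0∞)

/-- A quantitative form of `BoundedDegree`. -/
def DegreeLE (G : MixedGraph V E) (D : ℕ) : Prop :=
  ∀ x, {e : E | ∃ y, G.Joins e x y ∨ G.Joins e y x}.encard ≤ D

theorem DegreeLE.finite_joins {G : MixedGraph V E} {D : ℕ} (h : G.DegreeLE D) (x y : V) :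
    Finite {e // G.Joins e x y} := by
  have h1 : {e : E | ∃ y, G.Joins e x y ∨ G.Joins e y x}.Finite :=
    Set.finite_of_encard_le_coe (h x)
  exact (h1.subset fun e he => ⟨y, Or.inl he⟩ : {e | G.Joins e x y}.Finite)

theorem DegreeLE.adj_eq {G : MixedGraph V E} {D : ℕ} (h : G.DegreeLE D) (x y : V) :
    G.adj x y = G.mult x y := by
  have := h.finite_joins x y
  simp only [adj, mult, ENat.card_eq_coe_natCard]
  rfl

theorem adj_eq_tsum (G : MixedGraph V E) (x y : V) : G.adj x y = ∑' _ : {e // G.Joins e x y}, 1 := by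
  rw [adj, ENNReal.tsum_const, mul_one]

theorem DegreeLE.tsum_adj_le {G : MixedGraph V E} {D : ℕ} (h : G.DegreeLE D) (x : V) :
    ∑' y, G.adj x y ≤ D := by
  simp_rw [adj_eq_tsum]
  rw [← ENNReal.tsum_sigma (f := fun (y : V) (_ : {e // G.Joins e x y}) => (1 : ℝ≥0∞)),
    ENNReal.tsum_const, mul_one]
  have h1 : ENat.card (Σ y, {e // G.Joins e x y}) ≤
      ENat.card {e : E | ∃ y, G.Joins e x y ∨ G.Joins e y x} := by
    refine ENat.card_le_card_of_injective
      (f := fun p => ⟨p.2.1, p.1, Or.inl p.2.2⟩) ?_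
    rintro ⟨y, e, he⟩ ⟨y', e', he'⟩ hh
    simp only [Subtype.mk.injEq] at hh
    subst hh
    obtain rfl := he.right_unique he'
    rfl
  have h2 := h1.trans (h x)
  exact_mod_cast ENat.toENNReal_mono h2

theorem Joins.left_unique {G : MixedGraph V E} {e : E} {x y z : V} (h₁ : G.Joins e y x)
    (h₂ : G.Joins e z x) : y = z := by
  rcases h₁ with h₁ | h₁ <;> rcases h₂ with h₂ | h₂ <;> rw [h₁] at h₂ <;> simp at h₂ <;> grind

theorem DegreeLE.tsum_adj_le' {G : MixedGraph V E} {D : ℕ} (h : G.DegreeLE D) (x : V) :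
    ∑' y, G.adj y x ≤ D := by
  simp_rw [adj_eq_tsum]
  rw [← ENNReal.tsum_sigma (f := fun (y : V) (_ : {e // G.Joins e y x}) => (1 : ℝ≥0∞)),
    ENNReal.tsum_const, mul_one]
  have h1 : ENat.card (Σ y, {e // G.Joins e y x}) ≤
      ENat.card {e : E | ∃ y, G.Joins e x y ∨ G.Joins e y x} := by
    refine ENat.card_le_card_of_injective
      (f := fun p => ⟨p.2.1, p.1, Or.inr p.2.2⟩) ?_
    rintro ⟨y, e, he⟩ ⟨y', e', he'⟩ hh
    simp only [Subtype.mk.injEq] at hh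
    subst hh
    obtain rfl := he.left_unique he'
    rfl
  have h2 := h1.trans (h x)
  exact_mod_cast ENat.toENNReal_mono h2

theorem Loopless.adj_self {G : MixedGraph V E} (h : G.Loopless) (x : V) : G.adj x x = 0 := by
  rw [adj]
  have : IsEmpty {e // G.Joins e x x} := ⟨fun e => h e.1 x e.2⟩
  rw [(ENat.card_eq_zero_iff_empty _).2 this, ENat.toENNReal_zero]

/-- Automorphisms preserve multiplicities. -/
theorem joins_iso {G : MixedGraph V E} {H : MixedGraph V' E'} (σ : Iso G H) (e : E) (x y : V) :
    H.Joins (σ.edge e) (σ.vert x) (σ.vert y) ↔ G.Joins e x y := by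
  unfold Joins
  rw [σ.ends_edge, mapEnds]
  rcases h : G.ends e with s | p
  · have : s(σ.vert x, σ.vert y) = Sym2.map σ.vert s(x, y) := rfl
    simp only [Sum.map_inl, Sum.inl.injEq, reduceCtorEq, or_false]
    rw [this, (Sym2.map.injective σ.vert.injective).eq_iff]
  · have : (σ.vert x, σ.vert y) = Prod.map σ.vert σ.vert (x, y) := rfl
    simp only [Sum.map_inr, Sum.inr.injEq, reduceCtorEq, false_or]
    rw [this, (σ.vert.injective.prodMap σ.vert.injective).eq_iff]

theorem adj_iso {G : MixedGraph V E} {H : MixedGraph V' E'} (σ : Iso G H) (x y : V) :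
    H.adj (σ.vert x) (σ.vert y) = G.adj x y := by
  rw [adj, adj]
  congr 1
  exact (ENat.card_congr (σ.edge.subtypeEquiv fun e => (joins_iso σ e x y).symm)).symm

/-- Splitting off the first edge of a path corresponds to splitting off the first factor of the
power. -/
theorem tsum_path_length_eq (G : MixedGraph V E) (j : ℕ) (x z : V) :
    ∑' γ : G.Path x z, (if γ.length = j then (1 : ℝ≥0∞) else 0) = (G.adj ^ j) x z := by
  induction j generalizing x with
  | zero =>
    rw [pow_zero]
    by_cases h : x = z
    · subst h
      rw [Kern.one_self, tsum_eq_single (Path.nil x)]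
      · simp [Path.length]
      · intro γ hγ
        cases γ with
        | nil => exact absurd rfl hγ
        | cons e h γ => simp [Path.length]
    · rw [Kern.one_of_ne h, ENNReal.tsum_eq_zero]
      intro γ
      cases γ with
      | nil => exact absurd rfl h
      | cons e h γ => simp [Path.length]
  | succ j ih =>
    let c : (Σ y, {e // G.Joins e x y} × G.Path y z) → G.Path x z :=
      fun p => Path.cons p.2.1.1 p.2.1.2 p.2.2
    have hc : Function.Injective c := by
      rintro ⟨y, ⟨e, he⟩, γ⟩ ⟨y', ⟨e', he'⟩, γ'⟩ h
      simp only [c, Path.cons.injEq] at h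
      obtain ⟨rfl, rfl, h⟩ := h
      rw [eq_of_heq h]
    rw [← hc.tsum_eq, ENNReal.tsum_sigma', pow_succ', Kern.mul_apply]
    · refine tsum_congr fun y => ?_
      rw [ENNReal.tsum_prod', adj_eq_tsum, ← ENNReal.tsum_mul_right]
      refine tsum_congr fun e => ?_
      rw [one_mul, ← ih]
      simp [c, Path.length]
    · intro γ hγ
      cases γ with
      | nil => simp [Path.length] at hγ
      | cons e h γ => exact ⟨⟨_, ⟨e, h⟩, γ⟩, rfl⟩

theorem tsum_path (G : MixedGraph V E) (f : ℕ → ℝ≥0∞) (x z : V) :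
    ∑' γ : G.Path x z, f γ.length = ∑' j, f j * (G.adj ^ j) x z := by
  have h : ∀ γ : G.Path x z, f γ.length = ∑' j, if γ.length = j then f j else 0 := by
    intro γ
    rw [tsum_eq_single γ.length]
    · simp
    · intro j hj; simp [hj.symm]
  simp_rw [h]
  rw [ENNReal.tsum_comm]
  refine tsum_congr fun j => ?_
  rw [← tsum_path_length_eq, ← ENNReal.tsum_mul_left]
  exact tsum_congr fun γ => by split_ifs <;> simp

/-- The series is the exponential of `t` times the adjacency kernel, so paths can be replaced by
powers of kernels. -/
theorem genFun_eq_tsum (G : MixedGraph V E) (x y : V) (t : ℝ≥0) :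
    G.genFun x y t = ∑' j : ℕ, (t : ℝ≥0∞) ^ j / (j ! : ℝ≥0∞) * (G.adj ^ j) x y :=
  tsum_path G (fun j => (t : ℝ≥0∞) ^ j / (j ! : ℝ≥0∞)) x y

end MixedGraph

/-! ### Bounds for powers of lazy kernels, and sums over trajectories. -/

namespace Kern

variable {V : Type u}

/-- Integer-like kernels without loops and with row and column sums at most `D`. -/
structure Tame (A : Kern V) (D : ℕ) : Prop where
  row_le : ∀ x, ∑' y, A x y ≤ D
  col_le : ∀ y, ∑' x, A x y ≤ D
  diag : ∀ x, A x x = 0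
  eq_zero_or : ∀ x y, A x y = 0 ∨ 1 ≤ A x y

variable {A : Kern V} {D : ℕ}

theorem lazy_pow_succ_apply (c : ℝ≥0∞) (A : Kern V) (k : ℕ) (x y : V) :
    (lazy c A ^ (k + 1)) x y = (lazy c A ^ k) x y + ∑' z, (lazy c A ^ k) x z * (c * A z y) := by
  rw [pow_succ, mul_apply]
  simp_rw [lazy_apply, mul_add]
  rw [ENNReal.tsum_add, tsum_mul_one]

theorem Tame.lazy_row_le (hA : A.Tame D) (c : ℝ≥0∞) (x : V) :
    ∑' y, lazy c A x y ≤ 1 + c * D := by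
  simp_rw [lazy_apply]
  rw [ENNReal.tsum_add, ENNReal.tsum_mul_left]
  gcongr
  · have := tsum_one_mul x fun _ => (1 : ℝ≥0∞)
    simp only [mul_one] at this
    exact this.le
  · exact hA.row_le x

theorem Tame.row_pow_le (hA : A.Tame D) (c : ℝ≥0∞) (k : ℕ) (x : V) :
    ∑' y, (lazy c A ^ k) x y ≤ (1 + c * D) ^ k := by
  induction k with
  | zero =>
    have := tsum_one_mul x fun _ => (1 : ℝ≥0∞)
    simp only [mul_one] at this
    simp [this]
  | succ k ih =>
    simp_rw [pow_succ, mul_apply]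
    rw [ENNReal.tsum_comm]
    simp_rw [ENNReal.tsum_mul_left]
    calc _ ≤ ∑' b, (lazy c A ^ k) x b * (1 + c * D) := by
          gcongr with b; exact hA.lazy_row_le c b
      _ ≤ _ := by rw [ENNReal.tsum_mul_right]; gcongr

theorem Tame.lazy_col_le (hA : A.Tame D) (c : ℝ≥0∞) (y : V) :
    ∑' x, lazy c A x y ≤ 1 + c * D := by
  simp_rw [lazy_apply]
  rw [ENNReal.tsum_add, ENNReal.tsum_mul_left]
  gcongr
  · have := tsum_mul_one y fun _ => (1 : ℝ≥0∞)
    simp only [one_mul] at this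
    exact this.le
  · exact hA.col_le y

theorem Tame.col_pow_le (hA : A.Tame D) (c : ℝ≥0∞) (k : ℕ) (y : V) :
    ∑' x, (lazy c A ^ k) x y ≤ (1 + c * D) ^ k := by
  induction k with
  | zero =>
    have := tsum_mul_one y fun _ => (1 : ℝ≥0∞)
    simp only [one_mul] at this
    simp [this]
  | succ k ih =>
    simp_rw [pow_succ', mul_apply]
    rw [ENNReal.tsum_comm]
    simp_rw [ENNReal.tsum_mul_right]
    calc _ ≤ ∑' b, (1 + c * D) * (lazy c A ^ k) b y := by
          gcongr with b; exact hA.lazy_col_le c b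
      _ ≤ _ := by rw [ENNReal.tsum_mul_left]; gcongr

theorem Tame.pow_le (hA : A.Tame D) (c : ℝ≥0∞) (k : ℕ) (x y : V) :
    (lazy c A ^ k) x y ≤ (1 + c * D) ^ k :=
  (ENNReal.le_tsum y).trans (hA.row_pow_le c k x)

theorem Tame.pow_ne_top (hA : A.Tame D) {c : ℝ≥0∞} (hc : c ≠ ∞) (k : ℕ) (x y : V) :
    (lazy c A ^ k) x y ≠ ∞ :=
  ne_top_of_le_ne_top (by finiteness) (hA.pow_le c k x y)

/-- In the expansion of `(1 + c D)^k` the term `1` stands for the trajectory that never moves, and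
it does not contribute off the diagonal. -/
theorem Tame.pow_offdiag (hA : A.Tame D) (c : ℝ≥0∞) (k : ℕ) {x y : V} (hxy : x ≠ y) :
    (lazy c A ^ k) x y + 1 ≤ (1 + c * D) ^ k := by
  induction k with
  | zero => simp [one_of_ne hxy]
  | succ k ih =>
    rw [lazy_pow_succ_apply]
    calc _ = ((lazy c A ^ k) x y + 1) + ∑' z, (lazy c A ^ k) x z * (c * A z y) := by ring
      _ ≤ (1 + c * D) ^ k + ∑' z, (1 + c * D) ^ k * (c * A z y) := by
          gcongr with z; exact hA.pow_le c k x z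
      _ ≤ (1 + c * D) ^ k + (1 + c * D) ^ k * (c * D) := by
          rw [ENNReal.tsum_mul_left, ENNReal.tsum_mul_left]; gcongr; exact hA.col_le y
      _ = _ := by ring

/-- The term `k c D` stands for trajectories with a single move. They do not return to their
starting point, as there are no loops. -/
theorem Tame.pow_diag (hA : A.Tame D) (c : ℝ≥0∞) (k : ℕ) (x : V) :
    (lazy c A ^ k) x x + k * (c * D) ≤ (1 + c * D) ^ k := by
  induction k with
  | zero => simp
  | succ k ih =>
    rw [lazy_pow_succ_apply]
    -- `t` is the slack in the column bound; carrying it along avoids subtraction in `[0, ∞]`.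
    obtain ⟨t, ht⟩ := exists_add_of_le (show ∑' z, c * A z x ≤ c * D by
      rw [ENNReal.tsum_mul_left]; gcongr; exact hA.col_le x)
    have h1 : ∑' z, (lazy c A ^ k) x z * (c * A z x) + ∑' z, c * A z x ≤
        (1 + c * D) ^ k * ∑' z, c * A z x := by
      rw [← ENNReal.tsum_add, ← ENNReal.tsum_mul_left]
      refine ENNReal.tsum_le_tsum fun z => ?_
      by_cases hz : x = z
      · subst hz; simp [hA.diag]
      · calc _ = ((lazy c A ^ k) x z + 1) * (c * A z x) := by ring
          _ ≤ _ := by gcongr; exact hA.pow_offdiag c k hz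
    have h2 : ∑' z, (lazy c A ^ k) x z * (c * A z x) + c * D ≤ (1 + c * D) ^ k * (c * D) := by
      have h3 : (1 : ℝ≥0∞) ≤ (1 + c * D) ^ k := one_le_pow₀ le_self_add
      calc _ = (∑' z, (lazy c A ^ k) x z * (c * A z x) + ∑' z, c * A z x) + 1 * t := by
            conv_lhs => rw [ht]
            ring
        _ ≤ (1 + c * D) ^ k * ∑' z, c * A z x + (1 + c * D) ^ k * t := by gcongr
        _ = _ := by rw [← mul_add, ← ht]
    calc _ = ((lazy c A ^ k) x x + k * (c * D)) +
          (∑' z, (lazy c A ^ k) x z * (c * A z x) + c * D) := by push_cast; ring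
      _ ≤ (1 + c * D) ^ k + (1 + c * D) ^ k * (c * D) := by gcongr
      _ = _ := by ring

/-- Short-time bound for the entries of the powers of a lazy kernel. -/
theorem Tame.pow_short (hA : A.Tame D) (c : ℝ≥0) (k : ℕ) (hk : k * (c * D : ℝ) ≤ 1 / 2) (x y : V) :
    (lazy c A ^ k) x y ≤ ENNReal.ofReal (Real.exp ((k * (c * D : ℝ)) ^ 2)) := by
  set s : ℝ := k * (c * D : ℝ) with hs
  have hs0 : 0 ≤ s := by positivity
  have hp : ((1 : ℝ≥0∞) + c * D) ^ k ≤ ENNReal.ofReal (Real.exp s) := by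
    have h1 : ((1 : ℝ≥0∞) + c * D) = ENNReal.ofReal (1 + c * D) := by
      rw [ENNReal.ofReal_add (by norm_num) (by positivity), ENNReal.ofReal_mul (by positivity)]
      simp
    rw [h1, ← ENNReal.ofReal_pow (by positivity)]
    apply ENNReal.ofReal_le_ofReal
    rw [hs, Real.exp_nat_mul]
    gcongr
    linarith [Real.add_one_le_exp (c * D : ℝ)]
  -- The linear term in `s` disappears: on the diagonal it is subtracted by `pow_diag`, and off the
  -- diagonal `e^s - 1 ≤ s + s²` is below `1 + s²`. A short window therefore costs only `s²`.
  have hq : Real.exp s ≤ 1 + s + s ^ 2 := by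
    have := Real.abs_exp_sub_one_sub_id_le (x := s) (by rw [abs_of_nonneg hs0]; linarith)
    have := (abs_le.1 this).2
    linarith
  have he : 1 + s ^ 2 ≤ Real.exp (s ^ 2) := by linarith [Real.add_one_le_exp (s ^ 2)]
  by_cases hxy : x = y
  · subst hxy
    have h1 := (hA.pow_diag c k x).trans hp
    have h2 : (k : ℝ≥0∞) * (c * D) = ENNReal.ofReal s := by
      rw [hs, ENNReal.ofReal_mul (by positivity), ENNReal.ofReal_mul (by positivity)]
      simp
    rw [h2] at h1
    have h3 := ENNReal.le_sub_of_add_le_right ENNReal.ofReal_ne_top h1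
    refine h3.trans ?_
    rw [← ENNReal.ofReal_sub _ hs0]
    apply ENNReal.ofReal_le_ofReal
    linarith
  · have h1 := (hA.pow_offdiag c k hxy).trans hp
    have h3 := ENNReal.le_sub_of_add_le_right ENNReal.one_ne_top h1
    refine h3.trans ?_
    rw [← ENNReal.ofReal_one, ← ENNReal.ofReal_sub _ zero_le_one]
    apply ENNReal.ofReal_le_ofReal
    nlinarith

/-- Ordered products of kernels. -/
noncomputable def prodK (K : ℕ → Kern V) : ℕ → Kern V
  | 0 => 1
  | n + 1 => prodK K n * K n

/-- The sum over trajectories of the product of the kernels along them. -/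
theorem tsum_chain (K : ℕ → Kern V) (R : ℕ) (v : V) (h : V → ℝ≥0∞) :
    ∑' τ : Fin (R + 1) → V, (1 : Kern V) v (τ 0) *
      (∏ r : Fin R, K r (τ r.castSucc) (τ r.succ)) * h (τ (Fin.last R)) =
      ∑' y, prodK K R v y * h y := by
  induction R generalizing h with
  | zero =>
    rw [← (Equiv.funUnique (Fin 1) V).symm.tsum_eq]
    simp [prodK]
    rfl
  | succ R ih =>
    rw [← (Fin.snocEquiv (fun _ : Fin (R + 2) => V)).tsum_eq, ENNReal.tsum_prod', ENNReal.tsum_comm]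
    have : ∀ τ : Fin (R + 1) → V,
        ∑' y : V, (1 : Kern V) v ((Fin.snocEquiv fun _ : Fin (R + 2) => V) (y, τ) 0) *
          (∏ r : Fin (R + 1), K r ((Fin.snocEquiv fun _ : Fin (R + 2) => V) (y, τ) r.castSucc)
            ((Fin.snocEquiv fun _ : Fin (R + 2) => V) (y, τ) r.succ)) *
            h ((Fin.snocEquiv fun _ : Fin (R + 2) => V) (y, τ) (Fin.last (R + 1))) =
        (1 : Kern V) v (τ 0) * (∏ r : Fin R, K r (τ r.castSucc) (τ r.succ)) *
          ∑' y, K R (τ (Fin.last R)) y * h y := by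
      intro τ
      rw [← ENNReal.tsum_mul_left]
      refine tsum_congr fun y => ?_
      rw [Fin.prod_univ_castSucc]
      have e0 : (Fin.snocEquiv fun _ : Fin (R + 2) => V) (y, τ) 0 = τ 0 :=
        Fin.snoc_castSucc (α := fun _ => V) y τ 0
      have e1 : ∀ r : Fin (R + 1), (Fin.snocEquiv fun _ : Fin (R + 2) => V) (y, τ) r.castSucc = τ r :=
        fun r => Fin.snoc_castSucc (α := fun _ => V) y τ r
      have e2 : (Fin.snocEquiv fun _ : Fin (R + 2) => V) (y, τ) (Fin.last (R + 1)) = y :=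
        Fin.snoc_last (α := fun _ => V) y τ
      have e3 : ∀ r : Fin R, (Fin.snocEquiv fun _ : Fin (R + 2) => V) (y, τ) r.castSucc.succ =
          τ r.succ := fun r => by rw [Fin.succ_castSucc, e1]
      have e4 : (1 : Kern V) v ((Fin.snocEquiv fun _ : Fin (R + 2) => V) (y, τ) 0) =
          (1 : Kern V) v (τ 0) := congrArg ((1 : Kern V) v) e0
      rw [e4]
      simp only [e1, e2, e3, Fin.succ_last, Fin.val_castSucc, Fin.val_last, Nat.succ_eq_add_one]
      ring
    refine (tsum_congr this).trans ((ih fun z => ∑' y, K R z y * h y).trans ?_)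
    simp_rw [prodK, mul_apply, ← ENNReal.tsum_mul_left, ← ENNReal.tsum_mul_right]
    rw [ENNReal.tsum_comm]
    exact tsum_congr fun y => tsum_congr fun z => by ring

theorem prodK_const (K : Kern V) (n : ℕ) : prodK (fun _ => K) n = K ^ n := by
  induction n with
  | zero => rfl
  | succ n ih => rw [prodK, ih, pow_succ]

theorem prodK_add (K : ℕ → Kern V) (m n : ℕ) :
    prodK K (m + n) = prodK K m * prodK (fun r => K (m + r)) n := by
  induction n with
  | zero => simp [prodK]
  | succ n ih => rw [← add_assoc, prodK, ih, prodK, mul_assoc]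

theorem prodK_congr {K L : ℕ → Kern V} {n : ℕ} (h : ∀ r < n, K r = L r) : prodK K n = prodK L n := by
  induction n with
  | zero => rfl
  | succ n ih => rw [prodK, prodK, ih fun r hr => h r (by omega), h n (by omega)]

/-- The diagonal kernel at a point. -/
noncomputable def pointK (x : V) : Kern V := fun y z => (1 : Kern V) y x * (1 : Kern V) x z

theorem mul_pointK_mul (K L : Kern V) (x y z : V) : (K * pointK x * L) y z = K y x * L x z := by
  have h : ∀ b, (K * pointK x) y b = K y x * (1 : Kern V) x b := by
    intro b
    rw [mul_apply]
    simp_rw [pointK, ← mul_assoc]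
    rw [ENNReal.tsum_mul_right, tsum_mul_one]
  rw [mul_apply]
  simp_rw [h, mul_assoc]
  rw [ENNReal.tsum_mul_left, tsum_one_mul]

/-- Two-point marginals of the sum over trajectories. -/
theorem tsum_chain_two_point (W : Kern V) (a k b : ℕ) (v w x y : V) (ia ib : Fin (a + (k + 1) + b + 1))
    (hia : (ia : ℕ) = a) (hib : (ib : ℕ) = a + (k + 1)) :
    ∑' τ : Fin (a + (k + 1) + b + 1) → V, (1 : Kern V) v (τ 0) *
      (∏ r : Fin (a + (k + 1) + b), W (τ r.castSucc) (τ r.succ)) *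
        (1 : Kern V) (τ (Fin.last _)) w * ((1 : Kern V) (τ ia) x * (1 : Kern V) (τ ib) y) =
      (W ^ a) v x * (W ^ (k + 1)) x y * (W ^ b) y w := by
  classical
  -- The two constraints become diagonal kernels, inserted before the step with index `a` and after
  -- the step with index `a + k`.
  let P : Kern V → ℕ → ℕ → Kern V := fun Q m r => if r = m then Q else 1
  let K : ℕ → Kern V := fun r => P (pointK x) a r * W * P (pointK y) (a + k) r
  have hK : ∀ τ : Fin (a + (k + 1) + b + 1) → V, ∀ r : Fin (a + (k + 1) + b),
      K r (τ r.castSucc) (τ r.succ) = W (τ r.castSucc) (τ r.succ) *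
        ((if (r : ℕ) = a then (1 : Kern V) (τ r.castSucc) x else 1) *
          (if (r : ℕ) = a + k then (1 : Kern V) (τ r.succ) y else 1)) := by
    intro τ r
    have hl : ∀ (Q : Kern V) (x p q : V), (pointK x * Q) p q = Q p q * (1 : Kern V) p x := by
      intro Q x p q
      have := mul_pointK_mul 1 Q x p q
      rw [one_mul] at this
      rw [this]
      by_cases h : p = x
      · subst h; simp
      · simp [one_of_ne h]
    have hr : ∀ (Q : Kern V) (x p q : V), (Q * pointK x) p q = Q p q * (1 : Kern V) q x := by
      intro Q x p q
      have := mul_pointK_mul Q 1 x p q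
      rw [mul_one] at this
      rw [this]
      by_cases h : q = x
      · subst h; simp
      · simp [one_of_ne h, one_of_ne (Ne.symm h)]
    simp only [K, P]
    split_ifs with h1 h2 h2
    · rw [hr, hl, mul_assoc]
    · rw [mul_one, hl, mul_one]
    · rw [one_mul, hr, one_mul]
    · rw [one_mul, mul_one, mul_one, mul_one]
  have h1 := tsum_chain K (a + (k + 1) + b) v (fun q => (1 : Kern V) q w)
  rw [tsum_mul_one] at h1
  have hP : prodK K (a + (k + 1) + b) = W ^ a * pointK x * (W ^ (k + 1) * pointK y * W ^ b) := by
    rw [prodK_add, prodK_add, prodK_congr (L := fun _ => W) (n := a) (by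
      intro r hr; simp only [K, P]; rw [if_neg (by omega), if_neg (by omega), one_mul, mul_one]),
      prodK_congr (L := fun _ => W) (n := b) (by
      intro r hr; simp only [K, P]; rw [if_neg (by omega), if_neg (by omega), one_mul, mul_one]),
      prodK_const, prodK_const]
    suffices prodK (fun r => K (a + r)) (k + 1) = pointK x * W ^ (k + 1) * pointK y by
      rw [this]; simp only [mul_assoc]
    rw [prodK]
    rcases k with _ | k
    · simp [prodK, K, P]
    · rw [show k + 1 = 1 + k by ring, prodK_add, prodK_congr (L := fun _ => W) (n := k) (by
        intro r hr; simp only [K, P]; rw [if_neg (by omega), if_neg (by omega), one_mul, mul_one]),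
        prodK_const]
      have h0 : K a = pointK x * W := by
        simp only [K, P, if_true]; rw [if_neg (by omega), mul_one]
      have h2 : K (a + (1 + k)) = W * pointK y := by
        simp only [K, P]; rw [if_neg (by omega), if_pos (by ring), one_mul]
      simp only [prodK, add_zero, one_mul]
      rw [h0, h2, show 1 + k + 1 = 1 + k + 1 by rfl, pow_add, pow_add, pow_one]
      simp only [mul_assoc]
  rw [hP, mul_pointK_mul, mul_pointK_mul, ← mul_assoc] at h1
  rw [← h1]
  refine tsum_congr fun τ => ?_
  simp_rw [hK]
  rw [Finset.prod_mul_distrib, Finset.prod_mul_distrib]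
  have e1 : ∏ r : Fin (a + (k + 1) + b), (if (r : ℕ) = a then (1 : Kern V) (τ r.castSucc) x else 1) =
      (1 : Kern V) (τ ia) x := by
    rw [Finset.prod_eq_single (⟨a, by omega⟩ : Fin (a + (k + 1) + b))]
    · rw [if_pos rfl]
      exact congrArg (fun q => (1 : Kern V) (τ q) x) (Fin.ext (by simp [hia]))
    · intro r _ hr; rw [if_neg fun h => hr (Fin.ext h)]
    · simp
  have e2 : ∏ r : Fin (a + (k + 1) + b), (if (r : ℕ) = a + k then (1 : Kern V) (τ r.succ) y else 1) =
      (1 : Kern V) (τ ib) y := by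
    rw [Finset.prod_eq_single (⟨a + k, by omega⟩ : Fin (a + (k + 1) + b))]
    · rw [if_pos rfl]
      exact congrArg (fun q => (1 : Kern V) (τ q) y) (Fin.ext (by simp [hib]; ring))
    · intro r _ hr; rw [if_neg fun h => hr (Fin.ext h)]
    · simp
  rw [e1, e2]
  ring

end Kern

/-! ### Entropy of the bridge from `v` to `w`. -/

/-- A concave sequence lies above its chords. -/
theorem chord_le_of_concave {f : ℕ → ℝ} {N : ℕ} (hf : ∀ k, k + 2 ≤ N → f (k + 2) + f k ≤ 2 * f (k + 1))
    {k : ℕ} (hk : k ≤ N) : (N - k) * f 0 + k * f N ≤ N * f k := by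
  have anti : ∀ i j, i ≤ j → j + 1 ≤ N → f (j + 1) - f j ≤ f (i + 1) - f i := by
    intro i j hij
    induction j, hij using Nat.le_induction with
    | base => intro _; exact le_rfl
    | succ j hj ih => intro h; have := hf j (by omega); have := ih (by omega); linarith
  rcases hk.eq_or_lt with rfl | hk
  · simp
  have up : ∀ j, k + j ≤ N → f (k + j) - f k ≤ j * (f (k + 1) - f k) := by
    intro j
    induction j with
    | zero => intro _; simp
    | succ j ih =>
      intro h
      have h1 := ih (by omega)
      have h2 := anti k (k + j) (by omega) (by omega)
      push_cast
      rw [← add_assoc]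
      linarith
  have down : ∀ j, j ≤ k → f j - f 0 ≥ j * (f (k + 1) - f k) := by
    intro j
    induction j with
    | zero => intro _; simp
    | succ j ih =>
      intro h
      have h1 := ih (by omega)
      have h2 := anti j k (by omega) (by omega)
      push_cast
      linarith
  have h1 := up (N - k) (by omega)
  rw [Nat.add_sub_cancel' hk.le, Nat.cast_sub hk.le] at h1
  have h2 := down k le_rfl
  have hk0 : (0 : ℝ) ≤ k := by positivity
  have hN0 : (0 : ℝ) ≤ N - k := by
    rw [sub_nonneg]; exact_mod_cast hk.le
  nlinarith [mul_le_mul_of_nonneg_left h1 hk0, mul_le_mul_of_nonneg_left h2 hN0]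

namespace Kern

variable {V : Type u} {A : Kern V} {D : ℕ}

/-- The nonnegative logarithm `log (C / x)`. -/
noncomputable def lg (C : ℝ) (x : ℝ≥0∞) : ℝ≥0∞ := ENNReal.ofReal (Real.log (C / x.toReal))

/-- The (unnormalized) expectation of `log (C / W_k)` for the bridge with `k + j` steps. -/
noncomputable def psi (C : ℝ) (W : Kern V) (v w : V) (k j : ℕ) : ℝ≥0∞ :=
  ∑' y, (W ^ k) v y * lg C ((W ^ k) v y) * (W ^ j) y w

/-- By `Reversible.commute` the `a` free steps in front of the window can be moved behind it. This
is how the symmetry of the graph enters the entropy estimates. -/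
theorem Reversible.psi_shift (h : A.Reversible) (c : ℝ≥0∞) (C : ℝ) (v w : V) (a k j : ℕ) :
    ∑' x, ∑' y, (lazy c A ^ a) v x * ((lazy c A ^ k) x y * lg C ((lazy c A ^ k) x y)) *
      (lazy c A ^ j) y w = psi C (lazy c A) v w k (a + j) := by
  rw [ENNReal.tsum_comm]
  simp_rw [ENNReal.tsum_mul_right]
  have h1 : ∀ y, ∑' x, (lazy c A ^ a) v x * ((lazy c A ^ k) x y * lg C ((lazy c A ^ k) x y)) =
      ∑' x, ((lazy c A ^ k) v x * lg C ((lazy c A ^ k) v x)) * (lazy c A ^ a) x y :=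
    fun y => (h.commute c (fun t => t * lg C t) k a v y).symm
  simp_rw [h1, ← ENNReal.tsum_mul_right]
  rw [ENNReal.tsum_comm, psi]
  refine tsum_congr fun x => ?_
  simp_rw [mul_assoc]
  rw [ENNReal.tsum_mul_left, ENNReal.tsum_mul_left, pow_add, mul_apply]

theorem mul_le_mul_apply (K L : Kern V) (x y z : V) : K x y * L y z ≤ (K * L) x z :=
  ENNReal.le_tsum y

/-- This is `log x ≤ x - 1` at `x = γ δ / (α β)`. -/
theorem log_four_ineq {C α β γ δ : ℝ} (hC : 0 < C) (hα : 0 < α) (hβ : 0 < β) (hγ : 0 < γ)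
    (hδ : 0 < δ) : Real.log (C / α) + Real.log (C / β) + 1 ≤
      Real.log (C / γ) + Real.log (C / δ) + γ * δ / (α * β) := by
  have h := Real.log_le_sub_one_of_pos (show 0 < γ * δ / (α * β) by positivity)
  rw [Real.log_div (by positivity) (by positivity), Real.log_mul (by positivity) (by positivity),
    Real.log_mul (by positivity) (by positivity)] at h
  rw [Real.log_div hC.ne' hα.ne', Real.log_div hC.ne' hβ.ne', Real.log_div hC.ne' hγ.ne',
    Real.log_div hC.ne' hδ.ne']
  linarith

theorem lg_four {C : ℝ} {α β γ δ : ℝ≥0∞} (hα : α ≠ 0) (hβ : β ≠ 0) (hγ : γ ≠ 0) (hδ : δ ≠ 0)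
    (hα' : α ≤ ENNReal.ofReal C) (hβ' : β ≤ ENNReal.ofReal C) (hγ' : γ ≤ ENNReal.ofReal C)
    (hδ' : δ ≤ ENNReal.ofReal C) : lg C α + lg C β + 1 ≤ lg C γ + lg C δ + γ * δ / (α * β) := by
  have fin : ∀ {x : ℝ≥0∞}, x ≤ ENNReal.ofReal C → x ≠ ∞ :=
    fun hx => ne_top_of_le_ne_top ENNReal.ofReal_ne_top hx
  have pos : ∀ {x : ℝ≥0∞}, x ≠ 0 → x ≤ ENNReal.ofReal C → 0 < x.toReal :=
    fun hx h => ENNReal.toReal_pos hx (fin h)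
  have hC : 0 < C := by
    by_contra h
    rw [ENNReal.ofReal_of_nonpos (not_lt.1 h)] at hα'
    exact hα (le_antisymm hα' zero_le)
  have nn : ∀ {x : ℝ≥0∞}, x ≠ 0 → x ≤ ENNReal.ofReal C → 0 ≤ Real.log (C / x.toReal) := by
    intro x hx h
    apply Real.log_nonneg
    rw [one_le_div (pos hx h)]
    exact (ENNReal.toReal_le_of_le_ofReal hC.le h)
  have key := log_four_ineq hC (pos hα hα') (pos hβ hβ') (pos hγ hγ') (pos hδ hδ')
  have e : γ * δ / (α * β) = ENNReal.ofReal (γ.toReal * δ.toReal / (α.toReal * β.toReal)) := by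
    rw [ENNReal.ofReal_div_of_pos (mul_pos (pos hα hα') (pos hβ hβ')),
      ENNReal.ofReal_mul ENNReal.toReal_nonneg, ENNReal.ofReal_mul ENNReal.toReal_nonneg,
      ENNReal.ofReal_toReal (fin hα'), ENNReal.ofReal_toReal (fin hβ'),
      ENNReal.ofReal_toReal (fin hγ'), ENNReal.ofReal_toReal (fin hδ')]
  rw [e, lg, lg, lg, lg, ← ENNReal.ofReal_add (nn hα hα') (nn hβ hβ'),
    ← ENNReal.ofReal_add (nn hγ hγ') (nn hδ hδ'), ← ENNReal.ofReal_one,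
    ← ENNReal.ofReal_add (add_nonneg (nn hα hα') (nn hβ hβ')) zero_le_one,
    ← ENNReal.ofReal_add (add_nonneg (nn hγ hγ') (nn hδ hδ')) (by positivity)]
  exact ENNReal.ofReal_le_ofReal key

/-- Concavity of the expected logarithm (submodularity of entropy). -/
theorem Reversible.psi_concave (h : A.Reversible) (c : ℝ≥0∞) (C : ℝ) (v w : V) (k j : ℕ)
    (hC : ∀ i ≤ k + 2, ∀ x y, (lazy c A ^ i) x y ≤ ENNReal.ofReal C)
    (hZ : (lazy c A ^ (k + 2 + j)) v w ≠ ∞) :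
    psi C (lazy c A) v w (k + 2) j + psi C (lazy c A) v w k (j + 2) ≤
      2 * psi C (lazy c A) v w (k + 1) (j + 1) := by
  set W := lazy c A with hW
  -- The weight of the bridge through `b` after one step, `x` after `k + 1` and `d` after `k + 2`
  -- steps. The proof is strong subadditivity of entropy for these three positions, with shifts by
  -- `psi_shift`.
  let P : V → V → V → ℝ≥0∞ := fun b x d => W v b * (W ^ k) b x * W x d * (W ^ j) d w
  have p1 : ∀ x, ∑' b, W v b * (W ^ k) b x = (W ^ (k + 1)) v x := fun x => by
    rw [pow_succ', mul_apply]
  have p2 : ∀ d, ∑' x, (W ^ (k + 1)) v x * W x d = (W ^ (k + 2)) v d := fun d => by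
    rw [pow_succ W (k + 1), mul_apply]
  have p3 : ∀ b d, ∑' x, (W ^ k) b x * W x d = (W ^ (k + 1)) b d := fun b d => by
    rw [pow_succ, mul_apply]
  have p4 : ∀ x, ∑' d, W x d * (W ^ j) d w = (W ^ (j + 1)) x w := fun x => by
    rw [pow_succ', mul_apply]
  have p5 : ∀ d, ∑' b, W v b * (W ^ (k + 1)) b d = (W ^ (k + 2)) v d := fun d => by
    rw [pow_succ' W (k + 1), mul_apply]
  have s0 : ∑' d, ∑' x, ∑' b, P b x d = (W ^ (k + 2 + j)) v w := by
    simp only [P]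
    simp_rw [ENNReal.tsum_mul_right, p1, p2]
    rw [pow_add W (k + 2) j, mul_apply]
  have s1 : ∑' d, ∑' x, ∑' b, P b x d * lg C ((W ^ (k + 2)) v d) = psi C W v w (k + 2) j := by
    simp only [P]
    simp_rw [ENNReal.tsum_mul_right, p1, p2]
    rw [psi]
    exact tsum_congr fun d => by ring
  have s2 : ∑' d, ∑' x, ∑' b, P b x d * lg C ((W ^ k) b x) = psi C W v w k (j + 2) := by
    have e : ∑' d, ∑' x, ∑' b, P b x d * lg C ((W ^ k) b x) =
        ∑' b, ∑' x, (W ^ 1) v b * ((W ^ k) b x * lg C ((W ^ k) b x)) * (W ^ (j + 1)) x w := by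
      rw [ENNReal.tsum_comm]
      have : ∀ x, ∑' d, ∑' b, P b x d * lg C ((W ^ k) b x) =
          ∑' b, (W ^ 1) v b * ((W ^ k) b x * lg C ((W ^ k) b x)) * (W ^ (j + 1)) x w := by
        intro x
        rw [ENNReal.tsum_comm]
        refine tsum_congr fun b => ?_
        rw [← p4, ← ENNReal.tsum_mul_left, pow_one]
        exact tsum_congr fun d => by simp only [P]; ring
      rw [tsum_congr this, ENNReal.tsum_comm]
    rw [e, hW, h.psi_shift]
    congr 1; ring
  have s3 : ∑' d, ∑' x, ∑' b, P b x d * lg C ((W ^ (k + 1)) v x) = psi C W v w (k + 1) (j + 1) := by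
    rw [ENNReal.tsum_comm, psi]
    refine tsum_congr fun x => ?_
    rw [← p4, ← ENNReal.tsum_mul_left]
    refine tsum_congr fun d => ?_
    rw [← p1]
    simp_rw [← ENNReal.tsum_mul_right]
    exact tsum_congr fun b => by simp only [P]; ring
  have s4 : ∑' d, ∑' x, ∑' b, P b x d * lg C ((W ^ (k + 1)) b d) = psi C W v w (k + 1) (j + 1) := by
    have e : ∑' d, ∑' x, ∑' b, P b x d * lg C ((W ^ (k + 1)) b d) =
        ∑' b, ∑' d, (W ^ 1) v b * ((W ^ (k + 1)) b d * lg C ((W ^ (k + 1)) b d)) * (W ^ j) d w := by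
      rw [ENNReal.tsum_comm (f := fun b d => _ * _ * (W ^ j) d w)]
      refine tsum_congr fun d => ?_
      rw [ENNReal.tsum_comm]
      refine tsum_congr fun b => ?_
      rw [← p3, pow_one]
      simp_rw [← ENNReal.tsum_mul_right]
      rw [← ENNReal.tsum_mul_left, ← ENNReal.tsum_mul_right]
      exact tsum_congr fun x => by simp only [P, p3]; ring
    rw [e, hW, h.psi_shift]
    congr 1; ring
  -- `Q` is `P` times the quotient `γ δ / (α β)` of `lg_four`. Under `Q` the points `b` and `x` are
  -- conditionally independent given `d`, so that its total mass is at most that of the bridge.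
  let Q : V → V → V → ℝ≥0∞ := fun b x d => W v b * (W ^ (k + 1)) b d * ((W ^ (k + 1)) v x * W x d) *
    ((W ^ j) d w / (W ^ (k + 2)) v d)
  have s5 : ∑' d, ∑' x, ∑' b, Q b x d ≤ (W ^ (k + 2 + j)) v w := by
    simp only [Q]
    simp_rw [ENNReal.tsum_mul_right, p5, ENNReal.tsum_mul_left, p2]
    rw [pow_add W (k + 2) j, mul_apply]
    refine ENNReal.tsum_le_tsum fun d => ?_
    rw [mul_assoc]
    gcongr
    exact ENNReal.mul_div_le
  have key : ∀ b x d, P b x d * lg C ((W ^ (k + 2)) v d) + P b x d * lg C ((W ^ k) b x) + P b x d ≤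
      P b x d * lg C ((W ^ (k + 1)) v x) + P b x d * lg C ((W ^ (k + 1)) b d) + Q b x d := by
    intro b x d
    by_cases hP : P b x d = 0
    · simp [hP]
    have n1 : W v b ≠ 0 := fun h0 => hP (by simp [P, h0])
    have n2 : (W ^ k) b x ≠ 0 := fun h0 => hP (by simp [P, h0])
    have n3 : W x d ≠ 0 := fun h0 => hP (by simp [P, h0])
    have n4 : (W ^ (k + 1)) v x ≠ 0 := by
      have := mul_le_mul_apply W (W ^ k) v b x
      rw [← pow_succ'] at this
      exact fun h0 => mul_ne_zero n1 n2 (le_antisymm (h0 ▸ this) zero_le)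
    have n5 : (W ^ (k + 1)) b d ≠ 0 := by
      have := mul_le_mul_apply (W ^ k) W b x d
      rw [← pow_succ] at this
      exact fun h0 => mul_ne_zero n2 n3 (le_antisymm (h0 ▸ this) zero_le)
    have n6 : (W ^ (k + 2)) v d ≠ 0 := by
      have := mul_le_mul_apply (W ^ (k + 1)) W v x d
      rw [← pow_succ] at this
      exact fun h0 => mul_ne_zero n4 n3 (le_antisymm (h0 ▸ this) zero_le)
    have h4 := lg_four (C := C) n6 n2 n4 n5 (hC _ le_rfl _ _) (hC _ (by omega) _ _)
      (hC _ (by omega) _ _) (hC _ (by omega) _ _)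
    have e : Q b x d = P b x d * ((W ^ (k + 1)) v x * (W ^ (k + 1)) b d /
        ((W ^ (k + 2)) v d * (W ^ k) b x)) := by
      have n2' : (W ^ k) b x ≠ ∞ := ne_top_of_le_ne_top ENNReal.ofReal_ne_top (hC _ (by omega) _ _)
      simp only [P, Q, div_eq_mul_inv]
      rw [ENNReal.mul_inv (Or.inr n2') (Or.inr n2)]
      have : (W ^ k) b x * ((W ^ k) b x)⁻¹ = 1 := ENNReal.mul_inv_cancel n2 n2'
      calc _ = W v b * (W ^ (k + 1)) b d * ((W ^ (k + 1)) v x * W x d) * ((W ^ j) d w *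
            ((W ^ (k + 2)) v d)⁻¹) * ((W ^ k) b x * ((W ^ k) b x)⁻¹) := by rw [this, mul_one]
        _ = _ := by ring
    rw [e, ← mul_add, ← mul_add, ← mul_add]
    calc _ = P b x d * (lg C ((W ^ (k + 2)) v d) + lg C ((W ^ k) b x) + 1) := by ring
      _ ≤ _ := by gcongr
  have fin := ENNReal.tsum_le_tsum fun d => ENNReal.tsum_le_tsum fun x =>
    ENNReal.tsum_le_tsum fun b => key b x d
  simp_rw [ENNReal.tsum_add] at fin
  rw [s0, s1, s2, s3, s4] at fin
  have fin2 := fin.trans (add_le_add_right s5 _)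
  rw [two_mul]
  exact (ENNReal.add_le_add_iff_right hZ).1 fin2

/-- Lower bound for the entropy of the midpoint of the bridge. -/
theorem Reversible.psi_half (h : A.Reversible) (c : ℝ≥0∞) (C q : ℝ) (v w : V) (hvw : v ≠ w) (n : ℕ)
    (hC : ∀ x y, (lazy c A ^ n) x y ≤ ENNReal.ofReal C)
    (hC2 : (lazy c A ^ (2 * n)) v w ≤ ENNReal.ofReal C)
    (hZ : 1 ≤ (lazy c A ^ (2 * n)) v w) (hq : 0 ≤ q)
    (hv : ENNReal.ofReal q * (lazy c A ^ (2 * n)) v w ≤ (lazy c A ^ n) v v * (lazy c A ^ n) v w)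
    (hw : ENNReal.ofReal q * (lazy c A ^ (2 * n)) v w ≤ (lazy c A ^ n) v w * (lazy c A ^ n) w w)
    (hlog : Real.log ((lazy c A ^ (2 * n)) v w).toReal ≤ q ^ 2) :
    (lazy c A ^ (2 * n)) v w * ENNReal.ofReal (Real.log C) ≤ psi C (lazy c A) v w n n := by
  set W := lazy c A with hW
  set Z := (W ^ (2 * n)) v w with hZdef
  have hZt : Z ≠ ∞ := ne_top_of_le_ne_top ENNReal.ofReal_ne_top hC2
  have hZr : 1 ≤ Z.toReal := by
    rw [← ENNReal.toReal_one]; exact ENNReal.toReal_mono hZt hZ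
  have hCZ : Z.toReal ≤ C := by
    have hC0 : 0 ≤ C := by
      by_contra h0
      rw [ENNReal.ofReal_of_nonpos (not_le.1 h0).le] at hC2
      have := hZ.trans hC2
      simp at this
    exact ENNReal.toReal_le_of_le_ofReal hC0 hC2
  let t : V → ℝ≥0∞ := fun y => (W ^ n) v y * (W ^ n) y w
  have ht : ∑' y, t y = Z := by
    simp only [t]; rw [hZdef, two_mul, pow_add, mul_apply]
  have h1 : psi C W v w n n = ∑' y, t y * lg C ((W ^ n) v y) := by
    rw [psi]; exact tsum_congr fun y => by simp only [t]; ring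
  -- By the shift, the second half of the bridge has the same expected logarithm as the first half.
  have h2 : psi C W v w n n = ∑' y, t y * lg C ((W ^ n) y w) := by
    have := h.psi_shift c C v w n n 0
    rw [add_zero] at this
    rw [hW, ← this]
    refine tsum_congr fun x => ?_
    simp_rw [pow_zero]
    rw [tsum_mul_one]
    simp only [t]; ring
  have hle : ∀ y, t y ≤ Z := fun y => ht ▸ ENNReal.le_tsum y
  have hvw' : t v + t w ≤ Z := by
    classical
    rw [← ht]
    have := ENNReal.sum_le_tsum (f := t) {v, w}
    rwa [Finset.sum_pair hvw] at this
  -- Adding the two expressions, `2 psi = Z (2 log C - log Z + H)`, where `H` is the entropy of the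
  -- midpoint law `p y = t y / Z`. So `H ≥ log Z` is needed. Keep only the point `v`: `-log p ≥ 1 -
  -- p` gives `H ≥ p v (1 - p v) ≥ p v * p w ≥ q²`.
  have key : ∀ y, t y * ENNReal.ofReal (2 * Real.log C - Real.log Z.toReal) +
      t y * (1 : Kern V) y v * ENNReal.ofReal q ≤
      t y * lg C ((W ^ n) v y) + t y * lg C ((W ^ n) y w) := by
    intro y
    by_cases h0 : t y = 0
    · simp [h0]
    have n1 : (W ^ n) v y ≠ 0 := left_ne_zero_of_mul h0
    have n2 : (W ^ n) y w ≠ 0 := right_ne_zero_of_mul h0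
    have f1 : (W ^ n) v y ≠ ∞ := ne_top_of_le_ne_top ENNReal.ofReal_ne_top (hC _ _)
    have f2 : (W ^ n) y w ≠ ∞ := ne_top_of_le_ne_top ENNReal.ofReal_ne_top (hC _ _)
    have r1 := ENNReal.toReal_pos n1 f1
    have r2 := ENNReal.toReal_pos n2 f2
    have c1 := ENNReal.toReal_le_of_le_ofReal (by linarith) (hC v y)
    have c2 := ENNReal.toReal_le_of_le_ofReal (by linarith) (hC y w)
    have hC0 : 0 < C := by linarith
    have tr : (t y).toReal = ((W ^ n) v y).toReal * ((W ^ n) y w).toReal := ENNReal.toReal_mul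
    have tpos : 0 < (t y).toReal := by rw [tr]; positivity
    have tle : (t y).toReal ≤ Z.toReal := ENNReal.toReal_mono hZt (hle y)
    have hlogs : Real.log (C / ((W ^ n) v y).toReal) + Real.log (C / ((W ^ n) y w).toReal) =
        2 * Real.log C - Real.log Z.toReal + -Real.log ((t y).toReal / Z.toReal) := by
      rw [Real.log_div (by positivity) (by positivity), Real.log_div (by positivity) (by positivity),
        Real.log_div (by positivity) (by positivity), tr, Real.log_mul (by positivity) (by positivity)]
      ring
    have hnn : 0 ≤ 2 * Real.log C - Real.log Z.toReal := by
      have := Real.log_le_log (by linarith) hCZ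
      have := Real.log_nonneg (show 1 ≤ C by linarith)
      linarith
    rw [mul_assoc (t y) ((1 : Kern V) y v), ← mul_add, ← mul_add, lg, lg, ← ENNReal.ofReal_add (Real.log_nonneg (by
      rwa [one_le_div r1])) (Real.log_nonneg (by rwa [one_le_div r2])), hlogs]
    gcongr
    have hp := Real.log_le_sub_one_of_pos (show 0 < (t y).toReal / Z.toReal by positivity)
    by_cases hy : y = v
    · subst hy
      rw [one_self, one_mul, ← ENNReal.ofReal_add hnn hq]
      apply ENNReal.ofReal_le_ofReal
      have h3 : q * Z.toReal ≤ (t w).toReal := by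
        have := ENNReal.toReal_mono (ne_top_of_le_ne_top hZt (hle w)) hw
        rwa [ENNReal.toReal_mul, ENNReal.toReal_ofReal hq] at this
      have h4 : (t y).toReal + (t w).toReal ≤ Z.toReal := by
        rw [← ENNReal.toReal_add (ne_top_of_le_ne_top hZt (hle y)) (ne_top_of_le_ne_top hZt (hle w))]
        exact ENNReal.toReal_mono hZt hvw'
      have h5 : (t y).toReal / Z.toReal ≤ 1 - q := by
        rw [div_le_iff₀ (by linarith)]; linarith
      linarith
    · rw [one_of_ne hy, zero_mul, add_zero]
      apply ENNReal.ofReal_le_ofReal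
      have : (t y).toReal / Z.toReal ≤ 1 := by rwa [div_le_one (by linarith)]
      linarith
  have fin := ENNReal.tsum_le_tsum key
  rw [ENNReal.tsum_add, ENNReal.tsum_add, ← h1, ← h2, ENNReal.tsum_mul_right, ENNReal.tsum_mul_right,
    ht, tsum_mul_one, ← two_mul] at fin
  have hlow : 2 * (Z * ENNReal.ofReal (Real.log C)) ≤
      Z * ENNReal.ofReal (2 * Real.log C - Real.log Z.toReal) + t v * ENNReal.ofReal q := by
    have hC1 : 0 ≤ Real.log C := Real.log_nonneg (by linarith)
    have h6 : Real.log Z.toReal ≤ Real.log C := Real.log_le_log (by linarith) hCZ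
    calc 2 * (Z * ENNReal.ofReal (Real.log C)) = Z * ENNReal.ofReal (2 * Real.log C) := by
          rw [ENNReal.ofReal_mul (by norm_num)]; simp; ring
      _ ≤ Z * ENNReal.ofReal ((2 * Real.log C - Real.log Z.toReal) + q * q) := by
          gcongr; nlinarith
      _ = Z * ENNReal.ofReal (2 * Real.log C - Real.log Z.toReal) +
          ENNReal.ofReal q * Z * ENNReal.ofReal q := by
          rw [ENNReal.ofReal_add (by linarith) (by positivity), ENNReal.ofReal_mul hq]; ring
      _ ≤ _ := by gcongr
  have := hlow.trans fin
  rwa [ENNReal.mul_le_mul_iff_right (by norm_num) (by norm_num)] at this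

end Kern

/-! ### Independent passage times and moment methods. -/

/-- Independent measurable `[0, ∞)`-valued variables with common law `F`. -/
structure IIDField {E Ω : Type*} [MeasurableSpace Ω] (τ : E → Ω → ℝ≥0) (F : Measure ℝ≥0)
    (μ : Measure Ω) : Prop where
  measurable : ∀ e, Measurable (τ e)
  map_eq : ∀ e, μ.map (τ e) = F
  indep : iIndepFun τ μ

/-- The σ-algebra generated by the variables with index in `S`. -/
@[reducible] def sig {E Ω : Type*} (τ : E → Ω → ℝ≥0) (S : Set E) : MeasurableSpace Ω :=
  ⨆ e ∈ S, MeasurableSpace.comap (τ e) inferInstance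

section sig
variable {E Ω ι : Type*} {τ : E → Ω → ℝ≥0}

lemma sig_mono {S T : Set E} (h : S ⊆ T) : sig τ S ≤ sig τ T :=
  biSup_mono h

lemma measurable_sig {S : Set E} {e : E} (he : e ∈ S) : Measurable[sig τ S] (τ e) :=
  (comap_measurable (τ e)).mono (le_biSup (fun e => MeasurableSpace.comap (τ e) inferInstance) he)
    le_rfl

lemma measurable_sum_sig {S : Set E} {s : Finset E} (h : (s : Set E) ⊆ S) :
    Measurable[sig τ S] (fun ω => ∑ e ∈ s, τ e ω) :=
  Finset.measurable_fun_sum s (fun e he => measurable_sig (h he))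

variable [MeasurableSpace Ω] {F : Measure ℝ≥0} {μ : Measure Ω}

lemma IIDField.sig_le (h : IIDField τ F μ) (S : Set E) : sig τ S ≤ ‹MeasurableSpace Ω› :=
  iSup₂_le fun _ _ => (h.measurable _).comap_le

lemma IIDField.indep_sig (h : IIDField τ F μ) {S T : Set E} (hST : Disjoint S T) :
    Indep (sig τ S) (sig τ T) μ :=
  indep_iSup_of_disjoint (fun e => (h.measurable e).comap_le) h.indep hST

lemma IIDField.measure_inter (h : IIDField τ F μ) {S T : Set E} (hST : Disjoint S T) {A B : Set Ω}
    (hA : MeasurableSet[sig τ S] A) (hB : MeasurableSet[sig τ T] B) :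
    μ (A ∩ B) = μ A * μ B :=
  (Indep_iff _ _ μ).1 (h.indep_sig hST) A B hA hB

lemma IIDField.lintegral_prod [IsProbabilityMeasure μ] (h : IIDField τ F μ) {S : ι → Set E}
    {s : Finset ι}
    (hS : (s : Set ι).PairwiseDisjoint S) {f : ι → Ω → ℝ≥0∞}
    (hf : ∀ i ∈ s, Measurable[sig τ (S i)] (f i)) :
    ∫⁻ ω, ∏ i ∈ s, f i ω ∂μ = ∏ i ∈ s, ∫⁻ ω, f i ω ∂μ := by
  classical
  induction s using Finset.induction_on with
  | empty => simp
  | insert a s ha ih =>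
    have hd : Disjoint (S a) (⋃ i ∈ s, S i) := by
      rw [Set.disjoint_iUnion₂_right]
      intro i hi
      exact hS (by simp) (by simp [hi]) (by rintro rfl; exact ha hi)
    have hm : Measurable[sig τ (⋃ i ∈ s, S i)] (fun ω => ∏ i ∈ s, f i ω) :=
      Finset.measurable_fun_prod s fun i hi => (hf i (by simp [hi])).mono
        (sig_mono (Set.subset_biUnion_of_mem (u := S) hi)) le_rfl
    simp_rw [Finset.prod_insert ha]
    rw [← ih (hS.subset (by simp)) (fun i hi => hf i (by simp [hi]))]
    exact lintegral_mul_eq_lintegral_mul_lintegral_of_independent_measurableSpace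
      (h.sig_le _) (h.sig_le _) (h.indep_sig hd) (hf a (by simp)) hm

lemma IIDField.measure_biInter [IsProbabilityMeasure μ] (h : IIDField τ F μ) {S : ι → Set E}
    {s : Finset ι} (hS : (s : Set ι).PairwiseDisjoint S) {A : ι → Set Ω}
    (hA : ∀ i ∈ s, MeasurableSet[sig τ (S i)] (A i)) :
    μ (⋂ i ∈ s, A i) = ∏ i ∈ s, μ (A i) := by
  classical
  have hA' : ∀ i ∈ s, MeasurableSet (A i) := fun i hi => h.sig_le _ _ (hA i hi)
  have := h.lintegral_prod hS (f := fun i => (A i).indicator 1)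
    (fun i hi => Measurable.indicator measurable_const (hA i hi))
  rw [Finset.prod_congr rfl (fun i hi => lintegral_indicator_one (hA' i hi))] at this
  rw [← this, ← lintegral_indicator_one (Finset.measurableSet_biInter s hA')]
  refine lintegral_congr fun ω => ?_
  by_cases hω : ∀ i ∈ s, ω ∈ A i
  · rw [Set.indicator_of_mem (by simpa using hω), Finset.prod_eq_one]
    · rfl
    · intro i hi; rw [Set.indicator_of_mem (hω i hi)]; rfl
  · push Not at hω
    obtain ⟨i, hi, hn⟩ := hω
    rw [Set.indicator_of_notMem (by simp; exact ⟨i, hi, hn⟩),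
      Finset.prod_eq_zero hi (Set.indicator_of_notMem hn _)]

open Classical in
/-- Few of many independent events occur only with small probability. -/
lemma IIDField.measure_card_le [IsProbabilityMeasure μ] (h : IIDField τ F μ) {S : ι → Set E}
    {s : Finset ι} (hS : (s : Set ι).PairwiseDisjoint S) {A : ι → Set Ω}
    (hA : ∀ i ∈ s, MeasurableSet[sig τ (S i)] (A i)) (k : ℕ) :
    μ {ω | (s.filter (fun i => ω ∈ A i)).card ≤ k} ≤ 2 ^ k * ∏ i ∈ s, (1 - μ (A i) / 2) := by
  have hA' : ∀ i ∈ s, MeasurableSet (A i) := fun i hi => h.sig_le _ _ (hA i hi)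
  -- The product of the `f i` is `2` to the minus number of events that occur. Its expectation
  -- factorizes, and Markov's inequality applies.
  let f : ι → Ω → ℝ≥0∞ := fun i => (A i).indicator (fun _ => 2⁻¹) + (A i)ᶜ.indicator 1
  have hf : ∀ i ∈ s, Measurable[sig τ (S i)] (f i) := fun i hi =>
    (Measurable.indicator measurable_const (hA i hi)).add
      (Measurable.indicator measurable_const (hA i hi).compl)
  have hint : ∀ i ∈ s, ∫⁻ ω, f i ω ∂μ = 1 - μ (A i) / 2 := by
    intro i hi
    have hle : μ (A i) ≤ 1 := prob_le_one
    simp only [f, Pi.add_apply]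
    rw [lintegral_add_left (measurable_const.indicator (hA' i hi)),
      lintegral_indicator_const (hA' i hi), lintegral_indicator_one (hA' i hi).compl,
      prob_compl_eq_one_sub (hA' i hi)]
    have hne : μ (A i) ≠ ∞ := measure_ne_top _ _
    refine ENNReal.eq_sub_of_add_eq (ENNReal.div_ne_top hne (by simp)) ?_
    rw [mul_comm, ← div_eq_mul_inv, add_right_comm, ENNReal.add_halves, add_tsub_cancel_of_le hle]
  have key := h.lintegral_prod hS hf
  rw [Finset.prod_congr rfl hint] at key
  rw [← key]
  have hm : Measurable (fun ω => ∏ i ∈ s, f i ω) :=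
    Finset.measurable_fun_prod s fun i hi => (hf i hi).mono (h.sig_le _) le_rfl
  have hval : ∀ ω, ∏ i ∈ s, f i ω = (2⁻¹ : ℝ≥0∞) ^ (s.filter (fun i => ω ∈ A i)).card := by
    intro ω
    rw [← Finset.prod_filter_mul_prod_filter_not s (fun i => ω ∈ A i),
      Finset.prod_congr rfl (g := fun _ => 2⁻¹), Finset.prod_const, Finset.prod_eq_one, mul_one]
    · intro i hi
      simp [f, (Finset.mem_filter.1 hi).2]
    · intro i hi
      simp [f, (Finset.mem_filter.1 hi).2]
  have := mul_meas_ge_le_lintegral (μ := μ) hm ((2⁻¹ : ℝ≥0∞) ^ k)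
  have hsub : {ω | (s.filter (fun i => ω ∈ A i)).card ≤ k} ⊆
      {ω | (2⁻¹ : ℝ≥0∞) ^ k ≤ ∏ i ∈ s, f i ω} := by
    intro ω hω
    simp only [Set.mem_ofPred_eq] at hω ⊢
    rw [hval]
    exact pow_le_pow_of_le_one (by simp) (by simp) hω
  calc _ ≤ μ {ω | (2⁻¹ : ℝ≥0∞) ^ k ≤ ∏ i ∈ s, f i ω} := measure_mono hsub
    _ = 2 ^ k * ((2⁻¹ : ℝ≥0∞) ^ k * μ {ω | (2⁻¹ : ℝ≥0∞) ^ k ≤ ∏ i ∈ s, f i ω}) := by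
        rw [← mul_assoc, ← mul_pow, ENNReal.mul_inv_cancel (by simp) (by simp), one_pow, one_mul]
    _ ≤ _ := by gcongr

end sig

/-- The weighted second moment method. -/
lemma sq_sum_le_measure_biUnion {Ω ι : Type*} [MeasurableSpace Ω] {μ : Measure Ω}
    (s : Finset ι) {A : ι → Set Ω} (hA : ∀ i ∈ s, MeasurableSet (A i)) (c : ι → ℝ≥0∞) :
    (∑ i ∈ s, c i * μ (A i)) ^ 2 ≤
      μ (⋃ i ∈ s, A i) * ∑ i ∈ s, ∑ j ∈ s, c i * c j * μ (A i ∩ A j) := by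
  classical
  let f : Ω → ℝ≥0∞ := fun ω => ∑ i ∈ s, c i * (A i).indicator 1 ω
  let U := ⋃ i ∈ s, A i
  have hU : MeasurableSet U := Finset.measurableSet_biUnion s hA
  have hi : ∀ i ∈ s, Measurable (fun ω => c i * (A i).indicator (1 : Ω → ℝ≥0∞) ω) :=
    fun i hi => (Measurable.indicator measurable_const (hA i hi)).const_mul _
  have hf : Measurable f := Finset.measurable_fun_sum s hi
  have h1 : ∑ i ∈ s, c i * μ (A i) = ∫⁻ ω, f ω ∂μ := by
    rw [lintegral_finsetSum _ hi]
    refine Finset.sum_congr rfl fun i his => ?_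
    rw [lintegral_const_mul _ (Measurable.indicator measurable_one (hA i his)),
      lintegral_indicator_one (hA i his)]
  have h2 : ∑ i ∈ s, ∑ j ∈ s, c i * c j * μ (A i ∩ A j) = ∫⁻ ω, f ω ^ 2 ∂μ := by
    have hij : ∀ i ∈ s, ∀ j ∈ s, Measurable (fun ω => c i * c j *
        (A i ∩ A j).indicator (1 : Ω → ℝ≥0∞) ω) := fun i hi j hj =>
      (Measurable.indicator measurable_const ((hA i hi).inter (hA j hj))).const_mul _
    have : ∀ ω, f ω ^ 2 = ∑ i ∈ s, ∑ j ∈ s, c i * c j *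
        (A i ∩ A j).indicator (1 : Ω → ℝ≥0∞) ω := by
      intro ω
      rw [sq, Finset.sum_mul_sum]
      refine Finset.sum_congr rfl fun i _ => Finset.sum_congr rfl fun j _ => ?_
      rw [Set.inter_indicator_one]
      simp only [Pi.mul_apply]
      ring
    simp_rw [this]
    rw [lintegral_finsetSum _ (fun i hi => Finset.measurable_fun_sum s (hij i hi))]
    refine Finset.sum_congr rfl fun i his => ?_
    rw [lintegral_finsetSum _ (hij i his)]
    refine Finset.sum_congr rfl fun j hjs => ?_
    rw [lintegral_const_mul _ (Measurable.indicator measurable_one ((hA i his).inter (hA j hjs))),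
      lintegral_indicator_one ((hA i his).inter (hA j hjs))]
  have h3 : ∫⁻ ω, f ω ∂μ = ∫⁻ ω, ((U.indicator 1 : Ω → ℝ≥0∞) * f) ω ∂μ := by
    refine lintegral_congr fun ω => ?_
    by_cases hω : ω ∈ U
    · simp [hω]
    · simp only [Pi.mul_apply, Set.indicator_of_notMem hω, zero_mul]
      refine Finset.sum_eq_zero fun i his => ?_
      rw [Set.indicator_of_notMem (fun h => hω (Set.mem_biUnion his h)), mul_zero]
  -- Cauchy-Schwarz for the weighted number of events and the indicator of their union.
  have hol := ENNReal.lintegral_mul_le_Lp_mul_Lq μ (p := 2) (q := 2) Real.HolderConjugate.two_two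
    (f := U.indicator 1) (g := f) (Measurable.indicator measurable_const hU).aemeasurable
    hf.aemeasurable
  have h4 : ∫⁻ ω, (U.indicator (1 : Ω → ℝ≥0∞) ω) ^ (2 : ℝ) ∂μ = μ U := by
    rw [← lintegral_indicator_one hU]
    refine lintegral_congr fun ω => ?_
    by_cases hω : ω ∈ U <;> simp [hω]
  rw [h4] at hol
  rw [h1, h2, h3]
  refine (pow_le_pow_left₀ (by simp) hol 2).trans_eq ?_
  rw [mul_pow, ← ENNReal.rpow_natCast, ← ENNReal.rpow_natCast, ← ENNReal.rpow_mul,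
    ← ENNReal.rpow_mul]
  norm_num [U]

/-! ### Sums of passage times near zero. -/

section sums
variable {E Ω : Type*} {τ : E → Ω → ℝ≥0} [MeasurableSpace Ω] {F : Measure ℝ≥0} {μ : Measure Ω}

/-- Layer cake formula for the truncated difference; with `lintegral_Ioc_pow` it drives the
inductions on the number of summands below. -/
lemma lintegral_sub_eq [IsProbabilityMeasure μ] {Y : Ω → ℝ≥0} (hY : Measurable Y) (x : ℝ≥0) :
    ∫⁻ ω, ((x - Y ω : ℝ≥0) : ℝ≥0∞) ∂μ =
      ∫⁻ t in Set.Ioc (0 : ℝ) x, μ {ω | (Y ω : ℝ) ≤ x - t} := by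
  have h := lintegral_eq_lintegral_meas_le μ (f := fun ω => ((x - Y ω : ℝ≥0) : ℝ))
    (Eventually.of_forall fun ω => NNReal.coe_nonneg _)
    (measurable_const.sub hY).coe_nnreal_real.aemeasurable
  simp only [ENNReal.ofReal_coe_nnreal] at h
  rw [h, ← lintegral_indicator measurableSet_Ioi, ← lintegral_indicator measurableSet_Ioc]
  refine lintegral_congr fun t => ?_
  by_cases ht : 0 < t
  · by_cases htx : t ≤ x
    · rw [Set.indicator_of_mem (Set.mem_Ioi.2 ht), Set.indicator_of_mem (Set.mem_Ioc.2 ⟨ht, htx⟩)]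
      congr 1; ext ω
      simp only [Set.mem_ofPred_eq]
      rw [NNReal.coe_sub_def]
      rcases le_total ((x : ℝ) - Y ω) 0 with h0 | h0
      · rw [max_eq_right h0]; constructor <;> intro h' <;> linarith
      · rw [max_eq_left h0]; constructor <;> intro h' <;> linarith
    · rw [Set.indicator_of_mem (Set.mem_Ioi.2 ht),
        Set.indicator_of_notMem (fun h => htx (Set.mem_Ioc.1 h).2)]
      rw [show {a | t ≤ ((x - Y a : ℝ≥0) : ℝ)} = ∅ from ?_, measure_empty]
      ext ω
      simp only [Set.mem_ofPred_eq, Set.mem_empty_iff_false, iff_false, not_le]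
      refine lt_of_le_of_lt ?_ (not_le.1 htx)
      exact_mod_cast tsub_le_self
  · have h1 : t ∉ Set.Ioi (0 : ℝ) := ht
    have h2 : t ∉ Set.Ioc (0 : ℝ) x := fun h => ht h.1
    simp only [h1, h2, not_false_eq_true, Set.indicator_of_notMem]

lemma lintegral_Ioc_pow (θ x : ℝ≥0) (s : ℕ) :
    ∫⁻ t in Set.Ioc (0 : ℝ) x, ENNReal.ofReal ((θ * (x - t)) ^ s / s !) =
      ENNReal.ofReal (θ ^ s * x ^ (s + 1) / (s + 1)!) := by
  have hcont : Continuous (fun t : ℝ => ((θ : ℝ) * (x - t)) ^ s / s !) := by fun_prop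
  rw [← ofReal_integral_eq_lintegral_ofReal]
  · rw [← intervalIntegral.integral_of_le x.coe_nonneg]
    have : ∀ t : ℝ, ((θ : ℝ) * (x - t)) ^ s / s ! = (fun u : ℝ => θ ^ s / s ! * u ^ s) (x - t) := by
      intro t; simp only; rw [mul_pow]; ring
    simp_rw [this]
    rw [intervalIntegral.integral_comp_sub_left (fun u : ℝ => (θ : ℝ) ^ s / s ! * u ^ s),
      intervalIntegral.integral_const_mul, integral_pow]
    congr 1
    rw [Nat.factorial_succ]
    push_cast
    field_simp
    simp
  · exact (hcont.integrableOn_Icc).mono_set Set.Ioc_subset_Icc_self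
  · refine (ae_restrict_iff' measurableSet_Ioc).2 (Eventually.of_forall fun t ht => ?_)
    have : 0 ≤ (x : ℝ) - t := by linarith [ht.2]
    simp only [Pi.zero_apply]
    positivity

variable [IsProbabilityMeasure μ]

omit [IsProbabilityMeasure μ] in
lemma IIDField.indepFun_sum [DecidableEq E] (h : IIDField τ F μ) {s : Finset E} {e : E}
    (he : e ∉ s) : IndepFun (τ e) (fun ω => ∑ e ∈ s, τ e ω) μ := by
  have hd : Disjoint ({e} : Set E) (s : Set E) := by simpa using he
  rw [IndepFun_iff_Indep]
  refine indep_of_indep_of_le_left (indep_of_indep_of_le_right (h.indep_sig hd)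
    (Measurable.comap_le (measurable_sum_sig (Set.Subset.refl _)))) ?_
  exact Measurable.comap_le (measurable_sig (Set.mem_singleton e))

lemma IIDField.measure_add_le [DecidableEq E] (h : IIDField τ F μ) {s : Finset E} {e : E}
    (he : e ∉ s) (x : ℝ≥0) :
    μ {ω | ∑ e ∈ insert e s, τ e ω ≤ x} = ∫⁻ ω, F {a | a + ∑ e ∈ s, τ e ω ≤ x} ∂μ := by
  have hY : Measurable (fun ω => ∑ e ∈ s, τ e ω) :=
    Finset.measurable_fun_sum s fun e _ => h.measurable e
  have hmap := (indepFun_iff_map_prod_eq_prod_map_map (h.measurable e).aemeasurable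
    hY.aemeasurable).1 (h.indepFun_sum he)
  have hFp : IsProbabilityMeasure F :=
    h.map_eq e ▸ Measure.isProbabilityMeasure_map (h.measurable e).aemeasurable
  have hms : MeasurableSet {p : ℝ≥0 × ℝ≥0 | p.1 + p.2 ≤ x} :=
    measurableSet_le (measurable_fst.add measurable_snd) measurable_const
  have : {ω | ∑ e ∈ insert e s, τ e ω ≤ x} =
      (fun ω => (τ e ω, ∑ e ∈ s, τ e ω)) ⁻¹' {p : ℝ≥0 × ℝ≥0 | p.1 + p.2 ≤ x} := by
    ext ω; simp [Finset.sum_insert he]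
  have hp : IsProbabilityMeasure (μ.map (fun ω => ∑ e ∈ s, τ e ω)) :=
    Measure.isProbabilityMeasure_map hY.aemeasurable
  rw [this, ← Measure.map_apply ((h.measurable e).prodMk hY) hms, hmap, h.map_eq,
    Measure.prod_apply_symm hms, lintegral_map (measurable_measure_prodMk_right hms) hY]
  rfl

/-- Conditionally on the other summands, one summand contributes at most `θ` times the time that is
left. Integrating `(θ (x - t))^s / s!` over `t` then yields the next such term: the volume of a
simplex. -/
lemma IIDField.measure_sum_le (h : IIDField τ F μ) {θ δ : ℝ≥0}
    (hF : ∀ y ≤ δ, F (Set.Iic y) ≤ θ * y) (s : Finset E) {x : ℝ≥0} (hx : x ≤ δ) :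
    μ {ω | ∑ e ∈ s, τ e ω ≤ x} ≤ ENNReal.ofReal ((θ * x) ^ s.card / s.card !) := by
  classical
  induction s using Finset.induction_on generalizing x with
  | empty => simp
  | insert e s he ih =>
    have hY : Measurable (fun ω => ∑ e ∈ s, τ e ω) :=
      Finset.measurable_fun_sum s fun e _ => h.measurable e
    rw [h.measure_add_le he]
    calc _ ≤ ∫⁻ ω, θ * ((x - ∑ e ∈ s, τ e ω : ℝ≥0) : ℝ≥0∞) ∂μ := by
          refine lintegral_mono fun ω => ?_
          refine le_trans (measure_mono ?_) (hF _ (tsub_le_self.trans hx))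
          intro a ha
          exact le_tsub_of_add_le_right (show a + _ ≤ x from ha)
      _ = θ * ∫⁻ t in Set.Ioc (0 : ℝ) x, μ {ω | ((∑ e ∈ s, τ e ω : ℝ≥0) : ℝ) ≤ x - t} := by
          rw [lintegral_const_mul (θ : ℝ≥0∞) (f := fun ω => ((x - ∑ e ∈ s, τ e ω : ℝ≥0) : ℝ≥0∞))
            (measurable_coe_nnreal_ennreal.comp
            (measurable_const.sub hY)), lintegral_sub_eq hY]
      _ ≤ θ * ∫⁻ t in Set.Ioc (0 : ℝ) x, ENNReal.ofReal ((θ * (x - t)) ^ s.card / s.card !) := by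
          refine mul_le_mul_right ?_ _
          refine setLIntegral_mono' measurableSet_Ioc fun t ht => ?_
          have h0 : (0 : ℝ) ≤ x - t := by linarith [ht.2]
          obtain ⟨y, hy⟩ : ∃ y : ℝ≥0, (y : ℝ) = x - t := ⟨(x - t).toNNReal, Real.coe_toNNReal _ h0⟩
          have hyx : y ≤ x := by rw [← NNReal.coe_le_coe, hy]; linarith [ht.1]
          rw [← hy]
          exact_mod_cast ih (hyx.trans hx)
      _ = _ := by
          rw [lintegral_Ioc_pow, Finset.card_insert_of_notMem he, ← ENNReal.ofReal_coe_nnreal,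
            ← ENNReal.ofReal_mul θ.coe_nonneg]
          congr 1
          rw [mul_pow]; ring

lemma IIDField.le_measure_sum (h : IIDField τ F μ) {θ δ : ℝ≥0}
    (hF : ∀ y ≤ δ, θ * y ≤ F (Set.Iic y)) (s : Finset E) {x : ℝ≥0} (hx : x ≤ δ) :
    ENNReal.ofReal ((θ * x) ^ s.card / s.card !) ≤ μ {ω | ∑ e ∈ s, τ e ω ≤ x} := by
  classical
  induction s using Finset.induction_on generalizing x with
  | empty => simp
  | insert e s he ih =>
    have hY : Measurable (fun ω => ∑ e ∈ s, τ e ω) :=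
      Finset.measurable_fun_sum s fun e _ => h.measurable e
    rw [h.measure_add_le he]
    calc _ = θ * ∫⁻ t in Set.Ioc (0 : ℝ) x, ENNReal.ofReal ((θ * (x - t)) ^ s.card / s.card !) := by
          rw [lintegral_Ioc_pow, Finset.card_insert_of_notMem he, ← ENNReal.ofReal_coe_nnreal,
            ← ENNReal.ofReal_mul θ.coe_nonneg]
          congr 1
          rw [mul_pow]; ring
      _ ≤ θ * ∫⁻ t in Set.Ioc (0 : ℝ) x, μ {ω | ((∑ e ∈ s, τ e ω : ℝ≥0) : ℝ) ≤ x - t} := by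
          refine mul_le_mul_right ?_ _
          refine setLIntegral_mono' measurableSet_Ioc fun t ht => ?_
          have h0 : (0 : ℝ) ≤ x - t := by linarith [ht.2]
          obtain ⟨y, hy⟩ : ∃ y : ℝ≥0, (y : ℝ) = x - t := ⟨(x - t).toNNReal, Real.coe_toNNReal _ h0⟩
          have hyx : y ≤ x := by rw [← NNReal.coe_le_coe, hy]; linarith [ht.1]
          rw [← hy]
          exact_mod_cast ih (hyx.trans hx)
      _ = ∫⁻ ω, θ * ((x - ∑ e ∈ s, τ e ω : ℝ≥0) : ℝ≥0∞) ∂μ := by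
          rw [lintegral_const_mul (θ : ℝ≥0∞) (f := fun ω => ((x - ∑ e ∈ s, τ e ω : ℝ≥0) : ℝ≥0∞))
            (measurable_coe_nnreal_ennreal.comp
            (measurable_const.sub hY)), lintegral_sub_eq hY]
      _ ≤ _ := by
          refine lintegral_mono fun ω => ?_
          rcases le_total (∑ e ∈ s, τ e ω) x with hle | hle
          · refine (hF _ (tsub_le_self.trans hx)).trans (measure_mono ?_)
            intro a ha
            exact (add_le_add_left (show a ≤ x - _ from ha) _).trans_eq (tsub_add_cancel_of_le hle)
          · simp only
            rw [tsub_eq_zero_of_le hle]; simp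

end sums

/-! ### Monotone paths in cubes. -/

namespace MixedGraph
variable {V : Type u} {E : Type v} {G : MixedGraph V E} {n : ℕ}

/-- The edge of the power in direction `i` at the vertex `x` along `e`. -/
def pe (x : Fin n → V) (i : Fin n) (e : E) : PowEdge V E n := ⟨i, e, fun j => x j⟩

lemma pe_eq_iff {x z : Fin n → V} {i j : Fin n} {e f : E} :
    pe x i e = pe z j f ↔ i = j ∧ e = f ∧ ∀ k, k ≠ i → x k = z k := by
  constructor
  · intro h
    have hij : i = j := congrArg Sigma.fst h
    subst hij
    have h2 := eq_of_heq (Sigma.mk.inj h).2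
    refine ⟨rfl, congrArg Prod.fst h2, fun k hk => ?_⟩
    exact congrFun (congrArg Prod.snd h2) ⟨k, hk⟩
  · rintro ⟨rfl, rfl, h⟩
    unfold pe
    congr 2
    funext k
    exact h k k.2

lemma insertCoord_eq_iff {i : Fin n} {r : {j : Fin n // j ≠ i} → V} {a : V} {x : Fin n → V} :
    insertCoord i r a = x ↔ a = x i ∧ ∀ j (h : j ≠ i), r ⟨j, h⟩ = x j := by
  constructor
  · rintro rfl
    refine ⟨by simp [insertCoord], fun j h => by simp [insertCoord, h]⟩
  · rintro ⟨rfl, h⟩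
    funext j
    by_cases hj : j = i
    · subst hj; simp [insertCoord]
    · simp [insertCoord, hj, h]

lemma pow_joins_pe {x : Fin n → V} {i : Fin n} {e : E} {a : V} (h : G.Joins e (x i) a) :
    (G.pow n).Joins (pe x i e) x (Function.update x i a) := by
  have h1 : insertCoord i (fun j : {j : Fin n // j ≠ i} => x j) (x i) = x :=
    insertCoord_eq_iff.2 ⟨rfl, fun _ _ => rfl⟩
  have h2 : insertCoord i (fun j : {j : Fin n // j ≠ i} => x j) a = Function.update x i a :=
    insertCoord_eq_iff.2 ⟨by simp, fun j hj => by simp [hj]⟩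
  rcases h with h | h
  · left; simp [pow, pe, h, mapEnds, h1, h2]
  · right; simp [pow, pe, h, mapEnds, h1, h2]

lemma pow_joins {f : PowEdge V E n} {x y : Fin n → V} (h : (G.pow n).Joins f x y) :
    f = pe x f.1 f.2.1 ∧ G.Joins f.2.1 (x f.1) (y f.1) ∧ y = Function.update x f.1 (y f.1) := by
  obtain ⟨i, e, r⟩ := f
  suffices H : ∃ a b, G.Joins e a b ∧ insertCoord i r a = x ∧ insertCoord i r b = y by
    obtain ⟨a, b, hab, hx, hy⟩ := H
    rw [insertCoord_eq_iff] at hx hy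
    refine ⟨?_, ?_, ?_⟩
    · simp only [pe]; congr 2; funext j; exact hx.2 j j.2
    · simp only; rwa [← hx.1, ← hy.1]
    · funext j
      by_cases hj : j = i
      · subst hj; simp
      · simp [hj, ← hx.2 j hj, ← hy.2 j hj]
  simp only [Joins, pow] at h
  cases hE : G.ends e with
  | inl p =>
    induction p using Sym2.ind with
    | _ a b =>
      simp only [hE, mapEnds, Sum.map_inl, Sym2.map_mk, Sum.inl.injEq, reduceCtorEq, or_false,
        Sym2.eq_iff] at h
      rcases h with h | h
      · exact ⟨a, b, Or.inl hE, h.1, h.2⟩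
      · exact ⟨b, a, Or.inl (by rw [hE, Sym2.eq_swap]), h.2, h.1⟩
  | inr p =>
    obtain ⟨a, b⟩ := p
    simp only [hE, mapEnds, Sum.map_inr, Prod.map, Sum.inr.injEq, reduceCtorEq, false_or,
      Prod.mk.injEq] at h
    exact ⟨a, b, Or.inr hE, h.1, h.2⟩

/-- `MonoList G y x l`: the edges `l` form a path from `x` to `y` in the power each of whose edges
gives its coordinate its final value. -/
inductive MonoList (G : MixedGraph V E) (y : Fin n → V) : (Fin n → V) → List (PowEdge V E n) → Prop
  | nil : MonoList G y y []
  | cons {x : Fin n → V} {l : List (PowEdge V E n)} (i : Fin n) (e : E)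
      (h : G.Joins e (x i) (y i)) (hl : MonoList G y (Function.update x i (y i)) l) :
      MonoList G y x (pe x i e :: l)

lemma MonoList.exists_path {x y : Fin n → V} {l : List (PowEdge V E n)} (h : MonoList G y x l)
    (τ : PowEdge V E n → ℝ≥0) :
    ∃ γ : (G.pow n).Path x y, γ.time τ = ((l.map τ).sum : ℝ≥0) := by
  induction h with
  | nil => exact ⟨.nil _, by simp [Path.time]⟩
  | cons i e h hl ih =>
    obtain ⟨γ, hγ⟩ := ih
    exact ⟨.cons _ (pow_joins_pe h) γ, by simp [Path.time, hγ]⟩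

open Classical in
/-- The coordinates in which `x` and `y` differ. -/
noncomputable def moved (x y : Fin n → V) : Finset (Fin n) := Finset.univ.filter fun i => x i ≠ y i

lemma mem_moved {x y : Fin n → V} {i : Fin n} : i ∈ moved x y ↔ x i ≠ y i := by simp [moved]

lemma moved_update {x y : Fin n → V} {i : Fin n} :
    moved (Function.update x i (y i)) y = (moved x y).erase i := by
  ext j
  by_cases hj : j = i
  · subst hj; simp [mem_moved]
  · simp [mem_moved, hj]

/-- The vertices each of whose coordinates is that of `x` or that of `y`. -/
def Box (x y : Fin n → V) : Set (Fin n → V) := {z | ∀ i, z i = x i ∨ z i = y i}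

lemma Box.left (x y : Fin n → V) : x ∈ Box x y := fun _ => Or.inl rfl

lemma Box.right (x y : Fin n → V) : y ∈ Box x y := fun _ => Or.inr rfl

lemma box_update_subset {x y : Fin n → V} {i : Fin n} :
    Box (Function.update x i (y i)) y ⊆ Box x y := by
  intro z hz j
  rcases hz j with h | h
  · by_cases hj : j = i
    · subst hj; right; simpa using h
    · left; simpa [hj] using h
  · exact Or.inr h

/-- The edges that a monotone path from `x` to `y` can use. -/
def cubeEdges (G : MixedGraph V E) (x y : Fin n → V) : Set (PowEdge V E n) :=
  {f | ∃ z ∈ Box x y, ∃ i e, x i ≠ y i ∧ G.Joins e (x i) (y i) ∧ f = pe z i e}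

lemma cubeEdges_update_subset {x y : Fin n → V} {i : Fin n} :
    cubeEdges G (Function.update x i (y i)) y ⊆ cubeEdges G x y := by
  rintro f ⟨z, hz, j, e, hj, he, rfl⟩
  have hji : j ≠ i := by rintro rfl; simp at hj
  simp only [Function.update_of_ne hji] at hj he
  exact ⟨z, box_update_subset hz, j, e, hj, he, rfl⟩

lemma MonoList.mem_cubeEdges (hG : G.Loopless) {x y : Fin n → V} {l : List (PowEdge V E n)}
    (h : MonoList G y x l) : ∀ f ∈ l, f ∈ cubeEdges G x y := by
  induction h with
  | nil => simp
  | cons i e h hl ih =>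
    intro f hf
    rcases List.mem_cons.1 hf with rfl | hf
    · exact ⟨_, Box.left _ _, i, e, hG.ne h, h, rfl⟩
    · exact cubeEdges_update_subset (ih f hf)

lemma MonoList.nodup_length (hG : G.Loopless) {x y : Fin n → V} {l : List (PowEdge V E n)}
    (h : MonoList G y x l) : l.Nodup ∧ l.length = (moved x y).card := by
  induction h with
  | nil => simp [moved]
  | @cons x l i e h hl ih =>
    have hi : i ∈ moved x y := mem_moved.2 (hG.ne h)
    refine ⟨List.nodup_cons.2 ⟨fun hmem => ?_, ih.1⟩, ?_⟩
    · obtain ⟨z, hz, j, e', hj, -, hf⟩ := hl.mem_cubeEdges hG _ hmem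
      obtain ⟨rfl, -⟩ := pe_eq_iff.1 hf
      simp at hj
    · rw [List.length_cons, ih.2, moved_update, Finset.card_erase_add_one hi]

/-- A monotone path is given by the order in which the coordinates move and by one edge for each of
them. -/
lemma exists_finset_monoList (hG : G.Loopless) {D : ℕ} (hD : G.DegreeLE D) (y : Fin n → V) (s : ℕ)
    (x : Fin n → V) (hs : (moved x y).card = s) :
    ∃ P : Finset (List (PowEdge V E n)), (∀ l, MonoList G y x l → l ∈ P) ∧
      P.card ≤ s ! * ∏ i ∈ moved x y, G.mult (x i) (y i) := by
  classical
  induction s generalizing x with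
  | zero =>
    rw [Finset.card_eq_zero] at hs
    refine ⟨{[]}, fun l hl => ?_, by simp [hs]⟩
    have := (hl.nodup_length hG).2
    rw [hs, Finset.card_empty, List.length_eq_zero_iff] at this
    simp [this]
  | succ s ih =>
    have hx : ∀ i ∈ moved x y, ((moved (Function.update x i (y i)) y).card = s) := by
      intro i hi
      rw [moved_update, Finset.card_erase_of_mem hi, hs]; rfl
    choose! P hP hPc using fun i => ih (Function.update x i (y i))
    have hfin : ∀ i, {e | G.Joins e (x i) (y i)}.Finite := fun i => hD.finite_joins _ _
    refine ⟨(moved x y).biUnion fun i => (hfin i).toFinset.biUnion fun e =>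
      (P i).image (fun l => pe x i e :: l), ?_, ?_⟩
    · intro l hl
      cases hl with
      | nil => simp [moved] at hs
      | cons i e h hl =>
        have hi : i ∈ moved x y := mem_moved.2 (hG.ne h)
        refine Finset.mem_biUnion.2 ⟨i, hi, Finset.mem_biUnion.2 ⟨e, by simpa using h, ?_⟩⟩
        exact Finset.mem_image_of_mem _ (hP i (hx i hi) _ hl)
    · calc _ ≤ ∑ i ∈ moved x y, ∑ e ∈ (hfin i).toFinset, (P i).card := by
            refine Finset.card_biUnion_le.trans (Finset.sum_le_sum fun i _ => ?_)
            exact Finset.card_biUnion_le.trans (Finset.sum_le_sum fun e _ => Finset.card_image_le)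
        _ ≤ ∑ i ∈ moved x y, s ! * ∏ j ∈ moved x y, G.mult (x j) (y j) := by
            refine Finset.sum_le_sum fun i hi => ?_
            rw [Finset.sum_const, smul_eq_mul]
            have hc : (hfin i).toFinset.card = G.mult (x i) (y i) := by
              rw [← Set.ncard_eq_toFinset_card _ (hfin i)]; rfl
            rw [hc, ← Finset.mul_prod_erase _ _ hi]
            have h2 := hPc i (hx i hi)
            rw [moved_update] at h2
            have h3 : ∏ j ∈ (moved x y).erase i, G.mult (Function.update x i (y i) j) (y j) =
                ∏ j ∈ (moved x y).erase i, G.mult (x j) (y j) :=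
              Finset.prod_congr rfl fun j hj => by
                rw [Function.update_of_ne (Finset.ne_of_mem_erase hj)]
            rw [h3] at h2
            calc _ ≤ _ := Nat.mul_le_mul_left _ h2
              _ = _ := by ring
        _ = _ := by
            rw [Finset.sum_const, smul_eq_mul, hs, Nat.factorial_succ]; ring

/-- The vertices of a monotone path. -/
lemma MonoList.exists_verts (hG : G.Loopless) {x y : Fin n → V} {l : List (PowEdge V E n)}
    (h : MonoList G y x l) :
    ∃ B : Finset (Fin n → V), B.card ≤ n + 1 ∧ (∀ z ∈ B, z ∈ Box x y) ∧
      ∀ z i e a, pe z i e ∈ l → G.Joins e (z i) a → z ∈ B ∧ Function.update z i a ∈ B := by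
  classical
  suffices H : ∃ B : Finset (Fin n → V), B.card ≤ l.length + 1 ∧ x ∈ B ∧ (∀ z ∈ B, z ∈ Box x y) ∧
      ∀ z i e a, pe z i e ∈ l → G.Joins e (z i) a → z ∈ B ∧ Function.update z i a ∈ B by
    obtain ⟨B, h1, -, h2, h3⟩ := H
    refine ⟨B, h1.trans ?_, h2, h3⟩
    rw [(h.nodup_length hG).2]
    simpa using Finset.card_le_univ (moved x y)
  induction h with
  | nil => exact ⟨{y}, by simp, by simp, by simpa using Box.left y y, by simp⟩
  | @cons x l i e h hl ih =>
    obtain ⟨B, h1, h2, h3, h4⟩ := ih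
    refine ⟨insert x B, ?_, by simp, ?_, ?_⟩
    · rw [List.length_cons]
      exact (Finset.card_insert_le _ _).trans (by omega)
    · intro z hz
      rcases Finset.mem_insert.1 hz with rfl | hz
      · exact Box.left _ _
      · exact box_update_subset (h3 z hz)
    · intro z j e' a hmem hj
      rcases List.mem_cons.1 hmem with heq | hmem
      · obtain ⟨rfl, rfl, hzx⟩ := pe_eq_iff.1 heq
        rcases h.eq_or_eq hj with ⟨hz, ha⟩ | ⟨hz, ha⟩
        · have : z = x := by
            funext k; by_cases hk : k = j
            · subst hk; exact hz
            · exact hzx k hk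
          subst this ha
          exact ⟨by simp, by simp [h2]⟩
        · have h5 : Function.update x j (y j) = z := by
            funext k; by_cases hk : k = j
            · subst hk; simp [hz]
            · simp [hk, hzx k hk]
          have h6 : Function.update z j a = x := by
            funext k; by_cases hk : k = j
            · subst hk; simp [ha]
            · simp [hk, hzx k hk]
          rw [h6]
          exact ⟨by rw [← h5]; simp [h2], by simp⟩
      · have := h4 z j e' a hmem hj
        exact ⟨by simp [this.1], by simp [this.2]⟩

/-- Either a monotone path avoids a set of edges, or it can be cut before its first and after its
last edge in the set. -/
lemma MonoList.cut_last {x y : Fin n → V} {l : List (PowEdge V E n)}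
    (h : MonoList G y x l) (L : Set (PowEdge V E n)) (B : Set (Fin n → V))
    (hB : ∀ z i e a, pe z i e ∈ L → G.Joins e (z i) a → z ∈ B ∧ Function.update z i a ∈ B) :
    (∀ f ∈ l, f ∉ L) ∨ ∃ u ∈ B, ∃ l₁ l₂, l = l₁ ++ l₂ ∧ MonoList G y u l₂ ∧ ∀ f ∈ l₂, f ∉ L := by
  induction h with
  | nil => left; simp
  | @cons x l i e h hl ih =>
    rcases ih with ih | ⟨u, hu, l₁, l₂, rfl, h1, h2⟩
    · by_cases hL : pe x i e ∈ L
      · exact Or.inr ⟨_, (hB x i e _ hL h).2, [pe x i e], l, rfl, hl, ih⟩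
      · left; simpa [hL] using ih
    · exact Or.inr ⟨u, hu, pe x i e :: l₁, l₂, rfl, h1, h2⟩

/-- The part `l₂` between the first and the last edge in `L` is dropped; the outer pieces avoid `L`
and end, respectively begin, at vertices of `B`. The induction carries `u ∈ Box x y` in addition,
which keeps the initial piece monotone. -/
lemma MonoList.cut {x y : Fin n → V} {l : List (PowEdge V E n)}
    (h : MonoList G y x l) (L : Set (PowEdge V E n)) (B : Set (Fin n → V))
    (hB : ∀ z i e a, pe z i e ∈ L → G.Joins e (z i) a → z ∈ B ∧ Function.update z i a ∈ B) :
    (∀ f ∈ l, f ∉ L) ∨ ∃ u ∈ B, ∃ u' ∈ B, ∃ l₁ l₂ l₃, l = l₁ ++ l₂ ++ l₃ ∧ MonoList G u x l₁ ∧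
      MonoList G y u' l₃ ∧ ∀ f ∈ l₁ ++ l₃, f ∉ L := by
  suffices H : (∀ f ∈ l, f ∉ L) ∨ ∃ u ∈ B, ∃ u' ∈ B, ∃ l₁ l₂ l₃, l = l₁ ++ l₂ ++ l₃ ∧
      MonoList G u x l₁ ∧ MonoList G y u' l₃ ∧ (∀ f ∈ l₁ ++ l₃, f ∉ L) ∧ u ∈ Box x y by
    rcases H with H | ⟨u, hu, u', hu', l₁, l₂, l₃, h1, h2, h3, h4, -⟩
    · exact Or.inl H
    · exact Or.inr ⟨u, hu, u', hu', l₁, l₂, l₃, h1, h2, h3, h4⟩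
  induction h with
  | nil => left; simp
  | @cons x l i e h hl ih =>
    by_cases hL : pe x i e ∈ L
    · rcases (MonoList.cons i e h hl).cut_last L B hB with h' | ⟨u', hu', l₂, l₃, h1, h2, h3⟩
      · exact absurd hL (h' _ (by simp))
      · exact Or.inr ⟨x, (hB x i e _ hL h).1, u', hu', [], l₂, l₃, by simpa using h1, .nil, h2,
          by simpa using h3, Box.left _ _⟩
    · rcases ih with ih | ⟨u, hu, u', hu', l₁, l₂, l₃, rfl, h1, h2, h3, h4⟩
      · left; simpa [hL] using ih
      · refine Or.inr ⟨u, hu, u', hu', pe x i e :: l₁, l₂, l₃, by simp, ?_, h2, ?_,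
          box_update_subset h4⟩
        -- The coordinate `i` already has its final value at `u`, so the first edge is monotone for
        -- the target `u` as well.
        · have hui : u i = y i := by rcases h4 i with h5 | h5 <;> simpa using h5
          exact .cons i e (hui ▸ h) (hui ▸ h1)
        · intro f hf
          rcases List.mem_cons.1 hf with rfl | hf
          · exact hL
          · exact h3 f hf

end MixedGraph

/-! ### Fast crossings of a cube and their correlations. -/

/-- The product kernel on `V ^ ι`. -/
noncomputable def Kern.tens {V : Type u} {ι : Type v} [Fintype ι] (W : Kern V) : Kern (ι → V) :=
  fun x y => ∏ i, W (x i) (y i)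

theorem Kern.tens_apply {V : Type u} {ι : Type v} [Fintype ι] (W : Kern V) (x y : ι → V) :
    tens W x y = ∏ i, W (x i) (y i) := rfl

namespace MixedGraph
variable {V : Type u} {E : Type v} {G : MixedGraph V E} {n : ℕ} {D : ℕ}

lemma tens_lazy_eq (hG : G.Loopless) (hD : G.DegreeLE D) (θ : ℝ≥0∞) (x y : Fin n → V) :
    Kern.tens (Kern.lazy θ G.adj) x y = ∏ i ∈ moved x y, θ * G.mult (x i) (y i) := by
  classical
  rw [Kern.tens_apply, ← Finset.prod_filter_mul_prod_filter_not Finset.univ (fun i => x i ≠ y i)]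
  have h1 : ∏ i ∈ Finset.univ.filter (fun i => ¬ (x i ≠ y i)),
      Kern.lazy θ G.adj (x i) (y i) = 1 := by
    refine Finset.prod_eq_one fun i hi => ?_
    have : x i = y i := by simpa using hi
    rw [this, Kern.lazy_apply, hG.adj_self, Kern.one_self]; simp
  rw [h1, mul_one]
  have h2 : Finset.univ.filter (fun i => x i ≠ y i) = moved x y := by ext i; simp [mem_moved]
  rw [h2]
  refine Finset.prod_congr rfl fun i hi => ?_
  rw [Kern.lazy_apply, Kern.one_of_ne (mem_moved.1 hi), zero_add, hD.adj_eq]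

variable {Ω : Type*} {τ : PowEdge V E n → Ω → ℝ≥0}

/-- The edges in the list have total passage time at most `δ`. -/
def listEvent (τ : PowEdge V E n → Ω → ℝ≥0) (l : List (PowEdge V E n)) (δ : ℝ≥0) : Set Ω :=
  {ω | (l.map (fun f => τ f ω)).sum ≤ δ}

/-- Some monotone path from `x` to `y` has passage time at most `δ`. -/
def cubeEvent (G : MixedGraph V E) (τ : PowEdge V E n → Ω → ℝ≥0) (x y : Fin n → V) (δ : ℝ≥0) :
    Set Ω :=
  {ω | ∃ l, MonoList G y x l ∧ ω ∈ listEvent τ l δ}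

lemma passageTime_le_of_mem_cubeEvent {x y : Fin n → V} {δ : ℝ≥0} {ω : Ω}
    (h : ω ∈ cubeEvent G τ x y δ) : (G.pow n).passageTime (fun f => τ f ω) x y ≤ δ := by
  obtain ⟨l, hl, hω⟩ := h
  obtain ⟨γ, hγ⟩ := hl.exists_path (fun f => τ f ω)
  refine (iInf_le _ γ).trans ?_
  rw [hγ]
  exact_mod_cast hω

lemma cubeEvent_eq_biUnion {x y : Fin n → V} {δ : ℝ≥0} {P : Finset (List (PowEdge V E n))}
    (hP : ∀ l, l ∈ P ↔ MonoList G y x l) :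
    cubeEvent G τ x y δ = ⋃ l ∈ P, listEvent τ l δ := by
  ext ω
  simp only [cubeEvent, Set.mem_iUnion, hP, exists_prop]
  rfl

lemma listEvent_eq [DecidableEq (PowEdge V E n)] {l : List (PowEdge V E n)} (hl : l.Nodup)
    (δ : ℝ≥0) : listEvent τ l δ = {ω | ∑ f ∈ l.toFinset, τ f ω ≤ δ} := by
  ext ω
  change (l.map (fun f => τ f ω)).sum ≤ δ ↔ ∑ f ∈ l.toFinset, τ f ω ≤ δ
  rw [List.sum_toFinset _ hl]

lemma measurableSet_listEvent {l : List (PowEdge V E n)} (hl : l.Nodup) (δ : ℝ≥0)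
    {S : Set (PowEdge V E n)} (hS : ∀ f ∈ l, f ∈ S) : MeasurableSet[sig τ S] (listEvent τ l δ) := by
  classical
  rw [listEvent_eq hl]
  exact @measurableSet_le _ _ _ _ _ (sig τ S) _ _ _ _ _
    (measurable_sum_sig (fun f hf => hS f (by simpa using hf))) measurable_const

variable [MeasurableSpace Ω] {F : Measure ℝ≥0} {μ : Measure Ω} [IsProbabilityMeasure μ]

lemma measure_listEvent_le (h : IIDField τ F μ) (hG : G.Loopless) {ρ' δ : ℝ≥0}
    (hF : ∀ y ≤ δ, F (Set.Iic y) ≤ ρ' * y) {x y : Fin n → V} {l : List (PowEdge V E n)}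
    (hl : MonoList G y x l) :
    μ (listEvent τ l δ) ≤ ((ρ' * δ : ℝ≥0) : ℝ≥0∞) ^ (moved x y).card / (moved x y).card ! := by
  classical
  have hn := hl.nodup_length hG
  rw [listEvent_eq hn.1]
  refine (h.measure_sum_le hF _ le_rfl).trans_eq ?_
  rw [List.toFinset_card_of_nodup hn.1, hn.2, ENNReal.ofReal_div_of_pos (by positivity),
    ENNReal.ofReal_pow (by positivity), ENNReal.ofReal_natCast, ← NNReal.coe_mul,
    ENNReal.ofReal_coe_nnreal]

/-- The factorial that counts the orders of the moves cancels the one in the probability `θ^s / s!`.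
So the expected number of fast monotone paths is at most the product kernel. -/
lemma exists_finset_monoList_iff (hG : G.Loopless) (hD : G.DegreeLE D) (θ : ℝ≥0∞) (x y : Fin n → V) :
    ∃ P : Finset (List (PowEdge V E n)), (∀ l, l ∈ P ↔ MonoList G y x l) ∧
      ∑ _l ∈ P, θ ^ (moved x y).card / (moved x y).card ! ≤
        Kern.tens (Kern.lazy θ G.adj) x y := by
  classical
  obtain ⟨P, hP, hc⟩ := exists_finset_monoList hG hD y _ x rfl
  refine ⟨P.filter (MonoList G y x), fun l => by simpa using hP l, ?_⟩
  rw [Finset.sum_const, nsmul_eq_mul, tens_lazy_eq hG hD, Finset.prod_mul_distrib,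
    Finset.prod_const]
  have hc' : ((P.filter (MonoList G y x)).card : ℝ≥0∞) ≤
      (moved x y).card ! * ∏ i ∈ moved x y, (G.mult (x i) (y i) : ℝ≥0∞) := by
    exact_mod_cast (Finset.card_filter_le _ _).trans hc
  calc _ ≤ ((moved x y).card ! * ∏ i ∈ moved x y, (G.mult (x i) (y i) : ℝ≥0∞)) *
        (θ ^ (moved x y).card / (moved x y).card !) := by gcongr
    _ = ((moved x y).card ! * ((moved x y).card ! : ℝ≥0∞)⁻¹) *
        (θ ^ (moved x y).card * ∏ i ∈ moved x y, (G.mult (x i) (y i) : ℝ≥0∞)) := by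
        rw [div_eq_mul_inv]; ring
    _ = _ := by
        rw [ENNReal.mul_inv_cancel (by exact_mod_cast Nat.factorial_ne_zero _)
          (ENNReal.natCast_ne_top _), one_mul]

omit [IsProbabilityMeasure μ] [MeasurableSpace Ω] in
lemma measurableSet_cubeEvent (hG : G.Loopless) (hD : G.DegreeLE D) (x y : Fin n → V) (δ : ℝ≥0) :
    MeasurableSet[sig τ (cubeEdges G x y)] (cubeEvent G τ x y δ) := by
  obtain ⟨P, hP, -⟩ := exists_finset_monoList_iff hG hD 0 x y
  rw [cubeEvent_eq_biUnion hP]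
  refine @Finset.measurableSet_biUnion _ _ (sig τ (cubeEdges G x y)) _ _ fun l hl => ?_
  exact measurableSet_listEvent (((hP l).1 hl).nodup_length hG).1 δ (((hP l).1 hl).mem_cubeEdges hG)

/-- The correlation of a cube event with a given path. -/
lemma measure_listEvent_inter_cubeEvent_le (h : IIDField τ F μ) (hG : G.Loopless)
    (hD : G.DegreeLE D) {ρ' δ : ℝ≥0} (hF : ∀ y ≤ δ, F (Set.Iic y) ≤ ρ' * y)
    {l : List (PowEdge V E n)} (hl : l.Nodup) (B : Finset (Fin n → V))
    (hB : ∀ z i e a, pe z i e ∈ l → G.Joins e (z i) a → z ∈ B ∧ Function.update z i a ∈ B)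
    (x' y' : Fin n → V) :
    μ (listEvent τ l δ ∩ cubeEvent G τ x' y' δ) ≤ μ (listEvent τ l δ) *
      (Kern.tens (Kern.lazy (ρ' * δ : ℝ≥0) G.adj) x' y' + ∑ u ∈ B, ∑ u' ∈ B,
        Kern.tens (Kern.lazy (ρ' * δ : ℝ≥0) G.adj) x' u *
        Kern.tens (Kern.lazy (ρ' * δ : ℝ≥0) G.adj) u' y') := by
  classical
  set θ : ℝ≥0 := ρ' * δ
  set W := Kern.lazy (θ : ℝ≥0∞) G.adj
  let p : (Fin n → V) → (Fin n → V) → ℝ≥0∞ := fun x y =>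
    (θ : ℝ≥0∞) ^ (moved x y).card / ((moved x y).card ! : ℝ≥0∞)
  choose P hP hPs using fun x y => exists_finset_monoList_iff (n := n) hG hD (θ : ℝ≥0∞) x y
  -- The pieces of the second path before and after its contact with `l`. They avoid `l` and each
  -- other, so the three events are independent.
  let Q : (Fin n → V) → (Fin n → V) → Finset (List (PowEdge V E n) × List (PowEdge V E n)) :=
    fun u u' => (P x' u ×ˢ P u' y').filter fun q => (∀ f ∈ q.1 ++ q.2, f ∉ l) ∧ (q.1 ++ q.2).Nodup
  let P' := (P x' y').filter fun q => ∀ f ∈ q, f ∉ l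
  have hsub : listEvent τ l δ ∩ cubeEvent G τ x' y' δ ⊆
      (⋃ q ∈ P', listEvent τ l δ ∩ listEvent τ q δ) ∪
      ⋃ u ∈ B, ⋃ u' ∈ B, ⋃ q ∈ Q u u', listEvent τ l δ ∩ (listEvent τ q.1 δ ∩ listEvent τ q.2 δ) := by
    rintro ω ⟨hω, l', hl', hω'⟩
    rcases hl'.cut {f | f ∈ l} (B : Set (Fin n → V)) hB with hc |
      ⟨u, hu, u', hu', l₁, l₂, l₃, rfl, h1, h3, hd⟩
    · left
      simp only [Set.mem_iUnion]
      exact ⟨l', Finset.mem_filter.2 ⟨(hP _ _ _).2 hl', hc⟩, hω, hω'⟩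
    · right
      simp only [Set.mem_iUnion]
      have hs : (l₁.map (fun f => τ f ω)).sum + (l₂.map (fun f => τ f ω)).sum +
          (l₃.map (fun f => τ f ω)).sum ≤ δ := by
        have : ((l₁ ++ l₂ ++ l₃).map (fun f => τ f ω)).sum ≤ δ := hω'
        simpa [add_assoc] using this
      have hnd := (hl'.nodup_length hG).1
      refine ⟨u, hu, u', hu', (l₁, l₃), Finset.mem_filter.2 ⟨Finset.mem_product.2
        ⟨(hP _ _ _).2 h1, (hP _ _ _).2 h3⟩, hd, ?_⟩, hω, ?_, ?_⟩
      · rw [List.append_assoc] at hnd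
        exact hnd.sublist (List.Sublist.append_left (List.sublist_append_right _ _) _)
      · exact (le_trans (by rw [add_assoc]; exact le_self_add) hs :
          (l₁.map (fun f => τ f ω)).sum ≤ δ)
      · exact (le_trans le_add_self hs : (l₃.map (fun f => τ f ω)).sum ≤ δ)
  have hm1 : MeasurableSet[sig τ {f | f ∈ l}] (listEvent τ l δ) :=
    measurableSet_listEvent hl δ fun f hf => hf
  have hb1 : ∀ q ∈ P', μ (listEvent τ l δ ∩ listEvent τ q δ) ≤ μ (listEvent τ l δ) * p x' y' := by
    intro q hq
    obtain ⟨hq, hd⟩ := Finset.mem_filter.1 hq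
    have hq := (hP _ _ _).1 hq
    have hdis : Disjoint {f | f ∈ l} {f | f ∈ q} := by
      rw [Set.disjoint_left]; intro f hf hf'; exact hd f hf' hf
    rw [h.measure_inter hdis hm1 (measurableSet_listEvent (hq.nodup_length hG).1 δ fun f hf => hf)]
    gcongr
    exact measure_listEvent_le h hG hF hq
  have hb2 : ∀ u u', ∀ q ∈ Q u u', μ (listEvent τ l δ ∩ (listEvent τ q.1 δ ∩ listEvent τ q.2 δ)) ≤
      μ (listEvent τ l δ) * (p x' u * p u' y') := by
    intro u u' q hq
    obtain ⟨hq, hd, hnd⟩ := Finset.mem_filter.1 hq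
    have hq := Finset.mem_product.1 hq
    have h1 := (hP _ _ _).1 hq.1
    have h2 := (hP _ _ _).1 hq.2
    have hdis : Disjoint {f | f ∈ l} {f | f ∈ q.1 ++ q.2} := by
      rw [Set.disjoint_left]; intro f hf hf'; exact hd f hf' hf
    have hdis' : Disjoint {f | f ∈ q.1} {f | f ∈ q.2} := by
      rw [Set.disjoint_left]; intro f hf hf'
      exact (List.nodup_append.1 hnd).2.2 f hf f hf' rfl
    rw [h.measure_inter hdis hm1 (MeasurableSet.inter
      (measurableSet_listEvent (h1.nodup_length hG).1 δ fun f hf => List.mem_append_left _ hf)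
      (measurableSet_listEvent (h2.nodup_length hG).1 δ fun f hf => List.mem_append_right _ hf)),
      h.measure_inter hdis' (measurableSet_listEvent (h1.nodup_length hG).1 δ fun f hf => hf)
        (measurableSet_listEvent (h2.nodup_length hG).1 δ fun f hf => hf)]
    gcongr
    · exact measure_listEvent_le h hG hF h1
    · exact measure_listEvent_le h hG hF h2
  refine (measure_mono hsub).trans ((measure_union_le _ _).trans ?_)
  rw [mul_add]
  gcongr ?_ + ?_
  · refine (measure_biUnion_finset_le _ _).trans ((Finset.sum_le_sum hb1).trans ?_)
    rw [← Finset.mul_sum]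
    gcongr
    exact (Finset.sum_le_sum_of_subset (Finset.filter_subset _ _)).trans (hPs x' y')
  · rw [Finset.mul_sum]
    refine (measure_biUnion_finset_le _ _).trans (Finset.sum_le_sum fun u _ => ?_)
    rw [Finset.mul_sum]
    refine (measure_biUnion_finset_le _ _).trans (Finset.sum_le_sum fun u' _ => ?_)
    refine (measure_biUnion_finset_le _ _).trans ((Finset.sum_le_sum (hb2 u u')).trans ?_)
    rw [← Finset.mul_sum]
    gcongr
    refine (Finset.sum_le_sum_of_subset (Finset.filter_subset _ _)).trans ?_
    rw [Finset.sum_product, ← Finset.sum_mul_sum]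
    gcongr
    · exact hPs x' u
    · exact hPs u' y'

/-- The correlation of two cube events. -/
lemma exists_measure_cubeEvent_inter_le (h : IIDField τ F μ) (hG : G.Loopless)
    (hD : G.DegreeLE D) {ρ' δ : ℝ≥0} (hF : ∀ y ≤ δ, F (Set.Iic y) ≤ ρ' * y) (x y : Fin n → V) :
    ∃ (B : Finset (Fin n → V)) (c : (Fin n → V) → (Fin n → V) → ℝ≥0∞),
      (∀ u ∈ B, u ∈ Box x y) ∧
      ∑ u ∈ B, ∑ u' ∈ B, c u u' ≤ (n + 1) ^ 2 * Kern.tens (Kern.lazy (ρ' * δ : ℝ≥0) G.adj) x y ∧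
      ∀ x' y', μ (cubeEvent G τ x y δ ∩ cubeEvent G τ x' y' δ) ≤
        Kern.tens (Kern.lazy (ρ' * δ : ℝ≥0) G.adj) x y *
          Kern.tens (Kern.lazy (ρ' * δ : ℝ≥0) G.adj) x' y' +
        ∑ u ∈ B, ∑ u' ∈ B, c u u' * (Kern.tens (Kern.lazy (ρ' * δ : ℝ≥0) G.adj) x' u *
          Kern.tens (Kern.lazy (ρ' * δ : ℝ≥0) G.adj) u' y') := by
  classical
  set θ : ℝ≥0 := ρ' * δ
  set W := Kern.lazy (θ : ℝ≥0∞) G.adj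
  obtain ⟨P, hP, hPs⟩ := exists_finset_monoList_iff hG hD (θ : ℝ≥0∞) x y
  choose! A hAc hAB hA using fun l (hl : MonoList G y x l) => hl.exists_verts hG
  let B : Finset (Fin n → V) := P.biUnion A
  have hsum : ∑ l ∈ P, μ (listEvent τ l δ) ≤ Kern.tens W x y :=
    (Finset.sum_le_sum fun l hl => measure_listEvent_le h hG hF ((hP l).1 hl)).trans hPs
  -- Bounding the intersection by a union over the paths `l` of the first crossing, `c u u'`
  -- collects the probabilities of those that visit both `u` and `u'`. Each path has at most `n + 1`
  -- vertices, whence the factor `(n + 1)^2`.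
  let c : (Fin n → V) → (Fin n → V) → ℝ≥0∞ := fun u u' =>
    ∑ l ∈ P, if u ∈ A l ∧ u' ∈ A l then μ (listEvent τ l δ) else 0
  have hswap : ∀ g : (Fin n → V) → (Fin n → V) → ℝ≥0∞,
      ∑ u ∈ B, ∑ u' ∈ B, c u u' * g u u' =
      ∑ l ∈ P, μ (listEvent τ l δ) * ∑ u ∈ A l, ∑ u' ∈ A l, g u u' := by
    intro g
    simp only [c, Finset.sum_mul]
    rw [Finset.sum_congr rfl fun u _ => Finset.sum_comm, Finset.sum_comm]
    refine Finset.sum_congr rfl fun l hl => ?_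
    have hsub : A l ⊆ B := Finset.subset_biUnion_of_mem A hl
    rw [Finset.mul_sum, ← Finset.sum_subset hsub]
    · refine Finset.sum_congr rfl fun u hu => ?_
      rw [Finset.mul_sum, ← Finset.sum_subset hsub]
      · exact Finset.sum_congr rfl fun u' hu' => by rw [if_pos ⟨hu, hu'⟩]
      · intro u' _ hu'; rw [if_neg (fun h => hu' h.2), zero_mul]
    · intro u _ hu
      exact Finset.sum_eq_zero fun u' _ => by rw [if_neg (fun h => hu h.1), zero_mul]
  refine ⟨B, c, ?_, ?_, ?_⟩
  · intro u hu
    obtain ⟨l, hl, hu⟩ := Finset.mem_biUnion.1 hu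
    exact hAB l ((hP l).1 hl) u hu
  · have := hswap fun _ _ => 1
    simp only [mul_one] at this
    rw [this]
    calc _ ≤ ∑ l ∈ P, μ (listEvent τ l δ) * (n + 1) ^ 2 := by
          refine Finset.sum_le_sum fun l hl => ?_
          gcongr
          simp only [Finset.sum_const, nsmul_eq_mul, mul_one]
          rw [← sq]
          gcongr
          exact_mod_cast hAc l ((hP l).1 hl)
      _ ≤ _ := by rw [← Finset.sum_mul, mul_comm]; gcongr
  · intro x' y'
    rw [hswap]
    have hsub : cubeEvent G τ x y δ ∩ cubeEvent G τ x' y' δ ⊆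
        ⋃ l ∈ P, listEvent τ l δ ∩ cubeEvent G τ x' y' δ := by
      rw [cubeEvent_eq_biUnion hP, Set.iUnion₂_inter]
    refine (measure_mono hsub).trans ((measure_biUnion_finset_le _ _).trans ?_)
    calc _ ≤ ∑ l ∈ P, μ (listEvent τ l δ) * (Kern.tens W x' y' + ∑ u ∈ A l, ∑ u' ∈ A l,
            Kern.tens W x' u * Kern.tens W u' y') := by
          refine Finset.sum_le_sum fun l hl => ?_
          have hl := (hP l).1 hl
          exact measure_listEvent_inter_cubeEvent_le h hG hD hF (hl.nodup_length hG).1 (A l)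
            (hA l hl) x' y'
      _ ≤ _ := by
          simp_rw [mul_add]
          rw [Finset.sum_add_distrib, ← Finset.sum_mul]
          gcongr

end MixedGraph

/-! ### Lower bound for the probability of a fast crossing. -/

lemma card_perm_agree {S : Type*} [Fintype S] [DecidableEq S] (T : Finset S) (g₀ : Equiv.Perm S) :
    (Finset.univ.filter fun g : Equiv.Perm S => ∀ i ∉ T, g i = g₀ i).card = T.card ! := by
  have h1 : (Finset.univ.filter fun g : Equiv.Perm S => ∀ i ∉ T, g i = g₀ i).card =
      Fintype.card {f : Equiv.Perm S // ∀ a, ¬ (a ∈ T) → f a = a} := by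
    rw [Fintype.card_subtype]
    refine Finset.card_bij (fun g _ => g₀⁻¹ * g) ?_ ?_ ?_
    · intro g hg
      simp only [Finset.mem_filter, Finset.mem_univ, true_and] at hg ⊢
      intro i hi
      simp [hg i hi]
    · intro g _ g' _ h
      exact mul_left_cancel h
    · intro f hf
      simp only [Finset.mem_filter, Finset.mem_univ, true_and] at hf
      refine ⟨g₀ * f, ?_, by simp⟩
      simp only [Finset.mem_filter, Finset.mem_univ, true_and]
      intro i hi
      rw [Equiv.Perm.mul_apply, hf i hi]
  rw [h1, ← Fintype.card_congr (Equiv.Perm.subtypeEquivSubtypePerm (fun a => a ∈ T)),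
    Fintype.card_perm, Fintype.card_coe]

lemma card_filter_equiv_lt {S : Type*} [Fintype S] {s : ℕ} (q : S ≃ Fin s) (k : Fin s) :
    (Finset.univ.filter fun j => q j < k).card = k := by
  rw [← Fin.card_Iio k]
  refine Finset.card_bij (fun j _ => q j) (by simp) (fun _ _ _ _ h => q.injective h) ?_
  intro b hb
  exact ⟨q.symm b, by simpa using hb, by simp⟩

namespace MixedGraph
variable {V : Type u} {E : Type v} {G : MixedGraph V E} {n : ℕ} {D : ℕ}

section schedule
variable {x y : Fin n → V} {s : ℕ}

open Classical in
/-- The vertex after `k` steps when the coordinates move in the order `q`. -/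
noncomputable def schedState (q : {i // x i ≠ y i} ≃ Fin s) (k : ℕ) : Fin n → V :=
  fun j => if ∃ h : x j ≠ y j, (q ⟨j, h⟩ : ℕ) < k then y j else x j

/-- The edge used by the coordinate `i` when the coordinates move in the order `q`. -/
noncomputable def schedEdge (q : {i // x i ≠ y i} ≃ Fin s) (c : {i // x i ≠ y i} → E)
    (i : {i // x i ≠ y i}) : PowEdge V E n := pe (schedState q (q i)) i (c i)

lemma schedEdge_injective (q : {i // x i ≠ y i} ≃ Fin s) (c : {i // x i ≠ y i} → E) :
    Function.Injective (schedEdge q c) := by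
  intro i j h
  exact Subtype.ext (pe_eq_iff.1 h).1

/-- The edge records which coordinates have moved already, and their number is the rank of `i` in
the order. -/
lemma schedEdge_eq {q q' : {i // x i ≠ y i} ≃ Fin s} {c c' : {i // x i ≠ y i} → E}
    {i : {i // x i ≠ y i}} (h : schedEdge q c i = schedEdge q' c' i) : q i = q' i ∧ c i = c' i := by
  classical
  obtain ⟨-, h1, h2⟩ := pe_eq_iff.1 h
  refine ⟨?_, h1⟩
  rw [Fin.ext_iff, ← card_filter_equiv_lt q (q i), ← card_filter_equiv_lt q' (q' i)]
  congr 1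
  ext j
  simp only [Finset.mem_filter, Finset.mem_univ, true_and]
  by_cases hj : j = i
  · subst hj; simp
  · have h3 := h2 j (fun h => hj (Subtype.ext h))
    have hj2 := j.2
    unfold schedState at h3
    have e1 : (∃ h : x j ≠ y j, (q ⟨j, h⟩ : ℕ) < q i) ↔ q j < q i :=
      ⟨fun ⟨_, h⟩ => h, fun h => ⟨j.2, h⟩⟩
    have e2 : (∃ h : x j ≠ y j, (q' ⟨j, h⟩ : ℕ) < q' i) ↔ q' j < q' i :=
      ⟨fun ⟨_, h⟩ => h, fun h => ⟨j.2, h⟩⟩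
    simp only [e1, e2] at h3
    split_ifs at h3 with h4 h5 h5
    · tauto
    · exact absurd h3.symm hj2
    · exact absurd h3 hj2
    · tauto

lemma monoList_sched (q : {i // x i ≠ y i} ≃ Fin s) (c : {i // x i ≠ y i} → E)
    (hc : ∀ i : {i // x i ≠ y i}, G.Joins (c i) (x i) (y i)) :
    MonoList G y x ((List.finRange s).map fun k => schedEdge q c (q.symm k)) := by
  have h0 : schedState q 0 = x := by funext j; simp [schedState]
  have H : ∀ m k, k + m = s → MonoList G y (schedState q k)
      (((List.finRange s).drop k).map fun k => schedEdge q c (q.symm k)) := by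
    intro m
    induction m with
    | zero =>
      intro k hk
      have : schedState q k = y := by
        funext j
        unfold schedState
        split_ifs with h
        · rfl
        · by_contra hj
          exact h ⟨hj, by have := (q ⟨j, hj⟩).2; omega⟩
      rw [this, List.drop_eq_nil_of_le (by simp; omega)]
      exact .nil
    | succ m ih =>
      intro k hk
      have hk' : k < s := by omega
      rw [List.drop_eq_getElem_cons (by simpa using hk'), List.map_cons]
      have hg : (List.finRange s)[k]'(by simpa using hk') = ⟨k, hk'⟩ := by simp
      rw [hg]
      set i := q.symm ⟨k, hk'⟩ with hi
      have hqi : (q i : ℕ) = k := by rw [hi, Equiv.apply_symm_apply]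
      have hsi : schedState q k i = x i := by
        unfold schedState
        rw [if_neg]
        rintro ⟨h, h'⟩
        rw [show (⟨(i : Fin n), h⟩ : {i // x i ≠ y i}) = i from rfl, hqi] at h'
        exact lt_irrefl _ h'
      have hup : Function.update (schedState q k) i (y i) = schedState q (k + 1) := by
        funext j
        by_cases hj : j = i
        · subst hj
          rw [Function.update_self]
          unfold schedState
          rw [if_pos ⟨i.2, by rw [show (⟨(i : Fin n), i.2⟩ : {i // x i ≠ y i}) = i from rfl, hqi]; omega⟩]
        · rw [Function.update_of_ne hj]
          unfold schedState
          congr 1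
          refine propext (exists_congr fun h => ?_)
          have : (q ⟨j, h⟩ : ℕ) ≠ k := by
            rw [← hqi]
            intro h2
            exact hj (congrArg Subtype.val (q.injective (Fin.ext h2)))
          omega
      have := MonoList.cons (G := G) (x := schedState q k) (y := y)
        (l := ((List.finRange s).drop (k + 1)).map fun k => schedEdge q c (q.symm k)) i (c i)
        (by rw [hsi]; exact hc i) (by rw [hup]; exact ih (k + 1) (by omega))
      rw [schedEdge, hqi]
      exact this
  have := H s 0 (by omega)
  rwa [h0, List.drop_zero] at this

end schedule

variable {Ω : Type*} {τ : PowEdge V E n → Ω → ℝ≥0}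
variable [MeasurableSpace Ω] {F : Measure ℝ≥0} {μ : Measure Ω} [IsProbabilityMeasure μ]

/-- A lower bound for the probability of a cube event, by the second moment method. -/
lemma tens_le_measure_cubeEvent_mul (h : IIDField τ F μ) (hG : G.Loopless) (hD : G.DegreeLE D)
    {ρ₁ ρ₂ δ : ℝ≥0} (hF₁ : ∀ y ≤ δ, ρ₁ * y ≤ F (Set.Iic y))
    (hF₂ : ∀ y ≤ δ, F (Set.Iic y) ≤ ρ₂ * y) (x y : Fin n → V) :
    Kern.tens (Kern.lazy (ρ₁ * δ : ℝ≥0) G.adj) x y ≤ μ (cubeEvent G τ x y δ) *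
      ∏ i ∈ moved x y, (1 + (ρ₂ * δ : ℝ≥0) * (G.mult (x i) (y i) : ℝ≥0∞)) := by
  classical
  set θ₁ : ℝ≥0 := ρ₁ * δ
  set θ : ℝ≥0 := ρ₂ * δ with hθ
  let S := {i // x i ≠ y i}
  let s := Fintype.card S
  let σ : S ≃ Fin s := Fintype.equivFin S
  let J : S → Type v := fun i => {e // G.Joins e (x i) (y i)}
  have hfin : ∀ i, Finite (J i) := fun i => hD.finite_joins _ _
  let : ∀ i, Fintype (J i) := fun i => Fintype.ofFinite _
  have hJ : ∀ i, Fintype.card (J i) = G.mult (x i) (y i) := fun i => by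
    rw [mult, Nat.card_eq_fintype_card]
  let I := Equiv.Perm S × (∀ i, J i)
  let ed : I → S → PowEdge V E n := fun a => schedEdge (a.1.trans σ) (fun i => (a.2 i).1)
  have hinj : ∀ a, Function.Injective (ed a) := fun a => schedEdge_injective _ _
  let A : I → Set Ω := fun a => {ω | ∑ f ∈ Finset.univ.image (ed a), τ f ω ≤ δ}
  have hAm : ∀ a, MeasurableSet[sig τ (Set.range (ed a))] (A a) := fun a =>
    @measurableSet_le _ _ _ _ _ (sig τ (Set.range (ed a))) _ _ _ _ _
      (measurable_sum_sig (by simp)) measurable_const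
  have hcard : ∀ a, (Finset.univ.image (ed a)).card = s := fun a => by
    rw [Finset.card_image_of_injective _ (hinj a), Finset.card_univ]
  have hsub : (⋃ a ∈ (Finset.univ : Finset I), A a) ⊆ cubeEvent G τ x y δ := by
    intro ω hω
    simp only [Set.mem_iUnion] at hω
    obtain ⟨a, -, hω⟩ := hω
    refine ⟨_, monoList_sched (a.1.trans σ) (fun i => (a.2 i).1) (fun i => (a.2 i).2), ?_⟩
    change (List.map (fun f => τ f ω) (List.map _ _)).sum ≤ δ
    have hω' : ∑ f ∈ Finset.univ.image (ed a), τ f ω ≤ δ := hω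
    rw [Finset.sum_image (fun _ _ _ _ h => hinj a h)] at hω'
    rw [List.map_map, ← List.ofFn_eq_map, List.sum_ofFn]
    exact (Equiv.sum_comp (a.1.trans σ).symm (fun i => τ (ed a i) ω)).trans_le hω'
  -- the pairs
  let dif : I → I → Finset S := fun a b => Finset.univ.filter fun i => ed b i ≠ ed a i
  have hpair : ∀ a b, μ (A a ∩ A b) ≤
      μ (A a) * ((θ : ℝ≥0∞) ^ (dif a b).card / ((dif a b).card ! : ℝ≥0∞)) := by
    intro a b
    have hdis : Disjoint (Set.range (ed a)) ((dif a b).image (ed b) : Finset _) := by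
      rw [Set.disjoint_left]
      rintro _ ⟨i, rfl⟩ hmem
      obtain ⟨j, hj, hij⟩ := Finset.mem_image.1 (Finset.mem_coe.1 hmem)
      have : j = i := Subtype.ext (pe_eq_iff.1 hij).1
      subst this
      exact (Finset.mem_filter.1 hj).2 hij
    have hsb : A b ⊆ {ω | ∑ f ∈ (dif a b).image (ed b), τ f ω ≤ δ} := by
      intro ω hω
      have hω' : ∑ f ∈ Finset.univ.image (ed b), τ f ω ≤ δ := hω
      exact (Finset.sum_le_sum_of_subset (Finset.image_subset_image (Finset.subset_univ _))).trans hω'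
    refine (measure_mono (Set.inter_subset_inter_right _ hsb)).trans ?_
    rw [h.measure_inter hdis (hAm a) (@measurableSet_le _ _ _ _ _ (sig τ _) _ _ _ _ _
      (measurable_sum_sig (Set.Subset.refl _)) measurable_const)]
    gcongr
    refine (h.measure_sum_le hF₂ _ le_rfl).trans_eq ?_
    rw [Finset.card_image_of_injective _ (hinj b), ENNReal.ofReal_div_of_pos (by positivity),
      ENNReal.ofReal_pow (by positivity), ENNReal.ofReal_natCast, ← NNReal.coe_mul,
      ENNReal.ofReal_coe_nnreal]
  -- Off `T` the ranks and edges of `b` are those of `a`; free are only a permutation of `T` and the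
  -- edges on `T`. The factorial cancels that of `hpair`, and the sum over all `T` becomes the
  -- product of the factors `1 + θ mult`.
  have hfib : ∀ a (T : Finset S), ((Finset.univ.filter fun b => dif a b = T).card : ℝ≥0∞) ≤
      (T.card ! : ℝ≥0∞) * ∏ i ∈ T, (G.mult (x i) (y i) : ℝ≥0∞) := by
    intro a T
    have hc : (Finset.univ.filter fun b => dif a b = T).card ≤
        T.card ! * ∏ i ∈ T, G.mult (x i) (y i) := by
      have hsub : (Finset.univ.filter fun b => dif a b = T) ⊆
          (Finset.univ.filter fun g : Equiv.Perm S => ∀ i ∉ T, g i = a.1 i) ×ˢ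
          Fintype.piFinset (fun i => if i ∈ T then Finset.univ else {a.2 i}) := by
        intro b hb
        have hb : dif a b = T := by simpa using hb
        have hag : ∀ i ∉ T, b.1 i = a.1 i ∧ b.2 i = a.2 i := by
          intro i hi
          have : ed b i = ed a i := by
            by_contra hne
            exact hi (hb ▸ Finset.mem_filter.2 ⟨Finset.mem_univ _, hne⟩)
          have := schedEdge_eq this
          exact ⟨σ.injective this.1, Subtype.ext this.2⟩
        refine Finset.mem_product.2 ⟨by simpa using fun i hi => (hag i hi).1, ?_⟩
        rw [Fintype.mem_piFinset]
        intro i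
        split_ifs with hi
        · simp
        · simpa using (hag i hi).2
      refine (Finset.card_le_card hsub).trans ?_
      rw [Finset.card_product, card_perm_agree, Fintype.card_piFinset]
      refine Nat.mul_le_mul_left _ ?_
      rw [← Finset.prod_subset (Finset.subset_univ T)]
      · exact (Finset.prod_congr rfl fun i hi => by rw [if_pos hi, Finset.card_univ, hJ]).le
      · intro i _ hi; rw [if_neg hi, Finset.card_singleton]
    exact_mod_cast hc
  have hprod : ∏ i ∈ moved x y, (1 + (θ : ℝ≥0∞) * (G.mult (x i) (y i) : ℝ≥0∞)) =
      ∏ i : S, (1 + (θ : ℝ≥0∞) * (G.mult (x i) (y i) : ℝ≥0∞)) :=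
    Finset.prod_subtype _ (fun i => mem_moved) _
  have hrow : ∀ a, ∑ b, μ (A a ∩ A b) ≤
      μ (A a) * ∏ i ∈ moved x y, (1 + (θ : ℝ≥0∞) * (G.mult (x i) (y i) : ℝ≥0∞)) := by
    intro a
    refine (Finset.sum_le_sum fun b _ => hpair a b).trans ?_
    rw [← Finset.mul_sum]
    gcongr
    rw [hprod, Finset.prod_one_add, ← Finset.sum_fiberwise_of_maps_to (t := Finset.univ.powerset)
      (g := dif a) (by simp)]
    refine Finset.sum_le_sum fun T _ => ?_
    have : ∀ b ∈ Finset.univ.filter (fun b => dif a b = T),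
        (θ : ℝ≥0∞) ^ (dif a b).card / ((dif a b).card ! : ℝ≥0∞) =
        (θ : ℝ≥0∞) ^ T.card / (T.card ! : ℝ≥0∞) := fun b hb => by
      rw [(Finset.mem_filter.1 hb).2]
    rw [Finset.sum_congr rfl this, Finset.sum_const, nsmul_eq_mul, Finset.prod_mul_distrib,
      Finset.prod_const]
    calc _ ≤ ((T.card ! : ℝ≥0∞) * ∏ i ∈ T, (G.mult (x i) (y i) : ℝ≥0∞)) *
          ((θ : ℝ≥0∞) ^ T.card / (T.card ! : ℝ≥0∞)) := by gcongr; exact hfib a T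
      _ = ((T.card ! : ℝ≥0∞) * (T.card ! : ℝ≥0∞)⁻¹) *
          ((θ : ℝ≥0∞) ^ T.card * ∏ i ∈ T, (G.mult (x i) (y i) : ℝ≥0∞)) := by
          rw [div_eq_mul_inv]; ring
      _ = _ := by
          rw [ENNReal.mul_inv_cancel (by exact_mod_cast Nat.factorial_ne_zero _)
            (ENNReal.natCast_ne_top _), one_mul]
  -- conclusion
  set Q := ∏ i ∈ moved x y, (1 + (θ : ℝ≥0∞) * (G.mult (x i) (y i) : ℝ≥0∞)) with hQ
  set m := ∑ a : I, μ (A a) with hm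
  have hmtop : m ≠ ∞ := ENNReal.sum_ne_top.2 fun a _ => measure_ne_top _ _
  have hsm := sq_sum_le_measure_biUnion (μ := μ) (Finset.univ : Finset I) (A := A)
    (fun a _ => h.sig_le _ _ (hAm a)) (fun _ => 1)
  simp only [one_mul] at hsm
  have h1 : m ^ 2 ≤ μ (cubeEvent G τ x y δ) * (m * Q) := by
    refine hsm.trans ?_
    gcongr
    rw [hm, Finset.sum_mul]
    exact Finset.sum_le_sum fun a _ => hrow a
  have h2 : m ≤ μ (cubeEvent G τ x y δ) * Q := by
    by_cases hm0 : m = 0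
    · simp [hm0]
    · rw [sq, mul_left_comm] at h1
      exact (ENNReal.mul_le_mul_iff_right hm0 hmtop).1 h1
  refine le_trans ?_ h2
  have h3 : ∀ a, (θ₁ : ℝ≥0∞) ^ s / (s ! : ℝ≥0∞) ≤ μ (A a) := by
    intro a
    refine le_of_eq_of_le ?_ (h.le_measure_sum hF₁ _ le_rfl)
    rw [hcard, ENNReal.ofReal_div_of_pos (by positivity),
      ENNReal.ofReal_pow (by positivity), ENNReal.ofReal_natCast, ← NNReal.coe_mul,
      ENNReal.ofReal_coe_nnreal]
  have hs : (moved x y).card = s := by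
    rw [show s = Fintype.card S from rfl, Fintype.card_subtype]
    congr 1
  have hprod2 : ∏ i ∈ moved x y, (G.mult (x i) (y i) : ℝ≥0∞) =
      ∏ i : S, (G.mult (x i) (y i) : ℝ≥0∞) :=
    Finset.prod_subtype _ (fun i => mem_moved) _
  have hI : (Fintype.card I : ℝ≥0∞) = s ! * ∏ i : S, (G.mult (x i) (y i) : ℝ≥0∞) := by
    rw [Fintype.card_prod, Fintype.card_perm, Fintype.card_pi, Nat.cast_mul, Nat.cast_prod]
    simp_rw [hJ]
    rfl
  calc Kern.tens (Kern.lazy θ₁ G.adj) x y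
      = (θ₁ : ℝ≥0∞) ^ s * ∏ i : S, (G.mult (x i) (y i) : ℝ≥0∞) := by
        rw [tens_lazy_eq hG hD, Finset.prod_mul_distrib, Finset.prod_const, hs, hprod2]
    _ = ((s ! : ℝ≥0∞) * (s ! : ℝ≥0∞)⁻¹) *
        ((θ₁ : ℝ≥0∞) ^ s * ∏ i : S, (G.mult (x i) (y i) : ℝ≥0∞)) := by
        rw [ENNReal.mul_inv_cancel (by exact_mod_cast Nat.factorial_ne_zero _)
          (ENNReal.natCast_ne_top _), one_mul]
    _ = Fintype.card I * ((θ₁ : ℝ≥0∞) ^ s / (s ! : ℝ≥0∞)) := by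
        rw [hI, div_eq_mul_inv]; ring
    _ ≤ m := by
        rw [hm, ← nsmul_eq_mul, ← Finset.card_univ, ← Finset.sum_const]
        exact Finset.sum_le_sum fun a _ => h3 a

end MixedGraph

/-! ### The second moment method for chains of events. -/

namespace Kern
variable {X : Type u}

theorem mul_mono_apply {K K' L L' : Kern X} (hK : ∀ x y, K x y ≤ K' x y) (hL : ∀ x y, L x y ≤ L' x y)
    (x y : X) : (K * L) x y ≤ (K' * L') x y :=
  ENNReal.tsum_le_tsum fun z => mul_le_mul' (hK x z) (hL z y)

theorem scale_mul (c : ℝ≥0∞) (K L : Kern X) : scale c K * L = scale c (K * L) := by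
  funext x y
  rw [mul_apply, scale_apply, mul_apply, ← ENNReal.tsum_mul_left]
  exact tsum_congr fun z => by rw [scale_apply, mul_assoc]

theorem mul_scale (c : ℝ≥0∞) (K L : Kern X) : K * scale c L = scale c (K * L) := by
  funext x y
  rw [mul_apply, scale_apply, mul_apply, ← ENNReal.tsum_mul_left]
  exact tsum_congr fun z => by rw [scale_apply, mul_left_comm]

/-- Products of kernels that are perturbed by finitely many jumps. -/
theorem prodK_mul_pow_le {W : Kern X} {T : ℕ → Kern X} {B : ℕ → Finset X} {c : ℕ → X → X → ℝ≥0∞}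
    {v : X} {R : ℕ} {box : ℕ → Set X} {b Λ L : ℝ≥0∞}
    (hT : ∀ r < R, ∀ x y, T r x y ≤ W x y + ∑ u ∈ B r, ∑ u' ∈ B r, c r u u' * (W x u * W u' y))
    (hB : ∀ r < R, ∀ u ∈ B r, u ∈ box r) (hc : ∀ r < R, ∑ u ∈ B r, ∑ u' ∈ B r, c r u u' ≤ L)
    (hgap : ∀ r k, r + k < R → ∀ u ∈ box r, ∀ u' ∈ box (r + k), (W ^ (k + 1)) u u' ≤ b * Λ ^ k)
    (hv : v ∈ box 0) (r k m : ℕ) (hm : r + k = m + 1) (hmR : m < R) (y : X) (hy : y ∈ box m) :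
    (prodK T r * W ^ k) v y ≤ b * Λ ^ m * (1 + L * b) ^ r := by
  induction r generalizing k m y with
  | zero =>
    obtain rfl : k = m + 1 := by omega
    rw [prodK, one_mul, pow_zero, mul_one]
    exact hgap 0 m (by omega) v hv y (by simpa using hy)
  | succ r ih =>
    -- Expand the last perturbed factor. Without a jump the free window grows by one step. With a
    -- jump from `u` to `u'`, the current window is closed by one factor `W` and a new window is
    -- opened by another one, so both windows include the slice `r`. This is why `r + k` steps
    -- correspond to the last slice `m = r + k - 1`.
    have hstep : (prodK T (r + 1) * W ^ k) v y ≤ (prodK T r * W ^ (k + 1)) v y +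
        ∑ u ∈ B r, ∑ u' ∈ B r, c r u u' * ((prodK T r * W ^ 1) v u * (W ^ (k + 1)) u' y) := by
      let J : Kern X := fun x y => ∑ u ∈ B r, ∑ u' ∈ B r, c r u u' * (W x u * W u' y)
      have h1 : (prodK T (r + 1) * W ^ k) v y ≤ (prodK T r * ((W + J) * W ^ k)) v y := by
        rw [prodK, mul_assoc]
        exact mul_mono_apply (fun _ _ => le_rfl)
          (mul_mono_apply (hT r (by omega)) fun _ _ => le_rfl) _ _
      refine h1.trans_eq ?_
      rw [add_mul, mul_add, add_apply, ← pow_succ']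
      congr 1
      have h2 : ∀ x, (J * W ^ k) x y =
          ∑ u ∈ B r, ∑ u' ∈ B r, c r u u' * (W x u * (W ^ (k + 1)) u' y) := by
        intro x
        rw [mul_apply]
        simp only [J, Finset.sum_mul]
        rw [Summable.tsum_finsetSum fun _ _ => ENNReal.summable]
        refine Finset.sum_congr rfl fun u _ => ?_
        rw [Summable.tsum_finsetSum fun _ _ => ENNReal.summable]
        refine Finset.sum_congr rfl fun u' _ => ?_
        rw [pow_succ', mul_apply, ← ENNReal.tsum_mul_left, ← ENNReal.tsum_mul_left]
        exact tsum_congr fun z => by ring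
      rw [mul_apply]
      simp only [h2, Finset.mul_sum]
      rw [Summable.tsum_finsetSum fun _ _ => ENNReal.summable]
      refine Finset.sum_congr rfl fun u _ => ?_
      rw [Summable.tsum_finsetSum fun _ _ => ENNReal.summable]
      refine Finset.sum_congr rfl fun u' _ => ?_
      rw [pow_one, mul_apply, ← ENNReal.tsum_mul_right, ← ENNReal.tsum_mul_left]
      exact tsum_congr fun z => by ring
    obtain rfl : m = r + k := by omega
    calc _ ≤ _ := hstep
      _ ≤ b * Λ ^ (r + k) * (1 + L * b) ^ r + ∑ u ∈ B r, ∑ u' ∈ B r, c r u u' *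
          ((b * Λ ^ r * (1 + L * b) ^ r) * (b * Λ ^ k)) := by
          refine add_le_add (ih (k + 1) (r + k) (by omega) hmR y hy) ?_
          refine Finset.sum_le_sum fun u hu => Finset.sum_le_sum fun u' hu' => ?_
          exact mul_le_mul_right (mul_le_mul' (ih 1 r rfl (by omega) u (hB r (by omega) u hu))
            (hgap r k hmR u' (hB r (by omega) u' hu') y hy)) _
      _ = b * Λ ^ (r + k) * (1 + L * b) ^ r + (∑ u ∈ B r, ∑ u' ∈ B r, c r u u') *
          ((b * Λ ^ r * (1 + L * b) ^ r) * (b * Λ ^ k)) := by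
          simp_rw [Finset.sum_mul]
      _ ≤ b * Λ ^ (r + k) * (1 + L * b) ^ r + L *
          ((b * Λ ^ r * (1 + L * b) ^ r) * (b * Λ ^ k)) := by
          gcongr; exact hc r (by omega)
      _ = _ := by rw [pow_succ, pow_add]; ring

theorem prodK_le_of_gap {W : Kern X} {T : ℕ → Kern X} {B : ℕ → Finset X} {c : ℕ → X → X → ℝ≥0∞}
    {v : X} {R : ℕ} {box : ℕ → Set X} {b Λ L : ℝ≥0∞}
    (hT : ∀ r < R, ∀ x y, T r x y ≤ W x y + ∑ u ∈ B r, ∑ u' ∈ B r, c r u u' * (W x u * W u' y))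
    (hB : ∀ r < R, ∀ u ∈ B r, u ∈ box r) (hc : ∀ r < R, ∑ u ∈ B r, ∑ u' ∈ B r, c r u u' ≤ L)
    (hgap : ∀ r k, r + k < R → ∀ u ∈ box r, ∀ u' ∈ box (r + k), (W ^ (k + 1)) u u' ≤ b * Λ ^ k)
    (hv : v ∈ box 0) (hR : 0 < R) (y : X) (hy : y ∈ box (R - 1)) :
    prodK T R v y ≤ b * Λ ^ (R - 1) * (1 + L * b) ^ R := by
  have := prodK_mul_pow_le hT hB hc hgap hv R 0 (R - 1) (by omega) (by omega) y hy
  rwa [pow_zero, mul_one] at this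

end Kern

/-- Second moment method for chains of events with random entrance at the steps. -/
theorem chain_measure_ge {X : Type u} {Ω : Type*} [MeasurableSpace Ω] {μ : Measure Ω}
    [IsProbabilityMeasure μ] {W : Kern X} {v w : X} {h h' R : ℕ} (hR : R = h + h') (hh : 0 < h) (hh' : 0 < h')
    (𝒞 : Finset (Fin (R + 1) → X)) (h0 : ∀ z ∈ 𝒞, z 0 = v) (hl : ∀ z ∈ 𝒞, z (Fin.last _) = w)
    (hWtop : ∀ x y, W x y ≠ ∞) (hW0 : ∀ z ∈ 𝒞, ∀ r : Fin (R), W (z r.castSucc) (z r.succ) ≠ 0)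
    (S : (Fin (R + 1) → X) → Set Ω) (hS : ∀ z, MeasurableSet (S z))
    (Q : ℕ → X → Set Ω) (C : ℕ → X → X → Set Ω)
    (hprod : ∀ z ∈ 𝒞, ∀ z' ∈ 𝒞, μ (S z ∩ S z') =
      ∏ r : Fin (R), μ (Q r (z r.castSucc) ∩ Q r (z' r.castSucc)) *
        μ (C r (z r.castSucc) (z r.succ) ∩ C r (z' r.castSucc) (z' r.succ)))
    (K q : ℝ≥0∞)
    (hQ : ∀ r x x', r ≠ h → μ (Q r x ∩ Q r x') ≤ K * (μ (Q r x) * μ (Q r x')))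
    (hQh : ∀ x x', μ (Q h x ∩ Q h x') ≤ (1 + q⁻¹ * (1 : Kern X) x x') * (μ (Q h x) * μ (Q h x')))
    (hQ0 : ∀ r x, μ (Q r x) ≠ 0) (hK1 : 1 ≤ K)
    (b : (Fin (R + 1) → X) → Fin (R) → ℝ≥0∞) (β : ℝ≥0∞)
    (hb : ∀ z ∈ 𝒞, ∀ r : Fin (R), W (z r.castSucc) (z r.succ) ≤
      b z r * μ (C r (z r.castSucc) (z r.succ)))
    (hβ : ∀ z ∈ 𝒞, ∏ r, b z r ≤ β)
    (box : (Fin (R + 1) → X) → ℕ → Set X) (L : ℝ≥0∞)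
    (hbox : ∀ z ∈ 𝒞, ∀ r : Fin (R), z r.castSucc ∈ box z r ∧ z r.succ ∈ box z r)
    (hpair : ∀ z ∈ 𝒞, ∀ r : Fin (R), ∃ (B : Finset X) (c : X → X → ℝ≥0∞),
      (∀ u ∈ B, u ∈ box z r) ∧ ∑ u ∈ B, ∑ u' ∈ B, c u u' ≤ L * W (z r.castSucc) (z r.succ) ∧
      ∀ x' y', μ (C r (z r.castSucc) (z r.succ) ∩ C r x' y') ≤
        W (z r.castSucc) (z r.succ) * W x' y' +
          ∑ u ∈ B, ∑ u' ∈ B, c u u' * (W x' u * W u' y'))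
    (g Λ Λ' : ℝ≥0∞)
    (hgap : ∀ z ∈ 𝒞, ∀ r k, r + k < R → ∀ u ∈ box z r, ∀ u' ∈ box z (r + k),
      (W ^ (k + 1)) u u' ≤ g * Λ ^ k)
    (hgap' : ∀ z ∈ 𝒞, ∀ r k, r + k < R → (r + k < h ∨ h ≤ r) → ∀ u ∈ box z r,
      ∀ u' ∈ box z (r + k), (W ^ (k + 1)) u u' ≤ g * Λ' ^ k) :
    ∑ z ∈ 𝒞, ∏ r : Fin (R), W (z r.castSucc) (z r.succ) ≤ μ (⋃ z ∈ 𝒞, S z) *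
      (β ^ 2 * K ^ (R) * (g * Λ ^ (R - 1) * (1 + L * g) ^ (R) +
        q⁻¹ * (g ^ 2 * Λ' ^ (R - 2) * (1 + L * g) ^ (R)))) := by
  classical
  let om : (Fin (R + 1) → X) → ℝ≥0∞ := fun z => ∏ r : Fin R, W (z r.castSucc) (z r.succ)
  have hCtop : ∀ r x y, μ (C r x y) ≠ ∞ := fun r x y => measure_ne_top _ _
  have hC0 : ∀ z ∈ 𝒞, ∀ r : Fin R, μ (C r (z r.castSucc) (z r.succ)) ≠ 0 := by
    intro z hz r h0
    have := hb z hz r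
    rw [h0, mul_zero] at this
    exact hW0 z hz r (le_antisymm this (by simp))
  have hSz : ∀ z ∈ 𝒞, μ (S z) = ∏ r : Fin R, μ (Q r (z r.castSucc)) *
      μ (C r (z r.castSucc) (z r.succ)) := by
    intro z hz
    have := hprod z hz z hz
    simpa using this
  have hS0 : ∀ z ∈ 𝒞, μ (S z) ≠ 0 := by
    intro z hz
    rw [hSz z hz]
    exact Finset.prod_ne_zero_iff.2 fun r _ => mul_ne_zero (hQ0 _ _) (hC0 z hz r)
  set P := g * Λ ^ (R - 1) * (1 + L * g) ^ R + q⁻¹ * (g ^ 2 * Λ' ^ (R - 2) * (1 + L * g) ^ R) with hP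
  -- the sum over the second chain
  have key : ∀ z ∈ 𝒞, ∑ z' ∈ 𝒞, om z' / μ (S z') * (μ (S z ∩ S z') / μ (S z)) ≤
      β ^ 2 * K ^ R * P := by
    intro z hz
    choose B c hBb hcL hBc using hpair z hz
    let B' : ℕ → Finset X := fun r => if hr : r < R then B ⟨r, hr⟩ else ∅
    let c' : ℕ → X → X → ℝ≥0∞ := fun r u u' => if hr : r < R then
      c ⟨r, hr⟩ u u' / W (z (Fin.castSucc ⟨r, hr⟩)) (z (Fin.succ ⟨r, hr⟩)) else 0
    -- The kernel for a second chain given that `z` succeeds: a free step, or a step that touches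
    -- the path of `z` at `u` and leaves it at `u'`.
    let T : ℕ → Kern X := fun r x y => W x y + ∑ u ∈ B' r, ∑ u' ∈ B' r, c' r u u' * (W x u * W u' y)
    have hB' : ∀ r < R, ∀ u ∈ B' r, u ∈ box z r := by
      intro r hr u hu
      simp only [B', hr, dite_true] at hu
      exact hBb ⟨r, hr⟩ u hu
    have hc' : ∀ r < R, ∑ u ∈ B' r, ∑ u' ∈ B' r, c' r u u' ≤ L := by
      intro r hr
      simp only [B', c', hr, dite_true, div_eq_mul_inv]
      simp_rw [← Finset.sum_mul]
      rw [← div_eq_mul_inv]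
      exact ENNReal.div_le_of_le_mul (hcL ⟨r, hr⟩)
    -- In slice `h` a common entrance costs the factor `q⁻¹`, whereas different entrances are
    -- independent.
    let K' : ℕ → Kern X := fun r x y =>
      (if r = h then 1 + q⁻¹ * (1 : Kern X) (z (Fin.castSucc ⟨h, by omega⟩)) x else 1) * T r x y
    -- one factor
    have hfac : ∀ z' ∈ 𝒞, ∀ r : Fin R,
        W (z' r.castSucc) (z' r.succ) / (μ (Q r (z' r.castSucc)) * μ (C r (z' r.castSucc) (z' r.succ))) *
        (μ (Q r (z r.castSucc) ∩ Q r (z' r.castSucc)) *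
          μ (C r (z r.castSucc) (z r.succ) ∩ C r (z' r.castSucc) (z' r.succ)) /
          (μ (Q r (z r.castSucc)) * μ (C r (z r.castSucc) (z r.succ)))) ≤
        b z r * b z' r * K * K' r (z' r.castSucc) (z' r.succ) := by
      intro z' hz' r
      set Wz := W (z r.castSucc) (z r.succ)
      set Wz' := W (z' r.castSucc) (z' r.succ)
      set a := μ (Q r (z r.castSucc))
      set a' := μ (Q r (z' r.castSucc))
      set d := μ (C r (z r.castSucc) (z r.succ))
      set d' := μ (C r (z' r.castSucc) (z' r.succ))
      have ha : a ≠ 0 := hQ0 _ _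
      have ha' : a' ≠ 0 := hQ0 _ _
      have hat : a ≠ ∞ := measure_ne_top _ _
      have hat' : a' ≠ ∞ := measure_ne_top _ _
      have hd : d ≠ 0 := hC0 z hz r
      have hd' : d' ≠ 0 := hC0 z' hz' r
      have hdt : d ≠ ∞ := measure_ne_top _ _
      have hdt' : d' ≠ ∞ := measure_ne_top _ _
      set kk : ℝ≥0∞ := (if (r : ℕ) = h then 1 + q⁻¹ *
        (1 : Kern X) (z (Fin.castSucc ⟨h, by omega⟩)) (z' r.castSucc) else 1) with hkk
      have hq : μ (Q r (z r.castSucc) ∩ Q r (z' r.castSucc)) ≤ K * kk * (a * a') := by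
        by_cases hr : (r : ℕ) = h
        · have hzr : z (Fin.castSucc ⟨h, by omega⟩) = z r.castSucc := by
            congr 1; exact Fin.ext hr.symm
          rw [hkk, if_pos hr, hzr]
          have := hQh (z r.castSucc) (z' r.castSucc)
          rw [← hr] at this
          refine this.trans ?_
          rw [mul_assoc]
          exact le_mul_of_one_le_left' hK1
        · rw [hkk, if_neg hr, mul_one]
          exact hQ r _ _ hr
      have hcc : μ (C r (z r.castSucc) (z r.succ) ∩ C r (z' r.castSucc) (z' r.succ)) ≤
          Wz * T r (z' r.castSucc) (z' r.succ) := by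
        refine (hBc r _ _).trans_eq ?_
        simp only [T, B', c', r.2, dite_true, Fin.eta]
        rw [mul_add, Finset.mul_sum]
        congr 1
        refine Finset.sum_congr rfl fun u _ => ?_
        rw [Finset.mul_sum]
        refine Finset.sum_congr rfl fun u' _ => ?_
        have hcan : Wz * (c ⟨r, r.2⟩ u u' / Wz) = c ⟨r, r.2⟩ u u' :=
          ENNReal.mul_div_cancel (hW0 z hz r) (hWtop _ _)
        exact (congrArg (fun t => t * _) hcan).symm.trans (mul_assoc _ _ _)
      have hb1 : Wz / d ≤ b z r := ENNReal.div_le_of_le_mul (hb z hz r)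
      have hb2 : Wz' / d' ≤ b z' r := ENNReal.div_le_of_le_mul (hb z' hz' r)
      calc _ ≤ Wz' / (a' * d') * (K * kk * (a * a') * (Wz * T r (z' r.castSucc) (z' r.succ)) /
            (a * d)) := by gcongr
        _ = (Wz / d) * (Wz' / d') * K * (kk * T r (z' r.castSucc) (z' r.succ)) := by
            simp only [div_eq_mul_inv]
            rw [ENNReal.mul_inv (Or.inl ha) (Or.inl hat), ENNReal.mul_inv (Or.inl ha') (Or.inl hat')]
            calc _ = (a * a⁻¹) * (a' * a'⁻¹) * (Wz * d⁻¹ * (Wz' * d'⁻¹) * K *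
                  (kk * T r (z' r.castSucc) (z' r.succ))) := by ring
              _ = _ := by
                  rw [ENNReal.mul_inv_cancel ha hat, ENNReal.mul_inv_cancel ha' hat', one_mul, one_mul]
        _ ≤ _ := by gcongr
    have hterm : ∀ z' ∈ 𝒞, om z' / μ (S z') * (μ (S z ∩ S z') / μ (S z)) ≤
        β ^ 2 * K ^ R * ∏ r : Fin R, K' r (z' r.castSucc) (z' r.succ) := by
      intro z' hz'
      have hne : ∀ z ∈ 𝒞, ∀ r ∈ (Finset.univ : Finset (Fin R)),
          μ (Q r (z r.castSucc)) * μ (C r (z r.castSucc) (z r.succ)) ≠ 0 :=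
        fun z hz r _ => mul_ne_zero (hQ0 _ _) (hC0 z hz r)
      rw [hSz z' hz', hSz z hz, hprod z hz z' hz']
      simp only [om, div_eq_mul_inv]
      rw [ENNReal.prod_inv_distrib, ENNReal.prod_inv_distrib, ← Finset.prod_mul_distrib,
        ← Finset.prod_mul_distrib, ← Finset.prod_mul_distrib]
      · refine (Finset.prod_le_prod' fun r _ => hfac z' hz' r).trans ?_
        rw [Finset.prod_mul_distrib, Finset.prod_mul_distrib, Finset.prod_mul_distrib,
          Finset.prod_const, Finset.card_univ, Fintype.card_fin, sq]
        gcongr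
        · exact hβ z hz
        · exact hβ z' hz'
      · intro r _ r' hr' _; exact Or.inl (hne z hz _ (by simp))
      · intro r _ r' hr' _; exact Or.inl (hne z' hz' _ (by simp))
    have hsum : ∑ z' ∈ 𝒞, ∏ r : Fin R, K' r (z' r.castSucc) (z' r.succ) ≤ P := by
      have hchain := Kern.tsum_chain K' R v (fun y => (1 : Kern X) y w)
      rw [Kern.tsum_mul_one] at hchain
      have h1 : ∑ z' ∈ 𝒞, ∏ r : Fin R, K' r (z' r.castSucc) (z' r.succ) ≤ Kern.prodK K' R v w := by
        rw [← hchain]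
        refine le_trans (Finset.sum_le_sum fun z' hz' => ?_) (ENNReal.sum_le_tsum 𝒞)
        rw [h0 z' hz', hl z' hz', Kern.one_self, Kern.one_self, one_mul, mul_one]
      refine h1.trans ?_
      set x := z (Fin.castSucc ⟨h, by omega⟩) with hx
      have hKh : K' h = T h + Kern.scale q⁻¹ (Kern.pointK x * T h) := by
        funext y y'
        rw [Kern.add_apply, Kern.scale_apply, Kern.mul_apply]
        have : ∀ t, Kern.pointK x y t * T h t y' = (1 : Kern X) x t * ((1 : Kern X) y x * T h t y') := by
          intro t; rw [Kern.pointK]; ring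
        simp_rw [this]
        rw [Kern.tsum_one_mul]
        simp only [K', if_true]
        rw [add_mul, one_mul, mul_assoc]
        congr 2
        by_cases hxy : x = y
        · subst hxy; rfl
        · rw [Kern.one_of_ne hxy, Kern.one_of_ne (Ne.symm hxy)]; simp
      have hKne : ∀ r, r ≠ h → K' r = T r := by
        intro r hr; funext y y'; simp [K', hr]
      -- The first term ignores the entrance in slice `h`. In the second one both chains are at `x`
      -- there, so the product falls into two halves, in which only windows within one half occur;
      -- they are bounded with `Λ'`.
      have hsplit : Kern.prodK K' R = Kern.prodK T R +
          Kern.scale q⁻¹ (Kern.prodK T h * Kern.pointK x * Kern.prodK (fun r => T (h + r)) h') := by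
        obtain ⟨k, rfl⟩ : ∃ k, h' = 1 + k := ⟨h' - 1, by omega⟩
        have e1 : Kern.prodK (fun r => T (h + r)) (1 + k) =
            T h * Kern.prodK (fun r => T (h + (1 + r))) k := by
          rw [Kern.prodK_add]; simp [Kern.prodK]
        have e2 : Kern.prodK (fun r => K' (h + r)) (1 + k) =
            K' h * Kern.prodK (fun r => T (h + (1 + r))) k := by
          rw [Kern.prodK_add]
          congr 1
          · simp [Kern.prodK]
          · exact Kern.prodK_congr fun r _ => hKne _ (by omega)
        rw [hR, Kern.prodK_add, Kern.prodK_add T, e1, e2, hKh,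
          Kern.prodK_congr (fun r hr => hKne r (by omega))]
        rw [add_mul, mul_add]
        congr 1
        rw [Kern.scale_mul, Kern.mul_scale, mul_assoc, mul_assoc]
      rw [hsplit, Kern.add_apply, Kern.scale_apply, Kern.mul_pointK_mul, hP]
      have hT : ∀ r < R, ∀ x y, T r x y ≤ W x y +
        ∑ u ∈ B' r, ∑ u' ∈ B' r, c' r u u' * (W x u * W u' y) := fun r _ x y => le_rfl
      have hx1 : x ∈ box z (h - 1) := by
        have := (hbox z hz ⟨h - 1, by omega⟩).2
        rwa [show Fin.succ (⟨h - 1, by omega⟩ : Fin R) = Fin.castSucc ⟨h, by omega⟩ from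
          Fin.ext (by simp; omega)] at this
      have hx2 : x ∈ box z h := (hbox z hz ⟨h, by omega⟩).1
      have hv0 : v ∈ box z 0 := by
        have := (hbox z hz ⟨0, by omega⟩).1
        rwa [show Fin.castSucc (⟨0, by omega⟩ : Fin R) = 0 from rfl, h0 z hz] at this
      have hwl : w ∈ box z (R - 1) := by
        have := (hbox z hz ⟨R - 1, by omega⟩).2
        rwa [show Fin.succ (⟨R - 1, by omega⟩ : Fin R) = Fin.last R from
          Fin.ext (by simp; omega), hl z hz] at this
      have b1 := Kern.prodK_le_of_gap hT hB' hc' (hgap z hz) hv0 (by omega) w hwl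
      have b2 := Kern.prodK_le_of_gap (R := h) (Λ := Λ') (fun r hr => hT r (by omega))
        (fun r hr => hB' r (by omega)) (fun r hr => hc' r (by omega))
        (fun r k hrk u hu u' hu' => by
          simpa using hgap' z hz r k (by omega) (Or.inl hrk) u hu u' hu') hv0 hh x hx1
      have b3 := Kern.prodK_le_of_gap (R := h') (Λ := Λ') (T := fun r => T (h + r))
        (B := fun r => B' (h + r)) (c := fun r => c' (h + r)) (box := fun r => box z (h + r))
        (fun r hr => hT (h + r) (by omega))
        (fun r hr => hB' (h + r) (by omega)) (fun r hr => hc' (h + r) (by omega))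
        (fun r k hrk u hu u' hu' => by
          simpa using hgap' z hz (h + r) k (by omega) (Or.inr (by omega)) u hu u'
            (by rwa [add_assoc])) hx2 hh' w (by rw [show h + (h' - 1) = R - 1 by omega]; exact hwl)
      refine add_le_add b1 (mul_le_mul_right ((mul_le_mul' b2 b3).trans_eq ?_) _)
      rw [show R - 2 = (h - 1) + (h' - 1) by omega, hR, pow_add, pow_add]; ring
    calc _ ≤ ∑ z' ∈ 𝒞, β ^ 2 * K ^ R * ∏ r : Fin R, K' r (z' r.castSucc) (z' r.succ) :=
          Finset.sum_le_sum hterm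
      _ ≤ _ := by rw [← Finset.mul_sum]; gcongr
  -- the second moment
  have hsm := sq_sum_le_measure_biUnion (μ := μ) 𝒞 (A := S) (fun z _ => hS z)
    (fun z => om z / μ (S z))
  have e1 : ∑ z ∈ 𝒞, om z / μ (S z) * μ (S z) = ∑ z ∈ 𝒞, om z :=
    Finset.sum_congr rfl fun z hz => ENNReal.div_mul_cancel (hS0 z hz) (measure_ne_top _ _)
  rw [e1] at hsm
  set m := ∑ z ∈ 𝒞, om z with hm
  have hmtop : m ≠ ∞ := ENNReal.sum_ne_top.2 fun z _ => ENNReal.prod_ne_top fun r _ => hWtop _ _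
  have e2 : ∑ z ∈ 𝒞, ∑ z' ∈ 𝒞, om z / μ (S z) * (om z' / μ (S z')) * μ (S z ∩ S z') ≤
      m * (β ^ 2 * K ^ R * P) := by
    rw [hm, Finset.sum_mul]
    refine Finset.sum_le_sum fun z hz => ?_
    calc _ = om z * ∑ z' ∈ 𝒞, om z' / μ (S z') * (μ (S z ∩ S z') / μ (S z)) := by
          rw [Finset.mul_sum]
          refine Finset.sum_congr rfl fun z' _ => ?_
          simp only [div_eq_mul_inv]; ring
      _ ≤ _ := by gcongr; exact key z hz
  have h1 : m ^ 2 ≤ μ (⋃ z ∈ 𝒞, S z) * (m * (β ^ 2 * K ^ R * P)) := hsm.trans (by gcongr)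
  by_cases hm0 : m = 0
  · change m ≤ _
    simp [hm0]
  · rw [sq, mul_left_comm] at h1
    exact (ENNReal.mul_le_mul_iff_right hm0 hmtop).1 h1

/-! ### Products of kernels over coordinates, and typical trajectories. -/

/-- A law of large numbers for finitely many functionals of independent variables with finitely many
values. -/
theorem exists_half_le_sum_prod {α J : Type*} [Fintype J] (Θ : Finset α) (p : α → ℝ)
    (hp : ∀ a ∈ Θ, 0 ≤ p a) (hsum : ∑ a ∈ Θ, p a = 1) (f : J → α → ℝ) (m : J → ℝ)
    (hm : ∀ j, ∑ a ∈ Θ, p a * f j a ≤ m j) {ε : ℝ} (hε : 0 < ε) :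
    ∃ N₀ : ℕ, ∀ N ≥ N₀, 1 / 2 ≤ ∑ z ∈ (Fintype.piFinset fun _ : Fin N => Θ).filter
      (fun z => ∀ j, ∑ i, f j (z i) ≤ N * (m j + ε)), ∏ i, p (z i) := by
  classical
  -- Chernoff's bound. The exponential moment `ph j` equals `1` at zero and has a negative
  -- derivative there, so it is below `1` for some `s > 0`.
  let ph : J → ℝ → ℝ := fun j s => ∑ a ∈ Θ, p a * Real.exp (s * (f j a - (m j + ε)))
  have hph : ∀ j, ∃ s > 0, ph j s < 1 := by
    intro j
    have hd : HasDerivAt (ph j) (∑ a ∈ Θ, p a * (f j a - (m j + ε))) 0 := by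
      have : ∀ a ∈ Θ, HasDerivAt (fun s => p a * Real.exp (s * (f j a - (m j + ε))))
          (p a * (f j a - (m j + ε))) 0 := by
        intro a _
        have h1 : HasDerivAt (fun s : ℝ => s * (f j a - (m j + ε))) (1 * (f j a - (m j + ε))) 0 :=
          (hasDerivAt_id 0).mul_const _
        have h2 := (h1.exp).const_mul (p a)
        simpa using h2
      exact HasDerivAt.fun_sum this
    have hneg : ∑ a ∈ Θ, p a * (f j a - (m j + ε)) < 0 := by
      simp_rw [mul_sub]
      rw [Finset.sum_sub_distrib, ← Finset.sum_mul, hsum]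
      linarith [hm j]
    have h0 : ph j 0 = 1 := by simp [ph, hsum]
    have ht := hd.tendsto_slope_zero_right
    obtain ⟨s, hs, hs0⟩ := ((ht.eventually (gt_mem_nhds hneg)).and self_mem_nhdsWithin).exists
    have hs0 : 0 < s := hs0
    refine ⟨s, hs0, ?_⟩
    rw [zero_add, h0, smul_eq_mul] at hs
    by_contra hcon
    have : 0 ≤ s⁻¹ * (ph j s - 1) := mul_nonneg (by positivity) (by linarith)
    linarith
  choose s hs0 hs1 using hph
  have hph0 : ∀ j, 0 ≤ ph j (s j) := fun j =>
    Finset.sum_nonneg fun a ha => mul_nonneg (hp a ha) (Real.exp_pos _).le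
  have ht : Tendsto (fun N : ℕ => ∑ j, ph j (s j) ^ N) atTop (𝓝 0) := by
    have : Tendsto (fun N : ℕ => ∑ j, ph j (s j) ^ N) atTop (𝓝 (∑ _j : J, 0)) :=
      tendsto_finsetSum _ fun j _ => tendsto_pow_atTop_nhds_zero_of_lt_one (hph0 j) (hs1 j)
    simpa using this
  obtain ⟨N₀, hN₀⟩ := eventually_atTop.1 (ht.eventually (gt_mem_nhds (show (0 : ℝ) < 1 / 2 by norm_num)))
  refine ⟨N₀, fun N hN => ?_⟩
  have hN := hN₀ N hN
  set P := Fintype.piFinset fun _ : Fin N => Θ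
  have htot : ∑ z ∈ P, ∏ i, p (z i) = 1 := by
    rw [← Finset.prod_univ_sum (fun _ => Θ) (fun _ a => p a)]
    simp [hsum]
  have hpz : ∀ z ∈ P, 0 ≤ ∏ i, p (z i) := fun z hz =>
    Finset.prod_nonneg fun i _ => hp _ (Fintype.mem_piFinset.1 hz i)
  have hbad : ∀ j, ∑ z ∈ P.filter (fun z => N * (m j + ε) < ∑ i, f j (z i)), ∏ i, p (z i) ≤
      ph j (s j) ^ N := by
    intro j
    have h1 : ph j (s j) ^ N = ∑ z ∈ P, ∏ i, p (z i) * Real.exp (s j * (f j (z i) - (m j + ε))) := by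
      rw [← Finset.prod_univ_sum (fun _ => Θ)
        (fun _ a => p a * Real.exp (s j * (f j a - (m j + ε))))]
      simp [ph]
    rw [h1]
    refine (Finset.sum_le_sum fun z hz => ?_).trans
      (Finset.sum_le_sum_of_subset_of_nonneg (Finset.filter_subset _ _) fun z hz _ => ?_)
    · obtain ⟨hz, hlt⟩ := Finset.mem_filter.1 hz
      rw [Finset.prod_mul_distrib, ← Real.exp_sum]
      refine le_mul_of_one_le_right (hpz z hz) (Real.one_le_exp ?_)
      rw [← Finset.mul_sum, Finset.sum_sub_distrib]
      refine mul_nonneg (hs0 j).le ?_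
      simp only [Finset.sum_const, Finset.card_univ, Fintype.card_fin, nsmul_eq_mul]
      linarith
    · refine Finset.prod_nonneg fun i _ => mul_nonneg (hp _ (Fintype.mem_piFinset.1 hz i))
        (Real.exp_pos _).le
  have hcov : ∑ z ∈ P, ∏ i, p (z i) ≤
      ∑ z ∈ P.filter (fun z => ∀ j, ∑ i, f j (z i) ≤ N * (m j + ε)), ∏ i, p (z i) +
      ∑ j, ∑ z ∈ P.filter (fun z => N * (m j + ε) < ∑ i, f j (z i)), ∏ i, p (z i) := by
    simp_rw [Finset.sum_filter]
    rw [Finset.sum_comm, ← Finset.sum_add_distrib]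
    refine Finset.sum_le_sum fun z hz => ?_
    have hn : ∀ j, 0 ≤ if N * (m j + ε) < ∑ i, f j (z i) then ∏ i, p (z i) else 0 := by
      intro j; split_ifs; exacts [hpz z hz, le_rfl]
    by_cases hg : ∀ j, ∑ i, f j (z i) ≤ N * (m j + ε)
    · rw [if_pos hg]
      linarith [Finset.sum_nonneg fun j (_ : j ∈ (Finset.univ : Finset J)) => hn j]
    · rw [if_neg hg, zero_add]
      push Not at hg
      obtain ⟨j, hj⟩ := hg
      refine le_trans ?_ (Finset.single_le_sum (fun j _ => hn j) (Finset.mem_univ j))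
      rw [if_pos hj]
  have := Finset.sum_le_sum fun j (_ : j ∈ (Finset.univ : Finset J)) => hbad j
  linarith

/-- Products of sums over all tuples. -/
theorem ENNReal.tsum_pi_prod {V : Type u} (n : ℕ) (f : Fin n → V → ℝ≥0∞) :
    ∑' y : Fin n → V, ∏ i, f i (y i) = ∏ i, ∑' a, f i a := by
  induction n with
  | zero => simp
  | succ n ih =>
    rw [← (Fin.consEquiv (fun _ => V)).tsum_eq]
    simp only [Fin.consEquiv, Equiv.coe_fn_mk, Fin.prod_univ_succ, Fin.cons_zero, Fin.cons_succ]
    rw [ENNReal.tsum_prod' (f := fun c : V × (Fin n → V) => f 0 c.1 * ∏ i : Fin n, f i.succ (c.2 i))]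
    simp_rw [ENNReal.tsum_mul_left]
    rw [ENNReal.tsum_mul_right, ih]

namespace Kern
variable {V : Type u}

theorem tens_mul (n : ℕ) (K L : Kern V) :
    (tens K * tens L : Kern (Fin n → V)) = tens (K * L) := by
  funext x y
  rw [mul_apply]
  simp only [tens_apply, ← Finset.prod_mul_distrib]
  exact ENNReal.tsum_pi_prod n fun i a => K (x i) a * L a (y i)

theorem tens_one (n : ℕ) : (tens (1 : Kern V) : Kern (Fin n → V)) = 1 := by
  funext x y
  by_cases h : x = y
  · subst h; rw [one_self]; simp [tens_apply]
  · rw [one_of_ne h]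
    obtain ⟨i, hi⟩ := Function.ne_iff.1 h
    exact Finset.prod_eq_zero (Finset.mem_univ i) (one_of_ne hi)

theorem tens_pow (n : ℕ) (K : Kern V) (k : ℕ) :
    (tens K ^ k : Kern (Fin n → V)) = tens (K ^ k) := by
  induction k with
  | zero => rw [pow_zero, pow_zero, tens_one]
  | succ k ih => rw [pow_succ, ih, tens_mul, pow_succ]

end Kern

namespace Kern
variable {V : Type u} {A : Kern V} {D : ℕ}

/-- The weight of a trajectory from `v` to `w`. -/
noncomputable def wt (W : Kern V) (R : ℕ) (v w : V) (τ : Fin (R + 1) → V) : ℝ≥0∞ :=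
  (1 : Kern V) v (τ 0) * (∏ r : Fin R, W (τ r.castSucc) (τ r.succ)) * (1 : Kern V) (τ (Fin.last R)) w

theorem tsum_wt (W : Kern V) (R : ℕ) (v w : V) : ∑' τ, wt W R v w τ = (W ^ R) v w := by
  have := tsum_chain (fun _ => W) R v (fun y => (1 : Kern V) y w)
  rw [tsum_mul_one, prodK_const] at this
  exact this

theorem tsum_wt_mul (W : Kern V) {R : ℕ} (v w : V) (a k j : ℕ) (hR : R = a + (k + 1) + j)
    (g : V → V → ℝ≥0∞) :
    ∑' τ, wt W R v w τ * g (τ ⟨a, by omega⟩) (τ ⟨a + (k + 1), by omega⟩) =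
      ∑' x, ∑' y, (W ^ a) v x * ((W ^ (k + 1)) x y * g x y) * (W ^ j) y w := by
  subst hR
  have h1 : ∀ τ : Fin (a + (k + 1) + j + 1) → V, wt W _ v w τ *
      g (τ ⟨a, by omega⟩) (τ ⟨a + (k + 1), by omega⟩) = ∑' x, ∑' y, g x y * (wt W _ v w τ *
        ((1 : Kern V) (τ ⟨a, by omega⟩) x * (1 : Kern V) (τ ⟨a + (k + 1), by omega⟩) y)) := by
    intro τ
    have : ∀ x y, g x y * (wt W _ v w τ *
        ((1 : Kern V) (τ ⟨a, by omega⟩) x * (1 : Kern V) (τ ⟨a + (k + 1), by omega⟩) y)) =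
        (1 : Kern V) (τ ⟨a, by omega⟩) x * ((1 : Kern V) (τ ⟨a + (k + 1), by omega⟩) y *
          (wt W _ v w τ * g x y)) := fun x y => by ring
    simp_rw [this]
    simp_rw [ENNReal.tsum_mul_left, tsum_one_mul]
  simp_rw [h1]
  rw [ENNReal.tsum_comm]
  refine tsum_congr fun x => ?_
  rw [ENNReal.tsum_comm]
  refine tsum_congr fun y => ?_
  rw [ENNReal.tsum_mul_left]
  have := tsum_chain_two_point W a k j v w x y ⟨a, by omega⟩ ⟨a + (k + 1), by omega⟩ rfl rfl
  unfold wt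
  refine (congrArg (g x y * ·) this).trans ?_
  ring

theorem tsum_prodK_le {K : ℕ → Kern V} {c : ℕ → ℝ≥0∞} (h : ∀ r x, ∑' y, K r x y ≤ c r) (n : ℕ) (x : V) :
    ∑' y, prodK K n x y ≤ ∏ r ∈ Finset.range n, c r := by
  induction n with
  | zero =>
    have := tsum_one_mul x fun _ => (1 : ℝ≥0∞)
    simp only [mul_one] at this
    simp [prodK, this]
  | succ n ih =>
    rw [prodK]
    simp_rw [mul_apply]
    rw [ENNReal.tsum_comm, Finset.prod_range_succ]
    simp_rw [ENNReal.tsum_mul_left]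
    calc _ ≤ ∑' b, prodK K n x b * c n := by gcongr with b; exact h n b
      _ ≤ _ := by rw [ENNReal.tsum_mul_right]; gcongr

open Classical in
/-- The number of moves of a trajectory. -/
noncomputable def moves {R : ℕ} (τ : Fin (R + 1) → V) : ℕ :=
  (Finset.univ.filter fun s : Fin R => τ s.castSucc ≠ τ s.succ).card

open Classical in
/-- `2` to the number of moves of a trajectory if it moves in step `r`, and `0` otherwise. -/
noncomputable def moveWt {R : ℕ} (r : Fin R) (τ : Fin (R + 1) → V) : ℕ :=
  if τ r.castSucc ≠ τ r.succ then 2 ^ moves τ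
  else 0

theorem Tame.lazy_self (hA : A.Tame D) (c : ℝ≥0∞) (x : V) : lazy c A x x = 1 := by
  rw [lazy_apply, one_self, hA.diag, mul_zero, add_zero]

/-- The factor `2 ^ moves` is absorbed by doubling `c`, and the requirement of a move in step `r`
replaces one lazy factor by `2 c A`. What matters is that the bound is proportional to `c`, the
probability scale of a single step. -/
theorem Tame.tsum_wt_moveWt_le (hA : A.Tame D) (c : ℝ≥0∞) {R : ℕ} (v w : V) (r : Fin R) :
    ∑' τ, wt (lazy c A) R v w τ * moveWt r τ ≤ 2 * c * D * (1 + 2 * c * D) ^ R := by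
  classical
  let K : ℕ → Kern V := fun s => if s = r then scale (2 * c) A else lazy (2 * c) A
  have hterm : ∀ τ : Fin (R + 1) → V, wt (lazy c A) R v w τ * moveWt r τ ≤
      (1 : Kern V) v (τ 0) * (∏ s : Fin R, K s (τ s.castSucc) (τ s.succ)) * 1 := by
    intro τ
    by_cases hr : τ r.castSucc = τ r.succ
    · simp [moveWt, hr]
    · have h2 : (moveWt r τ : ℝ≥0∞) =
          ∏ s : Fin R, if τ s.castSucc ≠ τ s.succ then (2 : ℝ≥0∞) else 1 := by
        rw [moveWt, if_pos hr, moves, Finset.prod_ite, Finset.prod_const, Finset.prod_const_one, mul_one]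
        push_cast
        rfl
      have h3 : (∏ s : Fin R, lazy c A (τ s.castSucc) (τ s.succ)) * moveWt r τ ≤
          ∏ s : Fin R, K s (τ s.castSucc) (τ s.succ) := by
        rw [h2, ← Finset.prod_mul_distrib]
        refine Finset.prod_le_prod' fun s _ => ?_
        by_cases hs : τ s.castSucc = τ s.succ
        · have hsr : (s : ℕ) ≠ r := fun h => hr (by rw [← Fin.ext h]; exact hs)
          simp only [K, hsr, if_false]
          rw [if_neg (not_not.2 hs), hs, hA.lazy_self, hA.lazy_self, mul_one]
        · rw [if_pos hs, lazy_apply, one_of_ne hs, zero_add]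
          by_cases hsr : (s : ℕ) = r
          · simp only [K, hsr, if_true]
            rw [scale_apply]
            exact (by ring : _ = _).le
          · simp only [K, hsr, if_false]
            rw [lazy_apply, one_of_ne hs, zero_add]
            exact (by ring : _ = _).le
      rw [mul_one]
      calc wt (lazy c A) R v w τ * moveWt r τ
          ≤ (1 : Kern V) v (τ 0) * (∏ s : Fin R, lazy c A (τ s.castSucc) (τ s.succ)) * 1 *
            moveWt r τ := by
            unfold wt
            gcongr
            rw [one_apply]; split_ifs <;> simp
        _ = (1 : Kern V) v (τ 0) * ((∏ s : Fin R, lazy c A (τ s.castSucc) (τ s.succ)) *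
            moveWt r τ) := by ring
        _ ≤ _ := by gcongr
  refine (ENNReal.tsum_le_tsum hterm).trans ?_
  rw [tsum_chain K R v fun _ => 1]
  simp only [mul_one]
  refine (tsum_prodK_le (c := fun s => if s = r then 2 * c * D else 1 + 2 * c * D) ?_ R v).trans ?_
  · intro s x
    by_cases hs : s = r
    · simp only [K, hs, if_true]
      simp_rw [scale_apply]
      rw [ENNReal.tsum_mul_left]
      gcongr; exact hA.row_le x
    · simp only [K, hs, if_false]
      exact hA.lazy_row_le _ x
  · rw [← Finset.mul_prod_erase _ _ (Finset.mem_range.2 r.2), if_pos rfl,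
      Finset.prod_congr rfl (g := fun _ => 1 + 2 * c * D)
        (fun s hs => by rw [if_neg (Finset.ne_of_mem_erase hs)]), Finset.prod_const]
    gcongr
    · exact le_self_add
    · exact (Finset.card_erase_le).trans (by simp)

/-- A trajectory of positive weight with `m` moves has weight at least `c ^ m`. -/
theorem Tame.pow_card_le_prod (hA : A.Tame D) (c : ℝ≥0∞) {R : ℕ} {τ : Fin (R + 1) → V}
    (hτ : ∀ r : Fin R, lazy c A (τ r.castSucc) (τ r.succ) ≠ 0) (hc : c ≤ 1) (a k : ℕ) (hak : a + k ≤ R) :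
    c ^ moves τ ≤
      (lazy c A ^ k) (τ ⟨a, by omega⟩) (τ ⟨a + k, by omega⟩) := by
  classical
  have hstep : ∀ s : Fin R, (if τ s.castSucc ≠ τ s.succ then c else 1) ≤
      lazy c A (τ s.castSucc) (τ s.succ) := by
    intro s
    by_cases hs : τ s.castSucc = τ s.succ
    · rw [if_neg (not_not.2 hs), hs, hA.lazy_self]
    · have := hτ s
      rw [if_pos hs]
      rw [lazy_apply, one_of_ne hs, zero_add] at this ⊢
      rcases hA.eq_zero_or (τ s.castSucc) (τ s.succ) with h0 | h1
      · rw [h0] at this; simp at this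
      · exact le_mul_of_one_le_right' h1
  have H : ∀ k, (hak : a + k ≤ R) → ∏ s ∈ Finset.univ.filter (fun s : Fin R => a ≤ (s : ℕ) ∧ (s : ℕ) < a + k),
      (if τ s.castSucc ≠ τ s.succ then c else 1) ≤
      (lazy c A ^ k) (τ ⟨a, by omega⟩) (τ ⟨a + k, by omega⟩) := by
    intro k
    induction k with
    | zero =>
      intro _
      rw [pow_zero]
      refine le_trans ?_ (one_self _).ge
      rw [Finset.prod_eq_one]
      intro s hs
      simp only [Finset.mem_filter] at hs
      omega
    | succ k ih =>
      intro hak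
      have hs : Finset.univ.filter (fun s : Fin R => a ≤ (s : ℕ) ∧ (s : ℕ) < a + (k + 1)) =
          insert (⟨a + k, by omega⟩ : Fin R)
            (Finset.univ.filter fun s : Fin R => a ≤ (s : ℕ) ∧ (s : ℕ) < a + k) := by
        ext s
        simp only [Finset.mem_filter, Finset.mem_univ, true_and, Finset.mem_insert, Fin.ext_iff]
        omega
      rw [hs, Finset.prod_insert (by simp), mul_comm, pow_succ]
      refine (mul_le_mul' (ih (by omega)) (hstep _)).trans ?_
      exact mul_le_mul_apply _ _ _ _ _
  refine le_trans ?_ (H k hak)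
  rw [moves, ← Finset.prod_const, Finset.prod_filter, Finset.prod_filter]
  refine Finset.prod_le_prod' fun s _ => ?_
  split_ifs <;> first | exact le_rfl | exact hc

end Kern

namespace Kern
variable {V : Type u} {A : Kern V} {D : ℕ}

theorem mul_lg_le {C : ℝ} (hC : 0 < C) {x : ℝ≥0∞} (hx : x ≠ ∞) : x * lg C x ≤ ENNReal.ofReal C := by
  by_cases h0 : x = 0
  · simp [h0]
  have hpos : 0 < x.toReal := ENNReal.toReal_pos h0 hx
  rw [lg]
  conv_lhs => rw [← ENNReal.ofReal_toReal hx]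
  rw [ENNReal.toReal_ofReal hpos.le, ← ENNReal.ofReal_mul hpos.le]
  apply ENNReal.ofReal_le_ofReal
  have := Real.log_le_sub_one_of_pos (show 0 < C / x.toReal by positivity)
  calc _ ≤ x.toReal * (C / x.toReal - 1) := by gcongr
    _ = C - x.toReal := by field_simp
    _ ≤ C := by linarith

theorem Tame.psi_ne_top (hA : A.Tame D) {c : ℝ≥0∞} (hc : c ≠ ∞) {C : ℝ} (hC : 0 < C) (v w : V)
    (k j : ℕ) : psi C (lazy c A) v w k j ≠ ∞ := by
  refine ne_top_of_le_ne_top (b := ENNReal.ofReal C * (1 + c * D) ^ j) (by finiteness) ?_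
  rw [psi]
  calc _ ≤ ∑' y, ENNReal.ofReal C * (lazy c A ^ j) y w := by
        gcongr with y; exact mul_lg_le hC (hA.pow_ne_top hc k v y)
    _ ≤ _ := by rw [ENNReal.tsum_mul_left]; gcongr; exact hA.col_pow_le c j w

theorem psi_zero_left (C : ℝ) (W : Kern V) (v w : V) (j : ℕ) :
    psi C W v w 0 j = ENNReal.ofReal (Real.log C) * (W ^ j) v w := by
  rw [psi, tsum_eq_single v]
  · rw [pow_zero, one_self, one_mul, lg]; simp
  · intro y hy; rw [pow_zero, one_of_ne hy.symm]; simp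

theorem psi_zero_right (C : ℝ) (W : Kern V) (v w : V) (k : ℕ) :
    psi C W v w k 0 = (W ^ k) v w * lg C ((W ^ k) v w) := by
  rw [psi, pow_zero, tsum_mul_one]

/-- Divided by `Z`, the sequence in `k` is concave, starts at `log C`, ends at `log C - log Z`, and
is at least `log C` in the middle. Compare with the chord over the first half for `k ≤ h`, and with
the chord over the whole range otherwise. -/
theorem Reversible.psi_ge (hrev : A.Reversible) (hA : A.Tame D) {c : ℝ≥0∞} (hc : c ≠ ∞) {C : ℝ}
    {v w : V} {h : ℕ} (hh : 0 < h)
    (hC : ∀ i ≤ 2 * h, ∀ x y, (lazy c A ^ i) x y ≤ ENNReal.ofReal C) (hC1 : 1 ≤ C)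
    (hZ : 1 ≤ (lazy c A ^ (2 * h)) v w)
    (hhalf : (lazy c A ^ (2 * h)) v w * ENNReal.ofReal (Real.log C) ≤ psi C (lazy c A) v w h h)
    {k : ℕ} (hk : k ≤ 2 * h) :
    ((lazy c A ^ (2 * h)) v w).toReal * (Real.log C -
        if k ≤ h then 0 else k / (2 * h : ℝ) * Real.log ((lazy c A ^ (2 * h)) v w).toReal) ≤
      (psi C (lazy c A) v w k (2 * h - k)).toReal := by
  set W := lazy c A with hW
  set Z := (W ^ (2 * h)) v w with hZd
  have hZt : Z ≠ ∞ := hA.pow_ne_top hc _ _ _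
  have hZ1 : 1 ≤ Z.toReal := by rw [← ENNReal.toReal_one]; exact ENNReal.toReal_mono hZt hZ
  have hCp : 0 < C := by linarith
  have hZC : Z.toReal ≤ C := ENNReal.toReal_le_of_le_ofReal hCp.le (hC _ le_rfl v w)
  have hlC : 0 ≤ Real.log C := Real.log_nonneg hC1
  let f : ℕ → ℝ := fun k => (psi C W v w k (2 * h - k)).toReal
  have hconc : ∀ k, k + 2 ≤ 2 * h → f (k + 2) + f k ≤ 2 * f (k + 1) := by
    intro k hk
    have := hrev.psi_concave c C v w k (2 * h - k - 2) (fun i hi => hC i (by omega))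
      (hA.pow_ne_top hc _ _ _)
    have h2 := ENNReal.toReal_mono (by
      exact ENNReal.mul_ne_top (by simp) (hA.psi_ne_top hc hCp v w _ _)) this
    rw [ENNReal.toReal_add (hA.psi_ne_top hc hCp v w _ _) (hA.psi_ne_top hc hCp v w _ _),
      ENNReal.toReal_mul] at h2
    simp only [f]
    rw [show 2 * h - (k + 2) = 2 * h - k - 2 by omega, show 2 * h - (k + 1) = 2 * h - k - 2 + 1 by omega,
      show (psi C W v w k (2 * h - k)) = psi C W v w k (2 * h - k - 2 + 2) by congr 1; omega]
    simpa using h2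
  have hf0 : f 0 = Z.toReal * Real.log C := by
    simp only [f, Nat.sub_zero]
    rw [psi_zero_left, ENNReal.toReal_mul, ENNReal.toReal_ofReal hlC, mul_comm]
  have hfR : f (2 * h) = Z.toReal * (Real.log C - Real.log Z.toReal) := by
    simp only [f, Nat.sub_self]
    rw [psi_zero_right, ENNReal.toReal_mul, lg, Real.log_div (by linarith) (by linarith),
      ENNReal.toReal_ofReal]
    have := Real.log_le_log (by linarith) hZC
    linarith
  have hfh : Z.toReal * Real.log C ≤ f h := by
    have := ENNReal.toReal_mono (hA.psi_ne_top hc hCp v w _ _) hhalf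
    rw [ENNReal.toReal_mul, ENNReal.toReal_ofReal hlC] at this
    simp only [f]
    rwa [show 2 * h - h = h by omega]
  change _ ≤ f k
  have hhr : (0 : ℝ) < h := by exact_mod_cast hh
  split_ifs with hkh
  · have := chord_le_of_concave (N := h) (fun k hk => hconc k (by omega)) hkh
    rw [hf0] at this
    have hkr : (k : ℝ) ≤ h := by exact_mod_cast hkh
    have h3 : (k : ℝ) * (Z.toReal * Real.log C) ≤ k * f h := by gcongr
    have : (h : ℝ) * (Z.toReal * Real.log C) ≤ h * f k := by linarith
    rw [sub_zero]
    exact le_of_mul_le_mul_left this hhr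
  · have := chord_le_of_concave (N := 2 * h) hconc hk
    rw [hf0, hfR] at this
    push_cast at this
    have h2 : (0 : ℝ) < 2 * h := by positivity
    refine le_of_mul_le_mul_left (le_trans (le_of_eq ?_) this) h2
    field_simp
    ring

/-- Each trajectory of positive weight has weight at least `c ^ R`, and the total weight is finite.
-/
theorem finite_wt_support (hA : A.Tame D) {c : ℝ≥0∞} (hc : c ≠ ∞) (hc0 : c ≠ 0) (hc1 : c ≤ 1) (R : ℕ)
    (v w : V) : {τ | wt (lazy c A) R v w τ ≠ 0}.Finite := by
  have hsum : ∑' τ, wt (lazy c A) R v w τ ≠ ∞ := by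
    rw [tsum_wt]; exact hA.pow_ne_top hc _ _ _
  refine (ENNReal.finite_const_le_of_tsum_ne_top hsum (pow_ne_zero R hc0)).subset ?_
  intro τ hτ
  have hτ : wt (lazy c A) R v w τ ≠ 0 := hτ
  have h1 := left_ne_zero_of_mul hτ
  have h2 := right_ne_zero_of_mul h1
  have h3 : (1 : Kern V) v (τ 0) = 1 := by
    have := left_ne_zero_of_mul h1
    rw [one_apply] at this ⊢
    split_ifs at this ⊢ <;> simp_all
  have h4 : (1 : Kern V) (τ (Fin.last R)) w = 1 := by
    have := right_ne_zero_of_mul hτ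
    rw [one_apply] at this ⊢
    split_ifs at this ⊢ <;> simp_all
  change c ^ R ≤ wt (lazy c A) R v w τ
  rw [wt, h3, h4, one_mul, mul_one]
  calc c ^ R = ∏ _r : Fin R, c := by simp
    _ ≤ _ := by
      refine Finset.prod_le_prod' fun r _ => ?_
      have hr := Finset.prod_ne_zero_iff.1 h2 r (Finset.mem_univ r)
      rw [lazy_apply] at hr ⊢
      by_cases hs : τ r.castSucc = τ r.succ
      · rw [hs, one_self]; exact hc1.trans le_self_add
      · rw [one_of_ne hs, zero_add] at hr ⊢
        rcases hA.eq_zero_or (τ r.castSucc) (τ r.succ) with h0 | h1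
        · rw [h0] at hr; simp at hr
        · exact le_mul_of_one_le_right' h1

theorem wt_ne_zero {W : Kern V} {R : ℕ} {v w : V} {τ : Fin (R + 1) → V} (h : wt W R v w τ ≠ 0) :
    τ 0 = v ∧ τ (Fin.last R) = w ∧ (∀ r : Fin R, W (τ r.castSucc) (τ r.succ) ≠ 0) ∧
      wt W R v w τ = ∏ r : Fin R, W (τ r.castSucc) (τ r.succ) := by
  have h1 := left_ne_zero_of_mul h
  have h2 : τ 0 = v := by
    by_contra hne
    exact left_ne_zero_of_mul h1 (one_of_ne (Ne.symm hne))
  have h3 : τ (Fin.last R) = w := by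
    by_contra hne
    exact right_ne_zero_of_mul h (one_of_ne hne)
  refine ⟨h2, h3, fun r => Finset.prod_ne_zero_iff.1 (right_ne_zero_of_mul h1) r (Finset.mem_univ r), ?_⟩
  rw [wt, h2, h3, one_self, one_self, one_mul, mul_one]

/-- Averages with respect to the bridge law as finite sums. -/
theorem sum_wt_mul_toReal {W : Kern V} {R : ℕ} {v w : V} (hW : (W ^ R) v w ≠ ∞)
    (Θ : Finset (Fin (R + 1) → V)) (hΘ : ∀ τ, τ ∈ Θ ↔ wt W R v w τ ≠ 0)
    (g : (Fin (R + 1) → V) → ℝ≥0∞) (hg : ∀ τ, g τ ≠ ∞) :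
    ∑ τ ∈ Θ, (wt W R v w τ).toReal * (g τ).toReal = (∑' τ, wt W R v w τ * g τ).toReal := by
  have hwt : ∀ τ, wt W R v w τ ≠ ∞ := fun τ =>
    ne_top_of_le_ne_top hW ((ENNReal.le_tsum τ).trans_eq (tsum_wt W R v w))
  rw [tsum_eq_sum (s := Θ), ENNReal.toReal_sum]
  · simp_rw [ENNReal.toReal_mul]
  · intro τ _; exact ENNReal.mul_ne_top (hwt τ) (hg τ)
  · intro τ hτ
    have : wt W R v w τ = 0 := by
      by_contra h; exact hτ ((hΘ τ).2 h)
    rw [this, zero_mul]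

end Kern

namespace Kern
variable {V : Type u} {A : Kern V} {D : ℕ}

theorem eq_ofReal_exp_lg {C : ℝ} (hC : 0 < C) {x : ℝ≥0∞} (hx0 : x ≠ 0) (hx : x ≤ ENNReal.ofReal C) :
    x = ENNReal.ofReal (Real.exp (Real.log C - (lg C x).toReal)) := by
  have hxt : x ≠ ∞ := ne_top_of_le_ne_top ENNReal.ofReal_ne_top hx
  have hpos := ENNReal.toReal_pos hx0 hxt
  have hle : x.toReal ≤ C := ENNReal.toReal_le_of_le_ofReal hC.le hx
  have h1 : Real.log (C / x.toReal) = Real.log C - Real.log x.toReal := Real.log_div hC.ne' hpos.ne'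
  have h2 := Real.log_le_log hpos hle
  rw [lg, h1, ENNReal.toReal_ofReal (by linarith), sub_sub_cancel, Real.exp_log hpos,
    ENNReal.ofReal_toReal hxt]

theorem one_le_moveWt {R : ℕ} {r : Fin R} {τ : Fin (R + 1) → V} (h : τ r.castSucc ≠ τ r.succ) :
    moves τ + 1 ≤ moveWt r τ := by
  rw [moveWt, if_pos h]
  exact Nat.lt_two_pow_self

/-- One coordinate of the comparison of a perturbed pair with a trajectory. -/
theorem Tame.pow_box_le (hA : A.Tame D) {θ : ℝ≥0} (hθ0 : θ ≠ 0) (hθ1 : θ ≤ 1) {R : ℕ} {C : ℝ}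
    (hC1 : 1 ≤ C) (hC : ∀ i ≤ R, ∀ x y, (lazy θ A ^ i) x y ≤ ENNReal.ofReal C)
    {τ : Fin (R + 1) → V} (hτ : ∀ r : Fin R, lazy θ A (τ r.castSucc) (τ r.succ) ≠ 0)
    {r r' : Fin R} {k : ℕ} (hk : (r : ℕ) + k = r') {a b : V}
    (ha : a = τ r.castSucc ∨ a = τ r.succ) (hb : b = τ r'.castSucc ∨ b = τ r'.succ) :
    (lazy θ A ^ (k + 1)) a b ≤ ENNReal.ofReal (Real.exp (Real.log C -
      (lg C ((lazy θ A ^ (k + 1)) (τ ⟨r, by omega⟩) (τ ⟨r + (k + 1), by omega⟩))).toReal +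
        (Real.log C - Real.log θ) * (moveWt r τ + moveWt r' τ))) := by
  have hr' := r'.2
  set x := (lazy θ A ^ (k + 1)) (τ ⟨r, by omega⟩) (τ ⟨r + (k + 1), by omega⟩) with hx
  have hlC := Real.log_nonneg hC1
  have hθr : (0 : ℝ) < θ := by positivity
  have hlθ : Real.log θ ≤ 0 := Real.log_nonpos hθr.le (by exact_mod_cast hθ1)
  have hlow := hA.pow_card_le_prod θ hτ (by exact_mod_cast hθ1) r (k + 1) (by omega)
  rw [← hx] at hlow
  have hx0 : x ≠ 0 := fun h0 => by
    rw [h0] at hlow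
    exact pow_ne_zero _ (by exact_mod_cast hθ0) (le_antisymm hlow (by simp))
  have hxe := eq_ofReal_exp_lg (by linarith : 0 < C) hx0 (hC _ (by omega) _ _)
  rw [Real.exp_add, ENNReal.ofReal_mul (Real.exp_pos _).le, ← hxe]
  -- If the coordinate rests in both boundary steps, `a` and `b` are the points of the trajectory
  -- itself. Otherwise the entry is bounded by `C`, while the entry of the trajectory is at least `θ
  -- ^ moves`; the ratio is paid by `moveWt`, which exceeds the number of moves.
  by_cases hm : τ r.castSucc = τ r.succ ∧ τ r'.castSucc = τ r'.succ
  · have ea : a = τ ⟨r, by omega⟩ := by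
      rcases ha with h | h
      · exact h
      · rw [h, ← hm.1]; rfl
    have eb : b = τ ⟨r + (k + 1), by omega⟩ := by
      have : (⟨r + (k + 1), by omega⟩ : Fin (R + 1)) = r'.succ := Fin.ext (by simp; omega)
      rw [this]
      rcases hb with h | h
      · rw [h, hm.2]
      · exact h
    rw [ea, eb, ← hx]
    refine le_mul_of_one_le_right' ?_
    rw [← ENNReal.ofReal_one]
    apply ENNReal.ofReal_le_ofReal
    apply Real.one_le_exp
    have : 0 ≤ Real.log C - Real.log θ := by linarith
    positivity
  · have hmw : (moves τ : ℝ) + 1 ≤ moveWt r τ + moveWt r' τ := by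
      have : moves τ + 1 ≤ moveWt r τ + moveWt r' τ := by
        by_cases h1 : τ r.castSucc = τ r.succ
        · have := one_le_moveWt (r := r') (τ := τ) fun h2 => hm ⟨h1, h2⟩
          omega
        · have := one_le_moveWt (r := r) (τ := τ) h1
          omega
      exact_mod_cast this
    calc _ ≤ ENNReal.ofReal C := hC _ (by omega) _ _
      _ = (θ : ℝ≥0∞) ^ moves τ * ENNReal.ofReal (C * (θ : ℝ)⁻¹ ^ moves τ) := by
          rw [← ENNReal.ofReal_coe_nnreal, ← ENNReal.ofReal_pow hθr.le,
            ← ENNReal.ofReal_mul (by positivity)]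
          congr 1
          rw [mul_left_comm, ← mul_pow, mul_inv_cancel₀ hθr.ne', one_pow, mul_one]
      _ ≤ _ := by
          gcongr
          rw [← Real.log_le_iff_le_exp (by positivity), Real.log_mul (by positivity) (by positivity),
            Real.log_pow, Real.log_inv]
          have h3 : 0 ≤ Real.log C - Real.log θ := by linarith
          have h4 := mul_le_mul_of_nonneg_left hmw h3
          have h5 : 0 ≤ (moves τ : ℝ) * Real.log C := by positivity
          nlinarith

/-- Typical trajectories. -/
theorem exists_typical (hA : A.Tame D) (hrev : A.Reversible) {θ : ℝ≥0} (hθ0 : θ ≠ 0) (hθ1 : θ ≤ 1)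
    {h : ℕ} (hh : 0 < h) {v w : V} {C g₁ : ℝ} (hC1 : 1 ≤ C)
    (hC : ∀ i ≤ 2 * h, ∀ x y, (lazy θ A ^ i) x y ≤ ENNReal.ofReal C)
    (hg : 2 * θ * D * (1 + 2 * θ * D : ℝ) ^ (2 * h) ≤ g₁)
    (hZ : 1 ≤ (lazy θ A ^ (2 * h)) v w)
    (hhalf : (lazy θ A ^ (2 * h)) v w * ENNReal.ofReal (Real.log C) ≤ psi C (lazy θ A) v w h h)
    {ε : ℝ} (hε : 0 < ε) :
    ∃ N₀ : ℕ, ∀ N ≥ N₀, ∃ 𝒞 : Finset (Fin (2 * h + 1) → Fin N → V),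
      (∀ z ∈ 𝒞, z 0 = fun _ => v) ∧ (∀ z ∈ 𝒞, z (Fin.last _) = fun _ => w) ∧
      (∀ z ∈ 𝒞, ∀ (r : Fin (2 * h)) i, lazy θ A (z r.castSucc i) (z r.succ i) ≠ 0) ∧
      ((lazy θ A ^ (2 * h)) v w) ^ N ≤ 2 * ∑ z ∈ 𝒞, ∏ r : Fin (2 * h),
        tens (lazy θ A) (z r.castSucc) (z r.succ) ∧
      (∀ z ∈ 𝒞, ∀ r : Fin (2 * h), ((MixedGraph.moved (z r.castSucc) (z r.succ)).card : ℝ) ≤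
        N * (g₁ + ε)) ∧
      ∀ z ∈ 𝒞, ∀ (r r' : Fin (2 * h)) (k : ℕ), (r : ℕ) + k = r' →
        ∀ a ∈ MixedGraph.Box (z r.castSucc) (z r.succ),
        ∀ b ∈ MixedGraph.Box (z r'.castSucc) (z r'.succ),
        tens (lazy θ A ^ (k + 1)) a b ≤ ENNReal.ofReal (Real.exp (N * (
          (if k + 1 ≤ h then 0 else (k + 1) / (2 * h : ℝ) *
            Real.log ((lazy θ A ^ (2 * h)) v w).toReal) +
          (ε + (Real.log C - Real.log θ) * (2 * (g₁ + ε)))))) := by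
  classical
  set W := lazy (θ : ℝ≥0∞) A with hW
  set Z := (W ^ (2 * h)) v w with hZd
  have hθt : (θ : ℝ≥0∞) ≠ ∞ := ENNReal.coe_ne_top
  have hθr : (0 : ℝ) < θ := by positivity
  have hlC := Real.log_nonneg hC1
  have hlθ : Real.log θ ≤ 0 := Real.log_nonpos hθr.le (by exact_mod_cast hθ1)
  have hZt : Z ≠ ∞ := hA.pow_ne_top hθt _ _ _
  have hZ1 : 1 ≤ Z.toReal := by rw [← ENNReal.toReal_one]; exact ENNReal.toReal_mono hZt hZ
  have hZ0 : 0 < Z.toReal := by linarith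
  have hfin := finite_wt_support hA hθt (by exact_mod_cast hθ0) (by exact_mod_cast hθ1) (2 * h) v w
  set Θ := hfin.toFinset with hΘd
  have hΘ : ∀ τ, τ ∈ Θ ↔ wt W (2 * h) v w τ ≠ 0 := fun τ => by rw [hΘd, Set.Finite.mem_toFinset]; rfl
  have havg := fun g hg => sum_wt_mul_toReal (W := W) hZt Θ hΘ g hg
  let p : (Fin (2 * h + 1) → V) → ℝ := fun τ => (wt W (2 * h) v w τ).toReal / Z.toReal
  have hp : ∀ τ ∈ Θ, 0 ≤ p τ := fun τ _ => by positivity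
  have hsum : ∑ τ ∈ Θ, p τ = 1 := by
    have := havg (fun _ => 1) (by simp)
    simp only [ENNReal.toReal_one, mul_one] at this
    rw [tsum_wt] at this
    rw [← Finset.sum_div, this, div_self hZ0.ne']
  let lam : ℕ → ℝ := fun k => if k + 1 ≤ h then 0 else (k + 1) / (2 * h : ℝ) * Real.log Z.toReal
  let L : ℕ → ℕ → (Fin (2 * h + 1) → V) → ℝ≥0∞ := fun a k τ =>
    if hak : a + (k + 1) ≤ 2 * h then
      lg C ((W ^ (k + 1)) (τ ⟨a, by omega⟩) (τ ⟨a + (k + 1), by omega⟩)) else 0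
  have hLt : ∀ a k τ, L a k τ ≠ ∞ := by
    intro a k τ
    simp only [L]
    split_ifs
    · exact ENNReal.ofReal_ne_top
    · simp
  -- The quantities to be averaged over the coordinates: for each window the logarithm of `W^(k+1)`
  -- between its ends, up to the constant `log C`, and for each step the move weight.
  let f : (Fin (2 * h) × Fin (2 * h)) ⊕ Fin (2 * h) → (Fin (2 * h + 1) → V) → ℝ := fun j τ =>
    match j with
    | .inl (a, k) => -(L a k τ).toReal
    | .inr r => moveWt r τ
  let m : (Fin (2 * h) × Fin (2 * h)) ⊕ Fin (2 * h) → ℝ := fun j =>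
    match j with
    | .inl (a, k) => if (a : ℕ) + (k + 1) ≤ 2 * h then lam k - Real.log C else 0
    | .inr _ => g₁
  have hm : ∀ j, ∑ τ ∈ Θ, p τ * f j τ ≤ m j := by
    rintro (⟨a, k⟩ | r)
    · have h1 : ∑ τ ∈ Θ, p τ * f (.inl (a, k)) τ =
          -((∑' τ, wt W (2 * h) v w τ * L a k τ).toReal / Z.toReal) := by
        rw [← havg _ (hLt a k), Finset.sum_div, ← Finset.sum_neg_distrib]
        refine Finset.sum_congr rfl fun τ _ => ?_
        simp only [p, f]; ring
      rw [h1]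
      simp only [m]
      by_cases hak : (a : ℕ) + (k + 1) ≤ 2 * h
      · rw [if_pos hak]
        obtain ⟨j, hj⟩ := Nat.exists_eq_add_of_le hak
        have h2 : ∑' τ, wt W (2 * h) v w τ * L a k τ = psi C W v w (k + 1) (a + j) := by
          rw [← hrev.psi_shift θ C v w a (k + 1) j]
          have := tsum_wt_mul W v w (a : ℕ) k j hj (fun x y => lg C ((W ^ ((k : ℕ) + 1)) x y))
          rw [← this]
          refine tsum_congr fun τ => ?_
          simp only [L, hak, dite_true]
        rw [h2]
        have h3 := hrev.psi_ge hA hθt hh hC hC1 hZ hhalf (k := k + 1) (by omega)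
        rw [show 2 * h - ((k : ℕ) + 1) = a + j by omega] at h3
        have h4 : Real.log C - lam k ≤ (psi C W v w (k + 1) (a + j)).toReal / Z.toReal := by
          rw [le_div_iff₀ hZ0, mul_comm]
          have h5 : lam k = if (k : ℕ) + 1 ≤ h then 0 else
              (((k : ℕ) + 1 : ℕ) : ℝ) / (2 * h) * Real.log Z.toReal := by
            push_cast; rfl
          rw [h5]
          exact h3
        linarith
      · rw [if_neg hak]
        have h0 : ∀ τ, L a k τ = 0 := fun τ => by simp only [L]; exact dif_neg hak
        simp [h0]
    · have h1 : ∑ τ ∈ Θ, p τ * f (.inr r) τ =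
          (∑' τ, wt W (2 * h) v w τ * (moveWt r τ : ℝ≥0∞)).toReal / Z.toReal := by
        rw [← havg (fun τ => (moveWt r τ : ℝ≥0∞)) (fun τ => by simp), Finset.sum_div]
        refine Finset.sum_congr rfl fun τ _ => ?_
        simp only [p, f, ENNReal.toReal_natCast]; ring
      rw [h1]
      have h2 := ENNReal.toReal_mono (by finiteness) (hA.tsum_wt_moveWt_le θ v w r)
      have h3 : ((2 * (θ : ℝ≥0∞) * D * (1 + 2 * θ * D) ^ (2 * h))).toReal =
          2 * θ * D * (1 + 2 * θ * D : ℝ) ^ (2 * h) := by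
        rw [ENNReal.toReal_mul, ENNReal.toReal_pow, ENNReal.toReal_add (by simp) (by finiteness)]
        simp
      rw [h3] at h2
      refine (div_le_self ENNReal.toReal_nonneg hZ1).trans (h2.trans hg)
  -- The coordinates of a chain act as `N` independent samples of the bridge law, and at least half
  -- of the total mass `Z ^ N` is carried by chains with good averages.
  obtain ⟨N₀, hN₀⟩ := exists_half_le_sum_prod Θ p hp hsum f m hm hε
  refine ⟨N₀, fun N hN => ?_⟩
  have hN := hN₀ N hN
  set P := (Fintype.piFinset fun _ : Fin N => Θ).filter
    (fun z => ∀ j, ∑ i, f j (z i) ≤ N * (m j + ε)) with hP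
  let sw : (Fin N → Fin (2 * h + 1) → V) → (Fin (2 * h + 1) → Fin N → V) := fun z r i => z i r
  have hswinj : Function.Injective sw := fun z z' hz => by
    funext i r; exact congrFun (congrFun hz r) i
  have hmem : ∀ z ∈ P, (∀ i, wt W (2 * h) v w (z i) ≠ 0) ∧ ∀ j, ∑ i, f j (z i) ≤ N * (m j + ε) := by
    intro z hz
    obtain ⟨h1, h2⟩ := Finset.mem_filter.1 hz
    exact ⟨fun i => (hΘ _).1 (Fintype.mem_piFinset.1 h1 i), h2⟩
  refine ⟨P.image sw, ?_, ?_, ?_, ?_, ?_, ?_⟩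
  · intro z hz
    obtain ⟨z, hz', rfl⟩ := Finset.mem_image.1 hz
    funext i
    exact (wt_ne_zero ((hmem z hz').1 i)).1
  · intro z hz
    obtain ⟨z, hz', rfl⟩ := Finset.mem_image.1 hz
    funext i
    exact (wt_ne_zero ((hmem z hz').1 i)).2.1
  · intro z hz
    obtain ⟨z, hz', rfl⟩ := Finset.mem_image.1 hz
    intro r i
    exact (wt_ne_zero ((hmem z hz').1 i)).2.2.1 r
  · rw [Finset.sum_image (fun _ _ _ _ h => hswinj h)]
    have h1 : ∀ z ∈ P, ∏ r : Fin (2 * h), tens W (sw z r.castSucc) (sw z r.succ) =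
        Z ^ N * ENNReal.ofReal (∏ i, p (z i)) := by
      intro z hz
      simp only [tens_apply, sw]
      rw [Finset.prod_comm, ENNReal.ofReal_prod_of_nonneg (fun i _ => by positivity)]
      have : Z ^ N = ∏ _i : Fin N, Z := by simp
      rw [this, ← Finset.prod_mul_distrib]
      refine Finset.prod_congr rfl fun i _ => ?_
      rw [← (wt_ne_zero ((hmem z hz).1 i)).2.2.2]
      simp only [p]
      have hwt : wt W (2 * h) v w (z i) ≠ ∞ :=
        ne_top_of_le_ne_top hZt ((ENNReal.le_tsum (z i)).trans_eq (tsum_wt W (2 * h) v w))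
      rw [ENNReal.ofReal_div_of_pos hZ0, ENNReal.ofReal_toReal hwt, ENNReal.ofReal_toReal hZt,
        ENNReal.mul_div_cancel (by intro h0; rw [h0] at hZ; simp at hZ) hZt]
    rw [Finset.sum_congr rfl h1, ← Finset.mul_sum, ← ENNReal.ofReal_sum_of_nonneg
      (fun z _ => Finset.prod_nonneg fun i _ => by positivity), ← mul_assoc, mul_comm 2, mul_assoc]
    have h2 : (1 : ℝ≥0∞) ≤ 2 * ENNReal.ofReal (∑ z ∈ P, ∏ i, p (z i)) := by
      calc (1 : ℝ≥0∞) = 2 * ENNReal.ofReal (1 / 2) := by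
            rw [show (2 : ℝ≥0∞) = ENNReal.ofReal 2 by simp, ← ENNReal.ofReal_mul (by norm_num)]
            simp
        _ ≤ _ := by gcongr
    exact le_mul_of_one_le_right' h2
  · intro z hz r
    obtain ⟨z, hz', rfl⟩ := Finset.mem_image.1 hz
    have h1 := (hmem z hz').2 (.inr r)
    simp only [f, m] at h1
    refine le_trans ?_ h1
    rw [Finset.card_eq_sum_ones, Nat.cast_sum]
    refine le_trans ?_ (Finset.sum_le_sum_of_subset_of_nonneg (Finset.subset_univ
      (MixedGraph.moved (sw z r.castSucc) (sw z r.succ))) fun _ _ _ => by positivity)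
    refine Finset.sum_le_sum fun i hi => ?_
    have := one_le_moveWt (MixedGraph.mem_moved.1 hi : z i r.castSucc ≠ z i r.succ)
    exact_mod_cast (by omega : 1 ≤ moveWt r (z i))
  · intro z hz r r' k hk a ha b hb
    obtain ⟨z, hz', rfl⟩ := Finset.mem_image.1 hz
    have hr' := r'.2
    rw [tens_apply]
    refine (Finset.prod_le_prod' fun i _ => hA.pow_box_le hθ0 hθ1 hC1 hC
      (wt_ne_zero ((hmem z hz').1 i)).2.2.1 hk (ha i) (hb i)).trans ?_
    rw [← ENNReal.ofReal_prod_of_nonneg (fun _ _ => (Real.exp_pos _).le), ← Real.exp_sum]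
    apply ENNReal.ofReal_le_ofReal
    apply Real.exp_le_exp.2
    have h1 := (hmem z hz').2 (.inl (r, ⟨k, by omega⟩))
    have h2 := (hmem z hz').2 (.inr r)
    have h3 := (hmem z hz').2 (.inr r')
    have hak : (r : ℕ) + (k + 1) ≤ 2 * h := by omega
    simp only [f, m, L, hak, if_true, dite_true, lam] at h1 h2 h3
    rw [Finset.sum_neg_distrib] at h1
    rw [Finset.sum_add_distrib, Finset.sum_sub_distrib, ← Finset.mul_sum, Finset.sum_add_distrib]
    simp only [Finset.sum_const, Finset.card_univ, Fintype.card_fin, nsmul_eq_mul]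
    have h4 : (Real.log C - Real.log θ) * (∑ i, (moveWt r (z i) : ℝ) + ∑ i, (moveWt r' (z i) : ℝ)) ≤
        (Real.log C - Real.log θ) * (N * (g₁ + ε) + N * (g₁ + ε)) :=
      mul_le_mul_of_nonneg_left (add_le_add h2 h3) (by linarith)
    nlinarith

end Kern

/-! ### Concatenation of paths, and transitions of auxiliary coordinates along a fixed path of the
graph. -/

namespace MixedGraph
variable {V : Type u} {E : Type v} {G : MixedGraph V E}

/-- Concatenation of paths. -/
def Path.append : {x y z : V} → G.Path x y → G.Path y z → G.Path x z
  | _, _, _, .nil _, γ => γ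
  | _, _, _, .cons e h γ', γ => .cons e h (γ'.append γ)

theorem Path.time_append (τ : E → ℝ≥0) {x y z : V} (γ : G.Path x y) (γ' : G.Path y z) :
    (γ.append γ').time τ = γ.time τ + γ'.time τ := by
  induction γ with
  | nil => simp [Path.append, Path.time]
  | cons e h γ ih => simp [Path.append, Path.time, ih, add_assoc]

theorem passageTime_triangle (τ : E → ℝ≥0) (x y z : V) :
    G.passageTime τ x z ≤ G.passageTime τ x y + G.passageTime τ y z := by
  unfold passageTime
  refine ENNReal.le_iInf_add_iInf fun γ γ' => ?_
  rw [← Path.time_append]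
  exact iInf_le _ _

theorem passageTime_self (τ : E → ℝ≥0) (x : V) : G.passageTime τ x x = 0 :=
  le_antisymm (iInf_le _ (Path.nil x)) bot_le

theorem passageTime_chain (τ : E → ℝ≥0) (X : ℕ → V) (δ : ℕ → ℝ≥0∞) (K : ℕ)
    (h : ∀ i < K, G.passageTime τ (X i) (X (i + 1)) ≤ δ i) :
    G.passageTime τ (X 0) (X K) ≤ ∑ i ∈ Finset.range K, δ i := by
  induction K with
  | zero => simp [passageTime_self]
  | succ K ih =>
    rw [Finset.sum_range_succ]
    exact (passageTime_triangle τ _ (X K) _).trans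
      (add_le_add (ih fun i hi => h i (by omega)) (h K (by omega)))

theorem passageTime_le_of_joins (τ : E → ℝ≥0) {e : E} {x y : V} (h : G.Joins e x y) :
    G.passageTime τ x y ≤ τ e :=
  (iInf_le _ (Path.cons e h (Path.nil y))).trans (by simp [Path.time])

variable {n : ℕ} {D : ℕ}

section prob
variable {Ω : Type*} {τ : PowEdge V E n → Ω → ℝ≥0}

variable [MeasurableSpace Ω] {F : Measure ℝ≥0} {μ : Measure Ω} [IsProbabilityMeasure μ]

/-- A crude lower bound for the probability of a cube event. -/
theorem pow_le_measure_cubeEvent (h : IIDField τ F μ) (hG : G.Loopless) (hD : G.DegreeLE D)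
    {ρ₁ ρ₂ δ : ℝ≥0} (hF₁ : ∀ y ≤ δ, ρ₁ * y ≤ F (Set.Iic y))
    (hF₂ : ∀ y ≤ δ, F (Set.Iic y) ≤ ρ₂ * y) (x y : Fin n → V)
    (hxy : ∀ i, x i ≠ y i → ∃ e, G.Joins e (x i) (y i)) :
    ((ρ₁ * δ / (1 + ρ₂ * δ) : ℝ≥0) : ℝ≥0∞) ^ (moved x y).card ≤ μ (cubeEvent G τ x y δ) := by
  have h1 := tens_le_measure_cubeEvent_mul h hG hD hF₁ hF₂ x y
  rw [tens_lazy_eq hG hD] at h1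
  have h2 : ∀ i ∈ moved x y, ((ρ₁ * δ / (1 + ρ₂ * δ) : ℝ≥0) : ℝ≥0∞) *
      (1 + (ρ₂ * δ : ℝ≥0) * (G.mult (x i) (y i) : ℝ≥0∞)) ≤
        (ρ₁ * δ : ℝ≥0) * (G.mult (x i) (y i) : ℝ≥0∞) := by
    intro i hi
    obtain ⟨e, he⟩ := hxy i (mem_moved.1 hi)
    have : Finite {e // G.Joins e (x i) (y i)} := hD.finite_joins _ _
    have hm : 1 ≤ G.mult (x i) (y i) := Nat.one_le_iff_ne_zero.2
      (Nat.card_ne_zero.2 ⟨⟨⟨e, he⟩⟩, this⟩)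
    set k := G.mult (x i) (y i)
    have hm' : (1 : ℝ≥0) ≤ k := by exact_mod_cast hm
    have : (ρ₁ * δ / (1 + ρ₂ * δ) : ℝ≥0) * (1 + ρ₂ * δ * k) ≤ ρ₁ * δ * k := by
      rw [div_mul_eq_mul_div, div_le_iff₀ (by positivity), mul_assoc _ (k : ℝ≥0)]
      gcongr
      rw [mul_add, mul_one, mul_comm (k : ℝ≥0)]
      gcongr
    exact_mod_cast this
  have h3 := Finset.prod_le_prod' h2
  rw [Finset.prod_mul_distrib, Finset.prod_const] at h3
  set Pd := ∏ i ∈ moved x y, (1 + (ρ₂ * δ : ℝ≥0) * (G.mult (x i) (y i) : ℝ≥0∞))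
  have hP0 : Pd ≠ 0 := Finset.prod_ne_zero_iff.2 fun i _ => by positivity
  have hPt : Pd ≠ ∞ := ENNReal.prod_ne_top fun i _ => by finiteness
  exact (ENNReal.mul_le_mul_iff_left hP0 hPt).1 (h3.trans h1)

end prob

/-! ### Configurations with prescribed progress along a path -/

/-- The configuration with values `x` on the range of `m`, and `u (p j)` at the other
coordinates `j`. -/
noncomputable def conf {N : ℕ} (m : Fin N ↪ Fin n) (u : ℕ → V) (p : Fin n → ℕ) (x : Fin N → V) :
    Fin n → V :=
  Function.extend m x fun j => u (p j)

section conf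
variable {N : ℕ} {m : Fin N ↪ Fin n} {u : ℕ → V} {p p' : Fin n → ℕ} {x y : Fin N → V}

theorem conf_apply (i : Fin N) : conf m u p x (m i) = x i := m.injective.extend_apply _ _ _

theorem conf_apply' {j : Fin n} (hj : j ∉ Set.range m) : conf m u p x j = u (p j) :=
  Function.extend_apply' _ _ _ fun ⟨i, hi⟩ => hj ⟨i, hi⟩

/-- The progress after `i` steps of a transition from `P` to `P'` in which coordinate `j` starts at
step `s j`. -/
def progress (P P' s : Fin n → ℕ) (i : ℕ) (j : Fin n) : ℕ := min (P j + (i - s j)) (P' j)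

theorem progress_zero {P P' s : Fin n → ℕ} (h : P ≤ P') : progress P P' s 0 = P := by
  funext j
  simp [progress, h j]

theorem progress_eq_right {P P' s : Fin n → ℕ} {K : ℕ} (h : ∀ j, P' j ≤ P j + (K - s j)) :
    progress P P' s K = P' := by
  funext j
  simp [progress, h j]

/-- `u 0, …, u d` is a self-avoiding path of the graph. -/
structure SimplePath (G : MixedGraph V E) (u : ℕ → V) (d : ℕ) : Prop where
  inj : ∀ a ≤ d, ∀ b ≤ d, u a = u b → a = b
  joins : ∀ l < d, ∃ e, G.Joins e (u l) (u (l + 1))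

/-- A self-avoiding path does not cross an edge twice, not even in opposite directions. So the edge
of `G` that moves a coordinate tells how far this coordinate has progressed, which keeps successive
transitions edge-disjoint. -/
theorem SimplePath.edge_unique {d : ℕ} (hu : SimplePath G u d) {e : E} {l l' : ℕ} (hl : l < d)
    (hl' : l' < d) (h : G.Joins e (u l) (u (l + 1))) (h' : G.Joins e (u l') (u (l' + 1))) :
    l = l' := by
  rcases h.eq_or_eq h' with ⟨h1, -⟩ | ⟨h1, h2⟩
  · exact hu.inj _ hl.le _ hl'.le h1.symm
  · have := hu.inj _ hl'.le _ hl h1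
    have := hu.inj _ hl' _ hl.le h2
    omega

theorem ne_of_conf_ne {j : Fin n}
    (hj : conf m u p x j ≠ conf m u p' x j) : j ∉ Set.range m ∧ p j ≠ p' j := by
  have h1 : j ∉ Set.range m := by
    rintro ⟨i, rfl⟩
    exact hj (by rw [conf_apply, conf_apply])
  exact ⟨h1, fun h => hj (by rw [conf_apply' h1, conf_apply' h1, h])⟩

end conf

section route
variable {N : ℕ} (m : Fin N ↪ Fin n) (u : ℕ → V) (P P' s : Fin n → ℕ)

/-- The edges that can be used in a transition. -/
def routeEdges (G : MixedGraph V E) (K : ℕ) (x : Fin N → V) : Set (PowEdge V E n) :=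
  ⋃ i ∈ Finset.range K, cubeEdges G (conf m u (progress P P' s i) x)
    (conf m u (progress P P' s (i + 1)) x)

/-- All steps of a transition take time at most `δ`. -/
def routeEvent {Ω : Type*} (G : MixedGraph V E) (τ : PowEdge V E n → Ω → ℝ≥0) (K : ℕ) (δ : ℝ≥0)
    (x : Fin N → V) : Set Ω :=
  ⋂ i ∈ Finset.range K, cubeEvent G τ (conf m u (progress P P' s i) x)
    (conf m u (progress P P' s (i + 1)) x) δ

variable {m u P P' s} {K d : ℕ}

theorem moved_progress {x : Fin N → V} {i : ℕ} {j : Fin n}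
    (hj : conf m u (progress P P' s i) x j ≠ conf m u (progress P P' s (i + 1)) x j) :
    j ∉ Set.range m ∧ P j < P' j ∧ P j ≤ progress P P' s i j ∧ progress P P' s i j < P' j ∧
      progress P P' s (i + 1) j = progress P P' s i j + 1 ∧ s j ≤ i ∧
      progress P P' s i j = P j + (i - s j) := by
  obtain ⟨h1, h2⟩ := ne_of_conf_ne hj
  refine ⟨h1, ?_⟩
  simp only [progress] at h2 ⊢
  omega

theorem mem_routeEdges (hG : G.Loopless) {x : Fin N → V} {f : PowEdge V E n}
    (hf : f ∈ routeEdges m u P P' s G K x) :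
    ∃ (y : Fin n → V) (j : Fin n) (e : E) (i : ℕ), f = pe y j e ∧ i < K ∧ j ∉ Set.range m ∧
      s j ≤ i ∧ P j + (i - s j) < P' j ∧ (∀ k, y (m k) = x k) ∧
      G.Joins e (u (P j + (i - s j))) (u (P j + (i - s j) + 1)) ∧
      ∀ k ∉ Set.range m, y k = u (progress P P' s i k) ∨ y k = u (progress P P' s (i + 1) k) := by
  simp only [routeEdges, Set.mem_iUnion, Finset.mem_range] at hf
  obtain ⟨i, hi, z, hz, j, e, hj, he, rfl⟩ := hf
  obtain ⟨h1, h2, h3, h4, h5, h6, h7⟩ := moved_progress hj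
  refine ⟨z, j, e, i, rfl, hi, h1, h6, h7 ▸ h4, fun k => ?_, ?_, fun k hk => ?_⟩
  · have := hz (m k)
    rwa [conf_apply, conf_apply, or_self] at this
  · rw [conf_apply' h1, conf_apply' h1, h5, h7] at he
    exact he
  · have := hz k
    rwa [conf_apply' hk, conf_apply' hk] at this

theorem disjoint_route_steps (hu : SimplePath G u d) (hP' : ∀ j, P' j ≤ d) (x : Fin N → V) :
    ((Finset.range K : Finset ℕ) : Set ℕ).PairwiseDisjoint fun i =>
      cubeEdges G (conf m u (progress P P' s i) x) (conf m u (progress P P' s (i + 1)) x) := by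
  intro i _ i' _ hii'
  rw [Function.onFun, Set.disjoint_left]
  rintro f ⟨z, -, j, e, hj, he, rfl⟩ ⟨z', -, j', e', hj', he', hf⟩
  obtain ⟨rfl, rfl, -⟩ := pe_eq_iff.1 hf
  obtain ⟨h1, h2, h3, h4, h5, h6, h7⟩ := moved_progress hj
  obtain ⟨-, -, -, h4', h5', h6', h7'⟩ := moved_progress hj'
  rw [conf_apply' h1, conf_apply' h1, h5] at he
  rw [conf_apply' h1, conf_apply' h1, h5'] at he'
  have := hP' j
  have := hu.edge_unique (by omega) (by omega) he he'
  omega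

/-- A common edge would move the same coordinate at the same stage of its progress, but the first
transition stops where, or before, the second one starts. -/
theorem disjoint_routeEdges {P₂ P₂' s₂ : Fin n → ℕ} (hG : G.Loopless) (hu : SimplePath G u d)
    (hP' : ∀ j, P' j ≤ d) (hP₂ : ∀ j, P₂' j ≤ d) (h : P' ≤ P₂) (x x' : Fin N → V) :
    Disjoint (routeEdges m u P P' s G K x) (routeEdges m u P₂ P₂' s₂ G K x') := by
  rw [Set.disjoint_left]
  intro f hf hf'
  obtain ⟨y, j, e, i, rfl, -, -, -, h1, -, h2, -⟩ := mem_routeEdges hG hf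
  obtain ⟨y', j', e', i', hyy, -, -, -, h1', -, h2', -⟩ := mem_routeEdges hG hf'
  obtain ⟨rfl, rfl, -⟩ := pe_eq_iff.1 hyy
  have := hu.edge_unique (by have := hP' j; omega) (by have := hP₂ j; omega) h2 h2'
  have : P' j ≤ P₂ j := h j
  omega

/-- The transition does not move the coordinates in the range of `m`, so its edges still show `x`.
-/
theorem disjoint_routeEdges_of_ne (hG : G.Loopless) {x x' : Fin N → V} (h : x ≠ x') :
    Disjoint (routeEdges m u P P' s G K x) (routeEdges m u P P' s G K x') := by
  rw [Set.disjoint_left]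
  intro f hf hf'
  obtain ⟨y, j, e, i, rfl, -, hj, -, h1, hx, h2, -⟩ := mem_routeEdges hG hf
  obtain ⟨y', j', e', i', hyy, -, -, -, h1', hx', h2', -⟩ := mem_routeEdges hG hf'
  obtain ⟨rfl, rfl, hy⟩ := pe_eq_iff.1 hyy
  exact h (funext fun k => by rw [← hx, ← hx', hy _ fun hk => hj ⟨k, hk⟩])

section prob
variable {Ω : Type*} {τ : PowEdge V E n → Ω → ℝ≥0}

theorem passageTime_le_of_mem_routeEvent (hPP' : P ≤ P') (hK : ∀ j, P' j ≤ P j + (K - s j))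
    {δ : ℝ≥0} {x : Fin N → V} {ω : Ω} (h : ω ∈ routeEvent m u P P' s G τ K δ x) :
    (G.pow n).passageTime (fun f => τ f ω) (conf m u P x) (conf m u P' x) ≤ K * δ := by
  have := passageTime_chain (G := G.pow n) (fun f => τ f ω)
    (fun i => conf m u (progress P P' s i) x) (fun _ => δ) K fun i hi =>
      passageTime_le_of_mem_cubeEvent (Set.mem_iInter₂.1 h i (Finset.mem_range.2 hi))
  simpa [progress_zero hPP', progress_eq_right hK] using this

theorem measurableSet_routeEvent (hG : G.Loopless) (hD : G.DegreeLE D) (δ : ℝ≥0) (x : Fin N → V) :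
    MeasurableSet[sig τ (routeEdges m u P P' s G K x)] (routeEvent m u P P' s G τ K δ x) := by
  refine Finset.measurableSet_biInter _ fun i hi => ?_
  exact sig_mono (Set.subset_biUnion_of_mem (u := fun i => cubeEdges G
    (conf m u (progress P P' s i) x) (conf m u (progress P P' s (i + 1)) x)) hi) _
    (measurableSet_cubeEvent hG hD _ _ δ)

variable [MeasurableSpace Ω] {F : Measure ℝ≥0} {μ : Measure Ω} [IsProbabilityMeasure μ]

/-- The progress of moving coordinates differs from step to step, so the steps use disjoint edges
and their probabilities multiply. -/
theorem pow_le_measure_routeEvent (h : IIDField τ F μ) (hG : G.Loopless) (hD : G.DegreeLE D)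
    {ρ₁ ρ₂ δ : ℝ≥0} (hF₁ : ∀ y ≤ δ, ρ₁ * y ≤ F (Set.Iic y))
    (hF₂ : ∀ y ≤ δ, F (Set.Iic y) ≤ ρ₂ * y) (hρ : ρ₁ ≤ ρ₂) (hu : SimplePath G u d)
    (hP' : ∀ j, P' j ≤ d) {k : ℕ} (hk : (Finset.univ.filter fun j => P j < P' j).card ≤ k)
    (x : Fin N → V) :
    ((ρ₁ * δ / (1 + ρ₂ * δ) : ℝ≥0) : ℝ≥0∞) ^ (K * k) ≤ μ (routeEvent m u P P' s G τ K δ x) := by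
  rw [routeEvent, h.measure_biInter (disjoint_route_steps hu hP' x)
    fun i _ => measurableSet_cubeEvent hG hD _ _ δ]
  have h1 : (ρ₁ * δ / (1 + ρ₂ * δ) : ℝ≥0) ≤ 1 := by
    rw [div_le_one (by positivity)]
    have : ρ₁ * δ ≤ ρ₂ * δ := by gcongr
    exact this.trans le_add_self
  rw [mul_comm K k, pow_mul]
  calc _ = ∏ _i ∈ Finset.range K, ((ρ₁ * δ / (1 + ρ₂ * δ) : ℝ≥0) : ℝ≥0∞) ^ k := by
        rw [Finset.prod_const, Finset.card_range]
    _ ≤ _ := Finset.prod_le_prod' fun i _ => ?_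
  refine le_trans ?_ (pow_le_measure_cubeEvent h hG hD hF₁ hF₂ _ _ fun j hj => ?_)
  · refine pow_le_pow_right_of_le_one' (by exact_mod_cast h1) (le_trans (Finset.card_le_card ?_) hk)
    intro j hj
    exact Finset.mem_filter.2 ⟨Finset.mem_univ _, (moved_progress (mem_moved.1 hj)).2.1⟩
  · obtain ⟨h1, h2, h3, h4, h5, h6, h7⟩ := moved_progress hj
    rw [conf_apply' h1, conf_apply' h1, h5]
    exact hu.joins _ (by have := hP' j; omega)

end prob
end route
end MixedGraph

/-! ### Chains of crossings in separate slices of the power. -/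

namespace MixedGraph
variable {V : Type u} {E : Type v} {G : MixedGraph V E} {n : ℕ} {D : ℕ}

theorem DegreeLE.mult_le (hD : G.DegreeLE D) (x y : V) : G.mult x y ≤ D := by
  have h := (ENNReal.le_tsum y).trans (hD.tsum_adj_le x)
  rw [hD.adj_eq] at h
  exact_mod_cast h

section conf
variable {N : ℕ} {m : Fin N ↪ Fin n} {u : ℕ → V} {p p' : Fin n → ℕ}

theorem moved_conf (x y : Fin N → V) :
    moved (conf m u p x) (conf m u p y) = (moved x y).map m := by
  ext j
  rw [mem_moved, Finset.mem_map]
  constructor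
  · intro h
    by_cases hj : j ∈ Set.range m
    · obtain ⟨i, rfl⟩ := hj
      rw [conf_apply, conf_apply] at h
      exact ⟨i, mem_moved.2 h, rfl⟩
    · rw [conf_apply' hj, conf_apply' hj] at h
      exact absurd rfl h
  · rintro ⟨i, hi, rfl⟩
    rw [conf_apply, conf_apply]
    exact mem_moved.1 hi

theorem tens_conf (hG : G.Loopless) (hD : G.DegreeLE D) (θ : ℝ≥0∞) (x y : Fin N → V) :
    Kern.tens (Kern.lazy θ G.adj) (conf m u p x) (conf m u p y) =
      Kern.tens (Kern.lazy θ G.adj) x y := by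
  rw [tens_lazy_eq hG hD, tens_lazy_eq hG hD, moved_conf, Finset.prod_map]
  simp only [conf_apply]

theorem eq_conf_of_mem_box {x y : Fin N → V} {z : Fin n → V}
    (hz : z ∈ Box (conf m u p x) (conf m u p y)) :
    z = conf m u p (z ∘ m) ∧ z ∘ m ∈ Box x y := by
  constructor
  · funext j
    by_cases hj : j ∈ Set.range m
    · obtain ⟨i, rfl⟩ := hj
      rw [conf_apply]; rfl
    · have := hz j
      rw [conf_apply' hj, conf_apply' hj, or_self] at this
      rw [conf_apply' hj, this]
  · intro i
    have := hz (m i)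
    rwa [conf_apply, conf_apply] at this

/-- The edges in the directions of the range of `m`, at configurations that are given by `u ∘ p`
outside that range. -/
def sliceEdges (E : Type v) (m : Fin N ↪ Fin n) (u : ℕ → V) (p : Fin n → ℕ) :
    Set (PowEdge V E n) :=
  {f | ∃ (y : Fin n → V) (j : Fin n) (e : E), f = pe y j e ∧ j ∈ Set.range m ∧
    ∀ k ∉ Set.range m, y k = u (p k)}

theorem cubeEdges_subset_sliceEdges (x y : Fin N → V) :
    cubeEdges G (conf m u p x) (conf m u p y) ⊆ sliceEdges E m u p := by
  rintro f ⟨z, hz, j, e, hj, -, rfl⟩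
  refine ⟨z, j, e, rfl, ?_, fun k hk => ?_⟩
  · by_contra h
    rw [conf_apply' h, conf_apply' h] at hj
    exact hj rfl
  · have := hz k
    rwa [conf_apply' hk, conf_apply' hk, or_self] at this

theorem disjoint_sliceEdges (h : ∃ j ∉ Set.range m, u (p j) ≠ u (p' j)) :
    Disjoint (sliceEdges E m u p) (sliceEdges E m u p') := by
  rw [Set.disjoint_left]
  rintro f ⟨y, j, e, rfl, hj, hy⟩ ⟨y', j', e', hf, hj', hy'⟩
  obtain ⟨rfl, rfl, h1⟩ := pe_eq_iff.1 hf
  obtain ⟨k, hk, hne⟩ := h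
  exact hne (by rw [← hy k hk, ← hy' k hk, h1 k fun h => hk (h ▸ hj)])

section prob
variable {Ω : Type*} {τ : PowEdge V E n → Ω → ℝ≥0}
variable [MeasurableSpace Ω] {F : Measure ℝ≥0} {μ : Measure Ω} [IsProbabilityMeasure μ]

/-- Per moved coordinate, `ρ₂ / ρ₁` is the loss from the two-sided bound for `F`, and `1 + D θ` with
`θ = ρ₂ δ` is the loss from correlated paths inside one cube. -/
theorem tens_le_pow_mul_measure_cubeEvent (h : IIDField τ F μ) (hG : G.Loopless) (hD : G.DegreeLE D)
    {ρ₁ ρ₂ δ : ℝ≥0} (hF₁ : ∀ y ≤ δ, ρ₁ * y ≤ F (Set.Iic y))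
    (hF₂ : ∀ y ≤ δ, F (Set.Iic y) ≤ ρ₂ * y) (hρ : ρ₁ ≠ 0) (x y : Fin n → V) :
    Kern.tens (Kern.lazy (ρ₂ * δ : ℝ≥0) G.adj) x y ≤
      ((ρ₂ / ρ₁ * (1 + D * (ρ₂ * δ)) : ℝ≥0) : ℝ≥0∞) ^ (moved x y).card *
        μ (cubeEvent G τ x y δ) := by
  have h1 := tens_le_measure_cubeEvent_mul h hG hD hF₁ hF₂ x y
  rw [tens_lazy_eq hG hD] at h1 ⊢
  calc ∏ i ∈ moved x y, ((ρ₂ * δ : ℝ≥0) : ℝ≥0∞) * (G.mult (x i) (y i) : ℝ≥0∞)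
      = ((ρ₂ / ρ₁ : ℝ≥0) : ℝ≥0∞) ^ (moved x y).card *
        ∏ i ∈ moved x y, ((ρ₁ * δ : ℝ≥0) : ℝ≥0∞) * (G.mult (x i) (y i) : ℝ≥0∞) := by
        rw [← Finset.prod_const, ← Finset.prod_mul_distrib]
        refine Finset.prod_congr rfl fun i _ => ?_
        rw [← mul_assoc, ← ENNReal.coe_mul]
        congr 2
        field_simp
    _ ≤ ((ρ₂ / ρ₁ : ℝ≥0) : ℝ≥0∞) ^ (moved x y).card * (μ (cubeEvent G τ x y δ) *
          ((1 + D * (ρ₂ * δ) : ℝ≥0) : ℝ≥0∞) ^ (moved x y).card) := by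
        gcongr
        refine h1.trans ?_
        gcongr
        rw [← Finset.prod_const]
        refine Finset.prod_le_prod' fun i _ => ?_
        push_cast
        rw [mul_comm (D : ℝ≥0∞)]
        gcongr
        exact hD.mult_le _ _
    _ = _ := by
        rw [ENNReal.coe_mul (ρ₂ / ρ₁), mul_pow]
        ring

open Classical in
/-- The second moment bound for chains of cube events at successive configurations. -/
theorem sum_chain_le_measure (h : IIDField τ F μ) (hG : G.Loopless) (hD : G.DegreeLE D)
    {ρ₁ ρ₂ δ : ℝ≥0} (hF₁ : ∀ y ≤ δ, ρ₁ * y ≤ F (Set.Iic y))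
    (hF₂ : ∀ y ≤ δ, F (Set.Iic y) ≤ ρ₂ * y) (hρ : ρ₁ ≠ 0) (hρρ : ρ₁ ≤ ρ₂)
    {R k₀ k₁ : ℕ} (hR : R = k₀ + k₁) (hk₀ : 0 < k₀) (hk₁ : 0 < k₁)
    {v w : V} (P : ℕ → Fin n → ℕ)
    (hsep : ∀ r < R, ∀ r' < R, r ≠ r' → ∃ j ∉ Set.range m, u (P r j) ≠ u (P r' j))
    (𝒞 : Finset (Fin (R + 1) → Fin N → V)) (h0 : ∀ z ∈ 𝒞, z 0 = fun _ => v)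
    (hl : ∀ z ∈ 𝒞, z (Fin.last _) = fun _ => w)
    (hW0 : ∀ z ∈ 𝒞, ∀ (r : Fin R) i,
      Kern.lazy (ρ₂ * δ : ℝ≥0) G.adj (z r.castSucc i) (z r.succ i) ≠ 0)
    {k : ℕ} (hmv : ∀ z ∈ 𝒞, ∀ r : Fin R, (moved (z r.castSucc) (z r.succ)).card ≤ k)
    (Q : ℕ → (Fin N → V) → Set Ω) (U : ℕ → (Fin N → V) → Set (PowEdge V E n))
    (hQU : ∀ r x, MeasurableSet[sig τ (U r x)] (Q r x))
    (hU : ∀ r < R, ∀ r' < R, ∀ x x', (r ≠ r' ∨ x ≠ x') → Disjoint (U r x) (U r' x'))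
    (hUm : ∀ r x, ∀ f ∈ U r x, f.1 ∉ Set.range m)
    {q₁ q : ℝ≥0∞} (hq₁ : q₁ ≠ 0) (hq₁1 : q₁ ≤ 1) (hq : q ≠ 0)
    (hQ₁ : ∀ r x, r ≠ k₀ → q₁ ≤ μ (Q r x)) (hQ : ∀ x, q ≤ μ (Q k₀ x))
    (g Λ Λ' : ℝ≥0∞)
    (hgap : ∀ z ∈ 𝒞, ∀ (r r' : Fin R) (j : ℕ), (r : ℕ) + j = r' →
      ∀ a ∈ Box (z r.castSucc) (z r.succ), ∀ b ∈ Box (z r'.castSucc) (z r'.succ),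
      Kern.tens (Kern.lazy (ρ₂ * δ : ℝ≥0) G.adj ^ (j + 1)) a b ≤ g * Λ ^ j)
    (hgap' : ∀ z ∈ 𝒞, ∀ (r r' : Fin R) (j : ℕ), (r : ℕ) + j = r' → j < k₀ → j < k₁ →
      ∀ a ∈ Box (z r.castSucc) (z r.succ), ∀ b ∈ Box (z r'.castSucc) (z r'.succ),
      Kern.tens (Kern.lazy (ρ₂ * δ : ℝ≥0) G.adj ^ (j + 1)) a b ≤ g * Λ' ^ j)
    (hkk : k₀ = k₁) :
    ∑ z ∈ 𝒞, ∏ r : Fin R, Kern.tens (Kern.lazy (ρ₂ * δ : ℝ≥0) G.adj) (z r.castSucc) (z r.succ) ≤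
      μ (⋃ z ∈ 𝒞, ⋂ r : Fin R, Q r (z r.castSucc) ∩
        cubeEvent G τ (conf m u (P r) (z r.castSucc)) (conf m u (P r) (z r.succ)) δ) *
      (((((ρ₂ / ρ₁ * (1 + D * (ρ₂ * δ)) : ℝ≥0) : ℝ≥0∞) ^ k) ^ R) ^ 2 * q₁⁻¹ ^ R *
        (g * Λ ^ (R - 1) * (1 + (n + 1) ^ 2 * g) ^ R +
          q⁻¹ * (g ^ 2 * Λ' ^ (R - 2) * (1 + (n + 1) ^ 2 * g) ^ R))) := by
  set W : Kern (Fin N → V) := Kern.tens (Kern.lazy (ρ₂ * δ : ℝ≥0) G.adj) with hW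
  set κ : ℝ≥0 := ρ₂ / ρ₁ * (1 + D * (ρ₂ * δ)) with hκ
  have hκ1 : (1 : ℝ≥0∞) ≤ κ := by
    have h1 : 1 ≤ ρ₂ / ρ₁ := by rwa [one_le_div₀ (pos_iff_ne_zero.2 hρ)]
    have h2 : 1 ≤ 1 + D * (ρ₂ * δ) := le_self_add
    exact_mod_cast one_le_mul h1 h2
  have hQm : ∀ r x, MeasurableSet (Q r x) := fun r x => h.sig_le _ _ (hQU r x)
  have hCS : ∀ r x x', MeasurableSet[sig τ (sliceEdges E m u (P r))]
      (cubeEvent G τ (conf m u (P r) x) (conf m u (P r) x') δ) := fun r x x' =>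
    sig_mono (cubeEdges_subset_sliceEdges x x') _ (measurableSet_cubeEvent hG hD _ _ δ)
  have hCm : ∀ r x x', MeasurableSet (cubeEvent G τ (conf m u (P r) x) (conf m u (P r) x') δ) :=
    fun r x x' => h.sig_le _ _ (hCS r x x')
  let box : (Fin (R + 1) → Fin N → V) → ℕ → Set (Fin N → V) := fun z r =>
    if hr : r < R then Box (z (Fin.castSucc ⟨r, hr⟩)) (z (Fin.succ ⟨r, hr⟩)) else ∅
  have hboxe : ∀ z (r : Fin R), box z r = Box (z r.castSucc) (z r.succ) := fun z r => by
    simp only [box, dif_pos r.2]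
  refine chain_measure_ge (W := W) (v := fun _ => v) (w := fun _ => w) hR hk₀ hk₁ 𝒞 h0 hl
    (fun x y => ?_) (fun z hz r => ?_) (fun z => ⋂ r : Fin R, Q r (z r.castSucc) ∩
        cubeEvent G τ (conf m u (P r) (z r.castSucc)) (conf m u (P r) (z r.succ)) δ)
    (fun z => MeasurableSet.iInter fun r => (hQm _ _).inter (hCm _ _ _)) Q
    (fun r x y => cubeEvent G τ (conf m u (P r) x) (conf m u (P r) y) δ) ?_ q₁⁻¹ q
    (fun r x x' hr => ?_) (fun x x' => ?_) (fun r x => ?_) (ENNReal.one_le_inv.2 hq₁1)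
    (fun z r => (κ : ℝ≥0∞) ^ k) _ (fun z hz r => ?_) (fun z hz => ?_) box ((n + 1) ^ 2)
    (fun z hz r => ?_) (fun z hz r => ?_) g Λ Λ' (fun z hz r j hrj a ha b hb => ?_)
    (fun z hz r j hrj hj a ha b hb => ?_)
  · rw [hW, tens_lazy_eq hG hD]
    exact ENNReal.prod_ne_top fun i _ => by finiteness
  · rw [hW, Kern.tens_apply]
    exact Finset.prod_ne_zero_iff.2 fun i _ => hW0 z hz r i
  · intro z hz z' hz'
    -- Entrances move coordinates outside the range of `m`, crossings move coordinates inside it,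
    -- and crossings in different slices are told apart by `hsep`. So all factors depend on disjoint
    -- sets of edges.
    let S : Fin R ⊕ Fin R → Set (PowEdge V E n) := fun a =>
      match a with
      | .inl r => U r (z r.castSucc) ∪ U r (z' r.castSucc)
      | .inr r => sliceEdges E m u (P r)
    let A : Fin R ⊕ Fin R → Set Ω := fun a =>
      match a with
      | .inl r => Q r (z r.castSucc) ∩ Q r (z' r.castSucc)
      | .inr r => cubeEvent G τ (conf m u (P r) (z r.castSucc)) (conf m u (P r) (z r.succ)) δ ∩
          cubeEvent G τ (conf m u (P r) (z' r.castSucc)) (conf m u (P r) (z' r.succ)) δ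
    have hUs : ∀ r x r', Disjoint (U r x) (sliceEdges E m u (P r')) := fun r x r' => by
      rw [Set.disjoint_left]
      rintro f hf ⟨y, j, e, rfl, hj, -⟩
      exact hUm r x _ hf hj
    have hS : ((Finset.univ : Finset (Fin R ⊕ Fin R)) : Set _).PairwiseDisjoint S := by
      rintro (r | r) - (r' | r') - hne
      · have hrr : (r : ℕ) ≠ r' := fun h => hne (by rw [Fin.ext h])
        simp only [Function.onFun, S, Set.disjoint_union_left, Set.disjoint_union_right]
        exact ⟨⟨hU _ r.2 _ r'.2 _ _ (.inl hrr), hU _ r.2 _ r'.2 _ _ (.inl hrr)⟩,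
          hU _ r.2 _ r'.2 _ _ (.inl hrr), hU _ r.2 _ r'.2 _ _ (.inl hrr)⟩
      · simp only [Function.onFun, S, Set.disjoint_union_left]
        exact ⟨hUs _ _ _, hUs _ _ _⟩
      · simp only [Function.onFun, S, Set.disjoint_union_right]
        exact ⟨(hUs _ _ _).symm, (hUs _ _ _).symm⟩
      · have hrr : (r : ℕ) ≠ r' := fun h => hne (by rw [Fin.ext h])
        exact disjoint_sliceEdges (hsep r r.2 r' r'.2 hrr)
    have hA : ∀ a ∈ (Finset.univ : Finset (Fin R ⊕ Fin R)), MeasurableSet[sig τ (S a)] (A a) := by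
      rintro (r | r) -
      · exact MeasurableSet.inter (sig_mono Set.subset_union_left _ (hQU _ _))
          (sig_mono Set.subset_union_right _ (hQU _ _))
      · exact MeasurableSet.inter (hCS _ _ _) (hCS _ _ _)
    have h1 := h.measure_biInter hS hA
    rw [Fintype.prod_sum_type] at h1
    rw [Finset.prod_mul_distrib, ← h1]
    congr 1
    ext ω
    simp only [Set.mem_inter_iff, Set.mem_iInter, Finset.mem_univ, Sum.forall, A, forall_true_left]
    exact ⟨fun h => ⟨fun r => ⟨(h.1 r).1, (h.2 r).1⟩, fun r => ⟨(h.1 r).2, (h.2 r).2⟩⟩,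
      fun h => ⟨fun r => ⟨(h.1 r).1, (h.2 r).1⟩, fun r => ⟨(h.1 r).2, (h.2 r).2⟩⟩⟩
  · refine (measure_mono Set.inter_subset_left).trans ?_
    rw [mul_left_comm]
    refine le_mul_of_one_le_right' ?_
    calc (1 : ℝ≥0∞) = q₁⁻¹ * q₁ := (ENNReal.inv_mul_cancel hq₁ (ne_top_of_le_ne_top (by simp) hq₁1)).symm
      _ ≤ _ := by gcongr; exact hQ₁ r x' hr
  · by_cases hx : x = x'
    · subst hx
      rw [Set.inter_self, Kern.one_self, mul_one]
      have hqt : q ≠ ∞ := ne_top_of_le_ne_top (measure_ne_top _ _) (hQ x)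
      rw [← mul_assoc]
      refine le_mul_of_one_le_left' ?_
      calc (1 : ℝ≥0∞) = q⁻¹ * q := (ENNReal.inv_mul_cancel hq hqt).symm
        _ ≤ _ := by gcongr; exacts [le_add_self, hQ x]
    · rw [Kern.one_of_ne hx, mul_zero, add_zero, one_mul,
        h.measure_inter (hU _ (by omega) _ (by omega) _ _ (.inr hx)) (hQU _ _) (hQU _ _)]
  · by_cases hr : r = k₀
    · subst hr
      exact (lt_of_lt_of_le (pos_iff_ne_zero.2 hq) (hQ x)).ne'
    · exact (lt_of_lt_of_le (pos_iff_ne_zero.2 hq₁) (hQ₁ r x hr)).ne'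
  · have h1 := tens_le_pow_mul_measure_cubeEvent h hG hD hF₁ hF₂ hρ
      (conf m u (P r) (z r.castSucc)) (conf m u (P r) (z r.succ))
    rw [tens_conf hG hD, moved_conf, Finset.card_map] at h1
    refine h1.trans ?_
    gcongr
    exact hmv z hz r
  · simp
  · rw [hboxe]
    exact ⟨Box.left _ _, Box.right _ _⟩
  · obtain ⟨B, c, hB, hc, hp⟩ := exists_measure_cubeEvent_inter_le h hG hD hF₂
      (conf m u (P r) (z r.castSucc)) (conf m u (P r) (z r.succ))
    rw [tens_conf hG hD] at hc
    have hinj : Set.InjOn (fun a : Fin n → V => a ∘ m) (B : Set (Fin n → V)) := by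
      intro a ha b hb hab
      rw [(eq_conf_of_mem_box (hB a ha)).1, (eq_conf_of_mem_box (hB b hb)).1]
      exact congrArg _ hab
    have hsum : ∀ f : (Fin n → V) → (Fin n → V) → ℝ≥0∞,
        ∑ a ∈ B.image (fun a : Fin n → V => a ∘ m), ∑ b ∈ B.image (fun a : Fin n → V => a ∘ m),
          f (conf m u (P r) a) (conf m u (P r) b) = ∑ a ∈ B, ∑ b ∈ B, f a b := by
      intro f
      rw [Finset.sum_image hinj]
      refine Finset.sum_congr rfl fun a ha => ?_
      rw [Finset.sum_image hinj]
      refine Finset.sum_congr rfl fun b hb => ?_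
      rw [← (eq_conf_of_mem_box (hB a ha)).1, ← (eq_conf_of_mem_box (hB b hb)).1]
    refine ⟨B.image (fun a => a ∘ m), fun a b => c (conf m u (P r) a) (conf m u (P r) b), ?_, ?_, ?_⟩
    · intro a ha
      obtain ⟨b, hb, rfl⟩ := Finset.mem_image.1 ha
      rw [hboxe]
      exact (eq_conf_of_mem_box (hB b hb)).2
    · rw [hsum]
      exact hc
    · intro x' y'
      refine (hp _ _).trans ?_
      rw [tens_conf hG hD, tens_conf hG hD, ← hsum]
      refine le_of_eq ?_
      congr 1
      refine Finset.sum_congr rfl fun a _ => Finset.sum_congr rfl fun b _ => ?_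
      rw [tens_conf hG hD, tens_conf hG hD]
  · rw [hW, Kern.tens_pow]
    rw [show box z r = _ from hboxe z ⟨r, by omega⟩] at ha
    rw [show box z (r + j) = _ from hboxe z ⟨r + j, hrj⟩] at hb
    exact hgap z hz ⟨r, by omega⟩ ⟨r + j, hrj⟩ j rfl a ha b hb
  · rw [hW, Kern.tens_pow]
    rw [show box z r = _ from hboxe z ⟨r, by omega⟩] at ha
    rw [show box z (r + j) = _ from hboxe z ⟨r + j, hrj⟩] at hb
    exact hgap' z hz ⟨r, by omega⟩ ⟨r + j, hrj⟩ j rfl (by omega) (by omega) a ha b hb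

end prob
end conf
end MixedGraph

/-! ### Exponential rates, and the limit of fine discretization. -/

/-- The exponential function with values in `[0, ∞]`. -/
noncomputable def eexp (x : ℝ) : ℝ≥0∞ := ENNReal.ofReal (Real.exp x)

theorem eexp_add (x y : ℝ) : eexp (x + y) = eexp x * eexp y := by
  rw [eexp, Real.exp_add, ENNReal.ofReal_mul (Real.exp_pos _).le]; rfl

theorem eexp_zero : eexp 0 = 1 := by simp [eexp]

theorem eexp_nsmul (n : ℕ) (x : ℝ) : eexp (n * x) = eexp x ^ n := by
  rw [eexp, Real.exp_nat_mul, ENNReal.ofReal_pow (Real.exp_pos _).le]; rfl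

theorem eexp_neg (x : ℝ) : eexp (-x) = (eexp x)⁻¹ := by
  rw [eexp, Real.exp_neg, ENNReal.ofReal_inv_of_pos (Real.exp_pos _)]; rfl

theorem eexp_mono {x y : ℝ} (h : x ≤ y) : eexp x ≤ eexp y :=
  ENNReal.ofReal_le_ofReal (Real.exp_le_exp.2 h)

theorem eexp_ne_zero (x : ℝ) : eexp x ≠ 0 := by
  rw [eexp, Ne, ENNReal.ofReal_eq_zero, not_le]; exact Real.exp_pos x

theorem eexp_ne_top (x : ℝ) : eexp x ≠ ∞ := ENNReal.ofReal_ne_top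

theorem one_le_eexp {x : ℝ} (h : 0 ≤ x) : 1 ≤ eexp x := eexp_zero ▸ eexp_mono h

namespace Kern
variable {V : Type u} {A : Kern V} {D : ℕ}

theorem Tame.pow_apply_le (hA : A.Tame D) (j : ℕ) (x y : V) : (A ^ j) x y ≤ (D : ℝ≥0∞) ^ j := by
  induction j generalizing y with
  | zero =>
    rw [pow_zero, pow_zero, one_apply]
    split_ifs <;> simp
  | succ j ih =>
    rw [pow_succ, mul_apply, pow_succ]
    calc _ ≤ ∑' z, (D : ℝ≥0∞) ^ j * A z y := ENNReal.tsum_le_tsum fun z => by gcongr; exact ih z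
      _ = (D : ℝ≥0∞) ^ j * ∑' z, A z y := ENNReal.tsum_mul_left
      _ ≤ _ := by gcongr; exact hA.col_le y

theorem lazy_pow_le_tsum (A : Kern V) (t : ℝ≥0) {n : ℕ} (hn : 0 < n) (x y : V) :
    (lazy ((t / n : ℝ≥0) : ℝ≥0∞) A ^ n) x y ≤
      ∑' j : ℕ, (t : ℝ≥0∞) ^ j / (j ! : ℝ≥0∞) * (A ^ j) x y := by
  rw [lazy_pow_apply]
  refine le_trans (Finset.sum_le_sum fun j _ => ?_) (ENNReal.sum_le_tsum _)
  rw [← mul_assoc]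
  gcongr
  have h := Nat.choose_le_pow_div (α := ℝ≥0) j n
  have hn' : (n : ℝ≥0) ≠ 0 := by positivity
  have h2 : (n.choose j : ℝ≥0) * (t / n) ^ j ≤ t ^ j / j ! := by
    calc (n.choose j : ℝ≥0) * (t / n) ^ j ≤ ((n : ℝ≥0) ^ j / j !) * (t / n) ^ j := by gcongr
      _ = t ^ j / j ! := by rw [div_pow]; field_simp
  have h3 : (((n.choose j : ℝ≥0) * (t / n) ^ j : ℝ≥0) : ℝ≥0∞) ≤ ((t ^ j / j ! : ℝ≥0) : ℝ≥0∞) := by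
    exact_mod_cast h2
  rw [ENNReal.coe_div (by positivity)] at h3
  push_cast at h3
  exact h3

/-- Dominated convergence in the binomial expansion: `n.choose j * (t / n)^j` tends to `t^j / j!`
and is bounded by it. -/
theorem Tame.tendsto_lazy_pow (hA : A.Tame D) (t : ℝ≥0) (x y : V) :
    Tendsto (fun n : ℕ => (lazy ((t / n : ℝ≥0) : ℝ≥0∞) A ^ n) x y) atTop
      (𝓝 (∑' j : ℕ, (t : ℝ≥0∞) ^ j / (j ! : ℝ≥0∞) * (A ^ j) x y)) := by
  set a : ℕ → ℝ := fun j => ((A ^ j) x y).toReal with ha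
  have hat : ∀ j, (A ^ j) x y ≠ ∞ := fun j =>
    ne_top_of_le_ne_top (by finiteness) (hA.pow_apply_le j x y)
  have ha0 : ∀ j, 0 ≤ a j := fun j => ENNReal.toReal_nonneg
  have haD : ∀ j, a j ≤ (D : ℝ) ^ j := fun j => by
    have := ENNReal.toReal_mono (by finiteness) (hA.pow_apply_le j x y)
    simpa using this
  have hae : ∀ j, (A ^ j) x y = ENNReal.ofReal (a j) := fun j => (ENNReal.ofReal_toReal (hat j)).symm
  have hsum : Summable fun j : ℕ => ((t : ℝ) * D) ^ j / j ! := Real.summable_pow_div_factorial _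
  have hle : ∀ n j : ℕ, (n.choose j : ℝ) * ((t : ℝ) / n) ^ j * a j ≤ ((t : ℝ) * D) ^ j / j ! := by
    intro n j
    have h1 : (n.choose j : ℝ) * ((t : ℝ) / n) ^ j ≤ (t : ℝ) ^ j / j ! := by
      rcases Nat.eq_zero_or_pos n with rfl | hn
      · rcases Nat.eq_zero_or_pos j with rfl | hj
        · simp
        · simp [Nat.choose_eq_zero_of_lt hj]; positivity
      · calc (n.choose j : ℝ) * ((t : ℝ) / n) ^ j ≤ ((n : ℝ) ^ j / j !) * ((t : ℝ) / n) ^ j := by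
              gcongr; exact Nat.choose_le_pow_div (α := ℝ) j n
          _ = (t : ℝ) ^ j / j ! := by
              have : (n : ℝ) ≠ 0 := by positivity
              rw [div_pow]; field_simp
    calc _ ≤ (t : ℝ) ^ j / j ! * (D : ℝ) ^ j := by gcongr; exact haD j
      _ = _ := by rw [mul_pow]; ring
  have hL : ∀ n : ℕ, (lazy ((t / n : ℝ≥0) : ℝ≥0∞) A ^ n) x y =
      ENNReal.ofReal (∑' j : ℕ, (n.choose j : ℝ) * ((t : ℝ) / n) ^ j * a j) := by
    intro n
    rw [tsum_eq_sum (s := Finset.range (n + 1)) fun j hj => by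
      rw [Nat.choose_eq_zero_of_lt (by simpa using hj)]; simp,
      ENNReal.ofReal_sum_of_nonneg fun j _ => by have := ha0 j; positivity, lazy_pow_apply]
    refine Finset.sum_congr rfl fun j _ => ?_
    rw [ENNReal.ofReal_mul (by positivity), ENNReal.ofReal_mul (by positivity), hae,
      ENNReal.ofReal_natCast, ENNReal.ofReal_pow (by positivity), mul_assoc]
    congr 3
    rw [← NNReal.coe_natCast, ← NNReal.coe_div, ENNReal.ofReal_coe_nnreal]
  have hRs : Summable fun j : ℕ => (t : ℝ) ^ j / j ! * a j :=
    Summable.of_nonneg_of_le (fun j => by have := ha0 j; positivity) (fun j => by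
      calc (t : ℝ) ^ j / j ! * a j ≤ (t : ℝ) ^ j / j ! * (D : ℝ) ^ j := by gcongr; exact haD j
        _ = ((t : ℝ) * D) ^ j / j ! := by rw [mul_pow]; ring) hsum
  have hR : ∑' j : ℕ, (t : ℝ≥0∞) ^ j / (j ! : ℝ≥0∞) * (A ^ j) x y =
      ENNReal.ofReal (∑' j : ℕ, (t : ℝ) ^ j / j ! * a j) := by
    rw [ENNReal.ofReal_tsum_of_nonneg (fun j => by have := ha0 j; positivity) hRs]
    refine tsum_congr fun j => ?_
    rw [ENNReal.ofReal_mul (by positivity), ENNReal.ofReal_div_of_pos (by positivity), hae,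
      ENNReal.ofReal_pow (by positivity), ENNReal.ofReal_coe_nnreal, ENNReal.ofReal_natCast]
  rw [hR]
  simp_rw [hL]
  refine ENNReal.tendsto_ofReal (tendsto_tsum_of_dominated_convergence hsum (fun j => ?_)
    (Eventually.of_forall fun n j => ?_))
  · refine Tendsto.mul_const _ ?_
    have h1 : Tendsto (fun n : ℕ => (n : ℝ) * ((t : ℝ) / n)) atTop (𝓝 t) := by
      refine tendsto_const_nhds.congr' ?_
      filter_upwards [eventually_gt_atTop 0] with n hn
      field_simp
    exact tendsto_choose_mul_pow_atTop j h1
  · rw [Real.norm_of_nonneg (by have := ha0 j; positivity)]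
    exact hle n j

end Kern

/-- Constants and the polynomial numbers of vertices on paths disappear in a small exponential; `3 N
+ 1` dominates `n + 1` for `n ≤ 3 N`. -/
theorem exists_mul_pow_le_eexp {K : ℝ≥0∞} (hK : K ≠ ∞) (R : ℕ) {a : ℝ} (ha : 0 < a) :
    ∃ N₀ : ℕ, ∀ N ≥ N₀, K * ((3 * N + 1 : ℕ) : ℝ≥0∞) ^ R ≤ eexp (N * a) := by
  have h1 := (isLittleO_pow_exp_pos_mul_atTop R ha).comp_tendsto tendsto_natCast_atTop_atTop
  have h2 := h1.def (c := (4 ^ R * (K.toReal + 1))⁻¹) (by positivity)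
  obtain ⟨N₀, hN₀⟩ := eventually_atTop.1 h2
  refine ⟨max N₀ 1, fun N hN => ?_⟩
  have h3 := hN₀ N (le_of_max_le_left hN)
  have hN1 : (1 : ℝ) ≤ N := by exact_mod_cast le_of_max_le_right hN
  simp only [Function.comp] at h3
  rw [Real.norm_of_nonneg (by positivity), Real.norm_of_nonneg (by positivity),
    inv_mul_eq_div, le_div_iff₀ (by positivity)] at h3
  rw [← ENNReal.ofReal_toReal hK, ← ENNReal.ofReal_natCast, ← ENNReal.ofReal_pow (by positivity),
    ← ENNReal.ofReal_mul (by positivity), eexp]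
  apply ENNReal.ofReal_le_ofReal
  calc K.toReal * ((3 * N + 1 : ℕ) : ℝ) ^ R ≤ (K.toReal + 1) * (4 * N) ^ R := by
        gcongr
        · linarith
        · push_cast; linarith
    _ = N ^ R * (4 ^ R * (K.toReal + 1)) := by rw [mul_pow]; ring
    _ ≤ Real.exp (a * N) := h3
    _ = _ := by rw [mul_comm]

namespace MixedGraph
variable {V : Type u} {E : Type v} {G : MixedGraph V E} {D : ℕ}
variable {Ω : Type*} [MeasurableSpace Ω] {F : Measure ℝ≥0} {μ : Measure Ω} [IsProbabilityMeasure μ]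

set_option maxHeartbeats 1000000 in
-- All errors are rates per coordinate: `e` is charged for each window, `η` for each moved
-- coordinate, and `c` is the rate at which the entrance in slice `h` may be unlikely. Windows of at
-- most `ℓ` steps are bounded by `hshort`, longer ones by typicality.
theorem chain_of_bounds (hG : G.Loopless) (hD : G.DegreeLE D) (hA : G.adj.Tame D)
    (hrev : G.adj.Reversible) {ρ₁ ρ₂ δ : ℝ≥0} (hF₁ : ∀ y ≤ δ, ρ₁ * y ≤ F (Set.Iic y))
    (hF₂ : ∀ y ≤ δ, F (Set.Iic y) ≤ ρ₂ * y) (hρ : ρ₁ ≠ 0) (hρρ : ρ₁ ≤ ρ₂)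
    (hθ0 : ρ₂ * δ ≠ 0) (hθ1 : ρ₂ * δ ≤ 1)
    {h : ℕ} (hh : 0 < h) {v w : V} {C g₁ : ℝ} (hC1 : 1 ≤ C) (hg₁ : 0 ≤ g₁)
    (hC : ∀ i ≤ 2 * h, ∀ x y, (Kern.lazy (ρ₂ * δ : ℝ≥0) G.adj ^ i) x y ≤ ENNReal.ofReal C)
    (hg : 2 * (ρ₂ * δ : ℝ≥0) * D * (1 + 2 * (ρ₂ * δ : ℝ≥0) * D : ℝ) ^ (2 * h) ≤ g₁)
    (hZ : 1 ≤ (Kern.lazy (ρ₂ * δ : ℝ≥0) G.adj ^ (2 * h)) v w)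
    (hhalf : (Kern.lazy (ρ₂ * δ : ℝ≥0) G.adj ^ (2 * h)) v w * ENNReal.ofReal (Real.log C) ≤
      Kern.psi C (Kern.lazy (ρ₂ * δ : ℝ≥0) G.adj) v w h h)
    {ε : ℝ} (hε : 0 < ε) {c e η err : ℝ} {ℓ : ℕ}
    (hc : c ≤ Real.log ((Kern.lazy (ρ₂ * δ : ℝ≥0) G.adj ^ (2 * h)) v w).toReal)
    (hshort : ∀ j, j + 1 ≤ ℓ → ∀ x y, (Kern.lazy (ρ₂ * δ : ℝ≥0) G.adj ^ (j + 1)) x y ≤ eexp e)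
    (he0 : 0 ≤ e)
    (hlong : (ε + (Real.log C - Real.log (ρ₂ * δ : ℝ≥0)) * (2 * (g₁ + ε))) +
      Real.log ((Kern.lazy (ρ₂ * δ : ℝ≥0) G.adj ^ (2 * h)) v w).toReal / (2 * h) ≤ ℓ * e)
    (hη : ((ρ₂ / ρ₁ * (1 + D * (ρ₂ * δ)) : ℝ≥0) : ℝ) ≤ Real.exp η) (hη0 : 0 ≤ η)
    (herr : 4 * h * (g₁ + ε) * η + 4 * h * e < err)
    {q₁ : ℝ≥0∞} (hq₁ : q₁ ≠ 0) (hq₁1 : q₁ ≤ 1) :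
    ∃ N₀ : ℕ, ∀ N ≥ N₀, ∃ 𝒞 : Finset (Fin (2 * h + 1) → Fin N → V),
      (∀ z ∈ 𝒞, z 0 = fun _ => v) ∧ (∀ z ∈ 𝒞, z (Fin.last _) = fun _ => w) ∧
      ∀ n ≤ 3 * N, ∀ τ : PowEdge V E n → Ω → ℝ≥0, IIDField τ F μ →
      ∀ (m : Fin N ↪ Fin n) (u : ℕ → V) (P : ℕ → Fin n → ℕ),
      (∀ r < 2 * h, ∀ r' < 2 * h, r ≠ r' → ∃ j ∉ Set.range m, u (P r j) ≠ u (P r' j)) →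
      ∀ (Q : ℕ → (Fin N → V) → Set Ω) (U : ℕ → (Fin N → V) → Set (PowEdge V E n)),
      (∀ r x, MeasurableSet[sig τ (U r x)] (Q r x)) →
      (∀ r < 2 * h, ∀ r' < 2 * h, ∀ x x', (r ≠ r' ∨ x ≠ x') → Disjoint (U r x) (U r' x')) →
      (∀ r x, ∀ f ∈ U r x, f.1 ∉ Set.range m) →
      (∀ r x, r ≠ h → q₁ ≤ μ (Q r x)) → (∀ x, eexp (-(c * N)) ≤ μ (Q h x)) →
      eexp (-(err * N)) ≤ μ (⋃ z ∈ 𝒞, ⋂ r : Fin (2 * h), Q r (z r.castSucc) ∩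
        cubeEvent G τ (conf m u (P r) (z r.castSucc)) (conf m u (P r) (z r.succ)) δ) := by
  set W := Kern.lazy (ρ₂ * δ : ℝ≥0) G.adj with hW
  set Z := (W ^ (2 * h)) v w with hZd
  set cR := Real.log Z.toReal with hcR
  have hZt : Z ≠ ∞ := hA.pow_ne_top ENNReal.coe_ne_top _ _ _
  have hZ1 : 1 ≤ Z.toReal := by rw [← ENNReal.toReal_one]; exact ENNReal.toReal_mono hZt hZ
  have hcR0 : 0 ≤ cR := Real.log_nonneg hZ1
  have hZe : Z = eexp cR := by
    rw [eexp, hcR, Real.exp_log (by linarith), ENNReal.ofReal_toReal hZt]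
  have hhr : (0 : ℝ) < h := by exact_mod_cast hh
  have hgap : 0 < err - (4 * h * (g₁ + ε) * η + 4 * h * e) := by linarith
  obtain ⟨N₁, hN₁⟩ := Kern.exists_typical hA hrev hθ0 hθ1 hh hC1 hC hg hZ hhalf hε
  obtain ⟨N₂, hN₂⟩ := exists_mul_pow_le_eexp
    (K := 4 * q₁⁻¹ ^ (2 * h) * 2 ^ (2 * h))
    (by have := ENNReal.inv_ne_top.2 hq₁; finiteness) (2 * (2 * h)) hgap
  refine ⟨max N₁ N₂, fun N hN => ?_⟩
  obtain ⟨𝒞, h𝒞0, h𝒞l, h𝒞W, h𝒞Z, h𝒞m, h𝒞g⟩ := hN₁ N (le_of_max_le_left hN)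
  have hlarge := hN₂ N (le_of_max_le_right hN)
  refine ⟨𝒞, h𝒞0, h𝒞l, fun n hn τ hτ m u P hsep Q U hQU hU hUm hQ₁ hQ => ?_⟩
  set g : ℝ≥0∞ := eexp (N * e) with hgd
  set Λ : ℝ≥0∞ := eexp (N * (cR / (2 * h) + e)) with hΛd
  have hNr : (0 : ℝ) ≤ N := Nat.cast_nonneg N
  have hΛ1 : 1 ≤ Λ := one_le_eexp (by positivity)
  have hg1 : 1 ≤ g := one_le_eexp (by positivity)
  have hsh : ∀ j, j + 1 ≤ ℓ → ∀ a b : Fin N → V, Kern.tens (W ^ (j + 1)) a b ≤ g := by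
    intro j hj a b
    rw [Kern.tens_apply, hgd, eexp_nsmul]
    calc _ ≤ ∏ _i : Fin N, eexp e := Finset.prod_le_prod' fun i _ => hshort j hj _ _
      _ = _ := by simp
  -- `Λ` grows at the rate `log Z / (2 h)` per step, up to `e`. For windows shorter than half of the
  -- chain typicality gives no exponential growth, so `g` itself can serve as `Λ'`.
  have main := sum_chain_le_measure hτ hG hD hF₁ hF₂ hρ hρρ (R := 2 * h) (two_mul h) hh hh P hsep 𝒞
    h𝒞0 h𝒞l h𝒞W (k := ⌊N * (g₁ + ε)⌋₊) (fun z hz r => Nat.le_floor (h𝒞m z hz r)) Q U hQU hU hUm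
    hq₁ hq₁1 (eexp_ne_zero _) hQ₁ hQ g Λ g (fun z hz r r' j hj a ha b hb => by
      by_cases hjl : j + 1 ≤ ℓ
      · exact (hsh j hjl a b).trans (le_mul_of_one_le_right' (one_le_pow₀ hΛ1))
      · refine (h𝒞g z hz r r' j hj a ha b hb).trans ?_
        rw [← eexp, hgd, hΛd, ← eexp_nsmul, ← eexp_add]
        apply eexp_mono
        have hjl' : (ℓ : ℝ) ≤ j := by exact_mod_cast (by omega : ℓ ≤ j)
        have h1 : (ℓ : ℝ) * e ≤ j * e := mul_le_mul_of_nonneg_right hjl' he0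
        have h2 : (if j + 1 ≤ h then 0 else ((j : ℝ) + 1) / (2 * h) * cR) ≤
            (j + 1) * (cR / (2 * h)) := by
          split_ifs
          · positivity
          · apply le_of_eq; ring
        have h3 := mul_le_mul_of_nonneg_left (add_le_add h2 (by linarith :
          (ε + (Real.log C - Real.log (ρ₂ * δ : ℝ≥0)) * (2 * (g₁ + ε))) ≤
          (ℓ : ℝ) * e - cR / (2 * h))) hNr
        refine h3.trans ?_
        have h4 := mul_le_mul_of_nonneg_left h1 hNr
        have h5 : 0 ≤ (N : ℝ) * e := by positivity
        linarith)
    (fun z hz r r' j hj hj1 _ a ha b hb => by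
      by_cases hjl : j + 1 ≤ ℓ
      · exact (hsh j hjl a b).trans (le_mul_of_one_le_right' (one_le_pow₀ hg1))
      · refine (h𝒞g z hz r r' j hj a ha b hb).trans ?_
        rw [← eexp, hgd, ← eexp_nsmul, ← eexp_add, if_pos (by omega), zero_add]
        apply eexp_mono
        have hjl' : (ℓ : ℝ) ≤ j := by exact_mod_cast (by omega : ℓ ≤ j)
        have h1 : (ℓ : ℝ) * e ≤ j * e := mul_le_mul_of_nonneg_right hjl' he0
        have h2 : 0 ≤ cR / (2 * h) := by positivity
        have h4 := mul_le_mul_of_nonneg_left h1 hNr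
        have h5 : 0 ≤ (N : ℝ) * e := by positivity
        have h6 := mul_le_mul_of_nonneg_left (by linarith : (ε + (Real.log C -
          Real.log (ρ₂ * δ : ℝ≥0)) * (2 * (g₁ + ε))) ≤ ℓ * e) hNr
        refine h6.trans ?_
        linarith) rfl
  set X := μ (⋃ z ∈ 𝒞, ⋂ r : Fin (2 * h), Q r (z r.castSucc) ∩
        cubeEvent G τ (conf m u (P r) (z r.castSucc)) (conf m u (P r) (z r.succ)) δ) with hX
  have hκ : ((ρ₂ / ρ₁ * (1 + D * (ρ₂ * δ)) : ℝ≥0) : ℝ≥0∞) ≤ eexp η := by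
    rw [← ENNReal.ofReal_coe_nnreal]
    exact ENNReal.ofReal_le_ofReal hη
  have hB1 : ((((ρ₂ / ρ₁ * (1 + D * (ρ₂ * δ)) : ℝ≥0) : ℝ≥0∞) ^ ⌊N * (g₁ + ε)⌋₊) ^ (2 * h)) ^ 2 ≤
      eexp (N * (4 * h * (g₁ + ε) * η)) := by
    calc _ ≤ ((eexp η ^ ⌊N * (g₁ + ε)⌋₊) ^ (2 * h)) ^ 2 := by gcongr
      _ = eexp ((2 : ℕ) * ((2 * h : ℕ) * (⌊N * (g₁ + ε)⌋₊ * η))) := by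
          rw [eexp_nsmul, eexp_nsmul, eexp_nsmul]
      _ ≤ _ := by
          apply eexp_mono
          have h1 : (⌊N * (g₁ + ε)⌋₊ : ℝ) ≤ N * (g₁ + ε) := Nat.floor_le (by positivity)
          have h2 := mul_le_mul_of_nonneg_right h1 (by positivity : 0 ≤ h * η)
          push_cast
          linarith
  set LN : ℝ≥0∞ := ((3 * N + 1 : ℕ) : ℝ≥0∞) ^ 2 with hLN
  have hLn : ((n : ℝ≥0∞) + 1) ^ 2 ≤ LN := by
    rw [hLN]
    gcongr
    exact_mod_cast (by omega : n + 1 ≤ 3 * N + 1)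
  have hLN1 : 1 ≤ LN := one_le_pow₀ (by exact_mod_cast (by omega : 1 ≤ 3 * N + 1))
  have hB2 : (1 + ((n : ℝ≥0∞) + 1) ^ 2 * g) ^ (2 * h) ≤
      (2 * LN) ^ (2 * h) * eexp (N * (2 * h * e)) := by
    calc _ ≤ (2 * LN * g) ^ (2 * h) := by
          gcongr
          rw [mul_assoc, two_mul]
          gcongr
          exact one_le_mul hLN1 hg1
      _ = _ := by
          rw [mul_pow, hgd, ← eexp_nsmul]
          congr 2
          push_cast; ring
  have hh2 : ((2 * h - 1 : ℕ) : ℝ) = 2 * h - 1 := by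
    rw [Nat.cast_sub (by omega)]; push_cast; ring
  have hh3 : ((2 * h - 2 : ℕ) : ℝ) = 2 * h - 2 := by
    rw [Nat.cast_sub (by omega)]; push_cast; ring
  have hT1 : g * Λ ^ (2 * h - 1) ≤ eexp (N * (2 * h * e + cR)) := by
    rw [hgd, hΛd, ← eexp_nsmul, ← eexp_add, hh2]
    apply eexp_mono
    have h1 : (2 * h : ℝ) * (cR / (2 * h)) = cR := by field_simp
    have h2 : 0 ≤ cR / (2 * h) := by positivity
    have h3 : (2 * h - 1) * (cR / (2 * h) + e) + e ≤ 2 * h * e + cR := by nlinarith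
    linarith [mul_le_mul_of_nonneg_left h3 hNr]
  -- A meeting in slice `h` costs `exp (c N)`. Since `c ≤ log Z`, this is not more than the weight
  -- `Z ^ N` of the chains that do not meet.
  have hT2 : (eexp (-(c * N)))⁻¹ * (g ^ 2 * g ^ (2 * h - 2)) ≤ eexp (N * (2 * h * e + cR)) := by
    rw [← eexp_neg, neg_neg, ← pow_add, hgd, ← eexp_nsmul, ← eexp_add,
      show 2 + (2 * h - 2) = 2 * h by omega]
    apply eexp_mono
    push_cast
    linarith [mul_le_mul_of_nonneg_right hc hNr]
  -- Both parts of the second moment are `Z ^ N` up to small rates, so one factor `Z ^ N` cancels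
  -- and only the error rate is left.
  have hfin : eexp (N * cR) ≤ X * eexp (N * (err + cR)) := by
    calc eexp (N * cR) = Z ^ N := by rw [hZe, eexp_nsmul]
      _ ≤ _ := h𝒞Z
      _ ≤ 2 * (X * (eexp (N * (4 * h * (g₁ + ε) * η)) * q₁⁻¹ ^ (2 * h) *
          (eexp (N * (2 * h * e + cR)) * ((2 * LN) ^ (2 * h) * eexp (N * (2 * h * e))) +
            eexp (N * (2 * h * e + cR)) * ((2 * LN) ^ (2 * h) * eexp (N * (2 * h * e)))))) := by
          refine mul_le_mul_right (main.trans ?_) _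
          refine mul_le_mul_right ?_ _
          refine mul_le_mul' (mul_le_mul' hB1 le_rfl) (add_le_add (mul_le_mul' hT1 hB2) ?_)
          rw [← mul_assoc]
          exact mul_le_mul' hT2 hB2
      _ = X * (eexp (N * (4 * h * (g₁ + ε) * η)) * eexp (N * (2 * h * e + cR)) *
          eexp (N * (2 * h * e)) * ((4 * q₁⁻¹ ^ (2 * h) * 2 ^ (2 * h)) * LN ^ (2 * h))) := by
          rw [mul_pow]; ring
      _ ≤ X * (eexp (N * (4 * h * (g₁ + ε) * η)) * eexp (N * (2 * h * e + cR)) *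
          eexp (N * (2 * h * e)) * eexp (N * (err - (4 * h * (g₁ + ε) * η + 4 * h * e)))) := by
          rw [hLN, ← pow_mul]
          refine mul_le_mul_right ?_ _
          exact mul_le_mul_right hlarge _
      _ = _ := by
          rw [← eexp_add, ← eexp_add, ← eexp_add]
          congr 2
          ring
  rw [mul_add, eexp_add, ← mul_assoc] at hfin
  have h1 := (ENNReal.mul_le_mul_iff_left (eexp_ne_zero (N * cR)) (eexp_ne_top _)).1
    ((one_mul _).trans_le hfin)
  rw [eexp_neg, ← one_div, mul_comm err]
  exact ENNReal.div_le_of_le_mul h1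

end MixedGraph

/-! ### Choice of the discretization and of the error rates. -/

theorem ClassC.exists_bounds {ρ ρ₁ ρ₂ : ℝ≥0} {F : Measure ℝ≥0} (hF : ClassC ρ F) (h₁ : ρ₁ < ρ)
    (h₂ : ρ < ρ₂) : ∃ δ₀ > 0, ∀ y ≤ δ₀, ρ₁ * y ≤ F (Set.Iic y) ∧ F (Set.Iic y) ≤ ρ₂ * y := by
  have h3 : ∀ᶠ x in 𝓝[>] (0 : ℝ≥0), F (Set.Iic x) / (x : ℝ≥0∞) ∈ Set.Ioo (ρ₁ : ℝ≥0∞) ρ₂ :=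
    hF.tendsto.eventually (Ioo_mem_nhds (by exact_mod_cast h₁) (by exact_mod_cast h₂))
  obtain ⟨δ, hδ, h4⟩ := mem_nhdsGT_iff_exists_Ioo_subset.1 h3
  have hδ : 0 < δ := hδ
  have key : ∀ y, 0 < y → y < δ → ρ₁ * y ≤ F (Set.Iic y) ∧ F (Set.Iic y) ≤ ρ₂ * y := by
    intro y hy hyδ
    have h5 := h4 ⟨hy, hyδ⟩
    have hy0 : (y : ℝ≥0∞) ≠ 0 := by exact_mod_cast hy.ne'
    have h5' : F (Set.Iic y) / (y : ℝ≥0∞) ∈ Set.Ioo (ρ₁ : ℝ≥0∞) ρ₂ := h5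
    exact ⟨(ENNReal.le_div_iff_mul_le (.inl hy0) (.inl ENNReal.coe_ne_top)).1 h5'.1.le,
      (ENNReal.div_le_iff hy0 ENNReal.coe_ne_top).1 h5'.2.le⟩
  refine ⟨δ / 2, half_pos hδ, fun y hy => ?_⟩
  rcases eq_or_ne y 0 with rfl | hy0
  -- There is no atom at zero: `F (Iic 0)` is at most `ρ₂ y` for all small `y > 0`.
  · simp only [ENNReal.coe_zero, mul_zero, zero_le, true_and]
    refine le_of_tendsto_of_tendsto' (b := atTop) tendsto_const_nhds (f := fun _ : ℕ => F (Set.Iic 0))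
      (g := fun k : ℕ => (ρ₂ : ℝ≥0∞) * ((δ / 2 / (k + 1) : ℝ≥0) : ℝ≥0∞)) ?_ fun k => ?_
    · have : Tendsto (fun k : ℕ => (δ / 2 / (k + 1) : ℝ≥0)) atTop (𝓝 0) := by
        have := tendsto_const_div_atTop_nhds_zero_nat (δ / 2 : ℝ≥0)
        have := (tendsto_add_atTop_iff_nat 1).2 this
        simpa using this
      have h6 := ENNReal.Tendsto.const_mul (a := (ρ₂ : ℝ≥0∞)) (ENNReal.tendsto_coe.2 this)
        (.inr ENNReal.coe_ne_top)
      simpa using h6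
    · have hk : (0 : ℝ≥0) < δ / 2 / (k + 1) := by positivity
      have hk2 : δ / 2 / ((k : ℝ≥0) + 1) < δ :=
        (div_le_self (by positivity) (by simp)).trans_lt (half_lt_self hδ)
      exact (measure_mono (Set.Iic_subset_Iic.2 bot_le)).trans (key _ hk hk2).2
  · exact key y (pos_iff_ne_zero.2 hy0) (hy.trans_lt (half_lt_self hδ))

namespace Kern
variable {V : Type u} {A : Kern V} {D : ℕ}

theorem one_le_lazy_pow (c : ℝ≥0∞) (A : Kern V) (n : ℕ) (x : V) : 1 ≤ (lazy c A ^ n) x x := by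
  induction n with
  | zero => simp
  | succ n ih => exact ih.trans (lazy_pow_mono_left c A n x x)

theorem Tame.pow_le_exp (hA : A.Tame D) (c : ℝ≥0) {k : ℕ} {T : ℝ} (hT : k * (c * D : ℝ) ≤ T)
    (x y : V) : (lazy c A ^ k) x y ≤ ENNReal.ofReal (Real.exp T) := by
  refine (hA.pow_le c k x y).trans ?_
  have h1 : ((1 : ℝ≥0∞) + c * D) ^ k = ENNReal.ofReal ((1 + c * D : ℝ) ^ k) := by
    rw [ENNReal.ofReal_pow (by positivity), ENNReal.ofReal_add (by simp) (by positivity),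
      ENNReal.ofReal_mul (by positivity)]
    simp
  rw [h1]
  apply ENNReal.ofReal_le_ofReal
  calc (1 + c * D : ℝ) ^ k ≤ Real.exp (c * D) ^ k := by
        gcongr
        rw [add_comm]
        exact Real.add_one_le_exp _
    _ = Real.exp (k * (c * D)) := (Real.exp_nat_mul _ _).symm
    _ ≤ _ := Real.exp_le_exp.2 hT

end Kern

theorem tendsto_log_div_nat (A B : ℝ) :
    Tendsto (fun ℓ : ℕ => (A + B * Real.log ℓ) / ℓ) atTop (𝓝 0) := by
  have h1 : Tendsto (fun ℓ : ℕ => Real.log ℓ / ℓ) atTop (𝓝 0) :=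
    (Real.isLittleO_log_id_atTop.tendsto_div_nhds_zero).comp tendsto_natCast_atTop_atTop
  have h2 := tendsto_const_div_atTop_nhds_zero_nat A
  have h3 := h2.add (h1.const_mul B)
  simp only [mul_zero, add_zero] at h3
  refine h3.congr fun ℓ => ?_
  ring

namespace MixedGraph
variable {V : Type u} {E : Type v} {G : MixedGraph V E} {D : ℕ}
variable {Ω : Type*} [MeasurableSpace Ω] {F : Measure ℝ≥0} {μ : Measure Ω} [IsProbabilityMeasure μ]

theorem genFun_ne_top (hA : G.adj.Tame D) (t : ℝ≥0) (x y : V) : G.genFun x y t ≠ ∞ := by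
  rw [genFun_eq_tsum]
  refine ne_top_of_le_ne_top ENNReal.ofReal_ne_top (le_of_tendsto (hA.tendsto_lazy_pow t x y)
    (b := ENNReal.ofReal (Real.exp (t * D))) ?_)
  filter_upwards [eventually_gt_atTop 0] with n hn
  refine hA.pow_le_exp _ (le_of_eq ?_) x y
  have : (n : ℝ) ≠ 0 := by positivity
  push_cast
  field_simp

set_option maxHeartbeats 1000000 in
-- The conditions on `q` are those of `psi_half` in the limit of fine discretization. The order of
-- the quantifiers matters later: the admissible rate `c` of the middle entrance does not depend on
-- `err`, and the bound `q₁` for the other entrances may depend on the number of slices, because it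
-- enters only with a power independent of `N`.
theorem exists_chain (hG : G.Loopless) (hD : G.DegreeLE D) (hA : G.adj.Tame D) (hD1 : 1 ≤ D)
    (hrev : G.adj.Reversible) {v w : V} (hvw : v ≠ w) {t ρ : ℝ≥0} (ht : t ≠ 0) (hρ : 0 < ρ)
    (hF : ClassC ρ F) {q : ℝ} (hq : 0 ≤ q) (hm : 1 < G.genFun v w t)
    (hq1 : ENNReal.ofReal q * G.genFun v w t < G.genFun v w (t / 2))
    (hq2 : Real.log (G.genFun v w t).toReal ≤ q ^ 2) :
    ∃ c > 0, ∀ err > 0, ∃ (h : ℕ) (δ : ℝ≥0), 0 < h ∧ 2 * h * δ * ρ ≤ t ∧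
    ∀ q₁ : ℝ≥0∞, q₁ ≠ 0 → q₁ ≤ 1 →
    ∃ N₀ : ℕ, ∀ N ≥ N₀, ∃ 𝒞 : Finset (Fin (2 * h + 1) → Fin N → V),
      (∀ z ∈ 𝒞, z 0 = fun _ => v) ∧ (∀ z ∈ 𝒞, z (Fin.last _) = fun _ => w) ∧
      ∀ n ≤ 3 * N, ∀ τ : PowEdge V E n → Ω → ℝ≥0, IIDField τ F μ →
      ∀ (m : Fin N ↪ Fin n) (u : ℕ → V) (P : ℕ → Fin n → ℕ),
      (∀ r < 2 * h, ∀ r' < 2 * h, r ≠ r' → ∃ j ∉ Set.range m, u (P r j) ≠ u (P r' j)) →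
      ∀ (Q : ℕ → (Fin N → V) → Set Ω) (U : ℕ → (Fin N → V) → Set (PowEdge V E n)),
      (∀ r x, MeasurableSet[sig τ (U r x)] (Q r x)) →
      (∀ r < 2 * h, ∀ r' < 2 * h, ∀ x x', (r ≠ r' ∨ x ≠ x') → Disjoint (U r x) (U r' x')) →
      (∀ r x, ∀ f ∈ U r x, f.1 ∉ Set.range m) →
      (∀ r x, r ≠ h → q₁ ≤ μ (Q r x)) → (∀ x, eexp (-(c * N)) ≤ μ (Q h x)) →
      eexp (-(err * N)) ≤ μ (⋃ z ∈ 𝒞, ⋂ r : Fin (2 * h), Q r (z r.castSucc) ∩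
        cubeEvent G τ (conf m u (P r) (z r.castSucc)) (conf m u (P r) (z r.succ)) δ) := by
  set M := G.genFun v w t with hM
  have hMt : M ≠ ∞ := genFun_ne_top hA t v w
  have hMr : 1 < M.toReal := by
    rw [← ENNReal.toReal_one]; exact (ENNReal.toReal_lt_toReal (by simp) hMt).2 hm
  set cm := Real.log M.toReal with hcm
  have hcm0 : 0 < cm := Real.log_pos hMr
  have hMe : M = eexp cm := by
    rw [eexp, hcm, Real.exp_log (by linarith), ENNReal.ofReal_toReal hMt]
  -- `Z` only approximates `genFun`, so half of the limiting rate is used.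
  refine ⟨cm / 2, by linarith, fun err herr => ?_⟩
  have htr : (0 : ℝ) < t := by positivity
  have hDr : (1 : ℝ) ≤ D := by exact_mod_cast hD1
  set T : ℝ := t * D with hT
  have hT0 : 0 < T := by positivity
  -- The sum over the `2 h` steps of the mean move weight is bounded by `G0`, whatever `h` is.
  set G0 : ℝ := 2 * T * Real.exp (2 * T) with hG0d
  have hG0 : 0 < G0 := by positivity
  -- Chosen so that the loss from the two-sided bound for `F`, at rate `ν` for each move, amounts to
  -- `4 G0 ν = err / 4` in total.
  set ν : ℝ := err / (16 * G0) with hν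
  have hν0 : 0 < ν := by positivity
  set a : ℝ≥0 := Real.toNNReal (Real.exp (ν / 2)) with ha
  have har : (a : ℝ) = Real.exp (ν / 2) := Real.coe_toNNReal _ (Real.exp_pos _).le
  have ha1 : 1 < a := by
    rw [← NNReal.coe_lt_coe, har, NNReal.coe_one]
    exact Real.one_lt_exp_iff.2 (by linarith)
  have ha0 : 0 < a := zero_lt_one.trans ha1
  obtain ⟨δ₀, hδ₀, hFb⟩ := hF.exists_bounds (ρ₁ := ρ / a) (ρ₂ := ρ * a) (div_lt_self hρ ha1)
    (lt_mul_of_one_lt_right hρ ha1)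
  -- conditions on `ℓ`
  have hcube : Tendsto (fun ℓ : ℕ => ℓ ^ 3) atTop atTop := tendsto_pow_atTop (by norm_num)
  have h2cube : Tendsto (fun ℓ : ℕ => 2 * ℓ ^ 3) atTop atTop :=
    hcube.const_mul_atTop' (by norm_num)
  have e1 := (hA.tendsto_lazy_pow t v w).comp h2cube
  rw [← genFun_eq_tsum, ← hM] at e1
  have e2 := (hA.tendsto_lazy_pow (t / 2) v w).comp hcube
  rw [← genFun_eq_tsum] at e2
  have ev1 := e1.eventually (lt_mem_nhds (show eexp (cm / 2) < M by
    rw [hMe, eexp, eexp]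
    exact ENNReal.ofReal_lt_ofReal_iff (Real.exp_pos _) |>.2 (Real.exp_lt_exp.2 (by linarith))))
  have ev2 := e2.eventually (lt_mem_nhds hq1)
  have e3 : Tendsto (fun ℓ : ℕ => t / ((2 * ℓ ^ 3 : ℕ) : ℝ≥0)) atTop (𝓝 0) :=
    (tendsto_const_div_atTop_nhds_zero_nat t).comp h2cube
  have ev3 := e3.eventually (gt_mem_nhds (show (0 : ℝ≥0) < min 1 (δ₀ * (ρ * a)) by positivity))
  have e4 := (tendsto_log_div_nat (T ^ 2 + 2 * cm + 2 * G0 * (1 + 4 * (T - Real.log t + Real.log 2)))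
    (24 * G0)).add ((tendsto_const_div_atTop_nhds_zero_nat (2 * G0 * T)).comp hcube)
  rw [add_zero] at e4
  have ev4 := e4.eventually (gt_mem_nhds (show (0 : ℝ) < err / 2 by positivity))
  obtain ⟨ℓ, hℓ1, hℓT, hℓe1, hℓe2, hℓe3, hℓe4⟩ := ((eventually_ge_atTop 1).and
    ((eventually_ge_atTop ⌈T⌉₊).and (ev1.and (ev2.and (ev3.and ev4))))).exists
  simp only [Function.comp] at hℓe1 hℓe2 hℓe4
  -- With `2 ℓ³` slices, windows of at most `ℓ` slices have duration of order `ℓ⁻²`; by `pow_short`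
  -- they cost order `ℓ⁻⁴` each, hence `ℓ⁻¹` altogether. The error `e₁` of a longer window is of
  -- order `ℓ⁻³ log ℓ` and is spread over at least `ℓ` slices, which gives order `ℓ⁻¹ log ℓ`
  -- altogether.
  set h : ℕ := ℓ ^ 3 with hh
  have hh0 : 0 < h := by positivity
  have hℓr : (1 : ℝ) ≤ ℓ := by exact_mod_cast hℓ1
  have hℓ0 : (0 : ℝ) < ℓ := by linarith
  have hhr : (h : ℝ) = ℓ ^ 3 := by rw [hh]; push_cast; rfl
  set θ : ℝ≥0 := t / ((2 * h : ℕ) : ℝ≥0) with hθ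
  have hθr : (θ : ℝ) = t / (2 * ℓ ^ 3) := by rw [hθ]; push_cast; rw [hhr]
  have hθpos : 0 < θ := by positivity
  have hθr0 : (0 : ℝ) < θ := by exact_mod_cast hθpos
  have hθ1 : θ ≤ 1 := (hℓe3.trans_le (min_le_left _ _)).le
  set δ : ℝ≥0 := θ / (ρ * a) with hδ
  have hρδ : ρ * a * δ = θ := by rw [hδ]; field_simp
  have hδδ₀ : δ ≤ δ₀ := by
    rw [hδ, div_le_iff₀ (by positivity)]
    exact (hℓe3.trans_le (min_le_right _ _)).le
  have hℓe2' : ENNReal.ofReal q * M < (Kern.lazy (θ : ℝ≥0∞) G.adj ^ h) v w := by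
    have : θ = t / 2 / (h : ℝ≥0) := by rw [hθ]; push_cast; rw [div_div]
    rw [this]
    exact hℓe2
  refine ⟨h, δ, hh0, ?_, fun q₁ hq₁ hq₁1 => ?_⟩
  · have h1 : 2 * h * δ * (ρ * a) = t := by
      rw [mul_assoc, mul_comm δ, hρδ, hθ]
      push_cast
      field_simp
    calc 2 * h * δ * ρ ≤ 2 * h * δ * (ρ * a) := by
          gcongr; exact le_mul_of_one_le_right' ha1.le
      _ = t := h1
  have hkθ : ∀ k : ℕ, k ≤ 2 * h → (k : ℝ) * (θ * D) ≤ T := by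
    intro k hk
    have hk' : (k : ℝ) ≤ 2 * ℓ ^ 3 := by rw [← hhr]; exact_mod_cast hk
    calc (k : ℝ) * (θ * D) ≤ (2 * ℓ ^ 3) * (θ * D) := by gcongr
      _ = T := by rw [hθr, hT]; field_simp
  have hCb : ∀ i ≤ 2 * h, ∀ x y, (Kern.lazy (θ : ℝ≥0∞) G.adj ^ i) x y ≤
      ENNReal.ofReal (Real.exp T) := fun i hi x y => hA.pow_le_exp θ (hkθ i hi) x y
  set Z := (Kern.lazy (θ : ℝ≥0∞) G.adj ^ (2 * h)) v w with hZ
  have hZt : Z ≠ ∞ := hA.pow_ne_top ENNReal.coe_ne_top _ _ _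
  have hZM : Z ≤ M := by
    rw [hM, genFun_eq_tsum]
    exact Kern.lazy_pow_le_tsum G.adj t (n := 2 * h) (by omega) v w
  have hZe : eexp (cm / 2) ≤ Z := hℓe1.le
  have hZ1 : 1 ≤ Z := (one_le_eexp (by linarith)).trans hZe
  have hZr1 : 1 ≤ Z.toReal := by rw [← ENNReal.toReal_one]; exact ENNReal.toReal_mono hZt hZ1
  have hZlog : Real.log Z.toReal ≤ cm :=
    Real.log_le_log (by linarith) (ENNReal.toReal_mono hMt hZM)
  have hZlog0 : cm / 2 ≤ Real.log Z.toReal := by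
    rw [Real.le_log_iff_exp_le (by linarith)]
    exact (ENNReal.ofReal_le_iff_le_toReal hZt).1 hZe
  have hZlog1 : 0 ≤ Real.log Z.toReal := Real.log_nonneg hZr1
  have hqZ : ENNReal.ofReal q * Z ≤ (Kern.lazy (θ : ℝ≥0∞) G.adj ^ h) v w :=
    (mul_le_mul_right hZM _).trans hℓe2'.le
  have hhalf := hrev.psi_half θ (Real.exp T) q v w hvw h (hCb h (by omega)) (hCb _ le_rfl v w) hZ1 hq
    (hqZ.trans (le_mul_of_one_le_left' (Kern.one_le_lazy_pow _ _ _ _)))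
    (hqZ.trans (le_mul_of_one_le_right' (Kern.one_le_lazy_pow _ _ _ _)))
    (hZlog.trans hq2)
  -- Used both as the bound `g₁` for the mean move weight of one step and as the tolerance in the
  -- law of large numbers.
  set ε : ℝ := G0 / (2 * ℓ ^ 3) with hε
  have hε0 : 0 < ε := by positivity
  set e₁ : ℝ := ε + (T - Real.log θ) * (2 * (ε + ε)) with he₁
  have hlθ : Real.log θ ≤ 0 := Real.log_nonpos hθr0.le (by exact_mod_cast hθ1)
  have hlθ' : Real.log θ = Real.log t - (Real.log 2 + 3 * Real.log ℓ) := by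
    rw [hθr, Real.log_div htr.ne' (by positivity), Real.log_mul (by norm_num) (by positivity),
      Real.log_pow]
    norm_num
  have he₁0 : 0 ≤ e₁ := by
    have : 0 ≤ T - Real.log θ := by linarith
    positivity
  set e : ℝ := T ^ 2 / (4 * ℓ ^ 4) + (e₁ + cm / (2 * ℓ ^ 3)) / ℓ with he
  have he0 : 0 ≤ e := by positivity
  have hTℓ : T ≤ ℓ := (Nat.le_ceil T).trans (by exact_mod_cast hℓT)
  have main := chain_of_bounds (μ := μ) (ρ₁ := ρ / a) (ρ₂ := ρ * a) (δ := δ) hG hD hA hrev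
    (fun y hy => (hFb y (hy.trans hδδ₀)).1) (fun y hy => (hFb y (hy.trans hδδ₀)).2)
    (by positivity) ((div_le_self (by positivity) ha1.le).trans (le_mul_of_one_le_right' ha1.le))
    (by rw [hρδ]; exact hθpos.ne') (by rw [hρδ]; exact hθ1) hh0 (v := v) (w := w) (C := Real.exp T)
    (g₁ := ε) (Real.one_le_exp hT0.le) hε0.le (by rw [hρδ]; exact hCb) ?_
    (by rw [hρδ]; exact hZ1) (by rw [hρδ]; exact hhalf) hε0 (c := cm / 2) (e := e)
    (η := ν + T / (2 * ℓ ^ 3)) (err := err) (ℓ := ℓ) (by rw [hρδ]; exact hZlog0) ?_ he0 ?_ ?_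
    (by positivity) ?_ hq₁ hq₁1
  · exact main
  · rw [hρδ]
    have h1 : 2 * (θ : ℝ) * D = 2 * T / (2 * ℓ ^ 3) := by rw [hθr, hT]; ring
    rw [h1]
    have h2 : (1 + 2 * T / (2 * ℓ ^ 3) : ℝ) ^ (2 * h) ≤ Real.exp (2 * T) := by
      calc (1 + 2 * T / (2 * ℓ ^ 3) : ℝ) ^ (2 * h) ≤ Real.exp (2 * T / (2 * ℓ ^ 3)) ^ (2 * h) := by
            gcongr
            rw [add_comm]
            exact Real.add_one_le_exp _
        _ = Real.exp (2 * T) := by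
            rw [← Real.exp_nat_mul]
            congr 1
            push_cast
            rw [hhr]
            field_simp
    calc _ ≤ 2 * T / (2 * ℓ ^ 3) * Real.exp (2 * T) := by gcongr
      _ = ε := by rw [hε, hG0d]; ring
  · rw [hρδ]
    intro j hj x y
    have h1 : ((j + 1 : ℕ) : ℝ) * (θ * D) ≤ T / (2 * ℓ ^ 2) := by
      have : ((j + 1 : ℕ) : ℝ) ≤ ℓ := by exact_mod_cast hj
      calc ((j + 1 : ℕ) : ℝ) * (θ * D) ≤ ℓ * (θ * D) := by gcongr
        _ = T / (2 * ℓ ^ 2) := by rw [hθr, hT]; field_simp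
    have h2 : T / (2 * ℓ ^ 2) ≤ 1 / 2 := by
      rw [div_le_div_iff₀ (by positivity) (by norm_num)]
      nlinarith
    refine (hA.pow_short θ (j + 1) (h1.trans h2) x y).trans (eexp_mono ?_)
    calc (((j + 1 : ℕ) : ℝ) * (θ * D)) ^ 2 ≤ (T / (2 * ℓ ^ 2)) ^ 2 := by gcongr
      _ = T ^ 2 / (4 * ℓ ^ 4) := by rw [div_pow]; ring
      _ ≤ e := by rw [he]; have : 0 ≤ (e₁ + cm / (2 * ℓ ^ 3)) / ℓ := by positivity
                  linarith
  · rw [hρδ, Real.log_exp, ← hZ, hhr]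
    have h1 : (ℓ : ℝ) * e = T ^ 2 / (4 * ℓ ^ 3) + (e₁ + cm / (2 * ℓ ^ 3)) := by
      rw [he]; field_simp
    rw [h1]
    have h2 : Real.log Z.toReal / (2 * ℓ ^ 3) ≤ cm / (2 * ℓ ^ 3) := by gcongr
    have h3 : 0 ≤ T ^ 2 / (4 * (ℓ : ℝ) ^ 3) := by positivity
    linarith
  · rw [hρδ, Real.exp_add]
    have h1 : ((ρ * a / (ρ / a) : ℝ≥0) : ℝ) = Real.exp ν := by
      have : ρ * a / (ρ / a) = a * a := by field_simp
      rw [this, NNReal.coe_mul, har, ← Real.exp_add]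
      congr 1; ring
    rw [NNReal.coe_mul, h1]
    push_cast
    gcongr
    have h2 : (D : ℝ) * θ = T / (2 * ℓ ^ 3) := by rw [hθr, hT]; ring
    rw [h2, add_comm]
    exact Real.add_one_le_exp _
  · rw [hhr]
    have h1 : 4 * (ℓ : ℝ) ^ 3 * (ε + ε) * (ν + T / (2 * ℓ ^ 3)) + 4 * ℓ ^ 3 * e =
        err / 4 + ((T ^ 2 + 2 * cm + 2 * G0 * (1 + 4 * (T - Real.log t + Real.log 2)) +
          24 * G0 * Real.log ℓ) / ℓ + 2 * G0 * T / (ℓ ^ 3 : ℕ)) := by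
      rw [he, he₁, hlθ', hε, hν]
      push_cast
      field_simp
      ring
    rw [h1]
    linarith

end MixedGraph

/-! ### Exponential growth of the set of reached subsets -/

section growth
variable {E Ω : Type*} {a : ℕ} {τ : E → Ω → ℝ≥0} {f : Finset (Fin a) → Fin a → E}

/-- The event that `Y` is reached from `S` by adding one element, along an edge with passage time
at most `δ`. -/
def reach (τ : E → Ω → ℝ≥0) (f : Finset (Fin a) → Fin a → E) (δ : ℝ≥0)
    (S : Finset (Finset (Fin a))) (Y : Finset (Fin a)) : Set Ω :=
  {ω | ∃ j ∈ Y, Y.erase j ∈ S ∧ τ (f (Y.erase j) j) ω ≤ δ}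

open Classical in
/-- The sets reached from `S` by adding one element. -/
noncomputable def nextSets (τ : E → Ω → ℝ≥0) (f : Finset (Fin a) → Fin a → E) (δ : ℝ≥0)
    (S : Finset (Finset (Fin a))) (ω : Ω) : Finset (Finset (Fin a)) :=
  Finset.univ.filter fun Y => ω ∈ reach τ f δ S Y

/-- The sets reached after `k` generations. -/
noncomputable def growSets (τ : E → Ω → ℝ≥0) (f : Finset (Fin a) → Fin a → E) (δ : ℕ → ℝ≥0) :
    ℕ → Ω → Finset (Finset (Fin a))
  | 0, _ => {∅}
  | k + 1, ω => nextSets τ f (δ k) (growSets τ f δ k ω) ω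

theorem card_of_mem_growSets {δ : ℕ → ℝ≥0} {k : ℕ} {ω : Ω} {Y : Finset (Fin a)}
    (h : Y ∈ growSets τ f δ k ω) : Y.card = k := by
  induction k generalizing Y with
  | zero => rw [Finset.mem_singleton.1 h, Finset.card_empty]
  | succ k ih =>
    simp only [growSets, nextSets, Finset.mem_filter] at h
    obtain ⟨j, hj, hY, -⟩ := h.2
    rw [← Finset.card_erase_add_one hj, ih hY]

/-- The edges from the members of `S`. -/
def outEdges (f : Finset (Fin a) → Fin a → E) (S : Set (Finset (Fin a))) : Set E :=
  {e | ∃ J j, j ∉ J ∧ J ∈ S ∧ e = f J j}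

theorem outEdges_mono {S S' : Set (Finset (Fin a))} (h : S ⊆ S') : outEdges f S ⊆ outEdges f S' :=
  fun _ ⟨J, j, hj, hJ, he⟩ => ⟨J, j, hj, h hJ, he⟩

theorem measurableSet_edge {S : Set E} {e : E} (he : e ∈ S) (δ : ℝ≥0) :
    MeasurableSet[sig τ S] {ω | τ e ω ≤ δ} :=
  (measurable_sig he) measurableSet_Iic

/-- The edges into `Y`. -/
def inEdges (f : Finset (Fin a) → Fin a → E) (S : Finset (Finset (Fin a))) (Y : Finset (Fin a)) :
    Set E :=
  {e | ∃ j ∈ Y, Y.erase j ∈ S ∧ e = f (Y.erase j) j}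

theorem measurableSet_reach (δ : ℝ≥0) (S : Finset (Finset (Fin a))) (Y : Finset (Fin a)) :
    MeasurableSet[sig τ (inEdges f S Y)] (reach τ f δ S Y) := by
  have : reach τ f δ S Y = ⋃ j ∈ Y.filter (fun j => Y.erase j ∈ S),
      {ω | τ (f (Y.erase j) j) ω ≤ δ} := by
    ext ω
    simp only [reach, Set.mem_ofPred_eq, Set.mem_iUnion, Finset.mem_filter, exists_prop]
    exact ⟨fun ⟨j, h1, h2, h3⟩ => ⟨j, ⟨h1, h2⟩, h3⟩, fun ⟨j, ⟨h1, h2⟩, h3⟩ => ⟨j, h1, h2, h3⟩⟩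
  rw [this]
  refine Finset.measurableSet_biUnion _ fun j hj => measurableSet_edge ?_ δ
  obtain ⟨h1, h2⟩ := Finset.mem_filter.1 hj
  exact ⟨j, h1, h2, rfl⟩

theorem inEdges_subset (S : Finset (Finset (Fin a))) (Y : Finset (Fin a)) :
    inEdges f S Y ⊆ outEdges f (S : Set (Finset (Fin a))) := by
  rintro e ⟨j, hj, hS, rfl⟩
  exact ⟨Y.erase j, j, Finset.notMem_erase j Y, hS, rfl⟩

theorem measurableSet_nextSets (δ : ℝ≥0) (S : Finset (Finset (Fin a)))
    (𝒰 : Set (Finset (Finset (Fin a)))) :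
    MeasurableSet[sig τ (outEdges f (S : Set (Finset (Fin a))))]
      {ω | nextSets τ f δ S ω ∈ 𝒰} := by
  have h1 : ∀ S', MeasurableSet[sig τ (outEdges f (S : Set (Finset (Fin a))))]
      {ω | nextSets τ f δ S ω = S'} := by
    intro S'
    have : {ω | nextSets τ f δ S ω = S'} =
        ⋂ Y : Finset (Fin a), {ω | ω ∈ reach τ f δ S Y ↔ Y ∈ S'} := by
      ext ω
      simp only [Set.mem_ofPred_eq, Set.mem_iInter, Finset.ext_iff, nextSets, Finset.mem_filter,
        Finset.mem_univ, true_and]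
    rw [this]
    refine MeasurableSet.iInter fun Y => ?_
    have h2 := sig_mono (inEdges_subset S Y) _ (measurableSet_reach (τ := τ) (f := f) δ S Y)
    by_cases hY : Y ∈ S'
    · simp only [hY, iff_true]
      exact h2
    · simp only [hY, iff_false]
      exact h2.compl
  have : {ω | nextSets τ f δ S ω ∈ 𝒰} = ⋃ S' ∈ 𝒰, {ω | nextSets τ f δ S ω = S'} := by
    ext ω; simp
  rw [this]
  exact MeasurableSet.biUnion 𝒰.to_countable fun S' _ => h1 S'

/-- Generation `k` is decided by edges out of sets with fewer than `k` elements, so the step from it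
to the next generation uses fresh edges. -/
theorem measurableSet_growSets (δ : ℕ → ℝ≥0) (k : ℕ) (S : Finset (Finset (Fin a))) :
    MeasurableSet[sig τ (outEdges f {J | J.card < k})] {ω | growSets τ f δ k ω = S} := by
  induction k generalizing S with
  | zero =>
    simp only [growSets]
    exact MeasurableSet.const _
  | succ k ih =>
    have : {ω | growSets τ f δ (k + 1) ω = S} =
        ⋃ S' ∈ {S' : Finset (Finset (Fin a)) | ∀ Y ∈ S', Y.card = k},
          {ω | growSets τ f δ k ω = S'} ∩ {ω | nextSets τ f (δ k) S' ω ∈ ({S} : Set _)} := by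
      ext ω
      simp only [Set.mem_iUnion, Set.mem_inter_iff, Set.mem_ofPred_eq, exists_prop, growSets,
        Set.mem_singleton_iff]
      constructor
      · exact fun h => ⟨_, fun Y hY => card_of_mem_growSets hY, rfl, h⟩
      · rintro ⟨S', -, h1, h2⟩
        rw [h1, h2]
    rw [this]
    refine MeasurableSet.biUnion (Set.to_countable _) fun S' hS' => MeasurableSet.inter
      (sig_mono (outEdges_mono fun J hJ => ?_) _ (ih S'))
      (sig_mono (outEdges_mono fun J hJ => ?_) _ (measurableSet_nextSets (δ k) S' _))
    · exact Nat.lt_succ_of_lt hJ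
    · exact (hS' J hJ).trans_lt (Nat.lt_succ_self k)

/-- Bernoulli's inequality for `(1 + p)^d` and `(1 - p)^d (1 + p)^d ≤ 1` give the bound `1 / (1 + p
d)`. -/
theorem one_sub_pow_le {p : ℝ} (hp0 : 0 ≤ p) (hp1 : p ≤ 1) (d : ℕ) (hd : p * d ≤ 1) :
    (1 - p) ^ d ≤ 1 - p * d / 2 := by
  have h1 : (1 - p) ^ d * (1 + p * d) ≤ 1 := by
    calc (1 - p) ^ d * (1 + p * d) ≤ (1 - p) ^ d * (1 + p) ^ d := by
          have := pow_nonneg (by linarith : 0 ≤ 1 - p) d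
          gcongr
          rw [mul_comm]
          exact one_add_mul_le_pow (by linarith) d
      _ = (1 - p ^ 2) ^ d := by rw [← mul_pow]; ring
      _ ≤ 1 := pow_le_one₀ (by nlinarith) (by nlinarith)
  have h2 : 0 ≤ p * d := by positivity
  have h3 := pow_nonneg (by linarith : 0 ≤ 1 - p) d
  nlinarith

variable [MeasurableSpace Ω] {F : Measure ℝ≥0} {μ : Measure Ω} [IsProbabilityMeasure μ]

theorem IIDField.measure_le_eq (h : IIDField τ F μ) (e : E) (δ : ℝ≥0) :
    μ {ω | τ e ω ≤ δ} = F (Set.Iic δ) := by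
  rw [← h.map_eq e, Measure.map_apply (h.measurable e) measurableSet_Iic]
  rfl

/-- The edges `f J j` with `j ∉ J` are distinct. -/
def DistinctEdges (f : Finset (Fin a) → Fin a → E) : Prop :=
  ∀ J j J' j', j ∉ J → j' ∉ J' → f J j = f J' j' → J = J' ∧ j = j'

/-- Each predecessor of `Y` in `S` offers an independent chance `p`; as long as `p` times their
number is at most `1`, the chance of reaching `Y` is at least half of this product. -/
theorem one_sub_half_measure_reach_le (h : IIDField τ F μ) (hf : DistinctEdges f) {p : ℝ}
    (hp0 : 0 ≤ p) (hp1 : p ≤ 1) {δ : ℝ≥0} (hp : ENNReal.ofReal p ≤ F (Set.Iic δ))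
    (S : Finset (Finset (Fin a))) (Y : Finset (Fin a)) (hY : p * Y.card ≤ 1) :
    1 - μ (reach τ f δ S Y) / 2 ≤ eexp (-(p * (Y.filter fun j => Y.erase j ∈ S).card / 4)) := by
  set d := (Y.filter fun j => Y.erase j ∈ S).card with hd
  have hpd : p * d ≤ 1 := by
    refine le_trans ?_ hY
    gcongr
    exact hd ▸ Finset.card_le_card (Finset.filter_subset _ Y)
  have hc : μ (reach τ f δ S Y)ᶜ ≤ ENNReal.ofReal (1 - p * d / 2) := by
    have h1 : (reach τ f δ S Y)ᶜ = ⋂ j ∈ Y.filter (fun j => Y.erase j ∈ S),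
        {ω | τ (f (Y.erase j) j) ω ≤ δ}ᶜ := by
      ext ω
      simp only [reach, Set.mem_compl_iff, Set.mem_ofPred_eq, Set.mem_iInter, Finset.mem_filter,
        not_exists, not_and]
      exact ⟨fun h j hj => h j hj.1 hj.2, fun h j h1 h2 => h j ⟨h1, h2⟩⟩
    rw [h1, h.measure_biInter (S := fun j => {f (Y.erase j) j}) ?_
      fun j _ => (measurableSet_edge (Set.mem_singleton _) δ).compl]
    · calc _ ≤ ∏ j ∈ Y.filter (fun j => Y.erase j ∈ S), ENNReal.ofReal (1 - p) := by
            refine Finset.prod_le_prod' fun j _ => ?_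
            have hms : MeasurableSet {ω | τ (f (Y.erase j) j) ω ≤ δ} :=
              h.measurable _ measurableSet_Iic
            rw [prob_compl_eq_one_sub hms, h.measure_le_eq,
              ENNReal.ofReal_sub _ hp0, ENNReal.ofReal_one]
            gcongr
        _ = ENNReal.ofReal ((1 - p) ^ d) := by
            rw [Finset.prod_const, ENNReal.ofReal_pow (by linarith)]
        _ ≤ _ := ENNReal.ofReal_le_ofReal (one_sub_pow_le hp0 hp1 d hpd)
    · intro j hj j' hj' hne
      rw [Function.onFun, Set.disjoint_singleton]
      intro he
      exact hne (hf _ _ _ _ (Finset.notMem_erase j Y) (Finset.notMem_erase j' Y) he).2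
  have hm : MeasurableSet (reach τ f δ S Y) := h.sig_le _ _ (measurableSet_reach δ S Y)
  have h0 : (0 : ℝ) ≤ p * d := by positivity
  have hge : ENNReal.ofReal (p * d / 2) ≤ μ (reach τ f δ S Y) := by
    have h2 := prob_add_prob_compl (μ := μ) hm
    have h3 : 1 ≤ μ (reach τ f δ S Y) + ENNReal.ofReal (1 - p * d / 2) := by
      rw [← h2]; gcongr
    rw [ENNReal.ofReal_sub _ (by positivity), ENNReal.ofReal_one] at h3
    have h4 : ENNReal.ofReal (p * d / 2) ≤ 1 := by
      rw [← ENNReal.ofReal_one]; exact ENNReal.ofReal_le_ofReal (by linarith)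
    have h5 : 1 - (1 - ENNReal.ofReal (p * d / 2)) ≤ μ (reach τ f δ S Y) :=
      tsub_le_iff_right.2 h3
    rwa [ENNReal.sub_sub_cancel (by simp) h4] at h5
  calc 1 - μ (reach τ f δ S Y) / 2 ≤ 1 - ENNReal.ofReal (p * d / 2) / 2 := by gcongr
    _ = ENNReal.ofReal (1 - p * d / 4) := by
        rw [ENNReal.ofReal_sub _ (by positivity), ENNReal.ofReal_one,
          show p * d / 4 = p * d / 2 / 2 by ring,
          ENNReal.ofReal_div_of_pos (x := p * d / 2) (by norm_num), ENNReal.ofReal_ofNat]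
    _ ≤ _ := by
        apply ENNReal.ofReal_le_ofReal
        have := Real.add_one_le_exp (-(p * d / 4))
        linarith

theorem eexp_sum {ι : Type*} (s : Finset ι) (f : ι → ℝ) : ∏ i ∈ s, eexp (f i) = eexp (∑ i ∈ s, f i) := by
  simp only [eexp]
  rw [Real.exp_sum, ENNReal.ofReal_prod_of_nonneg fun _ _ => (Real.exp_pos _).le]

/-- Different `Y` are reached through different edges, hence independently. The exponents add up to
`p` times the number of pairs of a set in `S` and an element outside it, which is `S.card * (a -
k)`. -/
theorem measure_nextSets_card_le (h : IIDField τ F μ) (hf : DistinctEdges f) {p : ℝ}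
    (hp0 : 0 ≤ p) (hp1 : p ≤ 1) {δ : ℝ≥0} (hp : ENNReal.ofReal p ≤ F (Set.Iic δ)) {k : ℕ}
    (S : Finset (Finset (Fin a))) (hS : ∀ Y ∈ S, Y.card = k) (hk : p * (k + 1) ≤ 1) (K : ℕ) :
    μ {ω | (nextSets τ f δ S ω).card ≤ K} ≤ eexp (K - p * (S.card * (a - k)) / 4) := by
  classical
  have hdisj : ((Finset.univ : Finset (Finset (Fin a))) : Set _).PairwiseDisjoint
      fun Y => inEdges f S Y := by
    intro Y _ Y' _ hne
    rw [Function.onFun, Set.disjoint_left]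
    rintro e ⟨j, hj, -, rfl⟩ ⟨j', hj', -, he⟩
    obtain ⟨h1, rfl⟩ := hf _ _ _ _ (Finset.notMem_erase j Y) (Finset.notMem_erase j' Y') he
    exact hne (by rw [← Finset.insert_erase hj, h1, Finset.insert_erase hj'])
  have h1 := h.measure_card_le hdisj (A := fun Y => reach τ f δ S Y)
    (fun Y _ => measurableSet_reach δ S Y) K
  have h2 : {ω | (nextSets τ f δ S ω).card ≤ K} =
      {ω | (Finset.univ.filter fun Y => ω ∈ reach τ f δ S Y).card ≤ K} := by
    ext ω
    simp only [nextSets, Set.mem_ofPred_eq]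
  rw [h2]
  refine h1.trans ?_
  have h3 : ∀ Y ∈ (Finset.univ : Finset (Finset (Fin a))), 1 - μ (reach τ f δ S Y) / 2 ≤
      eexp (-(p * (Y.filter fun j => Y.erase j ∈ S).card / 4)) := by
    intro Y _
    by_cases hY : ∃ j ∈ Y, Y.erase j ∈ S
    · obtain ⟨j, hj, hjS⟩ := hY
      refine one_sub_half_measure_reach_le h hf hp0 hp1 hp S Y ?_
      rw [← Finset.card_erase_add_one hj, hS _ hjS]
      push_cast
      exact hk
    · have : (Y.filter fun j => Y.erase j ∈ S) = ∅ :=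
        Finset.filter_eq_empty_iff.2 fun j hj hjS => hY ⟨j, hj, hjS⟩
      rw [this]
      simp [eexp_zero]
  have hcard : (S.card : ℝ) * (a - k) ≤ ∑ Y : Finset (Fin a), ((Y.filter fun j => Y.erase j ∈ S).card : ℝ) := by
    have h4 : ∑ J ∈ S, (Jᶜ : Finset (Fin a)).card ≤
        ∑ Y : Finset (Fin a), (Y.filter fun j => Y.erase j ∈ S).card := by
      rw [← Finset.card_sigma, ← Finset.card_sigma]
      refine Finset.card_le_card_of_injOn
        (fun x => (⟨insert x.2 x.1, x.2⟩ : Sigma fun _ : Finset (Fin a) => Fin a)) ?_ ?_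
      · rintro ⟨J, j⟩ hx
        obtain ⟨hJ, hj⟩ := Finset.mem_sigma.1 hx
        rw [Finset.mem_compl] at hj
        exact Finset.mem_sigma.2 ⟨Finset.mem_univ _, Finset.mem_filter.2
          ⟨Finset.mem_insert_self _ _, by rw [Finset.erase_insert hj]; exact hJ⟩⟩
      · rintro ⟨J, j⟩ hx ⟨J', j'⟩ hx' he
        have hj := Finset.mem_compl.1 (Finset.mem_sigma.1 hx).2
        have hj' := Finset.mem_compl.1 (Finset.mem_sigma.1 hx').2
        simp only [Sigma.mk.injEq, heq_eq_eq] at he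
        obtain ⟨he1, rfl⟩ := he
        simp only [Sigma.mk.injEq, heq_eq_eq, and_true]
        exact (Finset.erase_insert hj).symm.trans ((congrArg (Finset.erase · j) he1).trans
          (Finset.erase_insert hj'))
    have h5 : ∑ J ∈ S, ((Jᶜ : Finset (Fin a)).card : ℝ) = S.card * (a - k) := by
      rw [Finset.sum_congr rfl (g := fun _ => (a : ℝ) - k), Finset.sum_const, nsmul_eq_mul]
      intro J hJ
      rw [Finset.card_compl, Fintype.card_fin, hS J hJ, Nat.cast_sub]
      rw [← hS J hJ]
      exact (Finset.card_le_univ J).trans_eq (Fintype.card_fin a)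
    rw [← h5]
    exact_mod_cast h4
  calc _ ≤ eexp K * ∏ Y : Finset (Fin a), eexp (-(p * (Y.filter fun j => Y.erase j ∈ S).card / 4)) := by
        refine mul_le_mul' ?_ (Finset.prod_le_prod' h3)
        rw [← mul_one (K : ℝ), eexp_nsmul]
        gcongr
        rw [eexp, show (2 : ℝ≥0∞) = ENNReal.ofReal 2 by simp]
        apply ENNReal.ofReal_le_ofReal
        have := Real.add_one_le_exp (1 : ℝ)
        linarith
    _ = eexp (K + ∑ Y : Finset (Fin a), -(p * (Y.filter fun j => Y.erase j ∈ S).card / 4)) := by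
        rw [eexp_sum, ← eexp_add]
    _ ≤ _ := by
        apply eexp_mono
        rw [Finset.sum_neg_distrib, ← Finset.sum_div, ← Finset.mul_sum]
        have := mul_le_mul_of_nonneg_left hcard hp0
        linarith

/-- Exponential growth. -/
theorem measure_growSets_card_le (h : IIDField τ F μ) (hf : DistinctEdges f) {δ : ℕ → ℝ≥0}
    {p₀ p : ℝ} (hp₀ : 0 ≤ p₀) (hp₀1 : p₀ ≤ 1) (hF₀ : ENNReal.ofReal p₀ ≤ F (Set.Iic (δ 0)))
    (hp0 : 0 ≤ p) (hp1 : p ≤ 1) {m : ℕ}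
    (hF : ∀ k, 1 ≤ k → k ≤ m → ENNReal.ofReal p ≤ F (Set.Iic (δ k))) (hpm : p * (m + 1) ≤ 1)
    (ham : 2 * m ≤ a) (hpa : 24 ≤ p * a) (K : ℕ) (hK : K ≤ p₀ * a / 8) :
    μ {ω | (growSets τ f δ (m + 1) ω).card ≤ 2 ^ m * K} ≤ eexp (-(K : ℝ)) + m * eexp (-(K : ℝ)) := by
  induction m with
  | zero =>
    have h1 := measure_nextSets_card_le h hf hp₀ hp₀1 hF₀ (k := 0) {∅} (by simp) (by simpa) K
    simp only [growSets, pow_zero, one_mul, Nat.cast_zero, zero_mul, add_zero]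
    refine h1.trans (eexp_mono ?_)
    simp only [Finset.card_singleton, Nat.cast_one, Nat.cast_zero, sub_zero, one_mul]
    linarith
  | succ m ih =>
    have ih' := ih (fun k h1 h2 => hF k h1 (by omega))
      (le_trans (by push_cast; nlinarith) hpm) (by omega)
    -- For given `S`, the exponent from `measure_nextSets_card_le` is at most `2 |S| - 3 |S|`,
    -- because `p a ≥ 24` and at least half of the `a` elements are unused; and `|S| ≥ K`.
    have hstep : μ {ω | 2 ^ m * K < (growSets τ f δ (m + 1) ω).card ∧
        (growSets τ f δ (m + 2) ω).card ≤ 2 * (growSets τ f δ (m + 1) ω).card} ≤ eexp (-(K : ℝ)) := by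
      set 𝒮 : Finset (Finset (Finset (Fin a))) :=
        Finset.univ.filter fun S => (∀ Y ∈ S, Y.card = m + 1) ∧ 2 ^ m * K < S.card with h𝒮
      have hsub : {ω | 2 ^ m * K < (growSets τ f δ (m + 1) ω).card ∧
          (growSets τ f δ (m + 2) ω).card ≤ 2 * (growSets τ f δ (m + 1) ω).card} ⊆
          ⋃ S ∈ 𝒮, {ω | growSets τ f δ (m + 1) ω = S} ∩
            {ω | (nextSets τ f (δ (m + 1)) S ω).card ≤ 2 * S.card} := by
        rintro ω ⟨h1, h2⟩
        simp only [Set.mem_iUnion]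
        exact ⟨growSets τ f δ (m + 1) ω, Finset.mem_filter.2 ⟨Finset.mem_univ _,
          fun Y hY => card_of_mem_growSets hY, h1⟩, rfl, h2⟩
      have hgm : ∀ S, MeasurableSet {ω | growSets τ f δ (m + 1) ω = S} := fun S =>
        h.sig_le _ _ (measurableSet_growSets δ (m + 1) S)
      calc _ ≤ ∑ S ∈ 𝒮, μ ({ω | growSets τ f δ (m + 1) ω = S} ∩
            {ω | (nextSets τ f (δ (m + 1)) S ω).card ≤ 2 * S.card}) :=
            (measure_mono hsub).trans (measure_biUnion_finset_le _ _)
        _ ≤ ∑ S ∈ 𝒮, μ {ω | growSets τ f δ (m + 1) ω = S} * eexp (-(K : ℝ)) := by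
            refine Finset.sum_le_sum fun S hS => ?_
            obtain ⟨-, hS1, hS2⟩ := Finset.mem_filter.1 hS
            have hi := h.measure_inter (S := outEdges f {J | J.card < m + 1})
              (T := outEdges f (S : Set (Finset (Fin a))))
              (A := {ω | growSets τ f δ (m + 1) ω = S})
              (B := {ω | (nextSets τ f (δ (m + 1)) S ω).card ≤ 2 * S.card})
              ?_ (measurableSet_growSets δ (m + 1) S)
              (measurableSet_nextSets (δ (m + 1)) S {S' | S'.card ≤ 2 * S.card})
            · rw [hi]
              gcongr
              refine (measure_nextSets_card_le h hf hp0 hp1 (hF (m + 1) (by omega) le_rfl) S hS1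
                (by push_cast at hpm ⊢; linarith) (2 * S.card)).trans (eexp_mono ?_)
              have h1 : (K : ℝ) ≤ S.card := by
                have : K ≤ 2 ^ m * K := Nat.le_mul_of_pos_left _ (by positivity)
                exact_mod_cast this.trans hS2.le
              have h2 : (a : ℝ) / 2 ≤ a - (m + 1 : ℕ) := by
                have : (2 * (m + 1 : ℕ) : ℝ) ≤ a := by exact_mod_cast ham
                linarith
              have h3 : p * (S.card * (a / 2)) ≤ p * (S.card * (a - (m + 1 : ℕ))) := by gcongr
              have h4 : 24 * (S.card : ℝ) ≤ p * a * S.card := by gcongr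
              push_cast at h3 ⊢
              nlinarith
            · rw [Set.disjoint_left]
              rintro e ⟨J, j, hj, hJ, rfl⟩ ⟨J', j', hj', hJ', he⟩
              obtain ⟨rfl, -⟩ := hf _ _ _ _ hj hj' he
              have := hS1 J hJ'
              have hJ : J.card < m + 1 := hJ
              omega
        _ = (∑ S ∈ 𝒮, μ {ω | growSets τ f δ (m + 1) ω = S}) * eexp (-(K : ℝ)) := by
            rw [Finset.sum_mul]
        _ ≤ 1 * eexp (-(K : ℝ)) := by
            gcongr
            rw [← measure_biUnion_finset ?_ fun S _ => hgm S]
            · exact prob_le_one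
            · intro S _ S' _ hne
              rw [Function.onFun, Set.disjoint_left]
              intro ω h1 h2
              exact hne (Eq.trans (Eq.symm h1) h2)
        _ = _ := one_mul _
    have hsub : {ω | (growSets τ f δ (m + 1 + 1) ω).card ≤ 2 ^ (m + 1) * K} ⊆
        {ω | (growSets τ f δ (m + 1) ω).card ≤ 2 ^ m * K} ∪
        {ω | 2 ^ m * K < (growSets τ f δ (m + 1) ω).card ∧
          (growSets τ f δ (m + 2) ω).card ≤ 2 * (growSets τ f δ (m + 1) ω).card} := by
      intro ω hω
      by_cases h1 : (growSets τ f δ (m + 1) ω).card ≤ 2 ^ m * K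
      · exact .inl h1
      · refine .inr ⟨not_le.1 h1, ?_⟩
        have h2 : (growSets τ f δ (m + 2) ω).card ≤ 2 ^ (m + 1) * K := hω
        rw [pow_succ] at h2
        show (growSets τ f δ (m + 2) ω).card ≤ 2 * (growSets τ f δ (m + 1) ω).card
        have h3 := not_le.1 h1
        nlinarith
    refine (measure_mono hsub).trans ((measure_union_le _ _).trans
      ((add_le_add ih' hstep).trans (le_of_eq ?_)))
    push_cast
    ring

end growth

namespace MixedGraph
variable {V : Type u} {E : Type v} {G : MixedGraph V E} {D : ℕ}

/-! ### Coordinates -/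

section layout
variable (N a k : ℕ)

/-- The first `N` coordinates. -/
def embM : Fin N ↪ Fin (N + a + k + a) :=
  ⟨fun i => ⟨i, by omega⟩, fun i j h => by simpa [Fin.ext_iff] using h⟩

/-- The block of `a` coordinates after the first `N`. -/
def embB : Fin a ↪ Fin (N + a + k + a) :=
  ⟨fun i => ⟨N + i, by omega⟩, fun i j h => by simpa [Fin.ext_iff] using h⟩

/-- The last `a` coordinates. -/
def embA : Fin a ↪ Fin (N + a + k + a) :=
  ⟨fun i => ⟨N + a + k + i, by omega⟩, fun i j h => by simpa [Fin.ext_iff] using h⟩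

variable {N a k}

theorem val_embA (i : Fin a) : (embA N a k i : ℕ) = N + a + k + i := rfl

theorem val_embB (i : Fin a) : (embB N a k i : ℕ) = N + i := rfl

theorem notMem_range_embM {j : Fin (N + a + k + a)} : j ∉ Set.range (embM N a k) ↔ N ≤ j := by
  constructor
  · intro h
    by_contra hj
    exact h ⟨⟨j, by omega⟩, rfl⟩
  · rintro h ⟨i, rfl⟩
    have h : N ≤ (i : ℕ) := h
    omega

theorem mem_map_embA {J : Finset (Fin a)} {j : Fin (N + a + k + a)} (h : j ∈ J.map (embA N a k)) :
    N + a + k ≤ j := by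
  obtain ⟨i, -, rfl⟩ := Finset.mem_map.1 h
  exact Nat.le_add_right _ _

theorem mem_map_embB {J : Finset (Fin a)} {j : Fin (N + a + k + a)} (h : j ∈ J.map (embB N a k)) :
    N ≤ j ∧ (j : ℕ) < N + a := by
  obtain ⟨i, -, rfl⟩ := Finset.mem_map.1 h
  exact ⟨Nat.le_add_right _ _, by rw [val_embB]; omega⟩

variable (N a k) (h d : ℕ) (J J' : Finset (Fin a))

/-- The progress of the coordinates during slice `r`. -/
def prog (r : ℕ) (j : Fin (N + a + k + a)) : ℕ :=
  if N + a + k ≤ j then (if r < h then (if j ∈ J.map (embA N a k) then 1 else 0) else d)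
  else if N ≤ j ∧ (j : ℕ) < N + a then
    (if r < h then 0 else (if j ∈ J'.map (embB N a k) then d - 1 else d))
  else if N + a ≤ j ∧ (j : ℕ) < N + a + r then d else 0

/-- The order in which the blocks of coordinates move within a transition. -/
def offset (j : Fin (N + a + k + a)) : ℕ :=
  if N + a + k ≤ j then 2 * d else if (j : ℕ) < N + a then 0 else d

variable {N a k h d J J'}

theorem prog_le (hd : 1 ≤ d) (r : ℕ) (j : Fin (N + a + k + a)) : prog N a k h d J J' r j ≤ d := by
  unfold prog
  split_ifs <;> omega

theorem prog_mono (hd : 1 ≤ d) : Monotone (prog N a k h d J J') := by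
  intro r r' hr j
  show prog N a k h d J J' r j ≤ prog N a k h d J J' r' j
  unfold prog
  split_ifs <;> omega

theorem offset_le (j : Fin (N + a + k + a)) : offset N a k d j ≤ 2 * d := by
  unfold offset
  split_ifs <;> omega

/-- The coordinates are, in this order: `N` for the chain, `a` for the end block, `k` clocks, `a`
for the starting block. Entering slice `r` switches one clock, and the two blocks move only on
entering slice `h`. The clocks make the slices disjoint. -/
theorem prog_change {r : ℕ} {j : Fin (N + a + k + a)}
    (hj : prog N a k h d J J' (r - 1) j < prog N a k h d J J' r j) (hr : r ≠ h) :
    (j : ℕ) = N + a + r - 1 ∧ N + a ≤ j ∧ (j : ℕ) < N + a + k ∧ 0 < r := by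
  unfold prog at hj
  split_ifs at hj <;> omega

theorem card_prog_change {r : ℕ} (hr : r ≠ h) :
    (Finset.univ.filter fun j => prog N a k h d J J' (r - 1) j < prog N a k h d J J' r j).card ≤ 1 := by
  refine Finset.card_le_one.2 fun i hi j hj => ?_
  have h1 := prog_change (Finset.mem_filter.1 hi).2 hr
  have h2 := prog_change (Finset.mem_filter.1 hj).2 hr
  exact Fin.ext (by omega)

theorem card_prog_change_mid :
    (Finset.univ.filter fun j => prog N a k h d J J' (h - 1) j < prog N a k h d J J' h j).card ≤
      2 * a + 1 := by
  have hsub : (Finset.univ.filter fun j => prog N a k h d J J' (h - 1) j <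
      prog N a k h d J J' h j).map Fin.valEmbedding ⊆
      Finset.Ico N (N + a) ∪ Finset.Ico (N + a + k) (N + a + k + a) ∪ {N + a + h - 1} := by
    intro x hx
    obtain ⟨j, hj, rfl⟩ := Finset.mem_map.1 hx
    have hj := (Finset.mem_filter.1 hj).2
    have hjn := j.2
    simp only [Finset.mem_union, Finset.mem_Ico, Finset.mem_singleton, Fin.valEmbedding_apply]
    unfold prog at hj
    split_ifs at hj <;> omega
  rw [← Finset.card_map Fin.valEmbedding]
  refine (Finset.card_le_card hsub).trans ((Finset.card_union_le _ _).trans ?_)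
  have := Finset.card_union_le (Finset.Ico N (N + a)) (Finset.Ico (N + a + k) (N + a + k + a))
  simp only [Nat.card_Ico, Finset.card_singleton] at this ⊢
  omega

end layout

/-! ### Disjoint sets of edges for different tries. -/

section tries
variable (E) (N a k h d : ℕ) (u : ℕ → V)

/-- Edges that are reserved for the first half of tries starting at `J`. -/
def edges₁ (J : Finset (Fin a)) : Set (PowEdge V E (N + a + k + a)) :=
  {f | ∃ y j e, f = pe y j e ∧ (j : ℕ) < N + a + k ∧
    (∀ i, y (embA N a k i) = u (if i ∈ J then 1 else 0)) ∧
    ∀ i, i ≠ j → (i : ℕ) = N + a + (h - 1) → y i = u 0}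

/-- Edges that are reserved for the second half of tries ending at `J'`. -/
def edges₂ (J' : Finset (Fin a)) : Set (PowEdge V E (N + a + k + a)) :=
  {f | ∃ y j e, f = pe y j e ∧ ((j : ℕ) < N ∨ N + a ≤ j) ∧ (j : ℕ) ≠ N + a + (h - 1) ∧
    (∀ i, y (embB N a k i) = u (if i ∈ J' then d - 1 else d)) ∧
    ∀ i : Fin (N + a + k + a), (i : ℕ) = N + a + (h - 1) → y i = u d}

/-- Edges that are reserved for the growth near the starting point. -/
def edgesA : Set (PowEdge V E (N + a + k + a)) :=
  {f | ∃ y j e, f = pe y j e ∧ N + a + k ≤ j ∧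
    ∀ i : Fin (N + a + k + a), (i : ℕ) = N + a + (h - 1) → y i = u 0}

/-- Edges that are reserved for the growth near the end point. -/
def edgesB : Set (PowEdge V E (N + a + k + a)) :=
  {f | ∃ y j e, f = pe y j e ∧ (N ≤ j ∧ (j : ℕ) < N + a) ∧
    ∀ i : Fin (N + a + k + a), (i : ℕ) = N + a + (h - 1) → y i = u d}

/-- Edges of the path that moves the coordinates one after the other. -/
def edgesSeq (n : ℕ) : Set (PowEdge V E n) :=
  {f | ∃ y j e, f = pe y j e ∧ (∀ i, i < j → y i = u d) ∧ ∀ i, j < i → y i = u 0}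

variable {E N a k h d u}

/-- These edges never move the starting block, so they show `J`. -/
theorem disjoint_edges₁ (hu : u 0 ≠ u 1) {J J₂ : Finset (Fin a)} (hJ : J ≠ J₂) :
    Disjoint (edges₁ E N a k h u J) (edges₁ E N a k h u J₂) := by
  rw [Set.disjoint_left]
  rintro f ⟨y, j, e, rfl, hj, hy, -⟩ ⟨y', j', e', hf, -, hy', -⟩
  obtain ⟨rfl, rfl, hyy⟩ := pe_eq_iff.1 hf
  apply hJ
  ext i
  have h1 := hyy (embA N a k i) (fun h => by rw [← h, val_embA] at hj; omega)
  rw [hy, hy'] at h1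
  by_cases hi : i ∈ J <;> by_cases hi' : i ∈ J₂ <;> simp [hi, hi', hu, hu.symm] at h1 ⊢

theorem disjoint_edges₂ (hu : u (d - 1) ≠ u d) {J J₂ : Finset (Fin a)} (hJ : J ≠ J₂) :
    Disjoint (edges₂ E N a k h d u J) (edges₂ E N a k h d u J₂) := by
  rw [Set.disjoint_left]
  rintro f ⟨y, j, e, rfl, hj, -, hy, -⟩ ⟨y', j', e', hf, -, -, hy', -⟩
  obtain ⟨rfl, rfl, hyy⟩ := pe_eq_iff.1 hf
  apply hJ
  ext i
  have h1 := hyy (embB N a k i) (fun h => by rw [← h, val_embB] at hj; omega)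
  rw [hy, hy'] at h1
  by_cases hi : i ∈ J <;> by_cases hi' : i ∈ J₂ <;> simp [hi, hi', hu, hu.symm] at h1 ⊢

/-- The clock `N + a + (h - 1)`, switched on entering slice `h`, separates the two halves; the edges
that move this clock are excluded from the second half. -/
theorem disjoint_edges₁₂ (hhk : h - 1 < k) (hu : u 0 ≠ u d) {J J' : Finset (Fin a)} :
    Disjoint (edges₁ E N a k h u J) (edges₂ E N a k h d u J') := by
  rw [Set.disjoint_left]
  rintro f ⟨y, j, e, rfl, -, -, hy⟩ ⟨y', j', e', hf, -, hc, -, hy'⟩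
  obtain ⟨rfl, rfl, hyy⟩ := pe_eq_iff.1 hf
  set c : Fin (N + a + k + a) := ⟨N + a + (h - 1), by omega⟩ with hcd
  have hcj : c ≠ j := fun h => hc (by rw [← h])
  exact hu (by rw [← hy c hcj rfl, ← hy' c rfl, hyy c hcj])

theorem disjoint_edgesA (hhk : h - 1 < k) (hu : u 0 ≠ u d) {J J' : Finset (Fin a)} :
    Disjoint (edgesA E N a k h u) (edges₁ E N a k h u J ∪ edges₂ E N a k h d u J') := by
  rw [Set.disjoint_left]
  rintro f ⟨y, j, e, rfl, hj, hy⟩ (⟨y', j', e', hf, hj', -⟩ | ⟨y', j', e', hf, -, hc, -, hy'⟩)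
  · obtain ⟨rfl, rfl, hyy⟩ := pe_eq_iff.1 hf
    omega
  · obtain ⟨rfl, rfl, hyy⟩ := pe_eq_iff.1 hf
    set c : Fin (N + a + k + a) := ⟨N + a + (h - 1), by omega⟩ with hcd
    have hcj : c ≠ j := fun h => hc (by rw [← h])
    exact hu (by rw [← hy c rfl, ← hy' c rfl, hyy c hcj])

theorem disjoint_edgesB (hhk : h - 1 < k) (hu : u 0 ≠ u d) {J J' : Finset (Fin a)} :
    Disjoint (edgesB E N a k h d u) (edges₁ E N a k h u J ∪ edges₂ E N a k h d u J') := by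
  rw [Set.disjoint_left]
  rintro f ⟨y, j, e, rfl, hj, hy⟩ (⟨y', j', e', hf, hj', -, hy'⟩ | ⟨y', j', e', hf, hj', -⟩)
  · obtain ⟨rfl, rfl, hyy⟩ := pe_eq_iff.1 hf
    set c : Fin (N + a + k + a) := ⟨N + a + (h - 1), by omega⟩ with hcd
    have hcj : c ≠ j := fun h => by rw [← h, hcd] at hj; simp only at hj; omega
    exact hu (by rw [← hy c rfl, ← hy' c hcj rfl, hyy c hcj])
  · obtain ⟨rfl, rfl, hyy⟩ := pe_eq_iff.1 hf
    omega

theorem disjoint_edgesAB : Disjoint (edgesA E N a k h u) (edgesB E N a k h d u) := by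
  rw [Set.disjoint_left]
  rintro f ⟨y, j, e, rfl, hj, hy⟩ ⟨y', j', e', hf, hj', -⟩
  obtain ⟨rfl, rfl, hyy⟩ := pe_eq_iff.1 hf
  omega

/-- Moving the coordinates in increasing order, the sequential path never sees the last block ahead
of time, the first block lagging behind, or the clock in the wrong state. This explains the position
of the blocks at the two ends, and why `J` and `J'` have to be nonempty. -/
theorem disjoint_edgesSeq (hhk : h - 1 < k) (hu : u 0 ≠ u d) (hu0 : u 0 ≠ u 1)
    (hud : u (d - 1) ≠ u d) {J J' : Finset (Fin a)} (hJ : J.Nonempty) (hJ' : J'.Nonempty) :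
    Disjoint (edgesSeq E d u (N + a + k + a)) (edgesA E N a k h u ∪ edgesB E N a k h d u ∪
      (edges₁ E N a k h u J ∪ edges₂ E N a k h d u J')) := by
  rw [Set.disjoint_left]
  set c : Fin (N + a + k + a) := ⟨N + a + (h - 1), by omega⟩ with hcd
  rintro f ⟨y, j, e, rfl, hy1, hy2⟩ ((⟨y', j', e', hf, hj, hy'⟩ | ⟨y', j', e', hf, hj, hy'⟩) |
    (⟨y', j', e', hf, hj, hy', -⟩ | ⟨y', j', e', hf, hj, hjc, hy', hy''⟩))
  · obtain ⟨rfl, rfl, hyy⟩ := pe_eq_iff.1 hf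
    have hcj : c < j := Fin.lt_def.2 (by simp only [hcd]; omega)
    exact hu (by rw [← hy' c rfl, ← hy1 c hcj, hyy c hcj.ne])
  · obtain ⟨rfl, rfl, hyy⟩ := pe_eq_iff.1 hf
    have hcj : j < c := Fin.lt_def.2 (by simp only [hcd]; omega)
    exact hu (by rw [← hy' c rfl, ← hy2 c hcj, hyy c hcj.ne'])
  · obtain ⟨rfl, rfl, hyy⟩ := pe_eq_iff.1 hf
    obtain ⟨i, hi⟩ := hJ
    have hij : j < embA N a k i := Fin.lt_def.2 (by rw [val_embA]; omega)
    have := hy' i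
    rw [if_pos hi] at this
    exact hu0 (by rw [← this, ← hy2 _ hij, hyy _ hij.ne'])
  · obtain ⟨rfl, rfl, hyy⟩ := pe_eq_iff.1 hf
    obtain ⟨i, hi⟩ := hJ'
    have hcj : c < j := by
      rcases lt_trichotomy c j with h1 | h1 | h1
      · exact h1
      · exact absurd (by rw [← h1]) hjc
      · exact absurd (by rw [← hy'' c rfl, ← hy2 c h1, hyy c h1.ne']) hu
    have hij : embB N a k i < j := lt_trans (Fin.lt_def.2 (by
      rw [val_embB]; simp only [hcd]; omega)) hcj
    have := hy' i
    rw [if_pos hi] at this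
    exact hud (by rw [← this, ← hy1 _ hij, hyy _ hij.ne])

theorem prog_embA {J J' : Finset (Fin a)} {r : ℕ} (hr : r < h) (i : Fin a) :
    prog N a k h d J J' r (embA N a k i) = if i ∈ J then 1 else 0 := by
  have h1 : N + a + k ≤ (embA N a k i : ℕ) := Nat.le_add_right _ _
  simp only [prog, h1, if_true, hr, Finset.mem_map']

theorem prog_embB {J J' : Finset (Fin a)} {r : ℕ} (hr : h ≤ r) (i : Fin a) :
    prog N a k h d J J' r (embB N a k i) = if i ∈ J' then d - 1 else d := by
  have h1 : (embB N a k i : ℕ) = N + i := rfl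
  have h2 : ¬ N + a + k ≤ (embB N a k i : ℕ) := by rw [h1]; omega
  have h3 : N ≤ (embB N a k i : ℕ) ∧ (embB N a k i : ℕ) < N + a := by rw [h1]; omega
  simp only [prog, h2, if_false, h3, and_self, if_true, not_lt.2 hr, Finset.mem_map']

theorem prog_clock {J J' : Finset (Fin a)} (hhk : h - 1 < k) (r : ℕ) {i : Fin (N + a + k + a)}
    (hi : (i : ℕ) = N + a + (h - 1)) : prog N a k h d J J' r i = if h - 1 < r then d else 0 := by
  unfold prog
  split_ifs <;> omega

theorem sliceEdges_subset (hhk : h - 1 < k) (hh : 0 < h) {J J' : Finset (Fin a)} (r : ℕ) :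
    sliceEdges E (embM N a k) u (prog N a k h d J J' r) ⊆
      edges₁ E N a k h u J ∪ edges₂ E N a k h d u J' := by
  rintro f ⟨y, j, e, rfl, hj, hy⟩
  have hjN : (j : ℕ) < N := by
    by_contra h1
    exact notMem_range_embM.2 (not_lt.1 h1) hj
  have hA : ∀ i, embA N a k i ∉ Set.range (embM N a k) := fun i =>
    notMem_range_embM.2 (by rw [val_embA]; omega)
  have hB : ∀ i, embB N a k i ∉ Set.range (embM N a k) := fun i =>
    notMem_range_embM.2 (by rw [val_embB]; omega)
  rcases lt_or_ge r h with hr | hr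
  · refine .inl ⟨y, j, e, rfl, by omega, fun i => ?_, fun i _ hi => ?_⟩
    · rw [hy _ (hA i), prog_embA hr]
    · rw [hy i (notMem_range_embM.2 (by omega)), prog_clock hhk r hi, if_neg (by omega)]
  · refine .inr ⟨y, j, e, rfl, .inl hjN, by omega, fun i => ?_, fun i hi => ?_⟩
    · rw [hy _ (hB i), prog_embB hr]
    · rw [hy i (notMem_range_embM.2 (by omega)), prog_clock hhk r hi, if_pos (by omega)]

/-- Only the transition into slice `h` is delicate. By `offset` the end block moves first, then the
clock, then the starting block. Until the clock has moved, the starting block still shows `J`; once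
it has moved, the end block already shows `J'`. -/
theorem routeEdges_subset (hG : G.Loopless) (hhk : h - 1 < k) (hh : 0 < h) (hd : 1 ≤ d)
    {J J' : Finset (Fin a)} (r : ℕ) (x : Fin N → V) :
    routeEdges (embM N a k) u (prog N a k h d J J' (r - 1)) (prog N a k h d J J' r)
      (offset N a k d) G (3 * d) x ⊆ edges₁ E N a k h u J ∪ edges₂ E N a k h d u J' := by
  intro f hf
  obtain ⟨y, j, e, i, rfl, hi, hj, hsi, hlt, -, -, hy⟩ := mem_routeEdges hG hf
  have hA : ∀ i, embA N a k i ∉ Set.range (embM N a k) := fun i =>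
    notMem_range_embM.2 (by rw [val_embA]; omega)
  have hB : ∀ i, embB N a k i ∉ Set.range (embM N a k) := fun i =>
    notMem_range_embM.2 (by rw [val_embB]; omega)
  have key : ∀ {l : Fin (N + a + k + a)} {p : ℕ}, l ∉ Set.range (embM N a k) →
      progress (prog N a k h d J J' (r - 1)) (prog N a k h d J J' r) (offset N a k d) i l = p →
      progress (prog N a k h d J J' (r - 1)) (prog N a k h d J J' r) (offset N a k d) (i + 1) l = p →
      y l = u p := by
    intro l p hl h1 h2
    have := hy l hl
    rwa [h1, h2, or_self] at this
  rw [notMem_range_embM] at hj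
  have hoA : ∀ l, offset N a k d (embA N a k l) = 2 * d := fun l => by
    have h1 : N + a + k ≤ (embA N a k l : ℕ) := Nat.le_add_right _ _
    simp only [offset, h1, if_true]
  have hoB : ∀ l, offset N a k d (embB N a k l) = 0 := fun l => by
    have h1 : (embB N a k l : ℕ) = N + l := rfl
    have h2 : ¬ N + a + k ≤ (embB N a k l : ℕ) := by rw [h1]; omega
    have h3 : (embB N a k l : ℕ) < N + a := by rw [h1]; omega
    simp only [offset, h2, if_false, h3, if_true]
  have hoc : ∀ l : Fin (N + a + k + a), (l : ℕ) = N + a + (h - 1) → offset N a k d l = d := by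
    intro l hl
    unfold offset
    rw [if_neg (by omega), if_neg (by omega)]
  rcases lt_trichotomy r h with hr | rfl | hr
  · obtain ⟨h1, h2, h3, h4⟩ := prog_change (lt_of_le_of_lt (Nat.le_add_right _ _) hlt) hr.ne
    refine .inl ⟨y, j, e, rfl, h3, fun l => ?_, fun l hlj hl => ?_⟩
    · refine key (hA l) ?_ ?_ <;>
      · simp only [progress]
        rw [prog_embA hr, prog_embA (by omega : r - 1 < h)]
        omega
    · refine key (notMem_range_embM.2 (by omega)) ?_ ?_ <;>
      · simp only [progress]
        rw [prog_clock hhk r hl, if_neg (by omega), Nat.min_zero]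
  · by_cases hjA : N + a + k ≤ (j : ℕ)
    · have hsj : 2 * d ≤ i := by simpa only [offset, hjA, if_true] using hsi
      refine .inr ⟨y, j, e, rfl, .inr (by omega), by omega, fun l => ?_, fun l hl => ?_⟩
      · refine key (hB l) ?_ ?_ <;>
        · simp only [progress]
          rw [prog_embB le_rfl, hoB]
          split_ifs <;> omega
      · refine key (notMem_range_embM.2 (by omega)) ?_ ?_ <;>
        · simp only [progress]
          rw [prog_clock hhk r hl, if_pos (by omega), hoc l hl]
          omega
    · have hi2 : i + 1 ≤ 2 * d ∧ ((j : ℕ) ≠ N + a + (r - 1) → i + 1 ≤ d) := by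
        have h1 := prog_le (N := N) (k := k) (h := r) (J := J) (J' := J') hd r j
        by_cases hjB : (j : ℕ) < N + a
        · have : offset N a k d j = 0 := by simp only [offset, hjA, hjB, if_true, if_false]
          omega
        · have h2 : offset N a k d j = d := by simp only [offset, hjA, hjB, if_false]
          refine ⟨by omega, fun hne => ?_⟩
          exfalso
          unfold prog at hlt
          split_ifs at hlt <;> omega
      refine .inl ⟨y, j, e, rfl, by omega, fun l => ?_, fun l hlj hl => ?_⟩
      · have h2 : 1 ≤ prog N a k r d J J' r (embA N a k l) := by
          have h1 : N + a + k ≤ (embA N a k l : ℕ) := Nat.le_add_right _ _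
          simp only [prog, h1, if_true, lt_irrefl, if_false]
          exact hd
        refine key (hA l) ?_ ?_ <;>
        · simp only [progress]
          rw [prog_embA (by omega : r - 1 < r), hoA]
          split_ifs <;> omega
      · have h3 : i + 1 ≤ d := hi2.2 fun h4 => hlj (Fin.ext (by omega))
        refine key (notMem_range_embM.2 (by omega)) ?_ ?_ <;>
        · simp only [progress]
          rw [prog_clock hhk (r - 1) hl, if_neg (by omega), hoc l hl]
          omega
  · obtain ⟨h1, h2, h3, h4⟩ := prog_change (lt_of_le_of_lt (Nat.le_add_right _ _) hlt) hr.ne'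
    refine .inr ⟨y, j, e, rfl, .inr h2, by omega, fun l => ?_, fun l hl => ?_⟩
    · refine key (hB l) ?_ ?_ <;>
      · simp only [progress]
        rw [prog_embB hr.le, prog_embB (by omega : h ≤ r - 1)]
        omega
    · refine key (notMem_range_embM.2 (by omega)) ?_ ?_ <;>
      · simp only [progress]
        rw [prog_clock hhk r hl, prog_clock hhk (r - 1) hl, if_pos (by omega), if_pos (by omega)]
        omega

end tries
end MixedGraph

/-! ### Tries from a set grown at the start to a set grown at the end. -/

namespace MixedGraph
variable {V : Type u} {E : Type v} {G : MixedGraph V E} {D n a : ℕ}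

/-- The configuration with value `α` on the image of `J` and `β` elsewhere. -/
def blockConf (em : Fin a ↪ Fin n) (α β : V) (J : Finset (Fin a)) : Fin n → V :=
  fun i => if i ∈ J.map em then α else β

/-- The edge in the direction of the element `j` of a block. -/
def blockEdge (em : Fin a ↪ Fin n) (α β : V) (e : E) (J : Finset (Fin a)) (j : Fin a) :
    PowEdge V E n :=
  pe (blockConf em α β J) (em j) e

section block
variable {em : Fin a ↪ Fin n} {α β : V} {e : E}

theorem blockConf_empty : blockConf em α β ∅ = fun _ => β := by
  funext i
  simp [blockConf]

theorem blockConf_apply (J : Finset (Fin a)) (j : Fin a) :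
    blockConf em α β J (em j) = if j ∈ J then α else β := by
  simp only [blockConf, Finset.mem_map']

theorem update_blockConf_insert (J : Finset (Fin a)) (j : Fin a) :
    Function.update (blockConf em α β J) (em j) α = blockConf em α β (insert j J) := by
  funext i
  by_cases hi : i = em j
  · subst hi
    rw [Function.update_self, blockConf_apply, if_pos (Finset.mem_insert_self _ _)]
  · rw [Function.update_of_ne hi]
    simp only [blockConf, Finset.map_insert, Finset.mem_insert, hi, false_or]

theorem update_blockConf_erase (J : Finset (Fin a)) (j : Fin a) :
    Function.update (blockConf em α β J) (em j) β = blockConf em α β (J.erase j) := by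
  funext i
  by_cases hi : i = em j
  · subst hi
    rw [Function.update_self, blockConf_apply, if_neg (Finset.notMem_erase _ _)]
  · rw [Function.update_of_ne hi]
    simp only [blockConf, Finset.map_erase, Finset.mem_erase, hi, ne_eq, not_false_eq_true, true_and]

theorem distinctEdges_blockEdge (hαβ : α ≠ β) : DistinctEdges (blockEdge em α β e) := by
  intro J j J' j' hj hj' h
  obtain ⟨h1, -, h2⟩ := pe_eq_iff.1 h
  have h1 := em.injective h1
  subst h1
  refine ⟨?_, rfl⟩
  ext i
  by_cases hij : i = j
  · subst hij
    exact ⟨fun h => absurd h hj, fun h => absurd h hj'⟩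
  · have h3 := h2 (em i) (fun h => hij (em.injective h))
    rw [blockConf_apply, blockConf_apply] at h3
    by_cases hi : i ∈ J <;> by_cases hi' : i ∈ J' <;> simp [hi, hi', hαβ, hαβ.symm] at h3 ⊢

variable {Ω : Type*} {τ : PowEdge V E n → Ω → ℝ≥0} {δ : ℕ → ℝ≥0} {ω : Ω}

theorem passageTime_blockConf_le (he : G.Joins e β α) {k : ℕ} {J : Finset (Fin a)}
    (hJ : J ∈ growSets τ (blockEdge em α β e) δ k ω) :
    (G.pow n).passageTime (fun f => τ f ω) (fun _ => β) (blockConf em α β J) ≤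
      ∑ i ∈ Finset.range k, (δ i : ℝ≥0∞) := by
  induction k generalizing J with
  | zero =>
    rw [Finset.mem_singleton.1 hJ, blockConf_empty, passageTime_self]
    exact bot_le
  | succ k ih =>
    simp only [growSets, nextSets, Finset.mem_filter] at hJ
    obtain ⟨-, j, hj, hJj, hτ⟩ := hJ
    refine (passageTime_triangle _ _ (blockConf em α β (J.erase j)) _).trans ?_
    rw [Finset.sum_range_succ]
    refine add_le_add (ih hJj) ?_
    have h1 := pow_joins_pe (G := G) (x := blockConf em α β (J.erase j)) (i := em j) (e := e) (a := α)
      (by rw [blockConf_apply, if_neg (Finset.notMem_erase _ _)]; exact he)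
    rw [update_blockConf_insert, Finset.insert_erase hj] at h1
    exact (passageTime_le_of_joins _ h1).trans (by exact_mod_cast hτ)

/-- The same growth read backwards in time: the element added last is the first coordinate to move.
`blockEdge` does not depend on the value in its own direction, so it can be crossed starting from
the larger set. -/
theorem passageTime_blockConf_le' (he : G.Joins e α β) {k : ℕ} {J : Finset (Fin a)}
    (hJ : J ∈ growSets τ (blockEdge em α β e) δ k ω) :
    (G.pow n).passageTime (fun f => τ f ω) (blockConf em α β J) (fun _ => β) ≤
      ∑ i ∈ Finset.range k, (δ i : ℝ≥0∞) := by
  induction k generalizing J with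
  | zero =>
    rw [Finset.mem_singleton.1 hJ, blockConf_empty, passageTime_self]
    exact bot_le
  | succ k ih =>
    simp only [growSets, nextSets, Finset.mem_filter] at hJ
    obtain ⟨-, j, hj, hJj, hτ⟩ := hJ
    refine (passageTime_triangle _ _ (blockConf em α β (J.erase j)) _).trans ?_
    rw [Finset.sum_range_succ, add_comm]
    refine add_le_add (ih hJj) ?_
    have h1 := pow_joins_pe (G := G) (x := blockConf em α β J) (i := em j) (e := e) (a := β)
      (by rw [blockConf_apply, if_pos hj]; exact he)
    rw [update_blockConf_erase] at h1
    have h2 : blockEdge em α β e (J.erase j) j = pe (blockConf em α β J) (em j) e := by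
      rw [blockEdge, pe_eq_iff]
      refine ⟨rfl, rfl, fun l hl => ?_⟩
      rw [← update_blockConf_erase, Function.update_of_ne hl]
    rw [h2] at hτ
    exact (passageTime_le_of_joins _ h1).trans (by exact_mod_cast hτ)

end block

section try_
variable {N k h d : ℕ} {u : ℕ → V} {Ω : Type*}

/-- The event that a path from the configuration given by `J` to the one given by `J'` is found that
follows one of the chains in `𝒞`. -/
def tryEvent (G : MixedGraph V E) (τ : PowEdge V E (N + a + k + a) → Ω → ℝ≥0) (u : ℕ → V) (h d : ℕ)
    (𝒞 : Finset (Fin (2 * h + 1) → Fin N → V)) (ε : ℕ → ℝ≥0) (δ : ℝ≥0) (J J' : Finset (Fin a)) : Set Ω :=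
  ⋃ z ∈ 𝒞, ⋂ r : Fin (2 * h),
    routeEvent (embM N a k) u (prog N a k h d J J' ((r : ℕ) - 1)) (prog N a k h d J J' r)
      (offset N a k d) G τ (3 * d) (ε r) (z r.castSucc) ∩
    cubeEvent G τ (conf (embM N a k) u (prog N a k h d J J' r) (z r.castSucc))
      (conf (embM N a k) u (prog N a k h d J J' r) (z r.succ)) δ

variable {τ : PowEdge V E (N + a + k + a) → Ω → ℝ≥0} {𝒞 : Finset (Fin (2 * h + 1) → Fin N → V)}
  {ε : ℕ → ℝ≥0} {δ : ℝ≥0} {J J' : Finset (Fin a)}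

theorem measurableSet_tryEvent (hG : G.Loopless) (hD : G.DegreeLE D) (hhk : h - 1 < k) (hh : 0 < h)
    (hd : 1 ≤ d) : MeasurableSet[sig τ (edges₁ E N a k h u J ∪ edges₂ E N a k h d u J')]
      (tryEvent G τ u h d 𝒞 ε δ J J') := by
  refine Finset.measurableSet_biUnion _ fun z _ => MeasurableSet.iInter fun r =>
    MeasurableSet.inter ?_ ?_
  · exact sig_mono (routeEdges_subset hG hhk hh hd r _) _ (measurableSet_routeEvent hG hD (ε r) _)
  · exact sig_mono ((cubeEdges_subset_sliceEdges _ _).trans (sliceEdges_subset hhk hh r)) _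
      (measurableSet_cubeEvent hG hD _ _ δ)

theorem prog_le_add (hd : 1 ≤ d) (r : ℕ) (j : Fin (N + a + k + a)) : prog N a k h d J J' r j ≤
    prog N a k h d J J' (r - 1) j + (3 * d - offset N a k d j) := by
  have h1 := prog_le (N := N) (k := k) (h := h) (J := J) (J' := J') hd r j
  have h2 := offset_le (N := N) (a := a) (k := k) (d := d) j
  omega

theorem conf_prog_zero (hh : 0 < h) :
    conf (embM N a k) u (prog N a k h d J J' 0) (fun _ => u 0) =
      blockConf (embA N a k) (u 1) (u 0) J := by
  funext j
  by_cases hj : j ∈ Set.range (embM N a k)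
  · obtain ⟨i, rfl⟩ := hj
    rw [conf_apply, blockConf, if_neg]
    intro h1
    have := mem_map_embA h1
    have h2 : (embM N a k i : ℕ) = i := rfl
    omega
  · rw [conf_apply' hj, blockConf]
    rw [notMem_range_embM] at hj
    by_cases h1 : j ∈ J.map (embA N a k)
    · have := mem_map_embA h1
      simp only [prog, this, h1, hh, if_true]
    · have h2 : prog N a k h d J J' 0 j = 0 := by
        unfold prog
        split_ifs <;> first | rfl | omega
      rw [h2, if_neg h1]

/-- With `k + 1 = 2 * h` all clocks have been switched by the last slice, so only the end block is
not yet at the end point. -/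
theorem conf_prog_last (hk : k + 1 = 2 * h) (hh : 0 < h) :
    conf (embM N a k) u (prog N a k h d J J' (2 * h - 1)) (fun _ => u d) =
      blockConf (embB N a k) (u (d - 1)) (u d) J' := by
  funext j
  by_cases hj : j ∈ Set.range (embM N a k)
  · obtain ⟨i, rfl⟩ := hj
    rw [conf_apply, blockConf, if_neg]
    intro h1
    have := mem_map_embB h1
    have h2 : (embM N a k i : ℕ) = i := rfl
    omega
  · rw [conf_apply' hj, blockConf]
    rw [notMem_range_embM] at hj
    by_cases h1 : j ∈ J'.map (embB N a k)
    · have h2 := mem_map_embB h1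
      have h3 : prog N a k h d J J' (2 * h - 1) j = d - 1 := by
        unfold prog
        rw [if_neg (by omega), if_pos h2, if_neg (by omega), if_pos h1]
      rw [h3, if_pos h1]
    · have h2 : prog N a k h d J J' (2 * h - 1) j = d := by
        unfold prog
        split_ifs <;> first | rfl | omega
      rw [h2, if_neg h1]

theorem passageTime_le_of_mem_tryEvent (hk : k + 1 = 2 * h) (hh : 0 < h) (hd : 1 ≤ d)
    (h0 : ∀ z ∈ 𝒞, z 0 = fun _ => u 0) (hl : ∀ z ∈ 𝒞, z (Fin.last _) = fun _ => u d) {ω : Ω}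
    (hω : ω ∈ tryEvent G τ u h d 𝒞 ε δ J J') :
    (G.pow _).passageTime (fun f => τ f ω) (blockConf (embA N a k) (u 1) (u 0) J)
      (blockConf (embB N a k) (u (d - 1)) (u d) J') ≤
      ∑ r ∈ Finset.range (2 * h), ((3 * d : ℕ) * (ε r : ℝ≥0∞) + δ) := by
  simp only [tryEvent, Set.mem_iUnion] at hω
  obtain ⟨z, hz, hω⟩ := hω
  have hω := Set.mem_iInter.1 hω
  have h1 := passageTime_chain (G := G.pow _) (fun f => τ f ω)
    -- The state before the entrance of slice `r` still has the progress of slice `r - 1`. The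
    -- truncated subtraction makes the entrance of slice `0` trivial.
    (fun r => conf (embM N a k) u (prog N a k h d J J' (r - 1)) (z ⟨min r (2 * h), by omega⟩))
    (fun r => (3 * d : ℕ) * (ε r : ℝ≥0∞) + δ) (2 * h) fun r hr => by
      have h2 := hω ⟨r, hr⟩
      have e1 : (⟨min r (2 * h), by omega⟩ : Fin (2 * h + 1)) = Fin.castSucc ⟨r, hr⟩ :=
        Fin.ext (by simp; omega)
      have e2 : (⟨min (r + 1) (2 * h), by omega⟩ : Fin (2 * h + 1)) = Fin.succ ⟨r, hr⟩ :=
        Fin.ext (by simp; omega)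
      simp only [e1, e2, Nat.add_sub_cancel]
      exact (passageTime_triangle _ _ _ _).trans (add_le_add
        (passageTime_le_of_mem_routeEvent (prog_mono hd (Nat.sub_le _ _)) (prog_le_add hd r) h2.1)
        (passageTime_le_of_mem_cubeEvent h2.2))
  have e1 : (⟨min 0 (2 * h), by omega⟩ : Fin (2 * h + 1)) = 0 := Fin.ext (by simp)
  have e2 : (⟨min (2 * h) (2 * h), by omega⟩ : Fin (2 * h + 1)) = Fin.last _ :=
    Fin.ext (by simp)
  simp only [e1, e2, h0 z hz, hl z hz, Nat.zero_sub, conf_prog_zero hh, conf_prog_last hk hh] at h1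
  exact h1

variable [MeasurableSpace Ω] {F : Measure ℝ≥0} {μ : Measure Ω} [IsProbabilityMeasure μ]

/-- The transitions serve as the entrances of the chain estimate. Only the one into slice `h` moves
a number of coordinates that grows with `a`. -/
theorem le_measure_tryEvent (hτ : IIDField τ F μ) (hG : G.Loopless) (hD : G.DegreeLE D)
    {ρ₁ ρ₂ : ℝ≥0} (hF₁ : ∀ r, ∀ y ≤ ε r, ρ₁ * y ≤ F (Set.Iic y))
    (hF₂ : ∀ r, ∀ y ≤ ε r, F (Set.Iic y) ≤ ρ₂ * y) (hρ : ρ₁ ≤ ρ₂) (hu : SimplePath G u d) (hd : 1 ≤ d)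
    (hk : k + 1 = 2 * h) (hh : 0 < h) {b q₀ : ℝ≥0∞}
    {ε₁ : ℝ≥0} (hε₁ : ∀ r, r ≠ h → ε r = ε₁)
    (hq₀ : q₀ ≤ ((ρ₁ * ε h / (1 + ρ₂ * ε h) : ℝ≥0) : ℝ≥0∞) ^ (3 * d * (2 * a + 1)))
    (hch : ∀ (m : Fin N ↪ Fin (N + a + k + a)) (u : ℕ → V) (P : ℕ → Fin (N + a + k + a) → ℕ),
      (∀ r < 2 * h, ∀ r' < 2 * h, r ≠ r' → ∃ j ∉ Set.range m, u (P r j) ≠ u (P r' j)) →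
      ∀ (Q : ℕ → (Fin N → V) → Set Ω) (U : ℕ → (Fin N → V) → Set (PowEdge V E (N + a + k + a))),
      (∀ r x, MeasurableSet[sig τ (U r x)] (Q r x)) →
      (∀ r < 2 * h, ∀ r' < 2 * h, ∀ x x', (r ≠ r' ∨ x ≠ x') → Disjoint (U r x) (U r' x')) →
      (∀ r x, ∀ f ∈ U r x, f.1 ∉ Set.range m) →
      (∀ r x, r ≠ h → ((ρ₁ * ε₁ / (1 + ρ₂ * ε₁) : ℝ≥0) : ℝ≥0∞) ^ (3 * d) ≤ μ (Q r x)) →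
      (∀ x, q₀ ≤ μ (Q h x)) →
      b ≤ μ (⋃ z ∈ 𝒞, ⋂ r : Fin (2 * h), Q r (z r.castSucc) ∩
        cubeEvent G τ (conf m u (P r) (z r.castSucc)) (conf m u (P r) (z r.succ)) δ)) :
    b ≤ μ (tryEvent G τ u h d 𝒞 ε δ J J') := by
  have hP : ∀ r j, prog N a k h d J J' r j ≤ d := fun r j => prog_le hd r j
  refine hch (embM N a k) u (prog N a k h d J J') ?_
    (fun r x => routeEvent (embM N a k) u (prog N a k h d J J' (r - 1)) (prog N a k h d J J' r)
      (offset N a k d) G τ (3 * d) (ε r) x)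
    (fun r x => routeEdges (embM N a k) u (prog N a k h d J J' (r - 1)) (prog N a k h d J J' r)
      (offset N a k d) G (3 * d) x) (fun r x => measurableSet_routeEvent hG hD (ε r) x) ?_ ?_ ?_ ?_
  · have key : ∀ r < 2 * h, ∀ r' < 2 * h, r < r' → ∃ j ∉ Set.range (embM N a k),
        u (prog N a k h d J J' r j) ≠ u (prog N a k h d J J' r' j) := by
      intro r hr r' hr' hrr
      refine ⟨⟨N + a + r, by omega⟩, notMem_range_embM.2 (by simp only; omega), ?_⟩
      have h1 : prog N a k h d J J' r ⟨N + a + r, by omega⟩ = 0 := by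
        unfold prog
        rw [if_neg (by simp only; omega), if_neg (by simp only; omega), if_neg (by simp only; omega)]
      have h2 : prog N a k h d J J' r' ⟨N + a + r, by omega⟩ = d := by
        unfold prog
        rw [if_neg (by simp only; omega), if_neg (by simp only; omega), if_pos (by simp only; omega)]
      rw [h1, h2]
      intro h3
      have := hu.inj 0 (by omega) d le_rfl h3
      omega
    intro r hr r' hr' hne
    rcases lt_or_gt_of_ne hne with h1 | h1
    · exact key r hr r' hr' h1
    · obtain ⟨j, hj, hj'⟩ := key r' hr' r hr h1
      exact ⟨j, hj, hj'.symm⟩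
  · have key : ∀ r r' : ℕ, r < r' → ∀ x x' : Fin N → V, Disjoint
        (routeEdges (embM N a k) u (prog N a k h d J J' (r - 1)) (prog N a k h d J J' r)
          (offset N a k d) G (3 * d) x)
        (routeEdges (embM N a k) u (prog N a k h d J J' (r' - 1)) (prog N a k h d J J' r')
          (offset N a k d) G (3 * d) x') := fun r r' hrr x x' =>
      disjoint_routeEdges hG hu (hP r) (hP r') (prog_mono hd (by omega)) x x'
    intro r _ r' _ x x' hne
    rcases lt_trichotomy r r' with h1 | rfl | h1
    · exact key r r' h1 x x'
    · exact disjoint_routeEdges_of_ne hG (hne.resolve_left (fun h => h rfl))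
    · exact (key r' r h1 x' x).symm
  · intro r x f hf
    obtain ⟨y, j, e, i, rfl, -, hj, -⟩ := mem_routeEdges hG hf
    exact hj
  · intro r x hr
    have := pow_le_measure_routeEvent (m := embM N a k) (K := 3 * d) (s := offset N a k d) hτ hG hD (hF₁ r) (hF₂ r) hρ hu (hP r)
      (card_prog_change (N := N) (k := k) (d := d) (J := J) (J' := J') hr) x
    rw [mul_one] at this
    rw [← hε₁ r hr]
    exact this
  · intro x
    exact hq₀.trans (pow_le_measure_routeEvent hτ hG hD (hF₁ h) (hF₂ h) hρ hu (hP h)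
      card_prog_change_mid x)

end try_
end MixedGraph

namespace MixedGraph
variable {V : Type u} {E : Type v} {G : MixedGraph V E} {D a N k h d : ℕ} {u : ℕ → V}

theorem outEdges_subset_edgesA (hhk : h - 1 < k) (e : E) (S : Set (Finset (Fin a))) :
    outEdges (blockEdge (embA N a k) (u 1) (u 0) e) S ⊆ edgesA E N a k h u := by
  rintro _ ⟨J, j, -, -, rfl⟩
  refine ⟨_, _, _, rfl, by rw [val_embA]; omega, fun i hi => ?_⟩
  rw [blockConf, if_neg]
  intro h1
  have := mem_map_embA h1
  omega

theorem outEdges_subset_edgesB (hhk : h - 1 < k) (e : E) (S : Set (Finset (Fin a))) :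
    outEdges (blockEdge (embB N a k) (u (d - 1)) (u d) e) S ⊆ edgesB E N a k h d u := by
  rintro _ ⟨J, j, -, -, rfl⟩
  refine ⟨_, _, _, rfl, by rw [val_embB]; omega, fun i hi => ?_⟩
  rw [blockConf, if_neg]
  intro h1
  have := mem_map_embB h1
  omega

variable {Ω : Type*} {τ : PowEdge V E (N + a + k + a) → Ω → ℝ≥0}
  [MeasurableSpace Ω] {F : Measure ℝ≥0} {μ : Measure Ω} [IsProbabilityMeasure μ]

/-- If each of the independent events indexed by the pairs has probability at least `b`, then with two
independent large random sets of indices some pair is successful. -/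
theorem measure_forall_notMem_le {ι E' : Type*} [Fintype ι] {τ : E' → Ω → ℝ≥0} (hτ : IIDField τ F μ)
    {A B : Set E'} {S₁ S₂ : ι → Set E'} (hAB : Disjoint A B)
    (hA : ∀ i j, Disjoint A (S₁ i ∪ S₂ j)) (hB : ∀ i j, Disjoint B (S₁ i ∪ S₂ j))
    (h₁ : ∀ i j, i ≠ j → Disjoint (S₁ i) (S₁ j)) (h₂ : ∀ i j, i ≠ j → Disjoint (S₂ i) (S₂ j))
    (h₁₂ : ∀ i j, Disjoint (S₁ i) (S₂ j)) {X Y : Ω → Finset ι}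
    (hX : ∀ S, MeasurableSet[sig τ A] {ω | X ω = S}) (hY : ∀ S, MeasurableSet[sig τ B] {ω | Y ω = S})
    {T : ι → ι → Set Ω} (hT : ∀ i j, MeasurableSet[sig τ (S₁ i ∪ S₂ j)] (T i j)) {b : ℝ≥0∞}
    (hb : ∀ i j, b ≤ μ (T i j)) (L : ℕ) :
    μ {ω | ∀ i ∈ X ω, ∀ j ∈ Y ω, ω ∉ T i j} ≤
      μ {ω | (X ω).card ≤ L} + μ {ω | (Y ω).card ≤ L} + (1 - b) ^ L := by
  classical
  set 𝒮 : Finset (Finset ι × Finset ι) :=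
    Finset.univ.filter fun p => L < p.1.card ∧ L < p.2.card with h𝒮
  have hXYm : ∀ p : Finset ι × Finset ι, MeasurableSet[sig τ (A ∪ B)]
      ({ω | X ω = p.1} ∩ {ω | Y ω = p.2}) := fun p =>
    (sig_mono Set.subset_union_left _ (hX p.1)).inter (sig_mono Set.subset_union_right _ (hY p.2))
  have hone : ∀ p ∈ 𝒮, μ (({ω | X ω = p.1} ∩ {ω | Y ω = p.2}) ∩
      {ω | ∀ i ∈ p.1, ∀ j ∈ p.2, ω ∉ T i j}) ≤
        μ ({ω | X ω = p.1} ∩ {ω | Y ω = p.2}) * (1 - b) ^ L := by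
    intro p hp
    obtain ⟨-, hp1, hp2⟩ := Finset.mem_filter.1 hp
    -- Match `L` members of one set with `L` members of the other. The matched tries have no member
    -- in common, so they use disjoint edges and are independent.
    let g₁ : Fin L → ι := fun i => p.1.equivFin.symm (Fin.castLE hp1.le i)
    let g₂ : Fin L → ι := fun i => p.2.equivFin.symm (Fin.castLE hp2.le i)
    have hg₁ : Function.Injective g₁ := fun i j hij =>
      Fin.castLE_injective hp1.le (p.1.equivFin.symm.injective (Subtype.ext hij))
    have hg₂ : Function.Injective g₂ := fun i j hij =>
      Fin.castLE_injective hp2.le (p.2.equivFin.symm.injective (Subtype.ext hij))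
    have hm : ∀ i ∈ (Finset.univ : Finset (Fin L)),
        MeasurableSet[sig τ (S₁ (g₁ i) ∪ S₂ (g₂ i))] (T (g₁ i) (g₂ i))ᶜ := fun i _ => (hT _ _).compl
    have hdis : ((Finset.univ : Finset (Fin L)) : Set (Fin L)).PairwiseDisjoint
        fun i => S₁ (g₁ i) ∪ S₂ (g₂ i) := by
      intro i _ j _ hij
      simp only [Function.onFun, Set.disjoint_union_left, Set.disjoint_union_right]
      exact ⟨⟨h₁ _ _ (hg₁.ne hij), (h₁₂ _ _).symm⟩, h₁₂ _ _, h₂ _ _ (hg₂.ne hij)⟩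
    calc _ ≤ μ (({ω | X ω = p.1} ∩ {ω | Y ω = p.2}) ∩
          ⋂ i ∈ (Finset.univ : Finset (Fin L)), (T (g₁ i) (g₂ i))ᶜ) := by
          refine measure_mono (Set.inter_subset_inter_right _ fun ω hω => ?_)
          simp only [Set.mem_iInter]
          exact fun i _ => hω _ (p.1.equivFin.symm _).2 _ (p.2.equivFin.symm _).2
      _ = μ ({ω | X ω = p.1} ∩ {ω | Y ω = p.2}) *
          μ (⋂ i ∈ (Finset.univ : Finset (Fin L)), (T (g₁ i) (g₂ i))ᶜ) := by
          refine hτ.measure_inter (T := ⋃ i, S₁ (g₁ i) ∪ S₂ (g₂ i)) ?_ (hXYm p)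
            (Finset.measurableSet_biInter _ fun i hi => sig_mono
              (Set.subset_iUnion (fun i => S₁ (g₁ i) ∪ S₂ (g₂ i)) i) _ (hm i hi))
          rw [Set.disjoint_iUnion_right]
          exact fun i => Set.disjoint_union_left.2 ⟨hA _ _, hB _ _⟩
      _ ≤ _ := by
          gcongr
          rw [hτ.measure_biInter hdis hm]
          calc _ ≤ ∏ _i : Fin L, (1 - b) := by
                refine Finset.prod_le_prod' fun i _ => ?_
                rw [prob_compl_eq_one_sub (hτ.sig_le _ _ (hT _ _))]
                exact tsub_le_tsub_left (hb _ _) 1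
            _ = _ := by simp
  have hsub : {ω | ∀ i ∈ X ω, ∀ j ∈ Y ω, ω ∉ T i j} ⊆
      ({ω | (X ω).card ≤ L} ∪ {ω | (Y ω).card ≤ L}) ∪ ⋃ p ∈ 𝒮, (({ω | X ω = p.1} ∩ {ω | Y ω = p.2}) ∩
        {ω | ∀ i ∈ p.1, ∀ j ∈ p.2, ω ∉ T i j}) := by
    intro ω hω
    by_cases h1 : (X ω).card ≤ L
    · exact .inl (.inl h1)
    by_cases h2 : (Y ω).card ≤ L
    · exact .inl (.inr h2)
    refine .inr ?_
    simp only [Set.mem_iUnion]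
    exact ⟨(X ω, Y ω), Finset.mem_filter.2 ⟨Finset.mem_univ _, not_le.1 h1, not_le.1 h2⟩,
      ⟨rfl, rfl⟩, hω⟩
  refine (measure_mono hsub).trans ((measure_union_le _ _).trans
    (add_le_add (measure_union_le _ _) ((measure_biUnion_finset_le _ _).trans
      ((Finset.sum_le_sum hone).trans ?_))))
  rw [← Finset.sum_mul, ← measure_biUnion_finset ?_ fun p _ => hτ.sig_le _ _ (hXYm p)]
  · calc _ ≤ 1 * (1 - b) ^ L := by gcongr; exact prob_le_one
      _ = _ := one_mul _
  · rintro ⟨p, q⟩ _ ⟨p', q'⟩ _ hne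
    rw [Function.onFun, Set.disjoint_left]
    rintro ω ⟨h1, h2⟩ ⟨h3, h4⟩
    exact hne (Prod.ext (Eq.trans (Eq.symm h1) h3) (Eq.trans (Eq.symm h2) h4))

/-- The bad event is that no try between grown sets succeeds. It depends only on tries between
nonempty sets, since grown sets have `m + 1` elements; this makes its edges disjoint from those of
the sequential path. -/
theorem exists_bad (hτ : IIDField τ F μ) (hG : G.Loopless) (hD : G.DegreeLE D)
    (hu : SimplePath G u d) (hd : 1 ≤ d) (hk : k + 1 = 2 * h) (hh : 0 < h) (hhk : h - 1 < k)
    {𝒞 : Finset (Fin (2 * h + 1) → Fin N → V)}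
    (h0 : ∀ z ∈ 𝒞, z 0 = fun _ => u 0) (hl : ∀ z ∈ 𝒞, z (Fin.last _) = fun _ => u d)
    {ε : ℕ → ℝ≥0} {δ : ℝ≥0} {b : ℝ≥0∞} (hb : ∀ J J', b ≤ μ (tryEvent G τ u h d 𝒞 ε δ J J'))
    (δg : ℕ → ℝ≥0) {m L : ℕ} {c : ℝ≥0∞}
    (hgrow : ∀ f : Finset (Fin a) → Fin a → PowEdge V E (N + a + k + a), DistinctEdges f →
      μ {ω | (growSets τ f δg (m + 1) ω).card ≤ L} ≤ c) :
    ∃ Bad : Set Ω, ∃ 𝒲 : Set (PowEdge V E (N + a + k + a)), MeasurableSet[sig τ 𝒲] Bad ∧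
      Disjoint (edgesSeq E d u (N + a + k + a)) 𝒲 ∧ μ Bad ≤ c + c + (1 - b) ^ L ∧
      ∀ ω ∉ Bad, (G.pow _).passageTime (fun f => τ f ω) (fun _ => u 0) (fun _ => u d) ≤
        2 * ∑ i ∈ Finset.range (m + 1), (δg i : ℝ≥0∞) +
          ∑ r ∈ Finset.range (2 * h), ((3 * d : ℕ) * (ε r : ℝ≥0∞) + δ) := by
  classical
  have hu0d : u 0 ≠ u d := fun h1 => by have := hu.inj 0 (by omega) d le_rfl h1; omega
  have hu01 : u 0 ≠ u 1 := fun h1 => by have := hu.inj 0 (by omega) 1 hd h1; omega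
  have hudd : u (d - 1) ≠ u d := fun h1 => by have := hu.inj (d - 1) (by omega) d le_rfl h1; omega
  obtain ⟨e₁, he₁⟩ := hu.joins 0 (by omega)
  obtain ⟨e₂, he₂⟩ := hu.joins (d - 1) (by omega)
  rw [zero_add] at he₁
  rw [Nat.sub_add_cancel hd] at he₂
  set fA := blockEdge (embA N a k) (u 1) (u 0) e₁ with hfA
  set fB := blockEdge (embB N a k) (u (d - 1)) (u d) e₂ with hfB
  set X := fun ω => growSets τ fA δg (m + 1) ω with hX
  set Y := fun ω => growSets τ fB δg (m + 1) ω with hY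
  have hXm : ∀ S, MeasurableSet[sig τ (edgesA E N a k h u)] {ω | X ω = S} := fun S =>
    sig_mono (outEdges_subset_edgesA hhk e₁ _) _ (measurableSet_growSets δg (m + 1) S)
  have hYm : ∀ S, MeasurableSet[sig τ (edgesB E N a k h d u)] {ω | Y ω = S} := fun S =>
    sig_mono (outEdges_subset_edgesB hhk e₂ _) _ (measurableSet_growSets δg (m + 1) S)
  have hTm : ∀ J J', MeasurableSet[sig τ (edges₁ E N a k h u J ∪ edges₂ E N a k h d u J')]
      (tryEvent G τ u h d 𝒞 ε δ J J') := fun J J' => measurableSet_tryEvent hG hD hhk hh hd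
  set Bad : Set Ω := {ω | ∀ J ∈ X ω, ∀ J' ∈ Y ω, ω ∉ tryEvent G τ u h d 𝒞 ε δ J J'} with hBad
  set 𝒲 : Set (PowEdge V E (N + a + k + a)) :=
    ⋃ (J : Finset (Fin a)) (J' : Finset (Fin a)) (_ : J.Nonempty) (_ : J'.Nonempty),
      (edgesA E N a k h u ∪ edgesB E N a k h d u ∪
        (edges₁ E N a k h u J ∪ edges₂ E N a k h d u J')) with h𝒲
  have hsub𝒲 : ∀ J J' : Finset (Fin a), J.Nonempty → J'.Nonempty →
      edgesA E N a k h u ∪ edgesB E N a k h d u ∪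
        (edges₁ E N a k h u J ∪ edges₂ E N a k h d u J') ⊆ 𝒲 := fun J J' hJ hJ' f hf =>
    Set.mem_iUnion.2 ⟨J, Set.mem_iUnion.2 ⟨J', Set.mem_iUnion.2 ⟨hJ, Set.mem_iUnion.2 ⟨hJ', hf⟩⟩⟩⟩
  refine ⟨Bad, 𝒲, ?_, ?_, ?_, fun ω hω => ?_⟩
  · have hXJ : ∀ J, MeasurableSet[sig τ (edgesA E N a k h u)] {ω | J ∈ X ω} := fun J => by
      have : {ω | J ∈ X ω} = ⋃ S ∈ {S | J ∈ S}, {ω | X ω = S} := by ext ω; simp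
      rw [this]
      exact MeasurableSet.biUnion (Set.to_countable _) fun S _ => hXm S
    have hYJ : ∀ J, MeasurableSet[sig τ (edgesB E N a k h d u)] {ω | J ∈ Y ω} := fun J => by
      have : {ω | J ∈ Y ω} = ⋃ S ∈ {S | J ∈ S}, {ω | Y ω = S} := by ext ω; simp
      rw [this]
      exact MeasurableSet.biUnion (Set.to_countable _) fun S _ => hYm S
    have hBe : Bad = ⋂ (J : Finset (Fin a)) (J' : Finset (Fin a)) (_ : J.Nonempty) (_ : J'.Nonempty),
        ({ω | J ∈ X ω}ᶜ ∪ ({ω | J' ∈ Y ω}ᶜ ∪ (tryEvent G τ u h d 𝒞 ε δ J J')ᶜ)) := by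
      ext ω
      simp only [hBad, Set.mem_ofPred_eq, Set.mem_iInter, Set.mem_union, Set.mem_compl_iff]
      constructor
      · intro h1 J J' _ _
        by_cases h2 : J ∈ X ω
        · by_cases h3 : J' ∈ Y ω
          · exact .inr (.inr (h1 J h2 J' h3))
          · exact .inr (.inl h3)
        · exact .inl h2
      · intro h1 J hJ J' hJ'
        have hne : ∀ {f : Finset (Fin a) → Fin a → PowEdge V E (N + a + k + a)} {J : Finset (Fin a)},
            J ∈ growSets τ f δg (m + 1) ω → J.Nonempty := fun h2 =>
          Finset.card_pos.1 (by rw [card_of_mem_growSets h2]; omega)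
        rcases h1 J J' (hne hJ) (hne hJ') with h2 | h2 | h2
        · exact absurd hJ h2
        · exact absurd hJ' h2
        · exact h2
    rw [hBe]
    refine MeasurableSet.iInter fun J => MeasurableSet.iInter fun J' => MeasurableSet.iInter fun hJ =>
      MeasurableSet.iInter fun hJ' => ?_
    have hs := hsub𝒲 J J' hJ hJ'
    exact (sig_mono ((Set.subset_union_left.trans Set.subset_union_left).trans hs) _ (hXJ J)).compl.union
      ((sig_mono ((Set.subset_union_right.trans Set.subset_union_left).trans hs) _ (hYJ J')).compl.union
        (sig_mono (Set.subset_union_right.trans hs) _ (hTm J J')).compl)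
  · simp only [h𝒲, Set.disjoint_iUnion_right]
    exact fun J J' hJ hJ' => disjoint_edgesSeq hhk hu0d hu01 hudd hJ hJ'
  · refine (measure_forall_notMem_le hτ disjoint_edgesAB
      (fun J J' => disjoint_edgesA hhk hu0d) (fun J J' => disjoint_edgesB hhk hu0d)
      (fun J J' hne => disjoint_edges₁ hu01 hne) (fun J J' hne => disjoint_edges₂ hudd hne)
      (fun J J' => disjoint_edges₁₂ hhk hu0d) hXm hYm hTm hb L).trans ?_
    gcongr
    · exact hgrow fA (distinctEdges_blockEdge hu01.symm)
    · exact hgrow fB (distinctEdges_blockEdge hudd)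
  · simp only [hBad, Set.mem_ofPred_eq, not_forall, not_not] at hω
    obtain ⟨J, hJ, J', hJ', hω⟩ := hω
    refine (passageTime_triangle _ _ (blockConf (embA N a k) (u 1) (u 0) J) _).trans ?_
    refine (add_le_add_right (passageTime_triangle _ _
      (blockConf (embB N a k) (u (d - 1)) (u d) J') _) _).trans ?_
    refine (add_le_add (passageTime_blockConf_le he₁ hJ) (add_le_add
      (passageTime_le_of_mem_tryEvent hk hh hd h0 hl hω)
      (passageTime_blockConf_le' he₂ hJ'))).trans (le_of_eq ?_)
    ring

end MixedGraph

/-! ### Exponentially small upper tail. -/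

namespace MixedGraph
variable {Ω : Type*} [MeasurableSpace Ω] {F : Measure ℝ≥0} {μ : Measure Ω} [IsProbabilityMeasure μ]

/-- The first generation may take the fixed time `ε` and produces a multiple of `a` sets. Each later
generation needs only time `24 / (ρ₁ a)` to double their number, so `κ a` generations take time `24
κ / ρ₁`, which is small for small `κ`. -/
theorem exists_growth [IsProbabilityMeasure F] {ρ₁ δ₀ gap : ℝ≥0} (hρ₁ : 0 < ρ₁) (hδ₀ : 0 < δ₀)
    (hF₁ : ∀ y ≤ δ₀, ρ₁ * y ≤ F (Set.Iic y)) (hgap : 0 < gap) :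
    ∃ κ > 0, ∃ c > 0, ∃ a₀ : ℕ, ∀ a ≥ a₀, ∃ (δg : ℕ → ℝ≥0) (m L : ℕ), Real.exp (κ * a) ≤ L ∧
      2 * ∑ i ∈ Finset.range (m + 1), (δg i : ℝ≥0∞) ≤ gap ∧
      ∀ (E : Type v) (τ : E → Ω → ℝ≥0) (f : Finset (Fin a) → Fin a → E), IIDField τ F μ →
        DistinctEdges f → μ {ω | (growSets τ f δg (m + 1) ω).card ≤ L} ≤ eexp (-(c * a)) := by
  set ε : ℝ≥0 := min δ₀ (gap / 8) with hε
  have hε0 : 0 < ε := lt_min hδ₀ (by positivity)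
  set p : ℝ := ρ₁ * ε with hp
  have hp0 : 0 < p := by positivity
  have hpF : ENNReal.ofReal p ≤ F (Set.Iic ε) := by
    have : ENNReal.ofReal p = ρ₁ * ε := by
      rw [hp, ← NNReal.coe_mul, ENNReal.ofReal_coe_nnreal, ENNReal.coe_mul]
    rw [this]; exact hF₁ _ (min_le_left _ _)
  have hp1 : p ≤ 1 := by
    have := hpF.trans prob_le_one
    rwa [← ENNReal.ofReal_one, ENNReal.ofReal_le_ofReal_iff zero_le_one] at this
  set κ : ℝ := min (1 / 96) (gap * ρ₁ / 192) with hκ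
  have hρr : (0 : ℝ) < ρ₁ := by exact_mod_cast hρ₁
  have hgr : (0 : ℝ) < gap := by exact_mod_cast hgap
  have hκ0 : 0 < κ := lt_min (by norm_num) (by positivity)
  obtain ⟨N₀, hN₀⟩ := exists_mul_pow_le_eexp (K := 1) (by simp) 1 (a := p / 32) (by positivity)
  set β : ℝ≥0 := 24 / ρ₁ with hβ
  have hβr : (β : ℝ) * ρ₁ = 24 := by rw [hβ]; push_cast; field_simp
  have hβ0 : (0 : ℝ) < β := by rw [hβ]; positivity
  have e1 : Tendsto (fun a : ℕ => β / (a : ℝ≥0)) atTop (𝓝 0) := tendsto_const_div_atTop_nhds_zero_nat β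
  have e2 : Tendsto (fun a : ℕ => κ * (a : ℝ)) atTop atTop :=
    tendsto_natCast_atTop_atTop.const_mul_atTop hκ0
  have e3 : Tendsto (fun a : ℕ => p * (a : ℝ)) atTop atTop :=
    tendsto_natCast_atTop_atTop.const_mul_atTop hp0
  obtain ⟨a₁, ha₁⟩ := eventually_atTop.1 ((e1.eventually (gt_mem_nhds hδ₀)).and
    ((e2.eventually_ge_atTop 2).and (e3.eventually_ge_atTop 32)))
  refine ⟨κ / 4, by positivity, p / 32, by positivity, max (max N₀ a₁) 96, fun a ha => ?_⟩
  have ha96 : 96 ≤ a := le_trans (le_max_right _ _) ha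
  have haN : N₀ ≤ a := le_trans (le_trans (le_max_left _ _) (le_max_left _ _)) ha
  obtain ⟨h1, h2, h3⟩ := ha₁ a (le_trans (le_trans (le_max_right _ _) (le_max_left _ _)) ha)
  have ha0 : (96 : ℝ) ≤ a := by exact_mod_cast ha96
  have hapos : (0 : ℝ) < a := by linarith
  set m : ℕ := ⌊κ * a⌋₊ with hm
  have hm1 : (m : ℝ) ≤ κ * a := Nat.floor_le (by positivity)
  have hm2 : κ * a < m + 1 := Nat.lt_floor_add_one _
  have hmκ : (m : ℝ) ≤ a / 96 := by
    have := mul_le_mul_of_nonneg_right (min_le_left (1 / 96) (gap * ρ₁ / 192 : ℝ)) hapos.le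
    linarith
  set K : ℕ := ⌊p * a / 8⌋₊ with hK
  have hK1 : (K : ℝ) ≤ p * a / 8 := Nat.floor_le (by positivity)
  have hK2 : p * a / 8 < K + 1 := Nat.lt_floor_add_one _
  set δg : ℕ → ℝ≥0 := fun i => if i = 0 then ε else β / a with hδg
  refine ⟨δg, m, 2 ^ m * K, ?_, ?_, fun E τ f hτ hf => ?_⟩
  · have hK3 : (1 : ℝ) ≤ K := by
      have : (0 : ℝ) < K := by linarith
      exact_mod_cast Nat.one_le_iff_ne_zero.2 (by rintro h; simp [h] at this)
    have h4 : Real.exp (κ / 4 * a) ≤ 2 ^ m := by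
      rw [← Real.exp_log (show (0 : ℝ) < 2 ^ m by positivity), Real.log_pow]
      refine Real.exp_le_exp.2 ?_
      have := mul_le_mul_of_nonneg_left Real.log_two_gt_d9.le (Nat.cast_nonneg (α := ℝ) m)
      linarith
    push_cast
    nlinarith [show (0 : ℝ) < 2 ^ m by positivity]
  · have h5 : 2 * ∑ i ∈ Finset.range (m + 1), δg i ≤ gap := by
      rw [Finset.sum_range_succ', hδg]
      simp only [Nat.add_eq_zero_iff, one_ne_zero, and_false, if_false, if_true, Finset.sum_const,
        Finset.card_range, nsmul_eq_mul]
      rw [← NNReal.coe_le_coe]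
      push_cast
      have h6 : (ε : ℝ) ≤ gap / 8 := by exact_mod_cast min_le_right δ₀ (gap / 8)
      have h7 : (m : ℝ) * (β / a) ≤ gap / 8 := by
        rw [mul_div_assoc', div_le_iff₀ hapos]
        have h8 : κ * β ≤ gap / 8 := by
          have := mul_le_mul_of_nonneg_right (min_le_right (1 / 96) (gap * ρ₁ / 192 : ℝ)) hβ0.le
          have h9 : (gap * ρ₁ / 192 : ℝ) * β = gap * (β * ρ₁) / 192 := by ring
          rw [h9, hβr] at this
          linarith
        have h9 := mul_le_mul_of_nonneg_right hm1 hβ0.le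
        have h10 := mul_le_mul_of_nonneg_right h8 hapos.le
        linarith
      linarith
    exact_mod_cast ENNReal.coe_le_coe.2 h5
  · have hδ0 : δg 0 = ε := if_pos rfl
    have hq : ∀ k, 1 ≤ k → k ≤ m → ENNReal.ofReal (24 / a) ≤ F (Set.Iic (δg k)) := by
      intro k hk _
      have h4 : δg k = β / a := if_neg (by omega)
      rw [h4]
      refine le_trans (le_of_eq ?_) (hF₁ _ h1.le)
      rw [← ENNReal.coe_mul, ← ENNReal.ofReal_coe_nnreal]
      congr 1
      push_cast
      rw [← hβr]
      ring
    have h6 := measure_growSets_card_le hτ hf (δ := δg) hp0.le hp1 (hδ0 ▸ hpF) (p := 24 / a) (by positivity)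
      (by rw [div_le_one hapos]; linarith) (m := m) hq
      (by rw [div_mul_eq_mul_div, div_le_one hapos]; linarith)
      (by have : (2 * m : ℝ) ≤ a := by linarith
          exact_mod_cast this)
      (by rw [div_mul_cancel₀ _ hapos.ne']) K hK1
    have h7 : eexp (-(K : ℝ)) ≤ eexp (-(p * a / 16)) := eexp_mono (by linarith)
    calc _ ≤ eexp (-(K : ℝ)) + m * eexp (-(K : ℝ)) := h6
      _ = ((1 + m : ℕ) : ℝ≥0∞) * eexp (-(K : ℝ)) := by push_cast; ring
      _ ≤ ((3 * a + 1 : ℕ) : ℝ≥0∞) * eexp (-(p * a / 16)) := by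
        refine mul_le_mul' (Nat.cast_le.2 ?_) h7
        have : (m : ℝ) ≤ a := by linarith
        have : m ≤ a := by exact_mod_cast this
        omega
      _ ≤ eexp (a * (p / 32)) * eexp (-(p * a / 16)) := by
        refine mul_le_mul_left ?_ _
        simpa using hN₀ a haN
      _ = _ := by rw [← eexp_add]; congr 1; ring

end MixedGraph

/-- With `e^(y+z)` independent tries of success probability `e^(-y)`, failure has probability at
most `exp (-e^z)`. -/
theorem one_sub_eexp_pow_le {y z : ℝ} {L : ℕ} (hL : Real.exp (y + z) ≤ L) :
    (1 - eexp (-y)) ^ L ≤ eexp (-z) := by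
  have h1 : 1 - eexp (-y) ≤ eexp (-Real.exp (-y)) := by
    rw [eexp, eexp, ← ENNReal.ofReal_one, ← ENNReal.ofReal_sub _ (Real.exp_pos _).le]
    exact ENNReal.ofReal_le_ofReal (by linarith [Real.add_one_le_exp (-Real.exp (-y))])
  refine (pow_le_pow_left' h1 L).trans ?_
  rw [← eexp_nsmul]
  refine eexp_mono ?_
  have h2 : Real.exp z ≤ L * Real.exp (-y) := by
    have := mul_le_mul_of_nonneg_right hL (Real.exp_pos (-y)).le
    rwa [← Real.exp_add, show y + z + -y = z by ring] at this
  linarith [Real.add_one_le_exp z]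

namespace MixedGraph
variable {V : Type u} {E : Type v} {G : MixedGraph V E} {D : ℕ}
  {Ω : Type*} [MeasurableSpace Ω] {F : Measure ℝ≥0} {μ : Measure Ω} [IsProbabilityMeasure μ]

/-- Order of choices: `exists_chain` gives the rate `c`; the block size `a`, about `η n`, is taken
so small that moving the blocks costs at most this rate; then the error rate `κ η / 4` is chosen so
that the exponentially many tries outnumber the inverse success probability; the number of slices
and the time `ε₁` for the other entrances come last. -/
theorem exists_bad_of_lt (hG : G.Loopless) (hD : G.DegreeLE D) (hA : G.adj.Tame D) (hD1 : 1 ≤ D)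
    (hrev : G.adj.Reversible) {u : ℕ → V} {d : ℕ} (hu : SimplePath G u d) (hd : 1 ≤ d)
    {t ρ s : ℝ≥0} (ht : t ≠ 0) (hρ : 0 < ρ) (hF : ClassC ρ F) {q : ℝ} (hq : 0 ≤ q)
    (hm : 1 < G.genFun (u 0) (u d) t)
    (hq1 : ENNReal.ofReal q * G.genFun (u 0) (u d) t < G.genFun (u 0) (u d) (t / 2))
    (hq2 : Real.log (G.genFun (u 0) (u d) t).toReal ≤ q ^ 2) (hs : t / ρ < s) :
    ∃ c > 0, ∃ n₁ : ℕ, ∀ n ≥ n₁, ∀ τ : PowEdge V E n → Ω → ℝ≥0, IIDField τ F μ →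
      ∃ Bad : Set Ω, ∃ 𝒲 : Set (PowEdge V E n), MeasurableSet[sig τ 𝒲] Bad ∧
        Disjoint (edgesSeq E d u n) 𝒲 ∧ μ Bad ≤ eexp (-(c * n)) ∧
        ∀ ω ∉ Bad,
          (G.pow n).passageTime (fun f => τ f ω) (fun _ => u 0) (fun _ => u d) ≤ s := by
  haveI := hF.isProbabilityMeasure
  have hvw : u 0 ≠ u d := fun h1 => by have := hu.inj 0 (by omega) d le_rfl h1; omega
  set gap : ℝ≥0 := s - t / ρ with hgap
  have hgap0 : 0 < gap := tsub_pos_of_lt hs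
  have hsum : t / ρ + gap = s := add_tsub_cancel_of_le hs.le
  obtain ⟨δ₀, hδ₀, hFb⟩ := hF.exists_bounds (ρ₁ := ρ / 2) (ρ₂ := ρ * 2) (half_lt_self hρ)
    (lt_mul_of_one_lt_right hρ one_lt_two)
  have hF₁ := fun y hy => (hFb y hy).1
  have hF₂ := fun y hy => (hFb y hy).2
  have hρρ : ρ / 2 ≤ ρ * 2 :=
    (half_lt_self hρ).le.trans (lt_mul_of_one_lt_right hρ one_lt_two).le
  set ϑ : ℝ≥0 → ℝ≥0 := fun ε => ρ / 2 * ε / (1 + ρ * 2 * ε) with hϑ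
  have hϑ0 : ∀ ε, 0 < ε → 0 < ϑ ε := fun ε hε => by rw [hϑ]; positivity
  have hϑ1 : ∀ ε, ϑ ε ≤ 1 := fun ε =>
    div_le_one_of_le₀ ((mul_le_mul_left hρρ ε).trans le_add_self) zero_le
  have hd0 : (0 : ℝ≥0) < d := by exact_mod_cast hd
  set εh : ℝ≥0 := min δ₀ (gap / (12 * d)) with hεh
  have hεh0 : 0 < εh := lt_min hδ₀ (by positivity)
  set b₀ : ℝ := -Real.log (ϑ εh) with hb₀
  have hb₀0 : 0 ≤ b₀ := by
    have := Real.log_nonpos (ϑ εh).2 (by exact_mod_cast hϑ1 εh)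
    change Real.log (ϑ εh) ≤ 0 at this
    linarith
  have hϑe : (ϑ εh : ℝ≥0∞) = eexp (-b₀) := by
    rw [eexp, hb₀, neg_neg, Real.exp_log (by exact_mod_cast hϑ0 _ hεh0), ENNReal.ofReal_coe_nnreal]
  obtain ⟨c, hc, hch⟩ := exists_chain (Ω := Ω) (μ := μ) hG hD hA hD1 hrev hvw ht hρ hF hq hm hq1 hq2
  obtain ⟨κ, hκ, cg, hcg, a₀, hgrow⟩ := exists_growth (μ := μ) (gap := gap / 2) (ρ₁ := ρ / 2)
    (by positivity) hδ₀ hF₁ (by positivity)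
  have hdr : (0 : ℝ) < d := by exact_mod_cast hd
  -- The middle entrance has probability at least `exp (-b₀)` to the power `3 d (2 a + 1)`. With `2
  -- a + 1 ≤ 3 η n` and `n ≤ 2 N`, the choice of `η` bounds this loss by `exp (c N)`.
  set η : ℝ := min (1 / 8) (c / (18 * d * (b₀ + 1))) with hη
  have hη0 : 0 < η := lt_min (by norm_num) (by positivity)
  have hη1 : η ≤ 1 / 8 := min_le_left _ _
  have hη2 : 9 * d * η * b₀ ≤ c / 2 := by
    have h1 : η * (18 * d * (b₀ + 1)) ≤ c := (le_div_iff₀ (by positivity)).1 (min_le_right _ _)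
    have h2 : 0 ≤ d * η := by positivity
    linarith
  obtain ⟨h, δ, hh, hδ, hch⟩ := hch (κ * η / 4) (by positivity)
  have hh0 : (0 : ℝ≥0) < h := by exact_mod_cast hh
  set ε₁ : ℝ≥0 := min δ₀ (gap / (24 * d * h)) with hε₁
  have hε₁0 : 0 < ε₁ := lt_min hδ₀ (by positivity)
  obtain ⟨N₀, hch⟩ := hch ((ϑ ε₁ : ℝ≥0∞) ^ (3 * d))
    (pow_ne_zero _ (by exact_mod_cast (hϑ0 _ hε₁0).ne'))
    (pow_le_one' (by exact_mod_cast hϑ1 ε₁) _)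
  set c₃ : ℝ := min (cg * η / 2) (κ * η / 4) with hc₃
  have hc₃0 : 0 < c₃ := lt_min (by positivity) (by positivity)
  have e1 : ∀ x : ℝ, 0 < x → Tendsto (fun n : ℕ => x * (n : ℝ)) atTop atTop := fun x hx =>
    tendsto_natCast_atTop_atTop.const_mul_atTop hx
  obtain ⟨n₁, hn₁⟩ := eventually_atTop.1 ((((e1 η hη0).eventually_ge_atTop (2 + 2 * a₀)).and
    ((e1 c₃ hc₃0).eventually_ge_atTop 4)).and (eventually_ge_atTop (8 * h + 2 * N₀)))
  refine ⟨c₃ / 2, by positivity, n₁, fun n hn τ hτ => ?_⟩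
  obtain ⟨⟨h1, h2⟩, h3⟩ := hn₁ n hn
  obtain ⟨a, ha1, ha2⟩ : ∃ a : ℕ, (a : ℝ) ≤ η * n ∧ η * n < a + 1 :=
    ⟨⌊η * n⌋₊, Nat.floor_le (by positivity), Nat.lt_floor_add_one _⟩
  have ha0r : (0 : ℝ) ≤ a₀ := Nat.cast_nonneg _
  have haa : a₀ ≤ a := by
    have : (a₀ : ℝ) < a + 1 := by linarith
    have : a₀ < a + 1 := by exact_mod_cast this
    omega
  have ha8 : 8 * a ≤ n := by
    have : (8 * a : ℝ) ≤ n := by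
      have := mul_le_mul_of_nonneg_right hη1 (Nat.cast_nonneg (α := ℝ) n)
      linarith
    exact_mod_cast this
  obtain ⟨k, hk⟩ : ∃ k, k + 1 = 2 * h := ⟨2 * h - 1, by omega⟩
  obtain ⟨N, rfl⟩ : ∃ N, n = N + a + k + a := ⟨n - 2 * a - k, by omega⟩
  obtain ⟨𝒞, h0, hl, hch⟩ := hch N (by omega)
  obtain ⟨δg, m, L, hL, hδg, hgrow⟩ := hgrow a haa
  set nn : ℝ := ((N + a + k + a : ℕ) : ℝ) with hnn
  have hNn : nn ≤ 2 * N := by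
    have : N + a + k + a ≤ 2 * N := by omega
    rw [hnn]; exact_mod_cast this
  have hnN : (N : ℝ) ≤ nn := by
    have : N ≤ N + a + k + a := by omega
    rw [hnn]; exact_mod_cast this
  have hb : ∀ J J', eexp (-(κ * η / 4 * N)) ≤
      μ (tryEvent G τ u h d 𝒞 (fun r => if r = h then εh else ε₁) δ J J') := by
    intro J J'
    refine le_measure_tryEvent hτ hG hD (ρ₁ := ρ / 2) (ρ₂ := ρ * 2)
      (fun r y hy => hF₁ y (hy.trans ?_)) (fun r y hy => hF₂ y (hy.trans ?_)) hρρ hu hd hk hh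
      (q₀ := eexp (-(c * N))) (ε₁ := ε₁) (fun r hr => if_neg hr) ?_ ?_
    · split_ifs <;> exact min_le_left _ _
    · split_ifs <;> exact min_le_left _ _
    · rw [if_pos rfl]
      change _ ≤ ((ϑ εh : ℝ≥0) : ℝ≥0∞) ^ _
      rw [hϑe, ← eexp_nsmul]
      refine eexp_mono ?_
      push_cast
      have h4 : (2 * a + 1 : ℝ) ≤ 3 * (η * nn) := by linarith
      have h5 := mul_le_mul_of_nonneg_left h4 (show (0 : ℝ) ≤ 3 * d * b₀ by positivity)
      have h6 := mul_le_mul_of_nonneg_right hη2 (show (0 : ℝ) ≤ nn by positivity)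
      have h7 := mul_le_mul_of_nonneg_left hNn hc.le
      linarith
    · exact hch _ (by omega) τ hτ
  obtain ⟨Bad, 𝒲, h4, h5, h6, h7⟩ := exists_bad hτ hG hD hu hd hk hh (by omega) h0 hl hb δg
    (fun f hf => hgrow _ τ f hτ hf)
  refine ⟨Bad, 𝒲, h4, h5, h6.trans ?_, fun ω hω => (h7 ω hω).trans ?_⟩
  · have hn0 : (0 : ℝ) ≤ nn := Nat.cast_nonneg _
    have g1 : eexp (-(cg * a)) ≤ eexp (-(c₃ * nn)) := eexp_mono <| neg_le_neg <| by
      have := mul_le_mul_of_nonneg_right (min_le_left (cg * η / 2) (κ * η / 4)) hn0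
      have h8 : η * nn ≤ 2 * a := by linarith
      have := mul_le_mul_of_nonneg_left h8 hcg.le
      linarith
    have g2 : (1 - eexp (-(κ * η / 4 * N))) ^ L ≤ eexp (-(c₃ * nn)) := by
      refine one_sub_eexp_pow_le (le_trans (Real.exp_le_exp.2 ?_) hL)
      have := mul_le_mul_of_nonneg_right (min_le_right (cg * η / 2) (κ * η / 4)) hn0
      have h8 : η * nn ≤ 2 * a := by linarith
      have := mul_le_mul_of_nonneg_left h8 hκ.le
      have := mul_le_mul_of_nonneg_left hnN (show 0 ≤ κ * η / 4 by positivity)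
      linarith
    have g3 : (3 : ℝ≥0∞) ≤ eexp (c₃ / 2 * nn) := by
      rw [eexp, show (3 : ℝ≥0∞) = ENNReal.ofReal 3 by simp]
      exact ENNReal.ofReal_le_ofReal (by linarith [Real.add_one_le_exp (c₃ / 2 * nn)])
    calc _ ≤ eexp (-(c₃ * nn)) + eexp (-(c₃ * nn)) + eexp (-(c₃ * nn)) :=
          add_le_add (add_le_add g1 g1) g2
      _ = 3 * eexp (-(c₃ * nn)) := by ring
      _ ≤ eexp (c₃ / 2 * nn) * eexp (-(c₃ * nn)) := mul_le_mul_left g3 _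
      _ = _ := by rw [← eexp_add]; congr 1; ring
  -- Half of the spare time `gap` is reserved for the growth at both ends, a quarter for the middle
  -- entrance and a quarter for the other entrances.
  · have g1 : ∑ r ∈ Finset.range (2 * h), ((3 * d : ℕ) * (if r = h then εh else ε₁) + δ) ≤
        t / ρ + gap / 2 := by
      have g2 : ∀ r, ((3 * d : ℕ) * (if r = h then εh else ε₁) + δ : ℝ≥0) ≤
          (if r = h then 3 * d * εh else 0) + (3 * d * ε₁ + δ) := by
        intro r
        push_cast
        split_ifs
        · rw [← add_assoc]
          exact add_le_add_left le_self_add _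
        · rw [zero_add]
      refine (Finset.sum_le_sum fun r _ => g2 r).trans ?_
      rw [Finset.sum_add_distrib, Finset.sum_ite_eq', if_pos (by simp; omega), Finset.sum_const,
        Finset.card_range, nsmul_eq_mul]
      have g3 : 3 * d * εh ≤ gap / 4 := by
        refine (mul_le_mul_right (min_le_right _ _) _).trans (le_of_eq ?_)
        field_simp; norm_num
      have g4 : 2 * h * (3 * d * ε₁) ≤ gap / 4 := by
        refine (mul_le_mul_right (mul_le_mul_right (min_le_right _ _) _) _).trans (le_of_eq ?_)
        field_simp; norm_num
      have g5 : 2 * h * δ ≤ t / ρ := by rwa [le_div_iff₀ hρ]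
      rw [← NNReal.coe_le_coe] at *
      push_cast at *
      linarith
    have g2 := ENNReal.coe_le_coe.2 g1
    rw [ENNReal.ofNNReal_finsetSum] at g2
    calc _ ≤ ((gap / 2 : ℝ≥0) : ℝ≥0∞) + ((t / ρ + gap / 2 : ℝ≥0) : ℝ≥0∞) := by
          refine add_le_add hδg (le_trans (le_of_eq ?_) g2)
          exact Finset.sum_congr rfl fun r _ => by push_cast; rfl
      _ = s := by
        rw [← ENNReal.coe_add, ← hsum]
        congr 1
        rw [add_left_comm, add_halves]

end MixedGraph

/-! ### First moment bound for fast paths. -/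

section sums
variable {E Ω : Type*} [MeasurableSpace Ω] {τ : E → Ω → ℝ≥0} {F : Measure ℝ≥0} {μ : Measure Ω}
  [IsProbabilityMeasure μ]

theorem lintegral_sub_weight_eq {Y : Ω → ℝ≥0} (hY : Measurable Y) (x : ℝ≥0) {g : ℝ → ℝ}
    (hg : Continuous g) (hg0 : ∀ t, 0 ≤ g t) :
    ∫⁻ ω, ENNReal.ofReal (∫ t in (0 : ℝ)..((x - Y ω : ℝ≥0) : ℝ), g t) ∂μ =
      ∫⁻ t in Set.Ioc (0 : ℝ) x, μ {ω | (Y ω : ℝ) ≤ x - t} * ENNReal.ofReal (g t) := by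
  rw [lintegral_comp_eq_lintegral_meas_le_mul μ (f := fun ω => ((x - Y ω : ℝ≥0) : ℝ))
    (Eventually.of_forall fun ω => NNReal.coe_nonneg _)
    (measurable_const.sub hY).coe_nnreal_real.aemeasurable
    (fun t _ => hg.intervalIntegrable _ _) (Eventually.of_forall hg0),
    ← lintegral_indicator measurableSet_Ioi, ← lintegral_indicator measurableSet_Ioc]
  refine lintegral_congr fun t => ?_
  by_cases ht : 0 < t
  · by_cases htx : t ≤ x
    · rw [Set.indicator_of_mem (Set.mem_Ioi.2 ht), Set.indicator_of_mem (Set.mem_Ioc.2 ⟨ht, htx⟩)]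
      congr 2; ext ω
      simp only [Set.mem_ofPred_eq]
      rw [NNReal.coe_sub_def, le_max_iff, or_iff_left (not_le.2 ht)]
      constructor <;> intro h' <;> linarith
    · rw [Set.indicator_of_mem (Set.mem_Ioi.2 ht),
        Set.indicator_of_notMem (fun h => htx (Set.mem_Ioc.1 h).2)]
      rw [show {a | t ≤ ((x - Y a : ℝ≥0) : ℝ)} = ∅ from ?_, measure_empty, zero_mul]
      ext ω
      simp only [Set.mem_ofPred_eq, Set.mem_empty_iff_false, iff_false, not_le]
      refine lt_of_le_of_lt ?_ (not_le.1 htx)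
      exact_mod_cast tsub_le_self
  · rw [Set.indicator_of_notMem (s := Set.Ioi 0) ht, Set.indicator_of_notMem fun h => ht h.1]

/-- Unlike `measure_sum_le` this holds for every `x`: the exponential factor pays for times where
`F` is not nearly linear. As it depends on `x` only and not on the number of edges, it is harmless
in the sum over paths. -/
theorem IIDField.measure_sum_le_exp (h : IIDField τ F μ) {θ : ℝ≥0} {κ : ℝ} (hκ : 0 ≤ κ)
    (hF : ∀ y : ℝ≥0, F (Set.Iic y) ≤ ENNReal.ofReal (∫ t in (0 : ℝ)..y, θ * Real.exp (κ * t)))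
    (s : Finset E) (x : ℝ≥0) : μ {ω | ∑ e ∈ s, τ e ω ≤ x} ≤
      ENNReal.ofReal (Real.exp (κ * x)) * ENNReal.ofReal ((θ * x) ^ s.card / s.card !) := by
  classical
  induction s using Finset.induction_on generalizing x with
  | empty =>
    have : 1 ≤ ENNReal.ofReal (Real.exp (κ * x)) := one_le_eexp (by positivity)
    simpa using this
  | insert e s he ih =>
    have hY : Measurable (fun ω => ∑ e ∈ s, τ e ω) :=
      Finset.measurable_fun_sum s fun e _ => h.measurable e
    rw [h.measure_add_le he]
    calc _ ≤ ∫⁻ ω, ENNReal.ofReal (∫ t in (0 : ℝ)..((x - ∑ e ∈ s, τ e ω : ℝ≥0) : ℝ),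
            θ * Real.exp (κ * t)) ∂μ := by
          refine lintegral_mono fun ω => ?_
          rcases le_total (∑ e ∈ s, τ e ω) x with hle | hle
          · exact (measure_mono fun a (ha : a + _ ≤ x) => le_tsub_of_add_le_right ha).trans (hF _)
          · have := hF 0
            simp only [NNReal.coe_zero, intervalIntegral.integral_same, ENNReal.ofReal_zero] at this
            simp only [tsub_eq_zero_of_le hle, NNReal.coe_zero, intervalIntegral.integral_same,
              ENNReal.ofReal_zero]
            refine (measure_mono fun a ha => ?_).trans this
            have ha : a + _ ≤ x := ha
            exact add_le_iff_nonpos_left.1 (ha.trans hle)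
      _ = ∫⁻ t in Set.Ioc (0 : ℝ) x, μ {ω | ((∑ e ∈ s, τ e ω : ℝ≥0) : ℝ) ≤ x - t} *
            ENNReal.ofReal (θ * Real.exp (κ * t)) :=
          lintegral_sub_weight_eq hY x (by fun_prop) fun t => by positivity
      _ ≤ ∫⁻ t in Set.Ioc (0 : ℝ) x, ENNReal.ofReal (θ * Real.exp (κ * x)) *
            ENNReal.ofReal ((θ * (x - t)) ^ s.card / s.card !) := by
          refine setLIntegral_mono' measurableSet_Ioc fun t ht => ?_
          have h0 : (0 : ℝ) ≤ x - t := by linarith [ht.2]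
          obtain ⟨y, hy⟩ : ∃ y : ℝ≥0, (y : ℝ) = x - t := ⟨(x - t).toNNReal, Real.coe_toNNReal _ h0⟩
          rw [← hy]
          have h1 := ih y
          simp only [← NNReal.coe_le_coe] at h1
          refine (mul_le_mul_left h1 _).trans (le_of_eq ?_)
          rw [show (x : ℝ) = y + t by linarith, mul_right_comm, mul_add, Real.exp_add,
            ← ENNReal.ofReal_mul (Real.exp_pos _).le]
          congr 2; ring
      _ = _ := by
          rw [lintegral_const_mul' _ _ ENNReal.ofReal_ne_top, lintegral_Ioc_pow,
            Finset.card_insert_of_notMem he, ← ENNReal.ofReal_mul (by positivity),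
            ← ENNReal.ofReal_mul (by positivity)]
          congr 1
          rw [mul_pow]; ring

end sums

theorem ClassC.exists_le_integral_exp {ρ θ : ℝ≥0} {F : Measure ℝ≥0} (hF : ClassC ρ F) (hρ : 0 < ρ)
    (hθ : ρ < θ) : ∃ κ : ℝ, 0 ≤ κ ∧
      ∀ y : ℝ≥0, F (Set.Iic y) ≤ ENNReal.ofReal (∫ t in (0 : ℝ)..y, θ * Real.exp (κ * t)) := by
  haveI := hF.isProbabilityMeasure
  obtain ⟨δ, hδ, h⟩ := hF.exists_bounds (half_lt_self hρ) hθ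
  have hθ0 : (0 : ℝ) < θ := by exact_mod_cast hρ.trans hθ
  have hδ0 : (0 : ℝ) < δ := hδ
  -- With this constant the quadratic term `θ κ y² / 2` of the integral reaches `1` at `y = δ`,
  -- where the linear bound for `F` ends.
  refine ⟨2 / (θ * δ ^ 2), by positivity, fun y => ?_⟩
  set κ : ℝ := 2 / (θ * δ ^ 2) with hκ
  have hκ0 : 0 ≤ κ := by positivity
  have h1 : θ * y + θ * κ * y ^ 2 / 2 ≤ ∫ t in (0 : ℝ)..y, θ * Real.exp (κ * t) := by
    have h2 : ∫ t in (0 : ℝ)..y, (θ + θ * κ * t : ℝ) = θ * y + θ * κ * y ^ 2 / 2 := by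
      rw [intervalIntegral.integral_add (Continuous.intervalIntegrable (by fun_prop) _ _)
        (Continuous.intervalIntegrable (by fun_prop) _ _),
        intervalIntegral.integral_const_mul, integral_id, intervalIntegral.integral_const]
      simp; ring
    rw [← h2]
    refine intervalIntegral.integral_mono_on y.2 (Continuous.intervalIntegrable (by fun_prop) _ _)
      (Continuous.intervalIntegrable (by fun_prop) _ _) fun t _ => ?_
    have := mul_le_mul_of_nonneg_left (Real.add_one_le_exp (κ * t)) hθ0.le
    linarith
  rcases le_total y δ with hy | hy
  · refine (h y hy).2.trans ?_
    rw [← ENNReal.ofReal_coe_nnreal, ← ENNReal.ofReal_coe_nnreal, ← ENNReal.ofReal_mul hθ0.le]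
    refine ENNReal.ofReal_le_ofReal (le_trans ?_ h1)
    have : (0 : ℝ) ≤ θ * κ * y ^ 2 / 2 := by positivity
    linarith
  · refine prob_le_one.trans ?_
    rw [← ENNReal.ofReal_one]
    refine ENNReal.ofReal_le_ofReal (le_trans ?_ h1)
    have h3 : (δ : ℝ) ^ 2 ≤ (y : ℝ) ^ 2 := by
      have : (δ : ℝ) ≤ y := hy
      gcongr
    have h4 : θ * κ * (δ : ℝ) ^ 2 = 2 := by rw [hκ]; field_simp
    have h5 := mul_le_mul_of_nonneg_left h3 (show (0 : ℝ) ≤ θ * κ by positivity)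
    have : (0 : ℝ) ≤ θ * y := by positivity
    linarith

namespace MixedGraph
variable {V : Type u} {E : Type v} {G : MixedGraph V E}

/-- The edges of a path. -/
def Path.edges : {x y : V} → G.Path x y → List E
  | _, _, .nil _ => []
  | _, _, .cons e _ γ => e :: γ.edges

theorem Path.length_edges {x y : V} (γ : G.Path x y) : γ.edges.length = γ.length := by
  induction γ with
  | nil => rfl
  | cons e h γ ih => simp [edges, length, ih]

theorem Path.time_eq (τ : E → ℝ≥0) {x y : V} (γ : G.Path x y) :
    γ.time τ = ((γ.edges.map τ).sum : ℝ≥0) := by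
  induction γ with
  | nil => simp [edges, time]
  | cons e h γ ih => simp [edges, time, ih]

theorem Path.edges_injective {x y : V} :
    Function.Injective fun γ : G.Path x y => γ.edges := by
  intro γ γ' h
  dsimp only at h
  induction γ with
  | nil =>
    cases γ' with
    | nil => rfl
    | cons => simp [edges] at h
  | cons e he γ ih =>
    cases γ' with
    | nil => simp [edges] at h
    | cons e' he' γ' =>
      simp only [edges, List.cons.injEq] at h
      obtain ⟨rfl, h⟩ := h
      obtain rfl := he.right_unique he'
      rw [ih h]

instance [Countable E] (x y : V) : Countable (G.Path x y) := Path.edges_injective.countable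

theorem Path.exists_suffix {x y : V} (γ : G.Path x y) {e : E} (he : e ∈ γ.edges) :
    ∃ a b, G.Joins e a b ∧ ∃ γ' : G.Path b y, (e :: γ'.edges).Sublist γ.edges := by
  induction γ with
  | nil => simp [edges] at he
  | cons f hf γ ih =>
    rw [edges, List.mem_cons] at he
    rcases he with rfl | he
    · exact ⟨_, _, hf, γ, List.Sublist.refl _⟩
    · obtain ⟨a, b, h1, γ', h2⟩ := ih he
      exact ⟨a, b, h1, γ', h2.trans (List.sublist_cons_self _ _)⟩

/-- If the first edge recurs, jump to the recurrence. In the same direction it is kept once; in the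
opposite direction the path is back at its start, and both crossings are dropped. -/
theorem Path.exists_nodup {x y : V} (γ : G.Path x y) :
    ∃ γ' : G.Path x y, γ'.edges.Nodup ∧ γ'.edges.Sublist γ.edges := by
  induction γ with
  | nil x => exact ⟨.nil x, by simp [edges], List.Sublist.refl _⟩
  | cons e h γ ih =>
    obtain ⟨γ', h1, h2⟩ := ih
    by_cases he : e ∈ γ'.edges
    · obtain ⟨a, b, h3, γ₂, h4⟩ := γ'.exists_suffix he
      rcases h.eq_or_eq h3 with ⟨rfl, rfl⟩ | ⟨rfl, rfl⟩
      · exact ⟨.cons e h γ₂, h4.nodup h1, h4.trans (h2.trans (List.sublist_cons_self _ _))⟩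
      · exact ⟨γ₂, (h4.nodup h1).of_cons, (List.sublist_cons_self _ _).trans
          (h4.trans (h2.trans (List.sublist_cons_self _ _)))⟩
    · exact ⟨.cons e h γ', List.nodup_cons.2 ⟨he, h1⟩, h2.cons_cons e⟩

/-- Union bound over the paths without repeated edges; only for these are the passage times along
the path independent. -/
theorem measure_passageTime_lt_le {Ω : Type*} [MeasurableSpace Ω] {τ : E → Ω → ℝ≥0}
    {F : Measure ℝ≥0} {μ : Measure Ω} [IsProbabilityMeasure μ] [Countable E]
    (h : IIDField τ F μ) {θ : ℝ≥0} {κ : ℝ} (hκ : 0 ≤ κ)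
    (hF : ∀ y : ℝ≥0, F (Set.Iic y) ≤ ENNReal.ofReal (∫ t in (0 : ℝ)..y, θ * Real.exp (κ * t)))
    (x y : V) (s : ℝ≥0) : μ {ω | G.passageTime (fun e => τ e ω) x y < s} ≤
      ENNReal.ofReal (Real.exp (κ * s)) * G.genFun x y (θ * s) := by
  classical
  have h1 : {ω | G.passageTime (fun e => τ e ω) x y < s} ⊆ ⋃ γ : G.Path x y,
      {ω | γ.edges.Nodup ∧ ∑ e ∈ γ.edges.toFinset, τ e ω ≤ s} := by
    intro ω hω
    obtain ⟨γ, hγ⟩ := iInf_lt_iff.1 (show (⨅ γ : G.Path x y, γ.time fun e => τ e ω) < s from hω)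
    obtain ⟨γ', h2, h3⟩ := γ.exists_nodup
    refine Set.mem_iUnion.2 ⟨γ', h2, ?_⟩
    rw [List.sum_toFinset _ h2]
    rw [Path.time_eq, ENNReal.coe_lt_coe] at hγ
    exact ((h3.map _).sum_le_sum fun _ _ => zero_le).trans hγ.le
  refine (measure_mono h1).trans ((measure_iUnion_le _).trans ?_)
  rw [genFun, ← ENNReal.tsum_mul_left]
  refine ENNReal.tsum_le_tsum fun γ => ?_
  by_cases hγ : γ.edges.Nodup
  · simp only [hγ, true_and]
    refine (h.measure_sum_le_exp hκ hF _ s).trans (le_of_eq ?_)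
    rw [List.toFinset_card_of_nodup hγ, γ.length_edges, ENNReal.ofReal_div_of_pos (by positivity),
      ENNReal.ofReal_pow (by positivity), ← NNReal.coe_mul, ENNReal.ofReal_coe_nnreal,
      ENNReal.ofReal_natCast]
  · simp [hγ]

end MixedGraph

/-! ### The generating function of a power, and the critical time. -/

theorem Kern.pow_apply_mono {V : Type u} {A B : Kern V} (h : ∀ x y, A x y ≤ B x y) (k : ℕ) :
    ∀ x y, (A ^ k) x y ≤ (B ^ k) x y := by
  induction k with
  | zero => simp
  | succ k ih =>
    intro x y
    rw [pow_succ, pow_succ, mul_apply, mul_apply]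
    exact ENNReal.tsum_le_tsum fun z => mul_le_mul' (ih x z) (h z y)

namespace MixedGraph
variable {V : Type u} {E : Type v} {G : MixedGraph V E} {D : ℕ}

theorem DegreeLE.tame (hD : G.DegreeLE D) (hG : G.Loopless) : G.adj.Tame D where
  row_le := hD.tsum_adj_le
  col_le := hD.tsum_adj_le'
  diag := hG.adj_self
  eq_zero_or x y := by
    rw [hD.adj_eq]
    rcases Nat.eq_zero_or_pos (G.mult x y) with h | h
    · simp [h]
    · exact .inr (by exact_mod_cast h)

theorem Loopless.pow (hG : G.Loopless) (n : ℕ) : (G.pow n).Loopless := fun f x h =>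
  hG _ _ (pow_joins h).2.1

theorem pow_joins_left {n : ℕ} {f : PowEdge V E n} {x y : Fin n → V} (h : (G.pow n).Joins f y x) :
    f = pe x f.1 f.2.1 := by
  obtain ⟨h1, -, h3⟩ := pow_joins h
  conv_lhs => rw [h1]
  exact pe_eq_iff.2 ⟨rfl, rfl, fun k hk => by rw [h3, Function.update_of_ne hk]⟩

theorem DegreeLE.pow (hD : G.DegreeLE D) (n : ℕ) : (G.pow n).DegreeLE (n * D) := by
  classical
  intro x
  have hfin := fun a => Set.finite_of_encard_le_coe (hD a)
  set S : Fin n → Finset (PowEdge V E n) := fun i => (hfin (x i)).toFinset.image (pe x i) with hS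
  have h1 : {f | ∃ y, (G.pow n).Joins f x y ∨ (G.pow n).Joins f y x} ⊆
      (Finset.univ.biUnion S : Finset (PowEdge V E n)) := by
    rintro f ⟨y, h | h⟩
    · obtain ⟨h1, h2, -⟩ := pow_joins h
      rw [h1]
      simp only [hS, Finset.coe_biUnion, Set.mem_iUnion]
      exact ⟨f.1, by simp, Finset.mem_image_of_mem _ ((hfin _).mem_toFinset.2 ⟨_, .inl h2⟩)⟩
    · obtain ⟨-, h2, h3⟩ := pow_joins h
      rw [pow_joins_left h]
      simp only [hS, Finset.coe_biUnion, Set.mem_iUnion]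
      exact ⟨f.1, by simp, Finset.mem_image_of_mem _ ((hfin _).mem_toFinset.2 ⟨_, .inr h2⟩)⟩
  refine (Set.encard_le_encard h1).trans ?_
  rw [Set.encard_coe_eq_coe_finsetCard]
  have h2 := Finset.card_biUnion_le_card_mul Finset.univ S D fun i _ => Finset.card_image_le.trans (by
    have := hD (x i)
    rw [(hfin (x i)).encard_eq_coe_toFinset_card] at this
    exact_mod_cast this)
  rw [Finset.card_univ, Fintype.card_fin] at h2
  exact_mod_cast h2

/-- An edge of the power moves exactly one coordinate, so the left side consists of terms from the
expansion of the product over the coordinates. -/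
theorem lazy_adj_pow_le_tens (hG : G.Loopless) {n : ℕ} (c : ℝ≥0∞) (x y : Fin n → V) :
    Kern.lazy c (G.pow n).adj x y ≤ Kern.tens (Kern.lazy c G.adj) x y := by
  classical
  have h0 : ∀ a : V, 1 ≤ Kern.lazy c G.adj a a := fun a => by
    rw [Kern.lazy_apply, Kern.one_self]; exact le_self_add
  rw [Kern.tens_apply, Kern.lazy_apply]
  rcases eq_or_ne x y with rfl | hxy
  · rw [(hG.pow n).adj_self, Kern.one_self, mul_zero, add_zero]
    exact Finset.one_le_prod' fun i _ => h0 _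
  rw [Kern.one_of_ne hxy, zero_add]
  by_cases hj : ∃ f, (G.pow n).Joins f x y
  · obtain ⟨f, hf⟩ := hj
    obtain ⟨-, -, h3⟩ := pow_joins hf
    have hi : ∀ f', (G.pow n).Joins f' x y → f'.1 = f.1 := by
      intro f' hf'
      obtain ⟨-, h4, -⟩ := pow_joins hf'
      by_contra hne
      have := hG.ne h4
      rw [h3, Function.update_of_ne hne] at this
      exact this rfl
    rw [← Finset.mul_prod_erase _ _ (Finset.mem_univ f.1), ← mul_one (c * _)]
    refine mul_le_mul' ?_ (Finset.one_le_prod' fun j hj => ?_)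
    · rw [Kern.lazy_apply]
      refine le_trans (mul_le_mul_right ?_ _) le_add_self
      refine ENat.toENNReal_mono (ENat.card_le_card_of_injective
        (f := fun f' => ⟨f'.1.2.1, hi _ f'.2 ▸ (pow_joins f'.2).2.1⟩) ?_)
      rintro ⟨f₁, h₁⟩ ⟨f₂, h₂⟩ h
      simp only [Subtype.mk.injEq] at h ⊢
      rw [(pow_joins h₁).1, (pow_joins h₂).1, h]
      exact pe_eq_iff.2 ⟨(hi _ h₁).trans (hi _ h₂).symm, rfl, fun _ _ => rfl⟩
    · rw [h3, Function.update_of_ne (Finset.ne_of_mem_erase hj)]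
      exact h0 _
  · haveI : IsEmpty {f // (G.pow n).Joins f x y} := ⟨fun f => hj ⟨f.1, f.2⟩⟩
    rw [adj_eq_tsum, tsum_empty, mul_zero]
    exact zero_le

theorem genFun_pow_le (hG : G.Loopless) (hD : G.DegreeLE D) {n : ℕ} (x y : Fin n → V) (t : ℝ≥0) :
    (G.pow n).genFun x y t ≤ ∏ i, G.genFun (x i) (y i) t := by
  rw [genFun_eq_tsum]
  refine le_of_tendsto (((hD.pow n).tame (hG.pow n)).tendsto_lazy_pow t x y) ?_
  filter_upwards [eventually_gt_atTop 0] with N hN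
  refine (Kern.pow_apply_mono (lazy_adj_pow_le_tens hG _) N x y).trans ?_
  rw [Kern.tens_pow, Kern.tens_apply]
  refine Finset.prod_le_prod' fun i _ => ?_
  rw [genFun_eq_tsum]
  exact Kern.lazy_pow_le_tsum _ t hN _ _

theorem continuous_genFun (hA : G.adj.Tame D) (x y : V) : Continuous (G.genFun x y) := by
  refine continuous_iff_continuousAt.2 fun t₀ => ?_
  set f : ℕ → ℝ≥0 → ℝ := fun j t => (t : ℝ) ^ j / j ! * ((G.adj ^ j) x y).toReal with hf
  have hle : ∀ j, ((G.adj ^ j) x y).toReal ≤ (D : ℝ) ^ j := fun j => by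
    have := ENNReal.toReal_mono (by simp) (hA.pow_apply_le j x y)
    simpa using this
  have hb : ∀ j, ∀ t ∈ Set.Iic (t₀ + 1), ‖f j t‖ ≤ (((t₀ + 1 : ℝ≥0) : ℝ) * D) ^ j / j ! := by
    intro j t ht
    have ht : (t : ℝ) ≤ (t₀ + 1 : ℝ≥0) := NNReal.coe_le_coe.2 ht
    rw [Real.norm_of_nonneg (by positivity), mul_pow, mul_div_right_comm]
    exact mul_le_mul (by gcongr) (hle j) ENNReal.toReal_nonneg (by positivity)
  have hs := Real.summable_pow_div_factorial (((t₀ + 1 : ℝ≥0) : ℝ) * D)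
  have h1 : ContinuousOn (fun t => ∑' j, f j t) (Set.Iic (t₀ + 1)) :=
    continuousOn_tsum (fun j => by fun_prop) hs hb
  have h2 : Set.Iic (t₀ + 1) ∈ 𝓝 t₀ := Iic_mem_nhds (lt_add_one t₀)
  refine (ENNReal.continuous_ofReal.continuousAt.comp (h1.continuousAt h2)).congr ?_
  filter_upwards [h2] with t ht
  rw [genFun_eq_tsum, Function.comp, ENNReal.ofReal_tsum_of_nonneg (fun j => by positivity)
    (Summable.of_norm_bounded hs fun j => hb j t ht)]
  refine tsum_congr fun j => ?_
  rw [hf, ENNReal.ofReal_mul (by positivity), ENNReal.ofReal_toReal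
    (ne_top_of_le_ne_top (by simp) (hA.pow_apply_le j x y)), ENNReal.ofReal_div_of_pos (by positivity),
    ENNReal.ofReal_pow (NNReal.coe_nonneg t), ENNReal.ofReal_natCast, ENNReal.ofReal_coe_nnreal]

theorem Path.length_ne_zero {x y : V} (hxy : x ≠ y) (γ : G.Path x y) : γ.length ≠ 0 := by
  cases γ with
  | nil => exact absurd rfl hxy
  | cons => simp [length]

theorem genFun_zero {x y : V} (hxy : x ≠ y) : G.genFun x y 0 = 0 :=
  ENNReal.tsum_eq_zero.2 fun γ => by simp [γ.length_ne_zero hxy]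

theorem genFun_mono (x y : V) : Monotone (G.genFun x y) := fun s t h =>
  ENNReal.tsum_le_tsum fun γ => by gcongr

/-- Every path has at least one edge, so each term of `genFun` divided by `t` is nondecreasing in
`t`. Hence `genFun` crosses the level `1` only once. -/
theorem mul_genFun_le {x y : V} (hxy : x ≠ y) {s t : ℝ≥0} (h : s ≤ t) :
    t * G.genFun x y s ≤ s * G.genFun x y t := by
  rw [genFun, genFun, ← ENNReal.tsum_mul_left, ← ENNReal.tsum_mul_left]
  refine ENNReal.tsum_le_tsum fun γ => ?_
  obtain ⟨k, hk⟩ := Nat.exists_eq_succ_of_ne_zero (γ.length_ne_zero hxy)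
  rw [hk, Nat.succ_eq_add_one, ← mul_div_assoc, ← mul_div_assoc, pow_succ, pow_succ]
  refine ENNReal.div_le_div_right ?_ _
  have : (s : ℝ≥0∞) ^ k ≤ (t : ℝ≥0∞) ^ k := by gcongr
  calc (t : ℝ≥0∞) * (s ^ k * s) = s * (s ^ k * t) := by ring
    _ ≤ _ := by gcongr

theorem genFun_lt_one (hA : G.adj.Tame D) {x y : V} (hxy : x ≠ y) {t : ℝ≥0}
    (ht : t < G.criticalTime x y) : G.genFun x y t < 1 := by
  by_contra! h
  obtain ⟨s, hs, h1⟩ := intermediate_value_Icc (zero_le : 0 ≤ t)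
    (continuous_genFun hA x y).continuousOn ⟨by rw [genFun_zero hxy]; exact zero_le, h⟩
  exact (lt_of_lt_of_le ht (iInf₂_le s h1)).not_ge (ENNReal.coe_le_coe.2 hs.2)

theorem exists_criticalTime_eq (hA : G.adj.Tame D) {x y : V} (hxy : x ≠ y) (γ : G.Path x y) :
    ∃ t : ℝ≥0, t ≠ 0 ∧ G.criticalTime x y = t ∧ G.genFun x y t = 1 := by
  set a : ℝ≥0∞ := (1 : ℝ≥0∞) / (γ.length ! : ℝ≥0∞) with ha
  have h1 : a ≤ G.genFun x y 1 := by
    have := ENNReal.le_tsum (f := fun γ : G.Path x y =>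
      ((1 : ℝ≥0) : ℝ≥0∞) ^ γ.length / (γ.length ! : ℝ≥0∞)) γ
    simpa [ha, genFun] using this
  -- The term of `γ` at time `1` is `1 / |γ|!`, and `genFun` grows at least linearly from there.
  have h2 : 1 ≤ G.genFun x y (γ.length !) := by
    have h3 := mul_genFun_le (G := G) hxy (show (1 : ℝ≥0) ≤ (γ.length ! : ℝ≥0) from
      Nat.one_le_cast.2 (Nat.factorial_pos _))
    rw [ENNReal.coe_one, one_mul] at h3
    refine le_trans ?_ ((mul_le_mul_right h1 _).trans h3)
    rw [ha, ENNReal.coe_natCast, ENNReal.mul_div_cancel (by exact_mod_cast Nat.factorial_ne_zero _)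
      (by simp)]
  obtain ⟨t, -, ht⟩ := intermediate_value_Icc zero_le
    (continuous_genFun hA x y).continuousOn ⟨by rw [genFun_zero hxy]; exact zero_le, h2⟩
  have ht0 : t ≠ 0 := by rintro rfl; rw [genFun_zero hxy] at ht; simp at ht
  refine ⟨t, ht0, le_antisymm (iInf₂_le t ht) (le_iInf₂ fun s hs => ?_), ht⟩
  by_contra! hlt
  have hlt : s < t := ENNReal.coe_lt_coe.1 hlt
  have h4 := mul_genFun_le (G := G) hxy hlt.le
  rw [hs, ht, mul_one, mul_one] at h4
  exact hlt.not_ge (ENNReal.coe_le_coe.1 h4)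

end MixedGraph

/-! ### From tail bounds to convergence. -/

theorem ENNReal.edist_coe_le (a : ℝ≥0∞) (c : ℝ≥0) : edist a (c : ℝ≥0∞) ≤ (a - c) + (c - a) := by
  cases a with
  | top => simp
  | coe a =>
    have : edist (a : ℝ≥0∞) (c : ℝ≥0∞) = edist a c := rfl
    rw [this, edist_nndist, NNReal.nndist_eq, ← ENNReal.coe_sub, ← ENNReal.coe_sub, ← ENNReal.coe_add,
      ENNReal.coe_le_coe]
    exact max_le le_self_add le_add_self

section conv
variable {Ω : Type*} [MeasurableSpace Ω] {μ : Measure Ω} {T : ℕ → Ω → ℝ≥0∞} {c : ℝ≥0}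

theorem tendstoInMeasure_of_tails (hc : 0 < c)
    (h₁ : ∀ s < c, Tendsto (fun n => μ {ω | T n ω < s}) atTop (𝓝 0))
    (h₂ : ∀ s > c, Tendsto (fun n => μ {ω | s < T n ω}) atTop (𝓝 0)) :
    TendstoInMeasure μ T atTop fun _ => (c : ℝ≥0∞) := by
  refine tendstoInMeasure_of_ne_top fun ε hε hε' => ?_
  lift ε to ℝ≥0 using hε'
  have hε : 0 < ε := by exact_mod_cast hε
  have hδ : 0 < ε / 4 := by positivity
  have h := (h₁ (c - ε / 4) (tsub_lt_self hc hδ)).add (h₂ (c + ε / 4) (lt_add_of_pos_right c hδ))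
  rw [add_zero] at h
  refine tendsto_of_tendsto_of_tendsto_of_le_of_le tendsto_const_nhds h (fun n => zero_le)
    fun n => (measure_mono fun ω hω => ?_).trans (measure_union_le _ _)
  by_contra hcon
  simp only [Set.mem_union, Set.mem_ofPred_eq, not_or, not_lt] at hcon hω
  have h3 : T n ω - c ≤ (ε / 4 : ℝ≥0) := by
    rw [tsub_le_iff_left, ← ENNReal.coe_add]; exact hcon.2
  have h4 : (c : ℝ≥0∞) - T n ω ≤ (ε / 4 : ℝ≥0) := by
    rw [tsub_le_iff_right, ← tsub_le_iff_left, ← ENNReal.coe_sub]; exact hcon.1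
  have h5 := (hω.trans (ENNReal.edist_coe_le _ _)).trans (add_le_add h3 h4)
  rw [← ENNReal.coe_add, ENNReal.coe_le_coe, ← NNReal.coe_le_coe] at h5
  push_cast at h5
  have : (0 : ℝ) < ε := hε
  linarith

/-- The deviation below `c` is bounded by `c`; the deviation above is small off `B n`, and on `B n`
it is controlled by the dominating variable `S n`. -/
theorem tendsto_lintegral_edist [IsProbabilityMeasure μ] (hc : 0 < c) (hT : ∀ n, Measurable (T n))
    (h₁ : ∀ s < c, Tendsto (fun n => μ {ω | T n ω < s}) atTop (𝓝 0))
    {S : ℕ → Ω → ℝ≥0∞} (hS : ∀ n, Measurable (S n)) (hTS : ∀ n ω, T n ω ≤ S n ω)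
    (h₂ : ∀ s > c, ∃ B : ℕ → Set Ω, (∀ n, MeasurableSet (B n)) ∧ (∀ᶠ n in atTop, ∀ ω ∉ B n, T n ω ≤ s) ∧
      Tendsto (fun n => ∫⁻ ω in B n, S n ω ∂μ) atTop (𝓝 0)) :
    Tendsto (fun n => ∫⁻ ω, edist (T n ω) c ∂μ) atTop (𝓝 0) := by
  refine ENNReal.tendsto_nhds_zero.2 fun ε hε => ?_
  obtain ⟨δ, hδ, hδε⟩ := ENNReal.lt_iff_exists_nnreal_btwn.1 (ENNReal.div_pos hε.ne' (by simp : (4 : ℝ≥0∞) ≠ ∞))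
  have hδ : 0 < δ := by exact_mod_cast hδ
  obtain ⟨B, hB, hBT, hBS⟩ := h₂ (c + δ) (lt_add_of_pos_right c hδ)
  have h3 := ENNReal.Tendsto.const_mul (a := (c : ℝ≥0∞)) (h₁ (c - δ) (tsub_lt_self hc hδ)) (.inr (by simp))
  rw [mul_zero] at h3
  have hδ' : (0 : ℝ≥0∞) < δ := by exact_mod_cast hδ
  filter_upwards [hBT, (ENNReal.tendsto_nhds_zero.1 hBS) δ hδ', (ENNReal.tendsto_nhds_zero.1 h3) δ hδ']
    with n h4 h5 h6
  have hm : MeasurableSet {ω | T n ω < (c - δ : ℝ≥0)} := measurableSet_lt (hT n) measurable_const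
  calc _ ≤ ∫⁻ ω, ((δ + (B n).indicator (S n) ω) +
        (δ + {ω | T n ω < (c - δ : ℝ≥0)}.indicator (fun _ => (c : ℝ≥0∞)) ω)) ∂μ := by
        refine lintegral_mono fun ω => (ENNReal.edist_coe_le _ _).trans (add_le_add ?_ ?_)
        · by_cases hω : ω ∈ B n
          · rw [Set.indicator_of_mem hω]
            exact tsub_le_self.trans ((hTS n ω).trans le_add_self)
          · rw [tsub_le_iff_left]
            refine (h4 ω hω).trans ?_
            rw [ENNReal.coe_add]
            exact add_le_add le_rfl le_self_add
        · by_cases hω : ω ∈ {ω | T n ω < (c - δ : ℝ≥0)}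
          · rw [Set.indicator_of_mem hω]
            exact tsub_le_self.trans le_add_self
          · rw [Set.indicator_of_notMem hω, add_zero, tsub_le_iff_right, ← tsub_le_iff_left,
              ← ENNReal.coe_sub]
            exact not_lt.1 hω
    _ = (δ + ∫⁻ ω in B n, S n ω ∂μ) + (δ + c * μ {ω | T n ω < (c - δ : ℝ≥0)}) := by
        rw [lintegral_add_left (f := fun ω => δ + (B n).indicator (S n) ω)
            (measurable_const.add ((hS n).indicator (hB n))),
          lintegral_add_left measurable_const, lintegral_add_left measurable_const,
          lintegral_indicator (hB n), lintegral_indicator hm, lintegral_const, lintegral_const,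
          Measure.restrict_apply_univ, measure_univ, mul_one]
    _ ≤ (δ + δ) + (δ + δ) := by gcongr
    _ = 4 * δ := by ring
    _ ≤ 4 * (ε / 4) := by gcongr
    _ = ε := ENNReal.mul_div_cancel (by simp) (by simp)

theorem tendsto_mul_eexp_neg (K : ℝ≥0∞) (hK : K ≠ ∞) {a : ℝ} (ha : 0 < a) :
    Tendsto (fun n : ℕ => n * K * eexp (-(a * n))) atTop (𝓝 0) := by
  have h1 : Tendsto (fun n : ℕ => ENNReal.ofReal ((n : ℝ) * Real.exp (-(a * n)))) atTop (𝓝 0) := by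
    rw [← ENNReal.ofReal_zero]
    refine ENNReal.tendsto_ofReal ?_
    have := (Real.tendsto_pow_mul_exp_neg_atTop_nhds_zero 1).comp
      (tendsto_natCast_atTop_atTop.const_mul_atTop ha : Tendsto (fun n : ℕ => a * (n : ℝ)) atTop atTop)
    have := this.const_mul a⁻¹
    rw [mul_zero] at this
    refine this.congr fun n => ?_
    simp only [Function.comp, pow_one]
    field_simp
  have h2 := ENNReal.Tendsto.const_mul h1 (.inr hK)
  rw [mul_zero] at h2
  refine h2.congr fun n => ?_
  rw [ENNReal.ofReal_mul (Nat.cast_nonneg n), ENNReal.ofReal_natCast, eexp]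
  ring

end conv

namespace MixedGraph
variable {V : Type u} {E : Type v} {G : MixedGraph V E}

theorem measurable_passageTime [Countable E] {Ω : Type*} [MeasurableSpace Ω] {τ : E → Ω → ℝ≥0}
    (h : ∀ e, Measurable (τ e)) (x y : V) :
    Measurable fun ω => G.passageTime (fun e => τ e ω) x y := by
  refine Measurable.iInf fun γ => ?_
  induction γ with
  | nil => exact measurable_const
  | cons e he γ ih => exact (h e).coe_nnreal_ennreal.add ih

section seq
variable {u : ℕ → V} {d n : ℕ}

open Classical in
/-- The edge used for the `l`-th step of coordinate `j` when the coordinates move one after the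
other. -/
def seqEdge (u : ℕ → V) (d : ℕ) (f : ℕ → E) (j : Fin n) (l : ℕ) : PowEdge V E n :=
  pe (fun i => if i < j then u d else u 0) j (f l)

theorem seqEdge_mem (f : ℕ → E) (j : Fin n) (l : ℕ) : seqEdge u d f j l ∈ edgesSeq E d u n :=
  ⟨_, _, _, rfl, fun _ hi => if_pos hi, fun _ hi => if_neg (not_lt.2 hi.le)⟩

theorem passageTime_le_seq {f : ℕ → E} (hf : ∀ l < d, G.Joins (f l) (u l) (u (l + 1)))
    (τ : PowEdge V E n → ℝ≥0) : (G.pow n).passageTime τ (fun _ => u 0) (fun _ => u d) ≤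
      ∑ j : Fin n, ∑ l ∈ Finset.range d, (τ (seqEdge u d f j l) : ℝ≥0∞) := by
  set X : ℕ → Fin n → V := fun j i => if (i : ℕ) < j then u d else u 0 with hX
  have h0 : X 0 = fun _ => u 0 := by ext i; simp [hX]
  have hn : X n = fun _ => u d := by ext i; simp [hX]
  have h1 := passageTime_chain (G := G.pow n) τ X (fun j => if h : j < n then
    ∑ l ∈ Finset.range d, (τ (seqEdge u d f ⟨j, h⟩ l) : ℝ≥0∞) else 0) n ?_
  · rw [h0, hn, Finset.sum_range] at h1
    refine h1.trans (le_of_eq (Finset.sum_congr rfl fun j _ => ?_))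
    rw [dif_pos j.2]
  intro j hj
  rw [dif_pos hj]
  set j' : Fin n := ⟨j, hj⟩ with hj'
  have h2 := passageTime_chain (G := G.pow n) τ (fun l => Function.update (X j) j' (u l))
    (fun l => (τ (seqEdge u d f j' l) : ℝ≥0∞)) d fun l hl => ?_
  · convert h2 using 1
    congr 1
    · ext i
      rcases eq_or_ne i j' with rfl | hne
      · simp [hX, hj']
      · rw [Function.update_of_ne hne]
    · ext i
      rcases eq_or_ne i j' with rfl | hne
      · simp [hX, hj']
      · rw [Function.update_of_ne hne]
        have : (i : ℕ) ≠ j := fun h => hne (Fin.ext h)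
        simp only [hX]
        congr 1
        apply propext
        omega
  · refine passageTime_le_of_joins τ ?_
    have h3 : seqEdge u d f j' l = pe (Function.update (X j) j' (u l)) j' (f l) :=
      pe_eq_iff.2 ⟨rfl, rfl, fun k hk => by
        rw [Function.update_of_ne hk]; simp [hX, hj', Fin.lt_def]⟩
    rw [h3]
    have h4 := pow_joins_pe (G := G) (x := Function.update (X j) j' (u l)) (i := j') (e := f l)
      (a := u (l + 1)) (by rw [Function.update_self]; exact hf l hl)
    rwa [Function.update_idem] at h4

variable {Ω : Type*} [MeasurableSpace Ω] {F : Measure ℝ≥0} {μ : Measure Ω} [IsProbabilityMeasure μ]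

/-- The sequential path uses no edge in `𝒲`, so its passage times are independent of the bad event
and the integral factorizes. -/
theorem lintegral_seq_le {τ : PowEdge V E n → Ω → ℝ≥0} (hτ : IIDField τ F μ) (f : ℕ → E)
    {Bad : Set Ω} {𝒲 : Set (PowEdge V E n)} (hB : MeasurableSet[sig τ 𝒲] Bad)
    (h𝒲 : Disjoint (edgesSeq E d u n) 𝒲) :
    ∫⁻ ω in Bad, ∑ j : Fin n, ∑ l ∈ Finset.range d, (τ (seqEdge u d f j l) ω : ℝ≥0∞) ∂μ =
      n * (d * ∫⁻ x, (x : ℝ≥0∞) ∂F) * μ Bad := by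
  have hBm := hτ.sig_le _ _ hB
  have h1 : ∀ e ∈ edgesSeq E d u n, ∫⁻ ω in Bad, (τ e ω : ℝ≥0∞) ∂μ =
      (∫⁻ x, (x : ℝ≥0∞) ∂F) * μ Bad := by
    intro e he
    have h2 := lintegral_mul_eq_lintegral_mul_lintegral_of_independent_measurableSpace
      (hτ.sig_le _) (hτ.sig_le _) (hτ.indep_sig h𝒲) (f := fun ω => (τ e ω : ℝ≥0∞))
      (g := Bad.indicator 1) (measurable_coe_nnreal_ennreal.comp (measurable_sig he))
      (measurable_const.indicator hB)
    rw [lintegral_indicator_one hBm, ← lintegral_map (f := fun x : ℝ≥0 => (x : ℝ≥0∞))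
      measurable_coe_nnreal_ennreal (hτ.measurable e), hτ.map_eq e] at h2
    rw [← h2, ← lintegral_indicator hBm]
    refine lintegral_congr fun ω => ?_
    by_cases hω : ω ∈ Bad <;> simp [hω]
  have hm : ∀ e, Measurable fun ω => (τ e ω : ℝ≥0∞) := fun e => (hτ.measurable e).coe_nnreal_ennreal
  rw [lintegral_finsetSum _ fun j _ => Finset.measurable_fun_sum _ fun l _ => hm _]
  simp_rw [lintegral_finsetSum _ fun l _ => hm _, h1 _ (seqEdge_mem f _ _)]
  simp only [Finset.sum_const, Finset.card_univ, Fintype.card_fin, Finset.card_range, nsmul_eq_mul]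
  ring

end seq
end MixedGraph

/-! ### Symmetric graphs are reversible; countability and simple paths. -/

/-- The bijection is `y ↦ x y⁻¹ z` in the group. Left translations preserve `A`, and right
translations do because `f` is invariant under conjugation. -/
theorem Kern.reversible_of_group {V : Type u} {Γ : Type u'} [Group Γ] (θ : V ≃ Γ) {A : Kern V}
    (f : Γ → ℝ≥0∞) (hA : ∀ x y, A x y = f ((θ x)⁻¹ * θ y)) (hf : ∀ g p, f (g * p * g⁻¹) = f p) :
    A.Reversible := by
  have hl : ∀ (g : Γ) (k : ℕ) (x y : V),
      (A ^ k) (θ.symm (g * θ x)) (θ.symm (g * θ y)) = (A ^ k) x y := fun g =>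
    pow_equiv ((θ.trans (Equiv.mulLeft g)).trans θ.symm) fun x y => by simp [hA, mul_assoc]
  have hr : ∀ (g : Γ) (k : ℕ) (x y : V),
      (A ^ k) (θ.symm (θ x * g)) (θ.symm (θ y * g)) = (A ^ k) x y := fun g =>
    pow_equiv ((θ.trans (Equiv.mulRight g)).trans θ.symm) fun x y => by
      rw [hA, hA, ← hf g⁻¹ ((θ x)⁻¹ * θ y)]
      simp [mul_assoc]
  intro x z
  refine ⟨(((θ.trans (Equiv.inv Γ)).trans (Equiv.mulLeft (θ x))).trans
    (Equiv.mulRight (θ z))).trans θ.symm, fun y k => ⟨?_, ?_⟩⟩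
  · rw [← hr ((θ y)⁻¹ * θ z) k x y]
    simp [mul_assoc]
  · rw [← hl (θ x * (θ y)⁻¹) k y z]
    simp [mul_assoc]

namespace MixedGraph
variable {V : Type u} {E : Type v} {G : MixedGraph V E} {D : ℕ}

theorem adj_eq_ite {x y : V} {P : Prop} [Decidable P] (h : Subsingleton {e // G.Joins e x y})
    (hP : (∃ e, G.Joins e x y) ↔ P) : G.adj x y = if P then 1 else 0 := by
  rw [adj_eq_tsum]
  split_ifs with h1
  · obtain ⟨e, he⟩ := hP.2 h1
    haveI := uniqueOfSubsingleton (⟨e, he⟩ : {e // G.Joins e x y})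
    rw [tsum_fintype]
    simp
  · haveI : IsEmpty {e // G.Joins e x y} := ⟨fun e => h1 (hP.1 ⟨e.1, e.2⟩)⟩
    rw [tsum_empty]

theorem IsNormalCayley.reversible (h : G.IsNormalCayley) : G.adj.Reversible := by
  classical
  obtain ⟨Γ, _, S, -, -, hS, hG⟩ := h
  have hS' : ∀ g p, g * p * g⁻¹ ∈ S ↔ p ∈ S := by
    intro g p
    constructor
    · intro h1
      rw [← hS g⁻¹]
      exact ⟨_, h1, by group⟩
    · intro h1
      rw [← hS g]
      exact ⟨_, h1, rfl⟩
  rcases hG with ⟨⟨θ⟩⟩ | ⟨⟨θ⟩⟩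
  · refine Kern.reversible_of_group θ.vert (fun p => if p ∈ S ∧ p ≠ 1 then 1 else 0) (fun x y => ?_)
      fun g p => by simp only [hS', ne_eq, conj_eq_one_iff]
    rw [← adj_iso θ]
    refine adj_eq_ite ⟨?_⟩ ⟨?_, fun h => ?_⟩
    · rintro ⟨⟨a, s⟩, ha⟩ ⟨⟨b, t⟩, hb⟩
      simp only [Joins, cayleyDirected, reduceCtorEq, Sum.inr.injEq, Prod.mk.injEq, false_or] at ha hb
      obtain ⟨rfl, ha⟩ := ha
      obtain ⟨rfl, hb⟩ := hb
      rw [← hb, mul_right_inj] at ha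
      simp only [Subtype.mk.injEq, Prod.mk.injEq, true_and]
      exact Subtype.ext ha
    · rintro ⟨⟨a, s⟩, ha⟩
      simp only [Joins, cayleyDirected, reduceCtorEq, Sum.inr.injEq, Prod.mk.injEq, false_or] at ha
      obtain ⟨rfl, ha⟩ := ha
      rw [← ha, inv_mul_cancel_left]
      exact s.2
    · exact ⟨(θ.vert x, ⟨_, h⟩), .inr (by simp [cayleyDirected])⟩
  · refine Kern.reversible_of_group θ.vert (fun p => if (p ∈ S ∨ p⁻¹ ∈ S) ∧ p ≠ 1 then 1 else 0)
      (fun x y => ?_) fun g p => by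
        have h1 : (g * p * g⁻¹)⁻¹ = g * p⁻¹ * g⁻¹ := by group
        simp only [h1, hS', ne_eq, conj_eq_one_iff]
    rw [← adj_iso θ]
    refine adj_eq_ite ⟨?_⟩ ⟨?_, fun h => ?_⟩
    · rintro ⟨p, hp⟩ ⟨q, hq⟩
      simp only [Joins, cayleyUndirected, reduceCtorEq, Sum.inl.injEq, or_false] at hp hq
      exact Subtype.ext (Subtype.ext (hp.trans hq.symm))
    · rintro ⟨⟨p, g, s, h1, h2, h3⟩, hp⟩
      simp only [Joins, cayleyUndirected, reduceCtorEq, Sum.inl.injEq, or_false] at hp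
      rw [h3, Sym2.eq_iff] at hp
      rcases hp with ⟨h4, h5⟩ | ⟨h4, h5⟩ <;> rw [← h4, ← h5]
      · simpa using ⟨.inl h1, h2⟩
      · simpa using ⟨.inr h1, h2⟩
    · rcases h with ⟨h1 | h1, h2⟩
      · exact ⟨⟨s(θ.vert x, θ.vert y), θ.vert x, _, h1, h2, by simp⟩, .inl rfl⟩
      · refine ⟨⟨s(θ.vert x, θ.vert y), θ.vert y, _, h1, inv_ne_one.2 h2, ?_⟩, .inl rfl⟩
        rw [Sym2.eq_swap]; simp

theorem IsAbelianCayley.isNormalCayley (h : G.IsAbelianCayley) : G.IsNormalCayley := by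
  obtain ⟨Γ, _, S, h1, h2, h3⟩ := h
  exact ⟨Γ, inferInstance, S, h1, h2, fun g => by simp, h3⟩

/-- The swaps make all powers symmetric, and the automorphism exchanging `x` and `z` serves as the
bijection. -/
theorem reversible_of_pairIso (h : ∀ x y : V, G.PairIso x y y x) : G.adj.Reversible := by
  have hs : ∀ k x y, (G.adj ^ k) x y = (G.adj ^ k) y x := fun k x y => by
    obtain ⟨σ, h1, h2⟩ := h x y
    rw [← Kern.pow_equiv σ.vert (adj_iso σ) k x y, h1, h2]
  intro x z
  obtain ⟨σ, h1, h2⟩ := h x z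
  refine ⟨σ.vert, fun y k => ⟨?_, ?_⟩⟩
  · rw [← Kern.pow_equiv σ.vert (adj_iso σ) k x y, h1, hs]
  · rw [← Kern.pow_equiv σ.vert (adj_iso σ) k y z, h2, hs]

/-- Balls around a vertex are countable. Countability is needed for the measurability of passage
times, for union bounds over paths and for almost sure statements about all edges. -/
theorem countable_vertices (hD : G.DegreeLE D) (hc : G.Connected) : Countable V := by
  rcases isEmpty_or_nonempty V with _ | ⟨⟨v⟩⟩
  · infer_instance
  set B : ℕ → Set V := fun k => Nat.rec {v}
    (fun _ s => s ∪ ⋃ x ∈ s, ⋃ e ∈ {e | ∃ y, G.Joins e x y ∨ G.Joins e y x},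
      ({y | G.Joins e x y} ∪ {y | G.Joins e y x})) k with hB
  have h1 : ∀ k, (B k).Countable := by
    intro k
    induction k with
    | zero => exact Set.countable_singleton v
    | succ k ih =>
      refine ih.union (ih.biUnion fun x _ =>
        (Set.finite_of_encard_le_coe (hD x)).countable.biUnion fun e _ => ?_)
      exact (Set.Subsingleton.finite fun _ h _ h' => Joins.right_unique h h').countable.union
        (Set.Subsingleton.finite fun _ h _ h' => Joins.left_unique h h').countable
  have h2 : ∀ x, x ∈ ⋃ k, B k := fun x => by
    induction hc v x with
    | refl => exact Set.mem_iUnion.2 ⟨0, rfl⟩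
    | tail _ he ih =>
      obtain ⟨k, hk⟩ := Set.mem_iUnion.1 ih
      obtain ⟨e, he⟩ := he
      refine Set.mem_iUnion.2 ⟨k + 1, .inr (Set.mem_biUnion hk (Set.mem_biUnion ⟨_, he⟩ ?_))⟩
      exact he
  exact Set.countable_univ_iff.1 ((Set.countable_iUnion h1).mono fun x _ => h2 x)

theorem countable_edges [Countable V] (hD : G.DegreeLE D) : Countable E := by
  refine Set.countable_univ_iff.1 ((Set.countable_iUnion fun x : V =>
    (Set.finite_of_encard_le_coe (hD x)).countable).mono fun e _ => ?_)
  obtain ⟨x, y, h⟩ : ∃ x y, G.Joins e x y := by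
    rcases h : G.ends e with p | ⟨x, y⟩
    · induction p with | h x y => exact ⟨x, y, .inl h⟩
    · exact ⟨x, y, .inr h⟩
  exact Set.mem_iUnion.2 ⟨x, y, .inl h⟩

theorem Path.exists_simplePath {x y : V} (γ : G.Path x y) :
    ∃ u d, SimplePath G u d ∧ u 0 = x ∧ u d = y := by
  induction γ with
  | nil x => exact ⟨fun _ => x, 0, ⟨fun a ha b hb _ => by omega, fun l hl => by omega⟩, rfl, rfl⟩
  | @cons x y z e h γ ih =>
    obtain ⟨u, d, hu, rfl, rfl⟩ := ih
    by_cases hx : ∃ a ≤ d, u a = x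
    · obtain ⟨a, ha, rfl⟩ := hx
      refine ⟨fun i => u (a + i), d - a, ⟨fun i hi j hj hij => ?_, fun l hl => hu.joins (a + l) (by omega)⟩,
        rfl, by simp only [Nat.add_sub_cancel' ha]⟩
      have := hu.inj (a + i) (by omega) (a + j) (by omega) hij
      omega
    · push Not at hx
      refine ⟨fun i => if i = 0 then x else u (i - 1), d + 1, ⟨fun i hi j hj hij => ?_, fun l hl => ?_⟩,
        rfl, rfl⟩
      · split_ifs at hij with h1 h2 h2
        · omega
        · exact absurd hij.symm (hx _ (by omega))
        · exact absurd hij (hx _ (by omega))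
        · have := hu.inj (i - 1) (by omega) (j - 1) (by omega) hij
          omega
      · rcases Nat.eq_zero_or_pos l with rfl | hl0
        · exact ⟨e, by simpa using h⟩
        · obtain ⟨e', he'⟩ := hu.joins (l - 1) (by omega)
          refine ⟨e', ?_⟩
          rw [Nat.sub_add_cancel hl0] at he'
          simpa [hl0.ne'] using he'

theorem nonempty_path_of_pow {n : ℕ} {x y : Fin n → V} (γ : (G.pow n).Path x y) (i : Fin n) :
    Nonempty (G.Path (x i) (y i)) := by
  induction γ with
  | nil x => exact ⟨.nil _⟩
  | @cons x y z f h γ ih =>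
    obtain ⟨γ'⟩ := ih
    obtain ⟨-, h2, h3⟩ := pow_joins h
    rcases eq_or_ne i f.1 with rfl | hne
    · exact ⟨.cons _ h2 γ'⟩
    · rw [h3, Function.update_of_ne hne] at γ'
      exact ⟨γ'⟩

theorem criticalTime_eq_top {x y : V} (h : IsEmpty (G.Path x y)) : G.criticalTime x y = ∞ := by
  simp [criticalTime, genFun]

theorem criticalTime_self (x : V) : G.criticalTime x x = 0 := by
  refine le_antisymm (iInf₂_le_of_le 0 ?_ le_rfl) zero_le
  rw [genFun_eq_tsum, tsum_eq_single 0 fun j hj => by simp [hj]]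
  simp

end MixedGraph

/-! ### Conclusion. -/

namespace MixedGraph
variable {V : Type u} {E : Type v} {G : MixedGraph V E} {D : ℕ}
  {Ω : Type*} [MeasurableSpace Ω] {F : Measure ℝ≥0} {μ : Measure Ω} [IsProbabilityMeasure μ]

theorem tendsto_measure_passageTime_lt [Countable V] [Countable E] (hG : G.Loopless)
    (hD : G.DegreeLE D) {v w : V} (hvw : v ≠ w) {ρ : ℝ≥0} (hρ : 0 < ρ) (hF : ClassC ρ F)
    {τ : (n : ℕ) → PowEdge V E n → Ω → ℝ≥0} (hτ : ∀ n, IIDField (τ n) F μ) {t s : ℝ≥0}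
    (ht : G.criticalTime v w = t) (hs : s < t / ρ) :
    Tendsto (fun n => μ {ω | (G.pow n).passageTime (fun e => τ n e ω) (fun _ => v) (fun _ => w) < s})
      atTop (𝓝 0) := by
  obtain ⟨θ, hθ, hθs⟩ : ∃ θ, ρ < θ ∧ θ * s < t := by
    rcases eq_or_ne s 0 with rfl | hs0
    · refine ⟨ρ + 1, lt_add_one _, ?_⟩
      rw [mul_zero]
      exact (div_pos_iff_of_pos_right hρ).1 hs
    · have hs' : ρ < t / s := by
        rw [lt_div_iff₀ (pos_iff_ne_zero.2 hs0), mul_comm]; exact (lt_div_iff₀ hρ).1 hs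
      obtain ⟨θ, h1, h2⟩ := exists_between hs'
      exact ⟨θ, h1, (lt_div_iff₀ (pos_iff_ne_zero.2 hs0)).1 h2⟩
  obtain ⟨κ, hκ, hFκ⟩ := hF.exists_le_integral_exp hρ hθ
  have h1 : G.genFun v w (θ * s) < 1 :=
    genFun_lt_one (hD.tame hG) hvw (by rw [ht]; exact_mod_cast hθs)
  have h2 := ENNReal.Tendsto.const_mul (a := ENNReal.ofReal (Real.exp (κ * s)))
    (ENNReal.tendsto_pow_atTop_nhds_zero_of_lt_one h1) (.inr ENNReal.ofReal_ne_top)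
  rw [mul_zero] at h2
  refine tendsto_of_tendsto_of_tendsto_of_le_of_le tendsto_const_nhds h2 (fun n => zero_le) fun n => ?_
  refine (measure_passageTime_lt_le (hτ n) hκ hFκ _ _ s).trans (mul_le_mul_right ?_ _)
  simpa using genFun_pow_le hG hD (n := n) (fun _ => v) (fun _ => w) (θ * s)

/-- At the critical time `log genFun` is zero while `genFun` at half of it is positive. By
continuity the conditions of `exists_bad_of_lt` hold slightly later, when `genFun` already exceeds
`1`. -/
theorem exists_bad_of_criticalTime_lt (hG : G.Loopless) (hD : G.DegreeLE D) (hD1 : 1 ≤ D)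
    (hrev : G.adj.Reversible) {u : ℕ → V} {d : ℕ} (hu : SimplePath G u d) (hd : 1 ≤ d)
    (hvw : u 0 ≠ u d) {t ρ s : ℝ≥0} (ht : t ≠ 0) (htm : G.genFun (u 0) (u d) t = 1) (hρ : 0 < ρ)
    (hF : ClassC ρ F) (hs : t / ρ < s) :
    ∃ c > 0, ∃ n₁ : ℕ, ∀ n ≥ n₁, ∀ τ : PowEdge V E n → Ω → ℝ≥0, IIDField τ F μ →
      ∃ Bad : Set Ω, ∃ 𝒲 : Set (PowEdge V E n), MeasurableSet[sig τ 𝒲] Bad ∧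
        Disjoint (edgesSeq E d u n) 𝒲 ∧ μ Bad ≤ eexp (-(c * n)) ∧
        ∀ ω ∉ Bad,
          (G.pow n).passageTime (fun f => τ f ω) (fun _ => u 0) (fun _ => u d) ≤ s := by
  have hA := hD.tame hG
  set m := G.genFun (u 0) (u d) with hm
  have hcont : Continuous m := continuous_genFun hA _ _
  have ht0 : 0 < t := pos_iff_ne_zero.2 ht
  have hhalf : 0 < m (t / 2) := by
    refine pos_iff_ne_zero.2 fun h0 => ?_
    obtain ⟨j, hj⟩ : ∃ γ : G.Path (u 0) (u d), True := by
      by_contra! h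
      haveI : IsEmpty (G.Path (u 0) (u d)) := ⟨fun γ => h γ⟩
      rw [hm, genFun, tsum_empty] at htm
      exact zero_ne_one htm
    have h1 := ENNReal.tsum_eq_zero.1 h0 j
    simp [ht] at h1
  set q : ℝ := (m (t / 2)).toReal / 2 with hq
  have hq0 : 0 < q := half_pos (ENNReal.toReal_pos hhalf.ne' (genFun_ne_top hA _ _ _))
  have hqm : ENNReal.ofReal q * 1 < m (t / 2) := by
    rw [mul_one]
    refine (ENNReal.ofReal_lt_iff_lt_toReal hq0.le (genFun_ne_top hA _ _ _)).2 ?_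
    rw [hq] at hq0 ⊢
    exact half_lt_self (by linarith)
  have e1 : ∀ᶠ t' in 𝓝 t, ENNReal.ofReal q * m t' < m (t / 2) := by
    refine (ENNReal.Tendsto.const_mul (hcont.tendsto t) (.inr ENNReal.ofReal_ne_top)).eventually
      (gt_mem_nhds ?_)
    rwa [htm]
  have e2 : ∀ᶠ t' in 𝓝 t, Real.log (m t').toReal < q ^ 2 := by
    have h1 : Tendsto (fun t' => (m t').toReal) (𝓝 t) (𝓝 1) := by
      have := (ENNReal.tendsto_toReal (show m t ≠ ∞ by rw [htm]; simp)).comp (hcont.tendsto t)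
      rwa [htm, ENNReal.toReal_one] at this
    have h2 := ((Real.continuousAt_log one_ne_zero).tendsto.comp h1)
    rw [Real.log_one] at h2
    exact h2.eventually (gt_mem_nhds (by positivity))
  have e3 : ∀ᶠ t' in 𝓝 t, t' / ρ < s :=
    (continuous_id.div_const ρ).tendsto t |>.eventually (gt_mem_nhds hs)
  have e4 : ∀ᶠ t' in 𝓝[>] t, t < t' := self_mem_nhdsWithin
  obtain ⟨t', h4, ⟨h1, h2⟩, h3⟩ := (e4.and (((e1.and e2).and e3).filter_mono nhdsWithin_le_nhds)).exists
  have hm1 : 1 < m t' := by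
    by_contra! hle
    have h5 : t' * m t ≤ t * m t' := mul_genFun_le hvw h4.le
    rw [htm, mul_one] at h5
    have h6 := h5.trans (mul_le_mul_right hle (t : ℝ≥0∞))
    rw [mul_one] at h6
    exact h4.not_ge (ENNReal.coe_le_coe.1 h6)
  refine exists_bad_of_lt hG hD hA hD1 hrev hu hd (ht0.trans h4).ne' hρ hF hq0.le hm1
    (h1.trans_le (genFun_mono _ _ (by gcongr))) h2.le h3

theorem tendsto_passageTime [Countable V] [Countable E] (hG : G.Loopless)
    (hD : G.DegreeLE D) (hrev : G.adj.Reversible) {v w : V} {ρ : ℝ≥0} (hρ : 0 < ρ) (hF : ClassC ρ F)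
    {τ : (n : ℕ) → PowEdge V E n → Ω → ℝ≥0} (hτ : ∀ n, IIDField (τ n) F μ) :
    TendstoInMeasure μ
        (fun n ω => (G.pow n).passageTime (fun e => τ n e ω) (fun _ => v) (fun _ => w))
        atTop (fun _ => G.criticalTime v w / (ρ : ℝ≥0∞)) ∧
      (ClassCL1 ρ F →
        TendstoInL1 μ
          (fun n ω => (G.pow n).passageTime (fun e => τ n e ω) (fun _ => v) (fun _ => w))
          (G.criticalTime v w / (ρ : ℝ≥0∞))) := by
  have hTm : ∀ n, Measurable fun ω =>
      (G.pow n).passageTime (fun e => τ n e ω) (fun _ => v) (fun _ => w) := fun n =>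
    measurable_passageTime (hτ n).measurable _ _
  -- This case covers `v = w` and the absence of paths, where both sides agree for all `n ≥ 1`. For
  -- `n = 0` the power has a single vertex and the passage time is zero.
  by_cases h : ∀ n ω, 1 ≤ n → (G.pow n).passageTime (fun e => τ n e ω) (fun _ => v)
      (fun _ => w) = G.criticalTime v w / (ρ : ℝ≥0∞)
  · have h1 : ∀ n ω, 1 ≤ n → edist ((G.pow n).passageTime (fun e => τ n e ω) (fun _ => v)
      (fun _ => w)) (G.criticalTime v w / (ρ : ℝ≥0∞)) = 0 := fun n ω hn => by
        rw [h n ω hn]; exact WeakPseudoEMetricSpace.edist_self _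
    refine ⟨fun ε hε => ?_, fun _ => ⟨fun n hn => ⟨(hTm n).aemeasurable, ?_⟩, ?_⟩⟩
    · refine tendsto_const_nhds.congr' ?_
      filter_upwards [eventually_ge_atTop 1] with n hn
      simp only [h1 n _ hn, nonpos_iff_eq_zero, hε.ne']
      simp
    · simp only [h1 n _ hn]
      simp
    · refine tendsto_const_nhds.congr' ?_
      filter_upwards [eventually_ge_atTop 1] with n hn
      simp only [h1 n _ hn]
      simp
  rcases eq_or_ne v w with rfl | hvw
  · exact (h fun n ω _ => by
      rw [passageTime_self, criticalTime_self, ENNReal.zero_div]).elim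
  rcases isEmpty_or_nonempty (G.Path v w) with hp | ⟨⟨γ⟩⟩
  · refine (h fun n ω hn => ?_).elim
    haveI : IsEmpty ((G.pow n).Path (fun _ => v) (fun _ => w)) :=
      ⟨fun γ => hp.elim (nonempty_path_of_pow γ ⟨0, hn⟩).some⟩
    rw [criticalTime_eq_top hp, ENNReal.top_div_of_ne_top ENNReal.coe_ne_top, passageTime, iInf_of_empty]
  obtain ⟨t, ht, htc, htm⟩ := exists_criticalTime_eq (hD.tame hG) hvw γ
  obtain ⟨u, d, hu, rfl, rfl⟩ := γ.exists_simplePath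
  have hd : 1 ≤ d := by
    rcases Nat.eq_zero_or_pos d with rfl | h
    · exact absurd rfl hvw
    · exact h
  -- The degree bound is enlarged to make it at least `1`.
  have hD' : G.DegreeLE (D + 1) := fun x => (hD x).trans (by exact_mod_cast Nat.le_succ D)
  have hup := fun s (hs : s > t / ρ) => exists_bad_of_criticalTime_lt (μ := μ) hG hD'
    (by omega) hrev hu hd hvw ht htm hρ hF hs
  have hlow := fun s (hs : s < t / ρ) => tendsto_measure_passageTime_lt hG hD hvw hρ hF hτ htc hs
  have hc : 0 < t / ρ := div_pos (pos_iff_ne_zero.2 ht) hρ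
  rw [htc, ← ENNReal.coe_div hρ.ne']
  refine ⟨tendstoInMeasure_of_tails hc hlow fun s hs => ?_, fun hF1 => ⟨fun n _ => ?_, ?_⟩⟩
  · obtain ⟨c, hc0, n₁, h⟩ := hup s hs
    have h1 := tendsto_mul_eexp_neg 1 (by simp) hc0
    refine tendsto_of_tendsto_of_tendsto_of_le_of_le' tendsto_const_nhds h1
      (Eventually.of_forall fun n => zero_le) ?_
    filter_upwards [eventually_ge_atTop n₁, eventually_ge_atTop 1] with n hn hn1
    obtain ⟨Bad, 𝒲, -, -, h3, h4⟩ := h n hn (τ n) (hτ n)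
    refine (measure_mono fun ω hω => by_contra fun hB => ?_).trans (h3.trans ?_)
    · exact (h4 ω hB).not_gt hω
    · rw [mul_one]
      exact le_mul_of_one_le_left' (by exact_mod_cast hn1)
  all_goals
    haveI : Nonempty E := ⟨(hu.joins 0 hd).choose⟩
    choose! f hf using hu.joins
    set S : (n : ℕ) → Ω → ℝ≥0∞ := fun n ω =>
      ∑ j : Fin n, ∑ l ∈ Finset.range d, (τ n (seqEdge u d f j l) ω : ℝ≥0∞) with hS
    have hmean := hF1.mean_lt_top.ne
    have hTS : ∀ n ω, (G.pow n).passageTime (fun e => τ n e ω) (fun _ => u 0) (fun _ => u d) ≤ S n ω :=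
      fun n ω => passageTime_le_seq hf _
  · refine ⟨(hTm n).aemeasurable, ?_⟩
    have h1 : ∫⁻ ω, S n ω ∂μ = n * (d * ∫⁻ x, (x : ℝ≥0∞) ∂F) := by
      have := lintegral_seq_le (hτ n) (u := u) (d := d) f (Bad := Set.univ) (𝒲 := ∅)
        MeasurableSet.univ (Set.disjoint_empty _)
      rwa [Measure.restrict_univ, measure_univ, mul_one] at this
    calc _ ≤ ∫⁻ ω, (S n ω + (t / ρ : ℝ≥0)) ∂μ := lintegral_mono fun ω =>
          (ENNReal.edist_coe_le _ _).trans (add_le_add (tsub_le_self.trans (hTS n ω)) tsub_le_self)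
      _ = n * (d * ∫⁻ x, (x : ℝ≥0∞) ∂F) + (t / ρ : ℝ≥0) := by
        rw [lintegral_add_right _ measurable_const, h1, lintegral_const, measure_univ, mul_one]
      _ < ∞ := ENNReal.add_lt_top.2 ⟨ENNReal.mul_lt_top (by simp)
          (ENNReal.mul_lt_top (by simp) hF1.mean_lt_top), ENNReal.coe_lt_top⟩
  · have hSm : ∀ n, Measurable (S n) := fun n => Finset.measurable_fun_sum _ fun j _ =>
      Finset.measurable_fun_sum _ fun l _ => ((hτ n).measurable _).coe_nnreal_ennreal
    refine tendsto_lintegral_edist hc hTm hlow hSm hTS fun s hs => ?_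
    obtain ⟨c, hc0, n₁, h⟩ := hup s hs
    choose! Bad 𝒲 h1 h2 h3 h4 using fun n hn => h n hn (τ n) (hτ n)
    refine ⟨fun n => if n₁ ≤ n then Bad n else ∅, fun n => ?_, ?_, ?_⟩
    · dsimp only
      split_ifs with hn
      · exact (hτ n).sig_le _ _ (h1 n hn)
      · exact MeasurableSet.empty
    · filter_upwards [eventually_ge_atTop n₁] with n hn
      rw [if_pos hn]
      exact h4 n hn
    · refine tendsto_of_tendsto_of_tendsto_of_le_of_le' tendsto_const_nhds
        (tendsto_mul_eexp_neg (d * ∫⁻ x, (x : ℝ≥0∞) ∂F) (ENNReal.mul_ne_top (by simp) hmean) hc0)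
        (Eventually.of_forall fun n => zero_le) ?_
      filter_upwards [eventually_ge_atTop n₁] with n hn
      rw [if_pos hn, hS]
      rw [lintegral_seq_le (hτ n) f (h1 n hn) (h2 n hn)]
      exact mul_le_mul_right (h3 n hn) _

end MixedGraph

theorem corollary1p6 {V E : Type*} (G : MixedGraph V E)
    (hloop : G.Loopless) (hconn : G.Connected) (hdeg : G.BoundedDegree)
    (hG : G.IsNormalCayley ∨ G.IsAbelianCayley ∨ ∀ x y : V, G.PairIso x y y x)
    (ρ : ℝ≥0) (hρ : 0 < ρ) (F : Measure ℝ≥0) (hF : ClassC ρ F)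
    {Ω : Type*} [MeasurableSpace Ω] (μ : Measure Ω) [IsProbabilityMeasure μ]
    (τ : (n : ℕ) → MixedGraph.PowEdge V E n → Ω → ℝ≥0)
    (hlaw : ∀ n e, HasLaw (τ n e) F μ) (hindep : ∀ n, iIndepFun (τ n) μ) (v w : V) :
    TendstoInMeasure μ
        (fun n ω => (G.pow n).passageTime (fun e => τ n e ω) (fun _ => v) (fun _ => w))
        atTop (fun _ => G.criticalTime v w / (ρ : ℝ≥0∞)) ∧
      (ClassCL1 ρ F →
        TendstoInL1 μ
          (fun n ω => (G.pow n).passageTime (fun e => τ n e ω) (fun _ => v) (fun _ => w))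
          (G.criticalTime v w / (ρ : ℝ≥0∞))) := by
  obtain ⟨D, hD⟩ : ∃ D, G.DegreeLE D := hdeg
  haveI := MixedGraph.countable_vertices hD hconn
  haveI := MixedGraph.countable_edges hD
  have hrev : G.adj.Reversible := by
    rcases hG with h | h | h
    · exact h.reversible
    · exact h.isNormalCayley.reversible
    · exact MixedGraph.reversible_of_pairIso h
  -- `HasLaw` gives only almost everywhere measurable passage times. They are replaced by measurable
  -- versions, which agree almost surely for all of the countably many edges at once.
  set τ' : (n : ℕ) → MixedGraph.PowEdge V E n → Ω → ℝ≥0 := fun n e => (hlaw n e).aemeasurable.mk _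
    with hτ'
  have hae : ∀ n e, τ n e =ᵐ[μ] τ' n e := fun n e => (hlaw n e).aemeasurable.ae_eq_mk
  have hiid : ∀ n, IIDField (τ' n) F μ := fun n =>
    ⟨fun e => (hlaw n e).aemeasurable.measurable_mk,
      fun e => by rw [← Measure.map_congr (hae n e), (hlaw n e).map_eq],
      (hindep n).congr (hae n)⟩
  obtain ⟨h1, h2⟩ := MixedGraph.tendsto_passageTime (v := v) (w := w) hloop hD hrev hρ hF hiid
  have hT : ∀ n, (fun ω => (G.pow n).passageTime (fun e => τ' n e ω) (fun _ => v) (fun _ => w)) =ᵐ[μ]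
      fun ω => (G.pow n).passageTime (fun e => τ n e ω) (fun _ => v) (fun _ => w) := fun n => by
    filter_upwards [ae_all_iff.2 (hae n)] with ω hω
    simp_rw [hω]
  have he : ∀ n, (fun ω => edist ((G.pow n).passageTime (fun e => τ' n e ω) (fun _ => v) (fun _ => w))
      (G.criticalTime v w / (ρ : ℝ≥0∞))) =ᵐ[μ] fun ω => edist ((G.pow n).passageTime
        (fun e => τ n e ω) (fun _ => v) (fun _ => w)) (G.criticalTime v w / (ρ : ℝ≥0∞)) := fun n =>
    (hT n).fun_comp fun x => edist x _
  refine ⟨h1.congr_left hT, fun hF1 => ?_⟩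
  obtain ⟨h3, h4⟩ := h2 hF1
  refine ⟨fun n hn => ⟨(h3 n hn).1.congr (hT n), ?_⟩, ?_⟩
  · rw [← lintegral_congr_ae (he n)]; exact (h3 n hn).2
  · exact h4.congr fun n => lintegral_congr_ae (he n)
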